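/- Let $k$ be an algebraically closed field of characteristic $0$ and let $(X,\Lambda_0)$ be a nonsingular Poisson variety over $k$: a smooth separated scheme of finite type over $k$ with a bivector field $\Lambda_0\in\Gamma(X,\wedge^2T_X)$ satisfying $[\Lambda_0,\Lambda_0]=0$ for the Schouten bracket. Let $T_X^\bullet$ be the complex $T_X\to\wedge^2T_X\to\wedge^3T_X\to\cdots$ with differential $[\Lambda_0,-]$ and $T_X$ in degree $0$, and let $\mathbb{H}^i(X,\Lambda_0,T_X^\bullet)$ be its hypercohomology, computed by the Čech complexes of affine open coverings with total differential $[\Lambda_0,-]+(-1)^{n+1}\delta$ on cochains of degree $n$. Let $A$ be a local Artinian $k$-algebra with residue field $k$. An infinitesimal Poisson deformation of $(X,\Lambda_0)$ over $A$ is a Poisson scheme $(\mathcal X,\Lambda)$ over $\operatorname{Spec}A$, flat over $\operatorname{Spec} A$, together with a cartesian square identifying $X$ with $\mathcal X\times_{\operatorname{Spec}A}\operatorname{Spec}k$ such that $\Lambda$ induces $\Lambda_0$. Let $\xi=(\mathcal X,\Lambda)$ be such a deformation and let $$e:\ 0\to(t)\to\tilde A\to A\to0$$ be a small extension: $\tilde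 A$ is a local Artinian $k$-algebra with residue field $k$ and maximal ideal $\tilde{\mathfrak m}$, $\tilde A\to A$ is a surjective $k$-algebra homomorphism with kernel $(t)$, and $0\neq t\in\tilde{\mathfrak m}$ with $t\,\tilde{\mathfrak m}=0$. A lifting of $\xi$ to $\tilde A$ is an infinitesimal Poisson deformation of $(X,\Lambda_0)$ over $\tilde A$ whose base change to $A$ is isomorphic to $\xi$ as a deformation of $(X,\Lambda_0)$. For every affine open covering $\{U_i\}$ of $X$ there are isomorphisms $\theta_i:U_i\times\operatorname{Spec}A\to\mathcal X|_{U_i}$ over $A$ inducing the identity on $U_i$. For every choice of $(\theta_i)$, let $\Lambda_i$ be the Poisson structure on $U_i\times\operatorname{Spec}A$ induced by $\Lambda$ and let $\theta_{ij}=\theta_j^{-1}\theta_i$. Then there are bivector fields $\tilde\Lambda_i\in\Gamma(U_i,\wedge^2T_X)\otimes_k\tilde A$ lifting $\Lambda_i$ and $\tilde A$-automorphisms $\tilde f_{ij}$ of the sheaf $\mathcal O_{U_{ij}}\otimes_k\tilde A$ lifting the automorphisms of $\mathcal O_{U_{ij}}\otimes_kA$ that correspond to $\theta_{ij}$. For all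 such choices there are polyvector fields $\Pi_i\in\Gamma(U_i,\wedge^3T_X)$, $\Lambda'_{ij}\in\Gamma(U_{ij},\wedge^2T_X)$ and $\tilde d_{ijk}\in\Gamma(U_{ijk},T_X)$ with $$[\tilde\Lambda_i,\tilde\Lambda_i]=t\,\Pi_i,\qquad \tilde f_{ij}\tilde\Lambda_j-\tilde\Lambda_i=t\,\Lambda'_{ij},\qquad \tilde f_{ij}\tilde f_{jk}=(\mathrm{Id}+t\,\tilde d_{ijk})\tilde f_{ik},$$ and $\alpha=(\{\Pi_i\},\{2\Lambda'_{ij}\},\{-2\tilde d_{ijk}\})$ is a Čech $2$-cocycle of $T_X^\bullet$. There is a unique class $o_\xi(e)\in\mathbb{H}^2(X,\Lambda_0,T_X^\bullet)$, the obstruction class, which is represented by $\alpha$ for every affine open covering of $X$ and all choices as above. It is $0$ if and only if a lifting of $\xi$ to $\tilde A$ exists. -/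

import Mathlib

open CategoryTheory Opposite TopologicalSpace AlgebraicGeometry
open scoped TensorProduct

universe u

noncomputable section

namespace PoissonDeform

/-! ### The Schouten bracket -/

/-- `σ` is a shuffle of type `(a, n - a)`: it is increasing on the first `a` indices and on the
remaining ones. -/
def IsShuffle {n : ℕ} (a : ℕ) (σ : Equiv.Perm (Fin n)) : Prop :=
  ∀ i j : Fin n, i < j → (j.1 < a ∨ a ≤ i.1) → σ i < σ j

instance {n : ℕ} (a : ℕ) : DecidablePred (IsShuffle (n := n) a) := fun σ =>
  inferInstanceAs (Decidable (∀ i j : Fin n, i < j → (j.1 < a ∨ a ≤ i.1) → σ i < σ j))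

/-- The half `∑_σ sgn(σ) P(Q(F_{σ(1)}, …, F_{σ(q+1)}), F_{σ(q+2)}, …)` of the Schouten bracket,
the sum being over `(q+1, p)`-shuffles. -/
def shuffleSum {R B : Type*} [CommRing R] [CommRing B] [Algebra R B] {p q n : ℕ}
    (h : n = q + p + 1) (P : B [⋀^Fin (p + 1)]→ₗ[R] B) (Q : B [⋀^Fin (q + 1)]→ₗ[R] B)
    (F : Fin n → B) : B :=
  ∑ σ : Equiv.Perm (Fin n) with IsShuffle (q + 1) σ,
    ((Equiv.Perm.sign σ : ℤˣ) : ℤ) •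
      P (Fin.cons (Q fun i : Fin (q + 1) => F (σ ⟨i.1, by omega⟩))
        (fun j : Fin p => F (σ ⟨q + 1 + j.1, by omega⟩)))

/-- The Schouten bracket `[P, Q]` of a skew-symmetric multiderivation `P` of degree `p + 1` and one
`Q` of degree `q + 1`, evaluated at `p + q + 1` functions. -/
def schouten {R B : Type*} [CommRing R] [CommRing B] [Algebra R B] {p q : ℕ}
    (P : B [⋀^Fin (p + 1)]→ₗ[R] B) (Q : B [⋀^Fin (q + 1)]→ₗ[R] B)
    (F : Fin (q + p + 1) → B) : B :=
  shuffleSum rfl P Q F - (-1) ^ (p * q) * shuffleSum (by omega) Q P F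

theorem shuffleSum_add_left {R B : Type*} [CommRing R] [CommRing B] [Algebra R B] {p q n : ℕ}
    (h : n = q + p + 1) (P P' : B [⋀^Fin (p + 1)]→ₗ[R] B) (Q : B [⋀^Fin (q + 1)]→ₗ[R] B)
    (F : Fin n → B) :
    shuffleSum h (P + P') Q F = shuffleSum h P Q F + shuffleSum h P' Q F := by
  simp [shuffleSum, Finset.sum_add_distrib]

theorem shuffleSum_add_right {R B : Type*} [CommRing R] [CommRing B] [Algebra R B] {p q n : ℕ}
    (h : n = q + p + 1) (P : B [⋀^Fin (p + 1)]→ₗ[R] B) (Q Q' : B [⋀^Fin (q + 1)]→ₗ[R] B)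
    (F : Fin n → B) :
    shuffleSum h P (Q + Q') F = shuffleSum h P Q F + shuffleSum h P Q' F := by
  simp only [shuffleSum, ← Finset.sum_add_distrib, ← smul_add]
  refine Finset.sum_congr rfl fun σ _ => ?_
  congr 1
  exact P.toMultilinearMap.cons_add _ _ _

theorem shuffleSum_smul_left {R B : Type*} [CommRing R] [CommRing B] [Algebra R B] {p q n : ℕ}
    (h : n = q + p + 1) (r : R) (P : B [⋀^Fin (p + 1)]→ₗ[R] B) (Q : B [⋀^Fin (q + 1)]→ₗ[R] B)
    (F : Fin n → B) :
    shuffleSum h (r • P) Q F = r • shuffleSum h P Q F := by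
  simp only [shuffleSum, Finset.smul_sum]
  refine Finset.sum_congr rfl fun σ _ => ?_
  rw [AlternatingMap.smul_apply, smul_comm]

theorem shuffleSum_smul_right {R B : Type*} [CommRing R] [CommRing B] [Algebra R B] {p q n : ℕ}
    (h : n = q + p + 1) (r : R) (P : B [⋀^Fin (p + 1)]→ₗ[R] B) (Q : B [⋀^Fin (q + 1)]→ₗ[R] B)
    (F : Fin n → B) :
    shuffleSum h P (r • Q) F = r • shuffleSum h P Q F := by
  simp only [shuffleSum, Finset.smul_sum]
  refine Finset.sum_congr rfl fun σ _ => ?_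
  rw [smul_comm r]
  congr 1
  exact P.toMultilinearMap.cons_smul _ _ _

theorem schouten_add_right {R B : Type*} [CommRing R] [CommRing B] [Algebra R B] {p q : ℕ}
    (P : B [⋀^Fin (p + 1)]→ₗ[R] B) (Q Q' : B [⋀^Fin (q + 1)]→ₗ[R] B) (F : Fin (q + p + 1) → B) :
    schouten P (Q + Q') F = schouten P Q F + schouten P Q' F := by
  simp only [schouten, shuffleSum_add_left, shuffleSum_add_right]
  ring

theorem schouten_smul_right {R B : Type*} [CommRing R] [CommRing B] [Algebra R B] {p q : ℕ}
    (r : R) (P : B [⋀^Fin (p + 1)]→ₗ[R] B) (Q : B [⋀^Fin (q + 1)]→ₗ[R] B)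
    (F : Fin (q + p + 1) → B) :
    schouten P (r • Q) F = r • schouten P Q F := by
  simp only [schouten, shuffleSum_smul_left, shuffleSum_smul_right, smul_sub, mul_smul_comm]

/-! ### Polyvector fields on a space with a presheaf of algebras -/

section PolyVec

variable {T : Type u} [TopologicalSpace T] {R : Type u} [CommRing R]

/-- The sections over `U` of the sheaf `Hom(⋀^p Ω, 𝒪)` for a presheaf `F` of commutative
`R`-algebras `𝒪`: families, indexed by the opens `V ≤ U`, of alternating `R`-multilinear maps
`𝒪(V)^p → 𝒪(V)` that are derivations in every argument and commute with restrictions. -/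
def PolyVec (F : (Opens T)ᵒᵖ ⥤ CommAlgCat.{u} R) (p : ℕ) (U : Opens T) :
    Submodule R (∀ V : {V : Opens T // V ≤ U}, (F.obj (op V.1)) [⋀^Fin p]→ₗ[R] (F.obj (op V.1))) where
  carrier := {P |
    (∀ (V : {V : Opens T // V ≤ U}) (v : Fin p → F.obj (op V.1)) (i : Fin p) (f g : F.obj (op V.1)),
      P V (Function.update v i (f * g)) =
        f * P V (Function.update v i g) + g * P V (Function.update v i f)) ∧
    (∀ (V W : {V : Opens T // V ≤ U}) (h : W.1 ≤ V.1) (v : Fin p → F.obj (op V.1)),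
      (F.map (homOfLE h).op).hom (P V v) = P W fun i => (F.map (homOfLE h).op).hom (v i))}
  zero_mem' := ⟨fun _ _ _ _ _ => by simp, fun _ _ _ _ => by simp⟩
  add_mem' := by
    rintro P Q ⟨h1, h2⟩ ⟨h3, h4⟩
    refine ⟨fun V v i f g => ?_, fun V W h v => ?_⟩
    · simp only [Pi.add_apply, AlternatingMap.add_apply, h1, h3]
      ring
    · simp only [Pi.add_apply, AlternatingMap.add_apply, map_add, h2 V W h v, h4 V W h v]
  smul_mem' := by
    rintro r P ⟨h1, h2⟩
    refine ⟨fun V v i f g => ?_, fun V W h v => ?_⟩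
    · simp only [Pi.smul_apply, AlternatingMap.smul_apply, h1, smul_add, mul_smul_comm]
    · simp only [Pi.smul_apply, AlternatingMap.smul_apply, map_smul, h2 V W h v]

/-- A bivector field `Λ` is a Poisson structure if `[Λ, Λ] = 0`. -/
def IsPoisson {F : (Opens T)ᵒᵖ ⥤ CommAlgCat.{u} R} {U : Opens T} (Λ : PolyVec F 2 U) : Prop :=
  ∀ (V : {V : Opens T // V ≤ U}) (G : Fin 3 → F.obj (op V.1)), schouten (Λ.1 V) (Λ.1 V) G = 0

/-- The presheaf `V ↦ S ⊗ 𝒪(V)`. -/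
def baseChange (S : Type u) [CommRing S] [Algebra R S] (F : (Opens T)ᵒᵖ ⥤ CommAlgCat.{u} R) :
    (Opens T)ᵒᵖ ⥤ CommAlgCat.{u} S where
  obj V := CommAlgCat.of S (S ⊗[R] F.obj V)
  map g := CommAlgCat.ofHom (Algebra.TensorProduct.map (AlgHom.id S S) (F.map g).hom)
  map_id V := by
    ext x
    simp
  map_comp f g := by
    ext x
    simp

/-! ### Čech hypercohomology of the shifted truncated Lichnerowicz–Poisson complex -/

variable (F : (Opens T)ᵒᵖ ⥤ CommAlgCat.{u} R) {ι κ : Type u}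

/-- The product over all `p, q ≥ 0` of the Čech groups `C^p(𝒰, ⋀^{q+1} T)`. -/
def CechCochain (U : ι → Opens T) : Type u :=
  ∀ p q : ℕ, ∀ I : Fin (p + 1) → ι, PolyVec F (q + 1) (⨅ j, U (I j))

instance (U : ι → Opens T) : AddCommGroup (CechCochain F U) :=
  inferInstanceAs (AddCommGroup
    (∀ p q : ℕ, ∀ I : Fin (p + 1) → ι, PolyVec F (q + 1) (⨅ j, U (I j))))

instance (U : ι → Opens T) : Module R (CechCochain F U) :=
  inferInstanceAs (Module R
    (∀ p q : ℕ, ∀ I : Fin (p + 1) → ι, PolyVec F (q + 1) (⨅ j, U (I j))))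

theorem CechCochain.add_apply (U : ι → Opens T) (c c' : CechCochain F U) (p q : ℕ)
    (I : Fin (p + 1) → ι) : (c + c' : CechCochain F U) p q I = c p q I + c' p q I := rfl

theorem CechCochain.smul_apply (U : ι → Opens T) (r : R) (c : CechCochain F U) (p q : ℕ)
    (I : Fin (p + 1) → ι) : (r • c : CechCochain F U) p q I = r • c p q I := rfl

/-- The same, with arbitrary families of functions in place of polyvector fields. -/
def RawCochain (U : ι → Opens T) : Type u :=
  ∀ (p q : ℕ) (I : Fin (p + 1) → ι) (V : {V : Opens T // V ≤ ⨅ j, U (I j)}),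
    (Fin (q + 1) → F.obj (op V.1)) → F.obj (op V.1)

instance (U : ι → Opens T) : AddCommGroup (RawCochain F U) :=
  inferInstanceAs (AddCommGroup
    (∀ (p q : ℕ) (I : Fin (p + 1) → ι) (V : {V : Opens T // V ≤ ⨅ j, U (I j)}),
      (Fin (q + 1) → F.obj (op V.1)) → F.obj (op V.1)))

instance (U : ι → Opens T) : Module R (RawCochain F U) :=
  inferInstanceAs (Module R
    (∀ (p q : ℕ) (I : Fin (p + 1) → ι) (V : {V : Opens T // V ≤ ⨅ j, U (I j)}),
      (Fin (q + 1) → F.obj (op V.1)) → F.obj (op V.1)))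

variable {F} {U : ι → Opens T}

/-- Forgetting that the entries of a cochain are polyvector fields. -/
def CechCochain.toRaw : CechCochain F U →ₗ[R] RawCochain F U where
  toFun c := fun p q I V G => (c p q I).1 V G
  map_add' _ _ := rfl
  map_smul' _ _ := rfl

/-- The `(p, q)` component of `[Λ, c]`. -/
def lichnerowiczPart (Λ : PolyVec F 2 ⊤) (c : CechCochain F U) : RawCochain F U
  | _, 0, _, _, _ => 0
  | p, q + 1, I, V, G => schouten (Λ.1 ⟨V.1, le_top⟩) ((c p q I).1 V) G

/-- The `(p, q)` component of the Čech coboundary `δ c`. -/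
def cechPart (c : CechCochain F U) : RawCochain F U
  | 0, _, _, _, _ => 0
  | p + 1, q, I, V, G => ∑ j : Fin (p + 2), (-1) ^ j.1 *
      (c p q fun i => I (j.succAbove i)).1
        ⟨V.1, le_iInf fun i => le_trans V.2 (iInf_le _ (j.succAbove i))⟩ G

/-- The differential `[Λ, -] + (-1)^n δ` of the total complex, from degree `n - 1` to degree `n`. -/
def totalDiff (Λ : PolyVec F 2 ⊤) (n : ℕ) : CechCochain F U →ₗ[R] RawCochain F U where
  toFun c := fun p q I V G =>
    lichnerowiczPart Λ c p q I V G + (-1) ^ n * cechPart c p q I V G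
  map_add' c c' := by
    have h1 : ∀ p q I V G, lichnerowiczPart Λ (c + c') p q I V G =
        lichnerowiczPart Λ c p q I V G + lichnerowiczPart Λ c' p q I V G := by
      intro p q I V G
      cases q with
      | zero => simp [lichnerowiczPart]
      | succ q => exact schouten_add_right _ _ _ _
    have h2 : ∀ p q I V G, cechPart (c + c') p q I V G =
        cechPart c p q I V G + cechPart c' p q I V G := by
      intro p q I V G
      cases p with
      | zero => simp [cechPart]
      | succ p =>
        simp only [cechPart, CechCochain.add_apply, Submodule.coe_add, Pi.add_apply,
          AlternatingMap.add_apply, mul_add, Finset.sum_add_distrib]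
    funext p q I V G
    change _ = (lichnerowiczPart Λ c p q I V G + (-1) ^ n * cechPart c p q I V G) +
      (lichnerowiczPart Λ c' p q I V G + (-1) ^ n * cechPart c' p q I V G)
    rw [h1, h2, mul_add, add_add_add_comm]
  map_smul' r c := by
    have h1 : ∀ p q I V G, lichnerowiczPart Λ (r • c) p q I V G =
        r • lichnerowiczPart Λ c p q I V G := by
      intro p q I V G
      cases q with
      | zero => simp [lichnerowiczPart]
      | succ q => exact schouten_smul_right _ _ _ _
    have h2 : ∀ p q I V G, cechPart (r • c) p q I V G = r • cechPart c p q I V G := by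
      intro p q I V G
      cases p with
      | zero => simp [cechPart]
      | succ p =>
        simp only [cechPart, CechCochain.smul_apply, Submodule.coe_smul, Pi.smul_apply,
          AlternatingMap.smul_apply, mul_smul_comm, Finset.smul_sum]
    funext p q I V G
    change _ = r • (lichnerowiczPart Λ c p q I V G + (-1) ^ n * cechPart c p q I V G)
    rw [h1, h2, smul_add, mul_smul_comm]

/-- The cochains supported on the bidegrees `(p, q)` with `p + q + s = n`; for `s = 0` these are the
cochains of total degree `n`, for `s = 1` those of total degree `n - 1`. -/
def homogeneous (F : (Opens T)ᵒᵖ ⥤ CommAlgCat.{u} R) (U : ι → Opens T) (n s : ℕ) :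
    Submodule R (CechCochain F U) where
  carrier := {c | ∀ p q, p + q + s ≠ n → c p q = 0}
  zero_mem' := fun _ _ _ => rfl
  add_mem' := fun {a b} ha hb p q h => by
    funext I
    rw [CechCochain.add_apply, ha p q h, hb p q h]
    exact add_zero _
  smul_mem' := fun r c hc p q h => by
    funext I
    rw [CechCochain.smul_apply, hc p q h]
    exact smul_zero _

/-- Cocycles of total degree `n`. -/
def cocycles (Λ : PolyVec F 2 ⊤) (U : ι → Opens T) (n : ℕ) : Submodule R (CechCochain F U) :=
  homogeneous F U n 0 ⊓ LinearMap.ker (totalDiff Λ (n + 1))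

/-- Coboundaries of total degree `n`: the cochains that are the differential of a cochain of total
degree `n - 1`. -/
def coboundaries (Λ : PolyVec F 2 ⊤) (U : ι → Opens T) (n : ℕ) : Submodule R (CechCochain F U) :=
  ((homogeneous F U n 1).map (totalDiff Λ n)).comap CechCochain.toRaw

/-- The `n`-th Čech hypercohomology module, with respect to the family `U`, of the complex
`T → ⋀² T → ⋀³ T → ⋯` with differential `[Λ, -]`, where `T` sits in degree `0`. -/
abbrev CechHyper (Λ : PolyVec F 2 ⊤) (U : ι → Opens T) (n : ℕ) : Type u :=
  cocycles Λ U n ⧸ (coboundaries Λ U n).submoduleOf (cocycles Λ U n)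

/-- The pullback of Čech cochains to a subfamily. -/
def CechCochain.reindex (U : ι → Opens T) (g : κ → ι) :
    CechCochain F U →ₗ[R] CechCochain F (fun a => U (g a)) where
  toFun c := fun p q I => c p q fun j => g (I j)
  map_add' _ _ := rfl
  map_smul' _ _ := rfl

theorem totalDiff_reindex (Λ : PolyVec F 2 ⊤) (U : ι → Opens T) (g : κ → ι) (n : ℕ)
    (c : CechCochain F U) (p q : ℕ) (I : Fin (p + 1) → κ) :
    totalDiff Λ n (CechCochain.reindex U g c) p q I = totalDiff Λ n c p q fun j => g (I j) := by
  cases p <;> cases q <;> rfl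

theorem reindex_homogeneous (U : ι → Opens T) (g : κ → ι) (n s : ℕ) (c : CechCochain F U)
    (hc : c ∈ homogeneous F U n s) :
    CechCochain.reindex U g c ∈ homogeneous F (fun a => U (g a)) n s := by
  intro p q h
  funext I
  exact congrFun (hc p q h) fun j => g (I j)

theorem reindex_cocycles (Λ : PolyVec F 2 ⊤) (U : ι → Opens T) (g : κ → ι) (n : ℕ)
    (c : CechCochain F U) (hc : c ∈ cocycles Λ U n) :
    CechCochain.reindex U g c ∈ cocycles Λ (fun a => U (g a)) n := by
  refine ⟨reindex_homogeneous U g n 0 c hc.1, ?_⟩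
  refine LinearMap.mem_ker.2 ?_
  funext p q I
  rw [totalDiff_reindex, LinearMap.mem_ker.1 hc.2]
  rfl

theorem reindex_coboundaries (Λ : PolyVec F 2 ⊤) (U : ι → Opens T) (g : κ → ι) (n : ℕ)
    (c : CechCochain F U) (hc : c ∈ coboundaries Λ U n) :
    CechCochain.reindex U g c ∈ coboundaries Λ (fun a => U (g a)) n := by
  obtain ⟨b, hb, hbc⟩ := hc
  refine ⟨CechCochain.reindex U g b, reindex_homogeneous U g n 1 b hb, ?_⟩
  funext p q I
  rw [totalDiff_reindex, hbc]
  rfl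

/-- The restriction map in Čech hypercohomology from a family of opens to a subfamily. -/
def CechHyper.restrict (Λ : PolyVec F 2 ⊤) (U : ι → Opens T) (g : κ → ι) (n : ℕ) :
    CechHyper Λ U n →ₗ[R] CechHyper Λ (fun a => U (g a)) n :=
  Submodule.mapQ _ _
    ((CechCochain.reindex U g).restrict fun c hc => reindex_cocycles Λ U g n c hc)
    (fun c hc => reindex_coboundaries Λ U g n c.1 hc)

end PolyVec

/-! ### Schemes over an affine base -/

/-- The `A`-algebra structure on `Γ(Y, V)` for a scheme `Y` over `Spec A`. -/
abbrev sectionAlgebra {A : Type u} [CommRing A] {Y : Scheme.{u}} (f : Y ⟶ Spec (.of A))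
    (V : Y.Opens) : Algebra A Γ(Y, V) :=
  ((Scheme.ΓSpecIso (.of A)).inv ≫ f.appLE ⊤ V (by simp)).hom.toAlgebra

/-- The structure sheaf of a scheme `Y` over `Spec A`, as a presheaf of `A`-algebras. -/
def algSheaf {A : Type u} [CommRing A] {Y : Scheme.{u}} (f : Y ⟶ Spec (.of A)) :
    (Opens Y)ᵒᵖ ⥤ CommAlgCat.{u} A where
  obj V :=
    letI := sectionAlgebra f V.unop
    CommAlgCat.of A Γ(Y, V.unop)
  map {V W} g :=
    letI := sectionAlgebra f V.unop
    letI := sectionAlgebra f W.unop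
    CommAlgCat.ofHom
      { (Y.presheaf.map g).hom with
        commutes' := fun a => by
          change ((((Scheme.ΓSpecIso (.of A)).inv ≫ f.appLE ⊤ V.unop _) ≫ Y.presheaf.map g).hom a)
            = ((Scheme.ΓSpecIso (.of A)).inv ≫ f.appLE ⊤ W.unop _).hom a
          rw [Category.assoc]
          exact congrArg (fun h => ((Scheme.ΓSpecIso (.of A)).inv ≫ h).hom a)
            (f.appLE_map _ g) }
  map_id V := by
    refine CommAlgCat.hom_ext (DFunLike.ext _ _ fun x => ?_)
    change (Y.presheaf.map (𝟙 V)).hom x = x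
    simp
  map_comp g h := by
    refine CommAlgCat.hom_ext (DFunLike.ext _ _ fun x => ?_)
    change (Y.presheaf.map (g ≫ h)).hom x = (Y.presheaf.map h).hom ((Y.presheaf.map g).hom x)
    simp

/-- The pullback of functions along a morphism `g : Y ⟶ Z`. -/
def pullSec {A A' : Type u} [CommRing A] [CommRing A'] {Y Z : Scheme.{u}} (f : Y ⟶ Spec (.of A))
    (f' : Z ⟶ Spec (.of A')) (g : Y ⟶ Z) (W : Z.Opens) :
    (algSheaf f').obj (op W) →+* (algSheaf f).obj (op (g ⁻¹ᵁ W)) :=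
  (g.app W).hom

/-- A morphism `g : Y ⟶ Z` is compatible with bivector fields on `Y` and `Z`, i.e. pullback of
functions preserves the brackets. -/
def PreservesBivector {A A' : Type u} [CommRing A] [CommRing A'] {Y Z : Scheme.{u}}
    (f : Y ⟶ Spec (.of A)) (f' : Z ⟶ Spec (.of A')) (g : Y ⟶ Z)
    (Λ : PolyVec (algSheaf f) 2 ⊤) (Λ' : PolyVec (algSheaf f') 2 ⊤) : Prop :=
  ∀ (W : Z.Opens) (v : Fin 2 → (algSheaf f').obj (op W)),
    pullSec f f' g W (Λ'.1 ⟨W, le_top⟩ v) =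
      Λ.1 ⟨g ⁻¹ᵁ W, le_top⟩ fun i => pullSec f f' g W (v i)

/-- The `n`-th hypercohomology of the shifted truncated Lichnerowicz–Poisson complex
`T_X → ⋀² T_X → ⋯` of a separated Poisson scheme, computed by the Čech complex of the
covering by all affine open subsets. -/
abbrev HyperCoh {k : Type u} [CommRing k] {X : Scheme.{u}} (π : X ⟶ Spec (.of k))
    (Λ₀ : PolyVec (algSheaf π) 2 ⊤) (n : ℕ) : Type u :=
  CechHyper Λ₀ (fun V : X.affineOpens => (V.1 : Opens X)) n

/-! ### Infinitesimal Poisson deformations -/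

section Deformation

variable {k : Type u} [Field k] {X : Scheme.{u}} (π : X ⟶ Spec (.of k))
  (Λ₀ : PolyVec (algSheaf π) 2 ⊤)

/-- An infinitesimal Poisson deformation of `(X, Λ₀)` over a local Artinian `k`-algebra `A` with
residue map `ε : A → k`: a cartesian square with flat right-hand column, a Poisson structure on the
total space over `Spec A`, and `X → 𝒳` compatible with the Poisson structures. -/
structure PoissonDeformation {A : Type u} [CommRing A] [Algebra k A] (ε : A →ₐ[k] k) where
  /-- the total space -/
  space : Scheme.{u}
  /-- the structure morphism -/
  proj : space ⟶ Spec (.of A)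
  flat : Flat proj
  /-- the inclusion of the closed fibre -/
  incl : X ⟶ space
  isPullback : IsPullback incl π proj (Spec.map (CommRingCat.ofHom ε.toRingHom))
  /-- the Poisson structure of the total space over `Spec A` -/
  biv : PolyVec (algSheaf proj) 2 ⊤
  isPoisson : IsPoisson biv
  incl_biv : PreservesBivector π proj incl Λ₀ biv

variable {π Λ₀} {A A₁ : Type u} [CommRing A] [Algebra k A] [CommRing A₁] [Algebra k A₁]
  {ε : A →ₐ[k] k}

/-- `ξ` has a lifting along `φ : A₁ → A`: a Poisson deformation over `A₁` whose base change to `A`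
is isomorphic to `ξ` as a Poisson deformation of `(X, Λ₀)`. -/
def PoissonDeformation.HasLifting (ξ : PoissonDeformation π Λ₀ ε) (φ : A₁ →ₐ[k] A) : Prop :=
  ∃ (η : PoissonDeformation π Λ₀ (ε.comp φ)) (g : ξ.space ⟶ η.space),
    IsPullback g ξ.proj η.proj (Spec.map (CommRingCat.ofHom φ.toRingHom)) ∧
    ξ.incl ≫ g = η.incl ∧
    PreservesBivector ξ.proj η.proj g ξ.biv η.biv

/-! ### The obstruction cocycle -/

/-- The reduction `A₁ ⊗ B → A ⊗ B` along `φ : A₁ → A`. -/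
abbrev red (φ : A₁ →ₐ[k] A) (B : CommAlgCat.{u} k) : A₁ ⊗[k] B →ₐ[k] A ⊗[k] B :=
  Algebra.TensorProduct.map φ (AlgHom.id k B)

/-- The reduction `A ⊗ B → k ⊗ B = B` along `ε : A → k`. -/
abbrev redk (ε : A →ₐ[k] k) (B : CommAlgCat.{u} k) : A ⊗[k] B →ₐ[k] B :=
  (Algebra.TensorProduct.lid k B).toAlgHom.comp (red ε B)

variable (ξ : PoissonDeformation π Λ₀ ε) {ι : Type u} (U : ι → X.Opens)

/-- Trivializations `θ_a : U_a × Spec A ≅ 𝒳|_{U_a}` over `Spec A` inducing the identity on `U_a`.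
As `X` and `𝒳` have the same underlying space, such an isomorphism is a
compatible family of isomorphisms `Γ(𝒳, W) ≅ A ⊗ Γ(X, V)`, where `V = X ∩ W` is contained
in `U_a`. -/
structure Trivialization where
  /-- the pullback of functions along `θ_a` -/
  iso : ∀ (a : ι) (W : ξ.space.Opens), ξ.incl ⁻¹ᵁ W ≤ U a →
    ((algSheaf ξ.proj).obj (op W) ≃ₐ[A] A ⊗[k] (algSheaf π).obj (op (ξ.incl ⁻¹ᵁ W)))
  iso_map : ∀ (a : ι) (W W' : ξ.space.Opens) (h : ξ.incl ⁻¹ᵁ W ≤ U a) (hW : W' ≤ W)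
    (h' : ξ.incl ⁻¹ᵁ W' ≤ ξ.incl ⁻¹ᵁ W) (x : (algSheaf ξ.proj).obj (op W)),
    iso a W' (h'.trans h) (((algSheaf ξ.proj).map (homOfLE hW).op).hom x) =
      ((baseChange A (algSheaf π)).map (homOfLE h').op).hom (iso a W h x)
  iso_incl : ∀ (a : ι) (W : ξ.space.Opens) (h : ξ.incl ⁻¹ᵁ W ≤ U a)
    (x : (algSheaf ξ.proj).obj (op W)),
    redk ε _ (iso a W h x) = pullSec π ξ.proj ξ.incl W x

variable {ξ U}

/-- The choices entering the obstruction cocycle: automorphisms `θ̃_{ab}` of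
`(U_a ∩ U_b) × Spec A₁` over `Spec A₁` lifting the transition automorphisms
`θ_{ab} = θ_b⁻¹ θ_a` of `(U_a ∩ U_b) × Spec A`, given by the corresponding automorphisms `f̃_{ab}`
of the sheaf of `A₁`-algebras `A₁ ⊗ 𝒪`, and bivector fields `Λ̃_a` on `U_a × Spec A₁` over
`Spec A₁` lifting the Poisson structures `Λ_a` which the trivializations induce
on `U_a × Spec A`. -/
structure LiftChoice (τ : Trivialization ξ U) (φ : A₁ →ₐ[k] A) where
  /-- the automorphisms `f̃_{ab}` -/
  aut : ∀ (a b : ι) (V : X.Opens), V ≤ U a → V ≤ U b →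
    (A₁ ⊗[k] (algSheaf π).obj (op V) ≃ₐ[A₁] A₁ ⊗[k] (algSheaf π).obj (op V))
  aut_map : ∀ (a b : ι) (V V' : X.Opens) (ha : V ≤ U a) (hb : V ≤ U b) (h : V' ≤ V)
    (x : A₁ ⊗[k] (algSheaf π).obj (op V)),
    aut a b V' (h.trans ha) (h.trans hb)
        (((baseChange A₁ (algSheaf π)).map (homOfLE h).op).hom x) =
      ((baseChange A₁ (algSheaf π)).map (homOfLE h).op).hom (aut a b V ha hb x)
  aut_red : ∀ (a b : ι) (W : ξ.space.Opens) (ha : ξ.incl ⁻¹ᵁ W ≤ U a) (hb : ξ.incl ⁻¹ᵁ W ≤ U b)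
    (x : A₁ ⊗[k] (algSheaf π).obj (op (ξ.incl ⁻¹ᵁ W))),
    red φ _ (aut a b _ ha hb x) = τ.iso a W ha ((τ.iso b W hb).symm (red φ _ x))
  /-- the bivector fields `Λ̃_a` -/
  biv : ∀ a : ι, PolyVec (baseChange A₁ (algSheaf π)) 2 (U a)
  biv_red : ∀ (a : ι) (W : ξ.space.Opens) (ha : ξ.incl ⁻¹ᵁ W ≤ U a)
    (v : Fin 2 → A₁ ⊗[k] (algSheaf π).obj (op (ξ.incl ⁻¹ᵁ W))),
    red φ _ ((biv a).1 ⟨_, ha⟩ v) =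
      τ.iso a W ha (ξ.biv.1 ⟨W, le_top⟩ fun i => (τ.iso a W ha).symm (red φ _ (v i)))

/-- The biderivation `Λ̃_a` on `A₁ ⊗ Γ(X, V)` for `V ≤ U_a`. -/
abbrev LiftChoice.bivAt {τ : Trivialization ξ U} {φ : A₁ →ₐ[k] A} (L : LiftChoice τ φ) (a : ι)
    (V : X.Opens) (h : V ≤ U a) : (A₁ ⊗[k] (algSheaf π).obj (op V)) [⋀^Fin 2]→ₗ[A₁]
      (A₁ ⊗[k] (algSheaf π).obj (op V)) :=
  (L.biv a).1 ⟨V, h⟩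

/-- `α = ({Π_a}, {2 Λ'_{ab}}, {-2 d_{abc}})`, where `[Λ̃_a, Λ̃_a] = t Π_a`,
`f̃_{ab} Λ̃_b - Λ̃_a = t Λ'_{ab}` and `f̃_{ab} f̃_{bc} = (id + t d_{abc}) f̃_{ac}`. -/
structure LiftChoice.IsObstructionCochain {τ : Trivialization ξ U} {φ : A₁ →ₐ[k] A}
    (L : LiftChoice τ φ) (t : A₁) (α : CechCochain (algSheaf π) U) : Prop where
  trivector : ∀ (I : Fin 1 → ι) (V : {V : X.Opens // V ≤ ⨅ j, U (I j)})
    (G : Fin 3 → A₁ ⊗[k] (algSheaf π).obj (op V.1)),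
    schouten (L.bivAt (I 0) V.1 (le_iInf_iff.1 V.2 0)) (L.bivAt (I 0) V.1 (le_iInf_iff.1 V.2 0)) G =
      t ⊗ₜ[k] (α 0 2 I).1 V fun i => redk (ε.comp φ) _ (G i)
  bivector : ∀ I : Fin 2 → ι, ∃ Λ' : PolyVec (algSheaf π) 2 (⨅ j, U (I j)),
    α 1 1 I = (2 : k) • Λ' ∧
    ∀ (V : {V : X.Opens // V ≤ ⨅ j, U (I j)}) (G : Fin 2 → A₁ ⊗[k] (algSheaf π).obj (op V.1)),
      L.aut (I 0) (I 1) V.1 (le_iInf_iff.1 V.2 0) (le_iInf_iff.1 V.2 1)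
          (L.bivAt (I 1) V.1 (le_iInf_iff.1 V.2 1) fun i =>
            (L.aut (I 0) (I 1) V.1 (le_iInf_iff.1 V.2 0) (le_iInf_iff.1 V.2 1)).symm (G i))
        - L.bivAt (I 0) V.1 (le_iInf_iff.1 V.2 0) G =
      t ⊗ₜ[k] Λ'.1 V fun i => redk (ε.comp φ) _ (G i)
  derivation : ∀ I : Fin 3 → ι, ∃ d : PolyVec (algSheaf π) 1 (⨅ j, U (I j)),
    α 2 0 I = (-2 : k) • d ∧
    ∀ (V : {V : X.Opens // V ≤ ⨅ j, U (I j)}) (x : A₁ ⊗[k] (algSheaf π).obj (op V.1)),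
      L.aut (I 0) (I 1) V.1 (le_iInf_iff.1 V.2 0) (le_iInf_iff.1 V.2 1)
          (L.aut (I 1) (I 2) V.1 (le_iInf_iff.1 V.2 1) (le_iInf_iff.1 V.2 2) x) =
        L.aut (I 0) (I 2) V.1 (le_iInf_iff.1 V.2 0) (le_iInf_iff.1 V.2 2) x +
        t ⊗ₜ[k] d.1 V fun _ => redk (ε.comp φ) _
          (L.aut (I 0) (I 2) V.1 (le_iInf_iff.1 V.2 0) (le_iInf_iff.1 V.2 2) x)

/-- `o` is the obstruction class of `ξ` along `φ : A₁ → A` with kernel `(t)`: for every affine open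
covering of `X`, trivializations of `ξ` exist, every trivialization admits choices of `f̃_{ab}` and
`Λ̃_a`, and for all choices the cochain `α` exists, is a cocycle, and represents the
restriction of `o` to the covering. -/
def PoissonDeformation.IsObstructionClass (ξ : PoissonDeformation π Λ₀ ε) (φ : A₁ →ₐ[k] A)
    (t : A₁) (o : HyperCoh π Λ₀ 2) : Prop :=
  ∀ (ι : Type u) (U : ι → X.affineOpens), (⨆ a, (U a).1) = ⊤ →
    Nonempty (Trivialization ξ fun a => (U a).1) ∧
    ∀ τ : Trivialization ξ fun a => (U a).1,
      Nonempty (LiftChoice τ φ) ∧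
      ∀ L : LiftChoice τ φ,
        ∃ α : cocycles Λ₀ (fun a => ((U a).1 : Opens X)) 2,
          L.IsObstructionCochain t α.1 ∧
          Submodule.Quotient.mk α =
            CechHyper.restrict Λ₀ (fun V : X.affineOpens => (V.1 : Opens X)) U 2 o

end Deformation

end PoissonDeform

end

-- Locally nothing obstructs. Over an affine open `U` of the smooth scheme `X`, formal smoothness
-- lifts the identity of the functions on `U` along the nilpotent reduction from the deformation to
-- its closed fibre, and flatness with Nakayama makes the resulting map from the trivial deformation
-- bijective (`exists_isSection`, `IsSection.bijective`). This needs that an open of `𝒳` is affine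
-- as soon as its trace on `X` is, a fact about closed immersions that are surjective on points
-- (`isAffine_of_surjective_isClosedImmersion`). Transition automorphisms lift from `A` to `A₁`
-- again by formal smoothness (`exists_lift_equivFamily`), and bivectors lift by a `k`-linear
-- splitting of `φ` (`exists_lift_polyVec`).
--
-- Since `t` kills the maximal ideal, the kernel of `A₁ ⊗ 𝒪 → A ⊗ 𝒪` is a copy `t ⊗ 𝒪` of the
-- structure sheaf of `X`. Hence whatever vanishes over `A` is `t` times a polyvector field on `X`
-- (`exists_polyVec_eq_tmul`). Applied to the failure of the Jacobi identity, of the agreement of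
-- bivectors on overlaps, and of the cocycle rule for automorphisms, this gives the three entries of
-- `α`. The four components of the cocycle equation (`mem_cocycles`) are the identity `[Λ, [Λ, Λ]] =
-- 0`, the comparison of the brackets of `Λ̃_a` and `Λ̃_b`, two ways of moving a bivector through
-- `f̃_ab f̃_bc`, and associativity of `f̃_ab f̃_bc f̃_cd`.
--
-- Two systems of choices, even over different trivializations, differ by automorphisms lifted from
-- `A`, bivectors `t l` and vector fields `t p`. The automorphisms leave `α` alone and the rest adds
-- the differential of `(2 l, -2 p)` (`exists_isChange`, `IsChange.represents`). Every affine
-- covering is indexed into the family of all affine opens, so choices made once for that family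
-- restrict to all coverings and define the class.
--
-- A lifting, trivialized over affine opens, supplies choices whose cochain is zero, so the class
-- vanishes. Conversely, if `α` is a coboundary, its primitive tells how to correct the choices so
-- that all three defects vanish (`exists_correction`). The spectra of `A₁ ⊗ Γ` then glue along
-- restriction maps twisted by the automorphisms to a flat thickening of `𝒳`, and the corrected
-- bivectors glue to a Poisson structure on it (`exists_space`, `IsObstructionCochain.hasLifting`).
-- Characteristic zero is needed to divide by `2`, both in `[Λ, Λ] = 2 · (Jacobiator)` and in the
-- coefficients of `α`.

attribute [reducible] PoissonDeform.baseChange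

set_option linter.unusedSectionVars false

noncomputable section

namespace PoissonDeform

/-! ### Explicit Schouten brackets in low degrees. -/

section Formulas

open Equiv

variable {R B : Type*} [CommRing R] [CommRing B] [Algebra R B]

theorem alternatingMap_eq_of_two (P : B [⋀^Fin 2]→ₗ[R] B) {f : Fin 2 → B} {a b : B} (h0 : f 0 = a)
    (h1 : f 1 = b) : P f = P ![a, b] :=
  congrArg P (funext fun i => by fin_cases i <;> assumption)

theorem alternatingMap_eq_of_three (P : B [⋀^Fin 3]→ₗ[R] B) {f : Fin 3 → B} {a b c : B}
    (h0 : f 0 = a) (h1 : f 1 = b) (h2 : f 2 = c) : P f = P ![a, b, c] :=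
  congrArg P (funext fun i => by fin_cases i <;> assumption)

theorem alternatingMap_eq_of_one (P : B [⋀^Fin 1]→ₗ[R] B) {f : Fin 1 → B} {a : B} (h0 : f 0 = a) :
    P f = P ![a] :=
  congrArg P (funext fun i => by fin_cases i; assumption)

theorem sign_smul_of_even {n : ℕ} {σ : Perm (Fin n)} {x : B} (y : B) (h : Perm.sign σ = 1)
    (e : x = y) : ((Perm.sign σ : ℤˣ) : ℤ) • x = y := by
  rw [h, e]; simp

theorem sign_smul_of_odd {n : ℕ} {σ : Perm (Fin n)} {x : B} (y : B) (h : Perm.sign σ = -1)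
    (e : x = y) : ((Perm.sign σ : ℤˣ) : ℤ) • x = -y := by
  rw [h, e]; simp

theorem shuffleSum_biv_der (P : B [⋀^Fin 2]→ₗ[R] B) (Q : B [⋀^Fin 1]→ₗ[R] B) (F : Fin 2 → B) :
    shuffleSum (p := 1) (q := 0) rfl P Q F = P ![Q ![F 0], F 1] - P ![Q ![F 1], F 0] := by
  have h : (Finset.univ.filter (IsShuffle (n := 2) 1)) = {1, swap 0 1} := by decide
  rw [shuffleSum, h, Finset.sum_insert (by decide), Finset.sum_singleton, sub_eq_add_neg]
  have key := fun f a b => alternatingMap_eq_of_two P (f := f) (a := a) (b := b)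
  have key' := fun f a => alternatingMap_eq_of_one Q (f := f) (a := a)
  exact congrArg₂ _
    (sign_smul_of_even _ (by decide) (key _ _ _ (key' _ _ rfl) rfl))
    (sign_smul_of_odd _ (by decide) (key _ _ _ (key' _ _ rfl) rfl))

theorem shuffleSum_der_biv (P : B [⋀^Fin 1]→ₗ[R] B) (Q : B [⋀^Fin 2]→ₗ[R] B) (F : Fin 2 → B) :
    shuffleSum (p := 0) (q := 1) rfl P Q F = P ![Q ![F 0, F 1]] := by
  have h : (Finset.univ.filter (IsShuffle (n := 2) 2)) = {1} := by decide
  rw [shuffleSum, h, Finset.sum_singleton]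
  exact sign_smul_of_even _ (by decide)
    (alternatingMap_eq_of_one P (alternatingMap_eq_of_two Q rfl rfl))

theorem shuffleSum_biv_biv (P Q : B [⋀^Fin 2]→ₗ[R] B) (F : Fin 3 → B) :
    shuffleSum (p := 1) (q := 1) rfl P Q F =
      P ![Q ![F 0, F 1], F 2] - P ![Q ![F 0, F 2], F 1] + P ![Q ![F 1, F 2], F 0] := by
  have h : (Finset.univ.filter (IsShuffle (n := 3) 2)) =
    {1, swap 1 2, swap 0 1 * swap 1 2} := by decide
  rw [shuffleSum, h, Finset.sum_insert (by decide), Finset.sum_insert (by decide),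
    Finset.sum_singleton]
  refine Eq.trans (congrArg₂ _
    (sign_smul_of_even (P ![Q ![F 0, F 1], F 2]) (by decide)
      (alternatingMap_eq_of_two P (alternatingMap_eq_of_two Q rfl rfl) rfl)) <| congrArg₂ _
    (sign_smul_of_odd (P ![Q ![F 0, F 2], F 1]) (by decide)
      (alternatingMap_eq_of_two P (alternatingMap_eq_of_two Q rfl rfl) rfl))
    (sign_smul_of_even (P ![Q ![F 1, F 2], F 0]) (by decide)
      (alternatingMap_eq_of_two P (alternatingMap_eq_of_two Q rfl rfl) rfl))) ?_
  ring

theorem shuffleSum_biv_triv (P : B [⋀^Fin 2]→ₗ[R] B) (Q : B [⋀^Fin 3]→ₗ[R] B) (F : Fin 4 → B) :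
    shuffleSum (p := 1) (q := 2) rfl P Q F =
      P ![Q ![F 0, F 1, F 2], F 3] - P ![Q ![F 0, F 1, F 3], F 2] +
      P ![Q ![F 0, F 2, F 3], F 1] - P ![Q ![F 1, F 2, F 3], F 0] := by
  have h : (Finset.univ.filter (IsShuffle (n := 4) 3)) =
    {1, swap 2 3, swap 1 2 * swap 2 3, swap 0 1 * swap 1 2 * swap 2 3} := by decide +kernel
  rw [shuffleSum, h, Finset.sum_insert (by decide), Finset.sum_insert (by decide),
    Finset.sum_insert (by decide), Finset.sum_singleton]
  refine Eq.trans (congrArg₂ _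
    (sign_smul_of_even (P ![Q ![F 0, F 1, F 2], F 3]) (by decide)
      (alternatingMap_eq_of_two P (alternatingMap_eq_of_three Q rfl rfl rfl) rfl)) <| congrArg₂ _
    (sign_smul_of_odd (P ![Q ![F 0, F 1, F 3], F 2]) (by decide)
      (alternatingMap_eq_of_two P (alternatingMap_eq_of_three Q rfl rfl rfl) rfl)) <| congrArg₂ _
    (sign_smul_of_even (P ![Q ![F 0, F 2, F 3], F 1]) (by decide)
      (alternatingMap_eq_of_two P (alternatingMap_eq_of_three Q rfl rfl rfl) rfl))
    (sign_smul_of_odd (P ![Q ![F 1, F 2, F 3], F 0]) (by decide)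
      (alternatingMap_eq_of_two P (alternatingMap_eq_of_three Q rfl rfl rfl) rfl))) ?_
  ring

theorem shuffleSum_triv_biv (P : B [⋀^Fin 3]→ₗ[R] B) (Q : B [⋀^Fin 2]→ₗ[R] B) (F : Fin 4 → B) :
    shuffleSum (p := 2) (q := 1) rfl P Q F =
      P ![Q ![F 0, F 1], F 2, F 3] - P ![Q ![F 0, F 2], F 1, F 3] +
      P ![Q ![F 0, F 3], F 1, F 2] + P ![Q ![F 1, F 2], F 0, F 3] -
      P ![Q ![F 1, F 3], F 0, F 2] + P ![Q ![F 2, F 3], F 0, F 1] := by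
  -- A `(2, 2)`-shuffle is determined by the set of its first two values; the list runs through
  -- `{0,1}`, `{0,2}`, `{0,3}`, `{1,2}`, `{1,3}`, `{2,3}`.
  have h : (Finset.univ.filter (IsShuffle (n := 4) 2)) =
    {1, swap 1 2, swap 2 3 * swap 1 2, swap 0 1 * swap 1 2, swap 0 1 * swap 2 3 * swap 1 2,
      swap 1 2 * swap 0 1 * swap 2 3 * swap 1 2} := by decide +kernel
  rw [shuffleSum, h, Finset.sum_insert (by decide), Finset.sum_insert (by decide),
    Finset.sum_insert (by decide), Finset.sum_insert (by decide), Finset.sum_insert (by decide),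
    Finset.sum_singleton]
  refine Eq.trans (congrArg₂ _
    (sign_smul_of_even (P ![Q ![F 0, F 1], F 2, F 3]) (by decide)
      (alternatingMap_eq_of_three P (alternatingMap_eq_of_two Q rfl rfl) rfl rfl)) <| congrArg₂ _
    (sign_smul_of_odd (P ![Q ![F 0, F 2], F 1, F 3]) (by decide)
      (alternatingMap_eq_of_three P (alternatingMap_eq_of_two Q rfl rfl) rfl rfl)) <| congrArg₂ _
    (sign_smul_of_even (P ![Q ![F 0, F 3], F 1, F 2]) (by decide)
      (alternatingMap_eq_of_three P (alternatingMap_eq_of_two Q rfl rfl) rfl rfl)) <| congrArg₂ _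
    (sign_smul_of_even (P ![Q ![F 1, F 2], F 0, F 3]) (by decide)
      (alternatingMap_eq_of_three P (alternatingMap_eq_of_two Q rfl rfl) rfl rfl)) <| congrArg₂ _
    (sign_smul_of_odd (P ![Q ![F 1, F 3], F 0, F 2]) (by decide)
      (alternatingMap_eq_of_three P (alternatingMap_eq_of_two Q rfl rfl) rfl rfl))
    (sign_smul_of_even (P ![Q ![F 2, F 3], F 0, F 1]) (by decide)
      (alternatingMap_eq_of_three P (alternatingMap_eq_of_two Q rfl rfl) rfl rfl))) ?_
  ring

theorem schouten_biv_der (P : B [⋀^Fin 2]→ₗ[R] B) (Q : B [⋀^Fin 1]→ₗ[R] B) (F : Fin 2 → B) :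
    schouten (p := 1) (q := 0) P Q F =
      P ![Q ![F 0], F 1] - P ![Q ![F 1], F 0] - Q ![P ![F 0, F 1]] := by
  have h := shuffleSum_der_biv Q P F
  have h' := shuffleSum_biv_der P Q F
  rw [schouten, h']
  simp only [mul_zero, pow_zero, one_mul]
  exact congrArg _ h

theorem schouten_biv_biv (P Q : B [⋀^Fin 2]→ₗ[R] B) (F : Fin 3 → B) :
    schouten (p := 1) (q := 1) P Q F =
      P ![Q ![F 0, F 1], F 2] - P ![Q ![F 0, F 2], F 1] + P ![Q ![F 1, F 2], F 0] +
      (Q ![P ![F 0, F 1], F 2] - Q ![P ![F 0, F 2], F 1] + Q ![P ![F 1, F 2], F 0]) := by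
  have h := shuffleSum_biv_biv Q P F
  have h' := shuffleSum_biv_biv P Q F
  rw [schouten, h', ← h]
  ring

theorem schouten_biv_triv (P : B [⋀^Fin 2]→ₗ[R] B) (Q : B [⋀^Fin 3]→ₗ[R] B) (F : Fin 4 → B) :
    schouten (p := 1) (q := 2) P Q F =
      P ![Q ![F 0, F 1, F 2], F 3] - P ![Q ![F 0, F 1, F 3], F 2] +
      P ![Q ![F 0, F 2, F 3], F 1] - P ![Q ![F 1, F 2, F 3], F 0] -
      (Q ![P ![F 0, F 1], F 2, F 3] - Q ![P ![F 0, F 2], F 1, F 3] +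
      Q ![P ![F 0, F 3], F 1, F 2] + Q ![P ![F 1, F 2], F 0, F 3] -
      Q ![P ![F 1, F 3], F 0, F 2] + Q ![P ![F 2, F 3], F 0, F 1]) := by
  have h := shuffleSum_triv_biv Q P F
  have h' := shuffleSum_biv_triv P Q F
  rw [schouten, h', ← h]
  norm_num

end Formulas

/-! ### The Jacobiator of a bivector. -/

section Bracket

variable {R B : Type*} [CommRing R] [CommRing B] [Algebra R B]

theorem biv_add_left (P : B [⋀^Fin 2]→ₗ[R] B) (a a' b : B) :
    P ![a + a', b] = P ![a, b] + P ![a', b] :=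
  P.toMultilinearMap.cons_add ![b] a a'

theorem biv_smul_left (P : B [⋀^Fin 2]→ₗ[R] B) (r : R) (a b : B) :
    P ![r • a, b] = r • P ![a, b] :=
  P.toMultilinearMap.cons_smul ![b] r a

theorem biv_swap (P : B [⋀^Fin 2]→ₗ[R] B) (a b : B) : P ![b, a] = -P ![a, b] := by
  have h := P.map_swap ![a, b] (show (0 : Fin 2) ≠ 1 by decide)
  rw [← h]
  exact congrArg P (funext fun i => by fin_cases i <;> rfl)

theorem biv_self (P : B [⋀^Fin 2]→ₗ[R] B) (a : B) : P ![a, a] = 0 :=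
  P.map_eq_zero_of_eq ![a, a] (i := 0) (j := 1) rfl (by decide)

theorem biv_add_right (P : B [⋀^Fin 2]→ₗ[R] B) (a b b' : B) :
    P ![a, b + b'] = P ![a, b] + P ![a, b'] := by
  rw [biv_swap, biv_add_left, neg_add, ← biv_swap, ← biv_swap]

theorem biv_smul_right (P : B [⋀^Fin 2]→ₗ[R] B) (r : R) (a b : B) :
    P ![a, r • b] = r • P ![a, b] := by
  rw [biv_swap, biv_smul_left, ← smul_neg, ← biv_swap]

theorem biv_neg_left (P : B [⋀^Fin 2]→ₗ[R] B) (a b : B) : P ![-a, b] = -P ![a, b] := by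
  have h := biv_smul_left P (-1) a b
  simpa using h

theorem biv_sub_left (P : B [⋀^Fin 2]→ₗ[R] B) (a a' b : B) :
    P ![a - a', b] = P ![a, b] - P ![a', b] := by
  rw [sub_eq_add_neg, biv_add_left, biv_neg_left, sub_eq_add_neg]

theorem biv_zero_left (P : B [⋀^Fin 2]→ₗ[R] B) (b : B) : P ![0, b] = 0 := by
  have h := biv_smul_left P 0 0 b
  simpa using h

theorem biv_zero_right (P : B [⋀^Fin 2]→ₗ[R] B) (b : B) : P ![b, 0] = 0 := by
  rw [biv_swap, biv_zero_left, neg_zero]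

/-- Half of the Schouten square of a bivector, as an alternating map. -/
def halfSquare (P : B [⋀^Fin 2]→ₗ[R] B) : B [⋀^Fin 3]→ₗ[R] B where
  toFun F := P ![P ![F 0, F 1], F 2] - P ![P ![F 0, F 2], F 1] + P ![P ![F 1, F 2], F 0]
  map_update_add' := by
    intro inst F i x y
    obtain rfl : inst = instDecidableEqFin 3 := Subsingleton.elim _ _
    fin_cases i <;> simp [biv_add_left, biv_add_right] <;> ring
  map_update_smul' := by
    intro inst F i r x
    obtain rfl : inst = instDecidableEqFin 3 := Subsingleton.elim _ _
    fin_cases i <;> simp [biv_smul_left, biv_smul_right, smul_sub, smul_add]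
  map_eq_zero_of_eq' := by
    have h01 : ∀ a b c : B, a = b →
        P ![P ![a, b], c] - P ![P ![a, c], b] + P ![P ![b, c], a] = 0 := by
      rintro a _ c rfl
      rw [biv_self, biv_zero_left]; ring
    have h12 : ∀ a b c : B, b = c →
        P ![P ![a, b], c] - P ![P ![a, c], b] + P ![P ![b, c], a] = 0 := by
      rintro a b _ rfl
      rw [biv_self, biv_zero_left]; ring
    have h02 : ∀ a b c : B, a = c →
        P ![P ![a, b], c] - P ![P ![a, c], b] + P ![P ![b, c], a] = 0 := by
      rintro a b _ rfl
      rw [biv_self, biv_zero_left, biv_swap P a b, biv_neg_left]; ring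
    intro v i j h hij
    fin_cases i <;> fin_cases j <;> first
      | exact absurd rfl hij
      | exact h01 _ _ _ h
      | exact h01 _ _ _ h.symm
      | exact h12 _ _ _ h
      | exact h12 _ _ _ h.symm
      | exact h02 _ _ _ h
      | exact h02 _ _ _ h.symm

theorem halfSquare_apply (P : B [⋀^Fin 2]→ₗ[R] B) (F : Fin 3 → B) :
    halfSquare P F = P ![P ![F 0, F 1], F 2] - P ![P ![F 0, F 2], F 1] + P ![P ![F 1, F 2], F 0] :=
  rfl

/-- For a bivector the sign in the bracket is `(-1)^(1 * 1) = -1`, so the two shuffle sums are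
added, and they coincide when the arguments do. Working with the half avoids division by `2` in the
algebraic identities. -/
theorem schouten_self (P : B [⋀^Fin 2]→ₗ[R] B) (F : Fin 3 → B) :
    schouten (p := 1) (q := 1) P P F = 2 * halfSquare P F := by
  rw [schouten_biv_biv, halfSquare_apply]; ring

/-- The Jacobi identity of the graded Lie algebra, `[P, [P, P]] = 0`, without division by `2`. After
expansion the triply nested brackets cancel in pairs, and the terms `{{a, b}, {c, d}}` cancel by
skew-symmetry. The Leibniz rule plays no role. -/
theorem schouten_halfSquare (P : B [⋀^Fin 2]→ₗ[R] B) (F : Fin 4 → B) :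
    schouten (p := 1) (q := 2) P (halfSquare P) F = 0 := by
  rw [schouten_biv_triv]
  have s : ∀ a b, P ![b, a] = -P ![a, b] := biv_swap P
  simp only [halfSquare_apply, Matrix.cons_val, Matrix.cons_val_zero, Matrix.cons_val_one,
    biv_add_left, biv_sub_left]
  generalize F 0 = a
  generalize F 1 = b
  generalize F 2 = c
  generalize F 3 = d
  rw [s (P ![a, b]) (P ![c, d]), s (P ![a, c]) (P ![b, d]), s (P ![a, d]) (P ![b, c])]
  ring_nf

end Bracket

/-! ### Square-zero extensions by the special fibre -/

/-- A ring `M` with a surjection `ρ : M → B` and an injection `j : B → M` onto an ideal on which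
`M` acts through `ρ`. -/
structure SmallExt {M B : Type*} [CommRing M] [CommRing B] (ρ : M →+* B) (j : B →+ M) : Prop where
  surj : Function.Surjective ρ
  inj : Function.Injective j
  mul_j : ∀ x b, x * j b = j (ρ x * b)
  ρ_j : ∀ b, ρ (j b) = 0

section SmallExt

variable {R R₁ M B : Type*} [CommRing R] [CommRing R₁] [CommRing B] [CommRing M] [Algebra R B]
  [Algebra R₁ M] {ρ : M →+* B} {j : B →+ M}

/-- The bivector `Λ` on `M` induces `Λ₀` on `B`, and on the ideal `j(B)`. -/
structure LiftsBiv (ρ : M →+* B) (j : B →+ M) (Λ : M [⋀^Fin 2]→ₗ[R₁] M)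
    (Λ₀ : B [⋀^Fin 2]→ₗ[R] B) : Prop where
  ρ_apply : ∀ x y, ρ (Λ ![x, y]) = Λ₀ ![ρ x, ρ y]
  j_left : ∀ b y, Λ ![j b, y] = j (Λ₀ ![b, ρ y])

theorem LiftsBiv.j_right {Λ : M [⋀^Fin 2]→ₗ[R₁] M} {Λ₀ : B [⋀^Fin 2]→ₗ[R] B}
    (h : LiftsBiv ρ j Λ Λ₀) (b : B) (y : M) : Λ ![y, j b] = j (Λ₀ ![ρ y, b]) := by
  rw [biv_swap, h.j_left, biv_swap Λ₀, map_neg, neg_neg]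

/-- The Jacobiator of a lift of `Λ₀` is closed for `[Λ₀, -]`. -/
theorem schouten_trivector_eq_zero (hj : SmallExt ρ j) {Λ : M [⋀^Fin 2]→ₗ[R₁] M}
    {Λ₀ : B [⋀^Fin 2]→ₗ[R] B} (h : LiftsBiv ρ j Λ Λ₀) (S₀ : B [⋀^Fin 3]→ₗ[R] B)
    (hS : ∀ F : Fin 3 → M, schouten (p := 1) (q := 1) Λ Λ F = j (S₀ fun i => ρ (F i)))
    (G : Fin 4 → B) : schouten (p := 1) (q := 2) Λ₀ S₀ G = 0 := by
  choose F hF using fun i => hj.surj (G i)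
  -- Twice the Jacobiator is what the trivector describes, so each term is written as a sum of two
  -- equal ones and the Jacobi identity `key` is used with coefficient `2`.
  have h2 : ∀ a b c : M, halfSquare Λ ![a, b, c] + halfSquare Λ ![a, b, c] =
      j (S₀ ![ρ a, ρ b, ρ c]) := fun a b c => by
    rw [← two_mul, ← schouten_self, hS]
    exact congrArg j (alternatingMap_eq_of_three _ rfl rfl rfl)
  have e1 : ∀ a b c d : M, Λ ![halfSquare Λ ![a, b, c], d] + Λ ![halfSquare Λ ![a, b, c], d] =
      j (Λ₀ ![S₀ ![ρ a, ρ b, ρ c], ρ d]) := fun a b c d => by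
    rw [← biv_add_left, h2, h.j_left]
  have e2 : ∀ a b c d : M, halfSquare Λ ![Λ ![a, b], c, d] + halfSquare Λ ![Λ ![a, b], c, d] =
      j (S₀ ![Λ₀ ![ρ a, ρ b], ρ c, ρ d]) := fun a b c d => by
    rw [h2, h.ρ_apply]
  have key := schouten_halfSquare Λ F
  rw [schouten_biv_triv] at key
  apply hj.inj
  rw [schouten_biv_triv, map_zero]
  simp only [← hF, map_add, map_sub, ← e1, ← e2]
  linear_combination 2 * key

/-- How the Jacobiators of two bivectors related by an automorphism differ. -/
theorem trivector_sub (hj : SmallExt ρ j) {Λa Λb : M [⋀^Fin 2]→ₗ[R₁] M}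
    {Λ₀ : B [⋀^Fin 2]→ₗ[R] B} (ha : LiftsBiv ρ j Λa Λ₀)
    (f : M →+* M) (hfj : ∀ b, f (j b) = j b) (hfρ : ∀ x, ρ (f x) = ρ x)
    {Sa Sb : B [⋀^Fin 3]→ₗ[R] B} {N : B [⋀^Fin 2]→ₗ[R] B}
    (hSa : ∀ F : Fin 3 → M, schouten (p := 1) (q := 1) Λa Λa F = j (Sa fun i => ρ (F i)))
    (hSb : ∀ F : Fin 3 → M, schouten (p := 1) (q := 1) Λb Λb F = j (Sb fun i => ρ (F i)))
    (hN : ∀ x y, f (Λb ![x, y]) = Λa ![f x, f y] + j (N ![ρ x, ρ y])) (G : Fin 3 → B) :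
    Sb G - Sa G = 2 * schouten (p := 1) (q := 1) Λ₀ N G := by
  choose F hF using fun i => hj.surj (G i)
  obtain rfl : (fun i => ρ (F i)) = G := funext hF
  have eb := congrArg f (hSb F)
  have ea := hSa fun i => f (F i)
  simp only [hfj, hfρ] at eb ea
  -- In a nested bracket the correction enters once through the inner and once through the outer
  -- bracket. These two contributions are the two halves of `[Λ₀, N]`.
  have key : ∀ x y z, f (Λb ![Λb ![x, y], z]) = Λa ![Λa ![f x, f y], f z] +
      j (Λ₀ ![N ![ρ x, ρ y], ρ z] + N ![Λ₀ ![ρ x, ρ y], ρ z]) := fun x y z => by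
    rw [hN, hN, biv_add_left, ha.j_left, hfρ, ← hfρ (Λb ![x, y]), hN, map_add, hj.ρ_j,
      ha.ρ_apply, hfρ, hfρ, add_zero, map_add, add_assoc]
  apply hj.inj
  rw [map_sub, ← eb, ← ea, schouten_self, schouten_self, schouten_biv_biv, two_mul (_ + _), map_add,
    halfSquare_apply, halfSquare_apply, map_mul, map_add, map_sub, key, key, key]
  simp only [map_add, map_sub, map_ofNat]
  ring

/-- The transformation law for the bivectors `N` along `f g ≡ (1 + d) h`. -/
theorem bivector_cocycle (hj : SmallExt ρ j) {Λa Λb Λc : M [⋀^Fin 2]→ₗ[R₁] M}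
    {Λ₀ : B [⋀^Fin 2]→ₗ[R] B} (ha : LiftsBiv ρ j Λa Λ₀) (hc : LiftsBiv ρ j Λc Λ₀)
    (f g h : M →+* M) (hfj : ∀ b, f (j b) = j b)
    (hgρ : ∀ x, ρ (g x) = ρ x) (hhρ : ∀ x, ρ (h x) = ρ x)
    {N N' N'' : B [⋀^Fin 2]→ₗ[R] B} {d : B [⋀^Fin 1]→ₗ[R] B}
    (hN : ∀ x y, f (Λb ![x, y]) = Λa ![f x, f y] + j (N ![ρ x, ρ y]))
    (hN' : ∀ x y, g (Λc ![x, y]) = Λb ![g x, g y] + j (N' ![ρ x, ρ y]))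
    (hN'' : ∀ x y, h (Λc ![x, y]) = Λa ![h x, h y] + j (N'' ![ρ x, ρ y]))
    (hd : ∀ x, f (g x) = h x + j (d ![ρ x])) (G : Fin 2 → B) :
    schouten (p := 1) (q := 0) Λ₀ d G = -(N G + N' G - N'' G) := by
  choose F hF using fun i => hj.surj (G i)
  obtain rfl : (fun i => ρ (F i)) = G := funext hF
  rw [alternatingMap_eq_of_two N (f := fun i => ρ (F i)) rfl rfl,
    alternatingMap_eq_of_two N' (f := fun i => ρ (F i)) rfl rfl,
    alternatingMap_eq_of_two N'' (f := fun i => ρ (F i)) rfl rfl, schouten_biv_der]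
  generalize F 0 = x
  generalize F 1 = y
  apply hj.inj
  -- The bivector is moved through `g` and then through `f`. The rewriting below evaluates both
  -- sides through `h` instead; terms quadratic in `d` disappear because `ρ` kills the ideal.
  have e1 : f (g (Λc ![x, y])) = Λa ![f (g x), f (g y)] + j (N ![ρ x, ρ y]) +
      j (N' ![ρ x, ρ y]) := by
    rw [hN', map_add, hfj, hN, hgρ, hgρ]
  rw [hd, hd, hd, hN'', hc.ρ_apply, biv_add_left, biv_add_right, biv_add_right, ha.j_left,
    ha.j_right, ha.j_left, hj.ρ_j, biv_zero_right, map_zero, hhρ, hhρ] at e1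
  simp only [map_sub, map_neg, map_add]
  rw [biv_swap Λ₀ (ρ x) (d ![ρ y]), map_neg]
  linear_combination -e1

/-- The cocycle condition for the derivations `d`. -/
theorem derivation_cocycle (hj : SmallExt ρ j) (f : Fin 4 → Fin 4 → M →+* M)
    (hfj : ∀ r s b, f r s (j b) = j b) (hfρ : ∀ r s x, ρ (f r s x) = ρ x)
    (d : Fin 4 → Fin 4 → Fin 4 → B → B)
    (hd : ∀ r s u, r < s → s < u → ∀ x, f r s (f s u x) = f r u x + j (d r s u (ρ x))) (b : B) :
    d 1 2 3 b - d 0 2 3 b + d 0 1 3 b - d 0 1 2 b = 0 := by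
  obtain ⟨x, rfl⟩ := hj.surj b
  -- Both bracketings of `f 0 1 ∘ f 1 2 ∘ f 2 3` are reduced to `f 0 3`.
  have e := congrArg (f 0 1) (hd 1 2 3 (by decide) (by decide) x)
  rw [map_add, hfj, hd 0 1 3 (by decide) (by decide), hd 0 1 2 (by decide) (by decide),
    hd 0 2 3 (by decide) (by decide), hfρ] at e
  apply hj.inj
  simp only [map_add, map_sub, map_zero]
  linear_combination -e

/-- The change of the Jacobiator under a change of the lift of `Λ₀`. -/
theorem trivector_change {Λ Λ' : M [⋀^Fin 2]→ₗ[R₁] M} (hj : SmallExt ρ j)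
    {Λ₀ : B [⋀^Fin 2]→ₗ[R] B} (h : LiftsBiv ρ j Λ Λ₀) {l : B [⋀^Fin 2]→ₗ[R] B}
    (hl : ∀ x y, Λ' ![x, y] = Λ ![x, y] + j (l ![ρ x, ρ y])) (F : Fin 3 → M) :
    schouten (p := 1) (q := 1) Λ' Λ' F = schouten (p := 1) (q := 1) Λ Λ F +
      j (2 * schouten (p := 1) (q := 1) Λ₀ l fun i => ρ (F i)) := by
  have key : ∀ x y z, Λ' ![Λ' ![x, y], z] = Λ ![Λ ![x, y], z] +
      j (Λ₀ ![l ![ρ x, ρ y], ρ z] + l ![Λ₀ ![ρ x, ρ y], ρ z]) := fun x y z => by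
    rw [hl, hl, biv_add_left, h.j_left, map_add, hj.ρ_j, add_zero, h.ρ_apply, map_add, add_assoc]
  rw [schouten_self, schouten_self, schouten_biv_biv, two_mul (_ + _), map_add,
    halfSquare_apply, halfSquare_apply, key, key, key]
  simp only [map_add, map_sub]
  ring

/-- The change of `N` under a change of the lifts. -/
theorem bivector_change {Λa Λb Λa' Λb' : M [⋀^Fin 2]→ₗ[R₁] M} (hj : SmallExt ρ j)
    {Λ₀ : B [⋀^Fin 2]→ₗ[R] B} (ha : LiftsBiv ρ j Λa Λ₀) (hb : LiftsBiv ρ j Λb Λ₀)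
    {la lb N : B [⋀^Fin 2]→ₗ[R] B} {p : B [⋀^Fin 1]→ₗ[R] B} 
    (hla : ∀ x y, Λa' ![x, y] = Λa ![x, y] + j (la ![ρ x, ρ y]))
    (hlb : ∀ x y, Λb' ![x, y] = Λb ![x, y] + j (lb ![ρ x, ρ y]))
    (f f' : M →+* M) (hfj : ∀ b, f (j b) = j b) (hfρ : ∀ x, ρ (f x) = ρ x)
    (hf : ∀ x, f' x = f x + j (p ![ρ x]))
    (hN : ∀ x y, f (Λb ![x, y]) = Λa ![f x, f y] + j (N ![ρ x, ρ y])) (x y : M) :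
    f' (Λb' ![x, y]) = Λa' ![f' x, f' y] + j (N ![ρ x, ρ y] + lb ![ρ x, ρ y] - la ![ρ x, ρ y] -
      schouten (p := 1) (q := 0) Λ₀ p ![ρ x, ρ y]) := by
  have e : f' (Λb' ![x, y]) = f (Λb ![x, y]) + j (lb ![ρ x, ρ y]) + j (p ![Λ₀ ![ρ x, ρ y]]) := by
    rw [hf, hlb, map_add, hfj, map_add, hj.ρ_j, add_zero, hb.ρ_apply]
  rw [e, hN, hla, hf, hf, biv_add_left, biv_add_right, biv_add_right, ha.j_left, ha.j_right,
    ha.j_left, map_add, map_add, hj.ρ_j, hj.ρ_j, biv_zero_right, map_zero, hfρ, hfρ, add_zero,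
    add_zero, schouten_biv_der]
  simp only [map_sub, map_add, Matrix.cons_val_zero, Matrix.cons_val_one]
  rw [biv_swap Λ₀ (ρ x) (p ![ρ y]), map_neg]
  ring

end SmallExt

/-! ### A nilpotent thickening of an affine scheme is affine. -/

section Thickening

variable {X Y : Scheme.{u}}

/-- As `s - w` is nilpotent, `s` divides a power of `w`. In `s ^ K - w ^ K = (s - w) * ∑ s ^ i * w ^
(K - 1 - i)` with `K` large, every summand is therefore divisible by `s ^ M`, which `s - w` kills.
-/
theorem exists_pow_eq_pow {R : Type*} [CommRing R] {s w : R} (h : IsNilpotent (s - w)) {M : ℕ}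
    (hM : s ^ M * (s - w) = 0) : ∃ K, 0 < K ∧ s ^ K = w ^ K := by
  obtain ⟨n, hn⟩ := h
  have h1 : s ∣ w ^ n := by
    have := sub_dvd_pow_sub_pow w (w - s) n
    rwa [sub_sub_cancel, ← neg_sub s w, neg_pow, hn, mul_zero, sub_zero] at this
  have h2 : s ^ M ∣ w ^ (n * M) := by
    rw [pow_mul]; exact pow_dvd_pow_of_dvd h1 M
  -- With this exponent a summand has either at least `M` factors `s` or at least `n * M` factors
  -- `w`.
  refine ⟨n * M + M + 1, by omega, sub_eq_zero.1 ?_⟩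
  rw [← (Commute.all s w).mul_geom_sum₂, Finset.mul_sum]
  refine Finset.sum_eq_zero fun i hi => ?_
  have key : ∀ c, s ^ M ∣ c → (s - w) * c = 0 := by
    rintro _ ⟨c, rfl⟩
    rw [← mul_assoc, mul_comm (s - w), hM, zero_mul]
  apply key
  rcases le_or_gt M i with h | h
  · exact (pow_dvd_pow _ h).mul_right _
  · refine (h2.trans (pow_dvd_pow _ ?_)).mul_left _
    omega

/-- Restriction of functions to a smaller open set. -/
abbrev resSec (Y : Scheme.{u}) {V W : Y.Opens} (h : W ≤ V) : Γ(Y, V) →+* Γ(Y, W) :=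
  (Y.presheaf.map (homOfLE h).op).hom

theorem resSec_resSec {V W Z : Y.Opens} (h : W ≤ V) (h' : Z ≤ W) (x : Γ(Y, V)) :
    resSec Y h' (resSec Y h x) = resSec Y (h'.trans h) x := by
  simp only [← CommRingCat.comp_apply, ← Functor.map_comp, ← op_comp, homOfLE_comp]

theorem app_resSec (i : X ⟶ Y) {V W : Y.Opens} (h : W ≤ V) (x : Γ(Y, V)) :
    (i.app W).hom (resSec Y h x) = resSec X (i.preimage_mono h) ((i.app V).hom x) := by
  have := i.naturality (homOfLE h).op
  exact congr($(this).hom x)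

theorem preimage_injective (i : X ⟶ Y) [Surjective i] {V W : Y.Opens}
    (h : i ⁻¹ᵁ V = i ⁻¹ᵁ W) : V = W := by
  refine Opens.ext (i.surjective.preimage_injective ?_)
  exact congrArg (fun Z : X.Opens => (Z : Set X)) h

theorem preimage_le_iff (i : X ⟶ Y) [Surjective i] {V W : Y.Opens} :
    i ⁻¹ᵁ V ≤ i ⁻¹ᵁ W ↔ V ≤ W := by
  refine ⟨fun h => ?_, fun h => i.preimage_mono h⟩
  exact i.surjective.preimage_subset_preimage_iff.1 h

theorem isNilpotent_of_app_eq_zero (i : X ⟶ Y) [Surjective i] {V : Y.Opens}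
    (hV : IsCompact (V : Set Y)) {x : Γ(Y, V)} (hx : (i.app V).hom x = 0) : IsNilpotent x := by
  rw [Scheme.isNilpotent_iff_basicOpen_eq_bot_of_isCompact hV]
  apply preimage_injective i
  rw [Scheme.preimage_basicOpen]
  erw [hx]
  simp

theorem isUnit_of_isUnit_app (i : X ⟶ Y) [Surjective i] {V : Y.Opens}
    {x : Γ(Y, V)} (hx : IsUnit ((i.app V).hom x)) : IsUnit x := by
  have : Y.basicOpen x = V := by
    apply preimage_injective i
    rw [Scheme.preimage_basicOpen]
    exact X.basicOpen_of_isUnit hx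
  have aux : ∀ (W : Y.Opens) (_ : W = V) (h : W ≤ V), IsUnit (resSec Y h x) → IsUnit x := by
    rintro _ rfl h hu
    simpa [resSec] using hu
  exact aux _ this (Y.basicOpen_le x) (Y.toRingedSpace.isUnit_res_basicOpen x)

/-- Lift `v` to a function `f` on the affine `S`. Then `S ⊓ D` is the basic open of `f`, and there
`g` and `f` differ by a nilpotent `δ`. In the binomial expansion of `(f + δ) ^ K` high powers of `δ`
vanish, and the other terms carry enough powers of `f` to clear the denominators of `δ`, so `g ^ K -
f ^ K` extends to `S` by a function that is zero on `X`. -/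
theorem exists_pow_lift_of_isAffineOpen (i : X ⟶ Y) [IsClosedImmersion i] [Surjective i]
    (v : Γ(X, ⊤)) {D : Y.Opens} (hD : i ⁻¹ᵁ D = X.basicOpen v) (g : Γ(Y, D))
    (hg : (i.app D).hom g = resSec X le_top v) {S : Y.Opens} (hS : IsAffineOpen S) :
    ∃ n : ℕ, 0 < n ∧ ∃ s : Γ(Y, S), (i.app S).hom s = resSec X le_top (v ^ n) ∧
      resSec Y (inf_le_left : S ⊓ D ≤ S) s = resSec Y inf_le_right (g ^ n) := by
  obtain ⟨f, hf⟩ := i.app_surjective S hS (resSec X le_top v)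
  have hfD : Y.basicOpen f = S ⊓ D := by
    apply preimage_injective i
    rw [Scheme.preimage_basicOpen]
    erw [hf]
    rw [resSec, Scheme.basicOpen_res, ← hD]
    rfl
  have hloc := hS.isLocalization_of_eq_basicOpen f (homOfLE (inf_le_left : S ⊓ D ≤ S)) hfD.symm
  let _ := (resSec Y (inf_le_left : S ⊓ D ≤ S)).toAlgebra
  have halg : ∀ x, algebraMap Γ(Y, S) Γ(Y, S ⊓ D) x = resSec Y inf_le_left x := fun _ => rfl
  set q := (i.app S).hom with hq
  set fD := resSec Y (inf_le_left : S ⊓ D ≤ S) f with hfD'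
  set gD := resSec Y (inf_le_right : S ⊓ D ≤ D) g with hgD
  set δ := gD - fD with hδ
  have hδq : (i.app (S ⊓ D)).hom δ = 0 := by
    rw [hδ, map_sub, hgD, hfD', app_resSec, app_resSec, hg]
    erw [hf]
    rw [resSec_resSec, resSec_resSec, sub_self]
  have hcomp : IsCompact ((S ⊓ D : Y.Opens) : Set Y) := by
    rw [← hfD]; exact (hS.basicOpen f).isCompact
  obtain ⟨m, hm⟩ := isNilpotent_of_app_eq_zero i hcomp hδq
  -- Some power of `f` clears the denominator of `δ`; further powers make the extension vanish on
  -- all of `X ∩ S` and not only on the basic open of `v`.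
  obtain ⟨N, e, heq, he⟩ : ∃ (N : ℕ) (e : Γ(Y, S)), q e = 0 ∧
      resSec Y (inf_le_left : S ⊓ D ≤ S) e = fD ^ N * δ := by
    obtain ⟨⟨e, _, N, rfl⟩, he⟩ := hloc.1.2 δ
    have he' : resSec Y (inf_le_left : S ⊓ D ≤ S) e = fD ^ N * δ := by
      have h2 := he.symm
      rw [map_pow, mul_comm] at h2
      exact h2
    have hres : resSec X (i.preimage_mono (inf_le_left : S ⊓ D ≤ S)) (q e) = 0 := by
      rw [hq, ← app_resSec i (inf_le_left : S ⊓ D ≤ S), he', map_mul, hδq, mul_zero]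
    obtain ⟨L, hL⟩ := exists_pow_mul_eq_zero_of_res_basicOpen_eq_zero_of_isAffineOpen X
      (hS.preimage i) (q e) (q f) (by
        have aux : ∀ (W : X.Opens) (_ : W = i ⁻¹ᵁ (S ⊓ D)) (h : W ≤ i ⁻¹ᵁ S),
            resSec X h (q e) = 0 := by
          rintro _ rfl _; exact hres
        refine aux _ ?_ (X.basicOpen_le _)
        rw [← hfD, Scheme.preimage_basicOpen])
    refine ⟨L + N, f ^ L * e, by rw [map_mul, map_pow, hL], ?_⟩
    rw [map_mul, map_pow, he', pow_add, mul_assoc]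
  have hterm : ∀ a b, N * b ≤ a → 0 < b → ∃ x : Γ(Y, S), q x = 0 ∧
      resSec Y inf_le_left x = fD ^ a * δ ^ b := by
    intro a b hab hb
    refine ⟨f ^ (a - N * b) * e ^ b, ?_, ?_⟩
    · rw [map_mul, map_pow q e, heq, zero_pow hb.ne', mul_zero]
    · rw [map_mul, map_pow, map_pow, he, mul_pow, ← pow_mul, ← mul_assoc, ← pow_add]
      congr 2; omega
  have hK : ∃ x : Γ(Y, S), q x = 0 ∧ resSec Y inf_le_left x =
      gD ^ (m * (N + 1) + 1) - fD ^ (m * (N + 1) + 1) := by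
    -- If the exponent of `δ` is `b < m`, the exponent of `f` exceeds `m * N`, hence is at least `N
    -- * b`, as `hterm` requires.
    set K := m * (N + 1) + 1 with hKdef
    have hgsum : gD ^ K - fD ^ K =
        ∑ a ∈ Finset.range K, fD ^ a * δ ^ (K - a) * (K.choose a : Γ(Y, S ⊓ D)) := by
      rw [show gD = fD + δ by rw [hδ]; ring, add_pow, Finset.sum_range_succ]
      simp
    have hx : ∀ a ∈ Finset.range K, ∃ x : Γ(Y, S), q x = 0 ∧
        resSec Y inf_le_left x = fD ^ a * δ ^ (K - a) * (K.choose a : Γ(Y, S ⊓ D)) := by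
      intro a ha
      rw [Finset.mem_range] at ha
      rcases le_or_gt m (K - a) with h | h
      · refine ⟨0, map_zero _, ?_⟩
        rw [map_zero, pow_eq_zero_of_le h hm, mul_zero, zero_mul]
      · obtain ⟨x, hx, hx'⟩ := hterm a (K - a) (by
          have : N * (K - a) ≤ N * m := Nat.mul_le_mul_left _ h.le
          have h2 : m * (N + 1) = N * m + m := by ring
          omega) (by omega)
        exact ⟨x * K.choose a, by rw [map_mul, hx, zero_mul], by rw [map_mul, hx', map_natCast]⟩
    choose! x hx hx' using hx
    refine ⟨∑ a ∈ Finset.range K, x a, ?_, ?_⟩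
    · rw [map_sum, Finset.sum_eq_zero hx]
    · rw [map_sum, hgsum, Finset.sum_congr rfl hx']
  obtain ⟨x, hx, hx'⟩ := hK
  refine ⟨_, Nat.succ_pos (m * (N + 1)), f ^ (m * (N + 1) + 1) + x, ?_, ?_⟩
  · rw [map_add, hx, add_zero, map_pow, map_pow]
    exact congrArg (· ^ _) hf
  · rw [map_add, hx', map_pow, map_pow]
    exact add_sub_cancel _ _

theorem exists_glue_two {Z : Scheme.{u}} {V W : Z.Opens} (s : Γ(Z, V)) (t : Γ(Z, W))
    (h : resSec Z (inf_le_left : V ⊓ W ≤ V) s = resSec Z (inf_le_right : V ⊓ W ≤ W) t) :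
    ∃ r : Γ(Z, V ⊔ W), resSec Z le_sup_left r = s ∧ resSec Z le_sup_right r = t := by
  refine ⟨(Z.sheaf.objSupIsoProdEqLocus V W).inv ⟨⟨s, t⟩, h⟩, ?_, ?_⟩
  · exact Z.sheaf.objSupIsoProdEqLocus_inv_fst V W ⟨⟨s, t⟩, h⟩
  · exact Z.sheaf.objSupIsoProdEqLocus_inv_snd V W ⟨⟨s, t⟩, h⟩

theorem eq_of_resSec_eq {Z : Scheme.{u}} {V W T : Z.Opens} (hT : T ≤ V ⊔ W) (hV : V ≤ T)
    (hW : W ≤ T) {s t : Γ(Z, T)} (h : resSec Z hV s = resSec Z hV t)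
    (h' : resSec Z hW s = resSec Z hW t) : s = t :=
  Z.sheaf.eq_of_locally_eq₂ (homOfLE hV) (homOfLE hW) hT s t h h'

/-- Induction over a finite affine covering of `V`. On the overlap of `V` with a further affine `S`,
the two lifts `a` and `b` of `v ^ n` differ by a nilpotent, since they agree on `X`, and they
coincide on the basic open of `a`, where both are `g ^ n`. Quasi-compactness of the overlap gives `a
^ M * (a - b) = 0`, and by `exists_pow_eq_pow` suitable powers glue. -/
theorem exists_pow_lift (i : X ⟶ Y) [IsClosedImmersion i] [Surjective i] [QuasiSeparatedSpace Y]
    (v : Γ(X, ⊤)) {D : Y.Opens} (hD : i ⁻¹ᵁ D = X.basicOpen v) (g : Γ(Y, D))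
    (hg : (i.app D).hom g = resSec X le_top v) {V : Y.Opens} (hV : IsCompact (V : Set Y)) :
    ∃ n : ℕ, 0 < n ∧ ∃ s : Γ(Y, V), (i.app V).hom s = resSec X le_top (v ^ n) ∧
      resSec Y (inf_le_left : V ⊓ D ≤ V) s = resSec Y inf_le_right (g ^ n) := by
  refine compact_open_induction_on V hV ?_ ?_
  · refine ⟨1, one_pos, 0, ?_, ?_⟩
    · have : Subsingleton Γ(X, i ⁻¹ᵁ ⊥) := by
        change Subsingleton Γ(X, ⊥); infer_instance
      exact Subsingleton.elim _ _
    · have : Subsingleton Γ(Y, ⊥ ⊓ D) := by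
        rw [bot_inf_eq]; infer_instance
      exact Subsingleton.elim _ _
  · rintro V hV S ⟨n₁, hn₁, s₁, hs₁, hs₁'⟩
    obtain ⟨n₂, hn₂, s₂, hs₂, hs₂'⟩ := exists_pow_lift_of_isAffineOpen i v hD g hg S.2
    set n := n₁ * n₂
    replace hs₁ : (i.app V).hom (s₁ ^ n₂) = resSec X le_top (v ^ n) := by
      rw [map_pow, hs₁, ← map_pow, ← pow_mul]
    replace hs₁' : resSec Y (inf_le_left : V ⊓ D ≤ V) (s₁ ^ n₂) = resSec Y inf_le_right (g ^ n) := by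
      rw [map_pow, hs₁', ← map_pow, ← pow_mul]
    replace hs₂ : (i.app S.1).hom (s₂ ^ n₁) = resSec X le_top (v ^ n) := by
      rw [map_pow, hs₂, ← map_pow, ← pow_mul, mul_comm]
    replace hs₂' : resSec Y (inf_le_left : S.1 ⊓ D ≤ S.1) (s₂ ^ n₁) =
        resSec Y inf_le_right (g ^ n) := by
      rw [map_pow, hs₂', ← map_pow, ← pow_mul, mul_comm]
    have hn : 0 < n := Nat.mul_pos hn₁ hn₂
    generalize s₁ ^ n₂ = s₁ at hs₁ hs₁'
    generalize s₂ ^ n₁ = s₂ at hs₂ hs₂'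
    have hVS : IsCompact ((V ⊓ S.1 : Y.Opens) : Set Y) :=
      QuasiSeparatedSpace.inter_isCompact _ _ V.2 hV S.1.2 S.2.isCompact
    obtain ⟨a, ha⟩ : ∃ a, a = resSec Y (inf_le_left : V ⊓ S.1 ≤ V) s₁ := ⟨_, rfl⟩
    obtain ⟨b, hb⟩ : ∃ b, b = resSec Y (inf_le_right : V ⊓ S.1 ≤ S.1) s₂ := ⟨_, rfl⟩
    have qa : (i.app (V ⊓ S.1)).hom a = resSec X le_top (v ^ n) := by
      rw [ha, app_resSec, hs₁, resSec_resSec]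
    have qb : (i.app (V ⊓ S.1)).hom b = resSec X le_top (v ^ n) := by
      rw [hb, app_resSec, hs₂, resSec_resSec]
    have hnil : IsNilpotent (a - b) :=
      isNilpotent_of_app_eq_zero i hVS (by rw [map_sub, qa, qb, sub_self])
    have hbas : Y.basicOpen a = V ⊓ S.1 ⊓ D := by
      apply preimage_injective i
      rw [Scheme.preimage_basicOpen]
      erw [qa]
      rw [resSec, Scheme.basicOpen_res, X.basicOpen_pow v hn, ← hD]
      rfl
    obtain ⟨M, hM⟩ := exists_pow_mul_eq_zero_of_res_basicOpen_eq_zero_of_isCompact Y hVS (a - b) a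
      (by
        have aux : ∀ (W : Y.Opens) (_ : W = V ⊓ S.1 ⊓ D) (h : W ≤ V ⊓ S.1),
            resSec Y h (a - b) = 0 := by
          rintro _ rfl h
          have h1 := congrArg (resSec Y (inf_le_inf_right D inf_le_left : V ⊓ S.1 ⊓ D ≤ V ⊓ D)) hs₁'
          have h2 := congrArg
            (resSec Y (inf_le_inf_right D inf_le_right : V ⊓ S.1 ⊓ D ≤ S.1 ⊓ D)) hs₂'
          simp only [resSec_resSec] at h1 h2
          rw [map_sub, ha, hb, resSec_resSec, resSec_resSec, h1, h2, sub_self]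
        exact aux _ hbas (Y.basicOpen_le _))
    obtain ⟨K, hK, hab⟩ := exists_pow_eq_pow hnil hM
    obtain ⟨r, hr₁, hr₂⟩ := exists_glue_two (s₁ ^ K) (s₂ ^ K) (by
      rw [map_pow, map_pow, ← ha, ← hb, hab])
    refine ⟨n * K, Nat.mul_pos hn hK, r, ?_, ?_⟩
    · refine eq_of_resSec_eq (V := i ⁻¹ᵁ V) (W := i ⁻¹ᵁ S.1) (T := i ⁻¹ᵁ (V ⊔ S.1)) le_rfl (i.preimage_mono le_sup_left)
        (i.preimage_mono le_sup_right) ?_ ?_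
      · rw [← app_resSec i (le_sup_left : V ≤ V ⊔ S.1), hr₁, map_pow, hs₁, resSec_resSec, ← map_pow, pow_mul _ n K]
      · rw [← app_resSec i (le_sup_right : S.1 ≤ V ⊔ S.1), hr₂, map_pow, hs₂, resSec_resSec, ← map_pow, pow_mul _ n K]
    · refine eq_of_resSec_eq (V := V ⊓ D) (W := S.1 ⊓ D) (inf_sup_right _ _ _).le
        (inf_le_inf_right D le_sup_left) (inf_le_inf_right D le_sup_right) ?_ ?_
      · rw [resSec_resSec, resSec_resSec, ← resSec_resSec le_sup_left inf_le_left, hr₁, map_pow,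
          hs₁', ← map_pow, pow_mul _ n K]
      · rw [resSec_resSec, resSec_resSec, ← resSec_resSec le_sup_right inf_le_left, hr₂, map_pow,
          hs₂', ← map_pow, pow_mul _ n K]

theorem exists_pow_lift_top (i : X ⟶ Y) [IsClosedImmersion i] [Surjective i]
    [QuasiSeparatedSpace Y] [CompactSpace Y] (v : Γ(X, ⊤)) {W : Y.Opens} (hW : IsAffineOpen W)
    (hv : X.basicOpen v ≤ i ⁻¹ᵁ W) :
    ∃ n : ℕ, 0 < n ∧ ∃ s : Γ(Y, ⊤), (i.app ⊤).hom s = v ^ n := by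
  obtain ⟨h, hh⟩ := i.app_surjective W hW (resSec X le_top v)
  have hD : i ⁻¹ᵁ (Y.basicOpen h) = X.basicOpen v := by
    rw [Scheme.preimage_basicOpen]
    erw [hh]
    rw [resSec, Scheme.basicOpen_res]
    exact inf_eq_right.2 hv
  obtain ⟨n, hn, s, hs, -⟩ := exists_pow_lift i v hD (resSec Y (Y.basicOpen_le h) h) (by
    rw [app_resSec]; erw [hh]; rw [resSec_resSec]) (V := ⊤) isCompact_univ
  refine ⟨n, hn, s, hs.trans ?_⟩
  exact congr($(X.presheaf.map_id (op ⊤)).hom (v ^ n))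

/-- A scheme is affine if it has an affine closed subscheme with the same underlying space. -/
theorem isAffine_of_surjective_isClosedImmersion (i : X ⟶ Y) [IsClosedImmersion i] [Surjective i]
    [IsAffine X] : IsAffine Y := by
  have hY : CompactSpace Y := ⟨by
    rw [← Set.range_eq_univ.2 i.surjective]; exact isCompact_range i.continuous⟩
  have hsep : QuasiSeparatedSpace Y :=
    (quasiSeparatedSpace_congr
      (i.isClosedEmbedding.isEmbedding.toHomeomorphOfSurjective i.surjective)).1 inferInstance
  -- The functions with a power known to lift to `Y`. They generate the unit ideal, and the set is
  -- stable under multiplication by functions, so every function on `X` is a sum of its members.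
  let S : Set Γ(X, ⊤) := {v | ∃ W : Y.Opens, IsAffineOpen W ∧ X.basicOpen v ≤ i ⁻¹ᵁ W}
  have hbasis : ∀ (y : Y) (V : Y.Opens), y ∈ V → ∃ s : Γ(Y, ⊤), y ∈ Y.basicOpen s ∧
      Y.basicOpen s ≤ V := by
    intro y V hy
    obtain ⟨x, rfl⟩ := i.surjective y
    obtain ⟨_, ⟨W, hW, rfl⟩, hxW, hWV⟩ :=
      Y.isBasis_affineOpens.exists_subset_of_mem_open hy V.2
    obtain ⟨v, hv, hxv⟩ := (isAffineOpen_top X).exists_basicOpen_le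
      (⟨x, hxW⟩ : ↥(i ⁻¹ᵁ W)) (Set.mem_univ x)
    obtain ⟨n, hn, s, hs⟩ := exists_pow_lift_top i v hW hv
    have e : i ⁻¹ᵁ (Y.basicOpen s) = X.basicOpen v := by
      rw [Scheme.preimage_basicOpen]; erw [hs]; exact X.basicOpen_pow v hn
    refine ⟨s, ?_, ?_⟩
    · change x ∈ i ⁻¹ᵁ (Y.basicOpen s)
      rw [e]; exact hxv
    · rw [← preimage_le_iff i, e]
      exact hv.trans (i.preimage_mono hWV)
  have hspan : Ideal.span S = ⊤ := by
    rw [← (isAffineOpen_top X).iSup_basicOpen_eq_self_iff]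
    refine top_le_iff.1 fun x _ => ?_
    obtain ⟨_, ⟨W, hW, rfl⟩, hxW, -⟩ :=
      Y.isBasis_affineOpens.exists_subset_of_mem_open (Set.mem_univ (i x)) isOpen_univ
    obtain ⟨v, hv, hxv⟩ := (isAffineOpen_top X).exists_basicOpen_le
      (⟨x, hxW⟩ : ↥(i ⁻¹ᵁ W)) (Set.mem_univ x)
    exact Opens.mem_iSup.2 ⟨⟨v, W, hW, hv⟩, hxv⟩
  -- Each member of `S` has a positive power in the image of the functions on `Y`, hence is integral
  -- over them.
  have hint : i.appTop.hom.IsIntegral := by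
    intro a
    have ha : a ∈ Submodule.span Γ(X, ⊤) S := by
      change a ∈ Ideal.span S
      rw [hspan]; trivial
    refine Submodule.closure_induction (p := fun a _ => i.appTop.hom.IsIntegralElem a) ?_ ?_ ?_ ha
    · exact RingHom.isIntegralElem_zero _
    · intro _ _ _ _ h1 h2
      exact RingHom.IsIntegralElem.add _ h1 h2
    · rintro r v ⟨W, hW, hv⟩
      obtain ⟨n, hn, s, hs⟩ := exists_pow_lift_top i (r • v) hW (by
        rw [smul_eq_mul, X.basicOpen_mul]; exact inf_le_right.trans hv)
      let _ := i.appTop.hom.toAlgebra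
      refine IsIntegral.of_pow hn ?_
      rw [← hs]
      exact isIntegral_algebraMap (R := Γ(Y, ⊤)) (A := Γ(X, ⊤))
  have hcomp : i ≫ Y.toSpecΓ = X.toSpecΓ ≫ Spec.map i.appTop := Scheme.toSpecΓ_naturality i
  have hrange : Set.range Y.toSpecΓ = Set.range (Spec.map i.appTop) := by
    ext z
    constructor
    · rintro ⟨y, rfl⟩
      obtain ⟨x, rfl⟩ := i.surjective y
      exact ⟨X.toSpecΓ x, by rw [← Scheme.Hom.comp_apply, ← hcomp, Scheme.Hom.comp_apply]⟩
    · rintro ⟨y, rfl⟩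
      obtain ⟨x, rfl⟩ := X.toSpecΓ.surjective y
      exact ⟨i x, by rw [← Scheme.Hom.comp_apply, hcomp, Scheme.Hom.comp_apply]⟩
  -- `Y` has the same points as `X`, so its image in the spectrum of its functions is the image of a
  -- spectrum under an integral ring map.
  have hclosed : IsClosed (Set.range Y.toSpecΓ) := by
    rw [hrange]
    exact (PrimeSpectrum.isClosedMap_comap_of_isIntegral _ hint).isClosed_range
  -- Basic opens of global functions form a basis of `Y`. Together with the closed range this makes
  -- the canonical morphism to the spectrum of functions affine.
  have hind : Topology.IsInducing Y.toSpecΓ := by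
    rw [Topology.isInducing_iff_nhds]
    intro y
    refine le_antisymm (Y.toSpecΓ.continuous.tendsto y).le_comap ?_
    intro V hV
    obtain ⟨V', hV', hVo, hyV⟩ := mem_nhds_iff.1 hV
    obtain ⟨s, hys, hs⟩ := hbasis y ⟨V', hVo⟩ hyV
    refine ⟨_, (PrimeSpectrum.basicOpen s).2.mem_nhds ?_, ?_⟩
    · have : y ∈ Y.toSpecΓ ⁻¹ᵁ (PrimeSpectrum.basicOpen s) := by
        rw [Scheme.toSpecΓ_preimage_basicOpen]; exact hys
      exact this
    · have : (Y.toSpecΓ ⁻¹ᵁ (PrimeSpectrum.basicOpen s) : Set Y) ⊆ V' := by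
        rw [Scheme.toSpecΓ_preimage_basicOpen]; exact hs
      exact fun z hz => hV' (this hz)
  have := isAffineHom_of_isInducing Y.toSpecΓ hind hclosed
  exact isAffine_of_isAffineHom Y.toSpecΓ

/-- An open of a scheme is affine if its intersection with a closed subscheme with the same
underlying space is. -/
theorem isAffineOpen_of_preimage (i : X ⟶ Y) [IsClosedImmersion i] [Surjective i] {W : Y.Opens}
    (h : IsAffineOpen (i ⁻¹ᵁ W)) : IsAffineOpen W := by
  have : IsAffine (i ⁻¹ᵁ W) := h
  have : Surjective (i ∣_ W) := IsZariskiLocalAtTarget.restrict ‹Surjective i› W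
  exact isAffine_of_surjective_isClosedImmersion (i ∣_ W)

end Thickening

/-! ### Sheaves of algebras -/

section SheafLike

variable {T : Type u} [TopologicalSpace T] {R : Type u} [CommRing R]

/-- The restriction maps of a presheaf of algebras. -/
abbrev rmap (F : (Opens T)ᵒᵖ ⥤ CommAlgCat.{u} R) {V W : Opens T} (h : W ≤ V) :
    F.obj (op V) →ₐ[R] F.obj (op W) :=
  (F.map (homOfLE h).op).hom

theorem rmap_rmap (F : (Opens T)ᵒᵖ ⥤ CommAlgCat.{u} R) {V W Z : Opens T} (h : W ≤ V) (h' : Z ≤ W)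
    (x : F.obj (op V)) : rmap F h' (rmap F h x) = rmap F (h'.trans h) x := by
  have : F.map (homOfLE (h'.trans h)).op = F.map (homOfLE h).op ≫ F.map (homOfLE h').op := by
    rw [← F.map_comp]; rfl
  exact congr($(this.symm).hom x)

theorem rmap_self (F : (Opens T)ᵒᵖ ⥤ CommAlgCat.{u} R) {V : Opens T} (h : V ≤ V)
    (x : F.obj (op V)) : rmap F h x = x := by
  have : F.map (homOfLE h).op = 𝟙 _ := F.map_id (op V)
  exact congr($(this).hom x)

theorem polyVec_rmap {F : (Opens T)ᵒᵖ ⥤ CommAlgCat.{u} R} {p : ℕ} {U : Opens T}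
    (P : PolyVec F p U) {V W : Opens T} (hV : V ≤ U) (h : W ≤ V) (v : Fin p → F.obj (op V)) :
    rmap F h (P.1 ⟨V, hV⟩ v) = P.1 ⟨W, h.trans hV⟩ fun i => rmap F h (v i) :=
  P.2.2 ⟨V, hV⟩ ⟨W, h.trans hV⟩ h v

/-- The sheaf condition for a presheaf of algebras. -/
structure IsSheafLike (F : (Opens T)ᵒᵖ ⥤ CommAlgCat.{u} R) : Prop where
  sep : ∀ {V : Opens T} (s t : F.obj (op V)),
    (∀ x ∈ V, ∃ (W : Opens T) (h : W ≤ V), x ∈ W ∧ rmap F h s = rmap F h t) → s = t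
  glue : ∀ {ι : Type u} (W : ι → Opens T) {V : Opens T} (hW : ∀ i, W i ≤ V)
    (_ : ∀ x ∈ V, ∃ i, x ∈ W i) (s : ∀ i, F.obj (op (W i)))
    (_ : ∀ (i j : ι) (Z : Opens T) (hi : Z ≤ W i) (hj : Z ≤ W j), rmap F hi (s i) = rmap F hj (s j)),
    ∃ t : F.obj (op V), ∀ i, rmap F (hW i) t = s i

/-- Agreement on overlaps is local, and near each point of an overlap there is a member lying below
both, to which both pieces restrict. -/
theorem IsSheafLike.exists_of_basis {F : (Opens T)ᵒᵖ ⥤ CommAlgCat.{u} R} (hF : IsSheafLike F)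
    {ι : Type u} (r : ι → ι → Prop) (W : ι → Opens T) {V : Opens T} (hr : ∀ i j, r i j → W i ≤ W j)
    (hW : ∀ i, W i ≤ V) (hV : ∀ x ∈ V, ∃ i, x ∈ W i)
    (hb : ∀ i j, ∀ x ∈ W i ⊓ W j, ∃ l, r l i ∧ r l j ∧ x ∈ W l)
    (s : ∀ i, F.obj (op (W i))) (hs : ∀ i j (h : r i j), rmap F (hr i j h) (s j) = s i) :
    ∃ t : F.obj (op V), ∀ i, rmap F (hW i) t = s i := by
  refine hF.glue W hW hV s fun i j Z hi hj => hF.sep _ _ fun x hx => ?_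
  obtain ⟨l, hli, hlj, hxl⟩ := hb i j x ⟨hi hx, hj hx⟩
  refine ⟨W l ⊓ Z, inf_le_right, ⟨hxl, hx⟩, ?_⟩
  rw [rmap_rmap, rmap_rmap, ← rmap_rmap F (hr l i hli) inf_le_left,
    ← rmap_rmap F (hr l j hlj) inf_le_left, hs l i hli, hs l j hlj]

theorem isSheafLike_algSheaf {A : Type u} [CommRing A] {Y : Scheme.{u}} (f : Y ⟶ Spec (.of A)) :
    IsSheafLike (algSheaf f) where
  sep {V} s t h := by
    choose W hW hx e using h
    refine Y.sheaf.eq_of_locally_eq' (fun x : V => W x.1 x.2) V (fun x => homOfLE (hW x.1 x.2))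
      (fun x hxV => Opens.mem_iSup.2 ⟨⟨x, hxV⟩, hx x hxV⟩) s t fun x => e x.1 x.2
  glue {ι} W {V} hW hV s hs := by
    obtain ⟨t, ht, -⟩ := Y.sheaf.existsUnique_gluing' W V (fun i => homOfLE (hW i))
      (fun x hx => Opens.mem_iSup.2 (hV x hx)) s
      (fun i j => hs i j (W i ⊓ W j) inf_le_left inf_le_right)
    exact ⟨t, ht⟩

end SheafLike

/-! ### The sheaf `A ⊗ 𝒪`. -/

section BaseChange

variable {T : Type u} [TopologicalSpace T] {k : Type u} [Field k]

theorem rmap_baseChange (A : Type u) [CommRing A] [Algebra k A]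
    (F : (Opens T)ᵒᵖ ⥤ CommAlgCat.{u} k) {V W : Opens T} (h : W ≤ V) (x : A ⊗[k] F.obj (op V)) :
    rmap (baseChange A F) h x = Algebra.TensorProduct.map (AlgHom.id A A) (rmap F h) x :=
  rfl

theorem rmap_baseChange_tmul (A : Type u) [CommRing A] [Algebra k A]
    (F : (Opens T)ᵒᵖ ⥤ CommAlgCat.{u} k) {V W : Opens T} (h : W ≤ V) (a : A) (x : F.obj (op V)) :
    rmap (baseChange A F) h (a ⊗ₜ[k] x) = a ⊗ₜ[k] rmap F h x :=
  rfl

/-- The coordinates of an element of `A ⊗ B` with respect to a basis of `A`. -/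
def tensorCoords {A B ι : Type*} [CommRing A] [Algebra k A] [CommRing B] [Algebra k B] 
    (b : Module.Basis ι k A) : A ⊗[k] B ≃ₗ[k] (ι →₀ B) :=
  letI := Classical.decEq ι
  TensorProduct.equivFinsuppOfBasisLeft b

theorem tensorCoords_map {A B B' ι : Type*} [CommRing A] [Algebra k A] [CommRing B] [Algebra k B]
    [CommRing B'] [Algebra k B'] (b : Module.Basis ι k A) (g : B →ₐ[k] B') (x : A ⊗[k] B) (i : ι) :
    tensorCoords b (Algebra.TensorProduct.map (AlgHom.id A A) g x) i = g (tensorCoords b x i) := by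
  induction x with
  | zero => simp
  | add x y hx hy => simp [hx, hy]
  | tmul a x => simp [tensorCoords]

/-- A basis of `A` identifies `A ⊗ F` with a power of `F`, compatibly with restriction. Finiteness
of the basis ensures that glued coordinates again come from an element of the tensor product. -/
theorem isSheafLike_baseChange (A : Type u) [CommRing A] [Algebra k A] [FiniteDimensional k A]
    {F : (Opens T)ᵒᵖ ⥤ CommAlgCat.{u} k} (hF : IsSheafLike F) : IsSheafLike (baseChange A F) := by
  let b := Module.finBasis k A
  refine ⟨fun {V} s t h => ?_, fun {ι} W {V} hW hV s hs => ?_⟩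
  · apply (tensorCoords (B := F.obj (op V)) b).injective
    ext i
    refine hF.sep _ _ fun x hx => ?_
    obtain ⟨W, hW, hxW, e⟩ := h x hx
    refine ⟨W, hW, hxW, ?_⟩
    rw [← tensorCoords_map b (rmap F hW), ← tensorCoords_map b (rmap F hW), ← rmap_baseChange,
      ← rmap_baseChange, e]
  · have key : ∀ l : Fin (Module.finrank k A), ∃ t : F.obj (op V), ∀ i, rmap F (hW i) t =
        tensorCoords (B := F.obj (op (W i))) b (s i) l := by
      intro l
      refine hF.glue W hW hV _ fun i j Z hi hj => ?_
      rw [← tensorCoords_map b (rmap F hi), ← tensorCoords_map b (rmap F hj), ← rmap_baseChange,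
        ← rmap_baseChange, hs]
    choose t ht using key
    refine ⟨(tensorCoords (B := F.obj (op V)) b).symm (Finsupp.equivFunOnFinite.symm t),
      fun i => ?_⟩
    apply (tensorCoords (B := F.obj (op (W i))) b).injective
    ext l
    rw [rmap_baseChange, tensorCoords_map, LinearEquiv.apply_symm_apply]
    exact ht l i

end BaseChange

/-! ### Morphisms from `A ⊗ 𝒪` over an affine open. -/

section AlgFamily

variable {T : Type u} [TopologicalSpace T] {A : Type u} [CommRing A]

/-- A morphism, over an open set `U`, of presheaves of algebras. -/
structure AlgFamily (F G : (Opens T)ᵒᵖ ⥤ CommAlgCat.{u} A) (U : Opens T) where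
  /-- the component at an open set contained in `U` -/
  app : ∀ V : Opens T, V ≤ U → (F.obj (op V) →ₐ[A] G.obj (op V))
  naturality : ∀ (V W : Opens T) (h : V ≤ U) (hW : W ≤ V) (x : F.obj (op V)),
    app W (hW.trans h) (rmap F hW x) = rmap G hW (app V h x)

theorem exists_extend_localization {k A B B' C : Type*} [CommRing k] [CommRing A] [Algebra k A]
    [CommRing B] [Algebra k B] [CommRing B'] [Algebra k B'] [CommRing C] [Algebra A C]
    (g : B →ₐ[k] B') (f : B) (hg : letI := g.toRingHom.toAlgebra; IsLocalization.Away f B')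
    (h : A ⊗[k] B →ₐ[A] C) (hu : IsUnit (h (1 ⊗ₜ f))) :
    ∃ h' : A ⊗[k] B' →ₐ[A] C, ∀ x, h' (Algebra.TensorProduct.map (AlgHom.id A A) g x) = h x := by
  let _ := g.toRingHom.toAlgebra
  have halg : ∀ x, algebraMap B B' x = g x := fun _ => rfl
  let _ : Algebra k C := ((algebraMap A C).comp (algebraMap k A)).toAlgebra
  have : IsScalarTower k A C := IsScalarTower.of_algebraMap_eq fun _ => rfl
  let hB : B →ₐ[k] C := (h.restrictScalars k).comp Algebra.TensorProduct.includeRight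
  have hB1 : ∀ b, hB b = h (1 ⊗ₜ b) := fun _ => rfl
  let l : B' →+* C := IsLocalization.Away.lift f (g := hB.toRingHom) hu
  have hl : ∀ b, l (g b) = h (1 ⊗ₜ b) := fun b => IsLocalization.Away.lift_eq f hu b
  let l' : B' →ₐ[k] C := { l with
    commutes' := fun r => by
      change l (algebraMap k B' r) = _
      rw [← g.commutes, hl, ← hB1, hB.commutes] }
  refine ⟨Algebra.TensorProduct.lift (Algebra.ofId A C) l' fun _ _ => Commute.all _ _, fun x => ?_⟩
  induction x with
  | zero => simp
  | add x y hx hy => rw [map_add, map_add, map_add, hx, hy]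
  | tmul a b =>
    rw [Algebra.TensorProduct.map_tmul, Algebra.TensorProduct.lift_tmul]
    change algebraMap A C a * l (g b) = _
    rw [hl, ← Algebra.smul_def, ← map_smul, TensorProduct.smul_tmul', smul_eq_mul, mul_one]

/-- A localization is an epimorphism of rings and remains one after tensoring with `A`. -/
theorem algHom_ext_localization {k A B B' C : Type*} [CommRing k] [CommRing A] [Algebra k A]
    [CommRing B] [Algebra k B] [CommRing B'] [Algebra k B'] [CommRing C] [Algebra A C]
    (g : B →ₐ[k] B') (f : B) (hg : letI := g.toRingHom.toAlgebra; IsLocalization.Away f B')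
    (h₁ h₂ : A ⊗[k] B' →ₐ[A] C)
    (e : ∀ x, h₁ (Algebra.TensorProduct.map (AlgHom.id A A) g x) =
      h₂ (Algebra.TensorProduct.map (AlgHom.id A A) g x)) : h₁ = h₂ := by
  let _ := g.toRingHom.toAlgebra
  have halg : ∀ x, algebraMap B B' x = g x := fun _ => rfl
  have key : h₁.toRingHom.comp (Algebra.TensorProduct.includeRight (A := A) (R := k) (B := B')).toRingHom =
      h₂.toRingHom.comp (Algebra.TensorProduct.includeRight (A := A) (R := k) (B := B')).toRingHom := by
    refine IsLocalization.ringHom_ext (Submonoid.powers f) (RingHom.ext fun b => ?_)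
    have := e (1 ⊗ₜ b)
    rw [Algebra.TensorProduct.map_tmul, map_one] at this
    exact this
  refine AlgHom.ext fun x => ?_
  induction x with
  | zero => simp
  | add x y hx hy => rw [map_add, map_add, hx, hy]
  | tmul a b =>
    have := congr($key b)
    change h₁ (1 ⊗ₜ b) = h₂ (1 ⊗ₜ b) at this
    rw [show a ⊗ₜ[k] b = a • ((1 : A) ⊗ₜ[k] b) by
      rw [TensorProduct.smul_tmul', smul_eq_mul, mul_one], map_smul, map_smul, this]

variable {k : Type u} [Field k] [Algebra k A] {X : Scheme.{u}} (π : X ⟶ Spec (.of k))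

theorem isLocalization_rmap {U : X.Opens} (hU : IsAffineOpen U) (f : Γ(X, U)) :
    letI := (rmap (algSheaf π) (X.basicOpen_le f)).toRingHom.toAlgebra
    IsLocalization.Away (R := (algSheaf π).obj (op U)) f ((algSheaf π).obj (op (X.basicOpen f))) :=
  hU.isLocalization_basicOpen f

variable {π}

/-- Over an affine open a morphism is determined by its effect on global functions: it extends to
basic opens by the universal property of localization, for which the functions have to become units,
and then to all opens by gluing. -/
theorem AlgFamily.exists_of_isAffineOpen {G : (Opens X)ᵒᵖ ⥤ CommAlgCat.{u} A} (hG : IsSheafLike G)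
    {U : X.Opens} (hU : IsAffineOpen U) (h : A ⊗[k] (algSheaf π).obj (op U) →ₐ[A] G.obj (op U))
    (hu : ∀ f : (algSheaf π).obj (op U), IsUnit (rmap G (X.basicOpen_le f) (h (1 ⊗ₜ f)))) :
    ∃ s : AlgFamily (baseChange A (algSheaf π)) G U, s.app U le_rfl = h := by
  -- The extension to a basic open is recorded together with its uniqueness, so that it does not
  -- depend on the function defining the open and compatibility between basic opens is automatic.
  have hD : ∀ D : {D : X.Opens // ∃ f : Γ(X, U), X.basicOpen f = D}, ∃ (hDU : D.1 ≤ U)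
      (hd : A ⊗[k] (algSheaf π).obj (op D.1) →ₐ[A] G.obj (op D.1)),
      (∀ x, hd (rmap (baseChange A (algSheaf π)) hDU x) = rmap G hDU (h x)) ∧
      ∀ (C : Type u) [CommRing C] [Algebra A C]
        (h₁ h₂ : A ⊗[k] (algSheaf π).obj (op D.1) →ₐ[A] C),
        (∀ x, h₁ (rmap (baseChange A (algSheaf π)) hDU x) =
          h₂ (rmap (baseChange A (algSheaf π)) hDU x)) → h₁ = h₂ := by
    rintro ⟨_, f, rfl⟩
    obtain ⟨h', hh'⟩ := exists_extend_localization (rmap (algSheaf π) (X.basicOpen_le f)) f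
      (isLocalization_rmap π hU f) ((rmap G (X.basicOpen_le f)).comp h) (hu f)
    exact ⟨X.basicOpen_le f, h', hh', fun C _ _ h₁ h₂ e => algHom_ext_localization
      (rmap (algSheaf π) (X.basicOpen_le f)) f (isLocalization_rmap π hU f) h₁ h₂ e⟩
  choose hDU hd hd1 hd2 using hD
  have hdnat : ∀ D D' (hDD : D'.1 ≤ D.1) (x : A ⊗[k] (algSheaf π).obj (op D.1)),
      hd D' (rmap (baseChange A (algSheaf π)) hDD x) = rmap G hDD (hd D x) := by
    intro D D' hDD x
    refine congr($(hd2 D _ ((hd D').comp (rmap (baseChange A (algSheaf π)) hDD))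
      ((rmap G hDD).comp (hd D)) fun x => ?_) x)
    change hd D' (rmap (baseChange A (algSheaf π)) hDD (rmap (baseChange A (algSheaf π)) _ x)) =
      rmap G hDD (hd D (rmap (baseChange A (algSheaf π)) _ x))
    rw [rmap_rmap, hd1, hd1, rmap_rmap]
  have hcov : ∀ V : X.Opens, V ≤ U → ∀ p ∈ V, ∃ D : {D : X.Opens // ∃ f : Γ(X, U),
      X.basicOpen f = D}, D.1 ≤ V ∧ p ∈ D.1 := by
    intro V hV p hp
    obtain ⟨f, hf, hpf⟩ := hU.exists_basicOpen_le (⟨p, hp⟩ : V) (hV hp)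
    exact ⟨⟨_, f, rfl⟩, hf, hpf⟩
  have hex : ∀ (V : X.Opens) (hV : V ≤ U) (x : A ⊗[k] (algSheaf π).obj (op V)),
      ∃ y : G.obj (op V), ∀ D (hDV : D.1 ≤ V),
        rmap G hDV y = hd D (rmap (baseChange A (algSheaf π)) hDV x) := by
    intro V hV x
    obtain ⟨y, hy⟩ := hG.exists_of_basis
      (ι := {D : {D : X.Opens // ∃ f : Γ(X, U), X.basicOpen f = D} // D.1 ≤ V})
      (fun D D' => D.1.1 ≤ D'.1.1) (fun D => D.1.1) (V := V) (fun _ _ h => h) (fun D => D.2)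
      (fun p hp => by
        obtain ⟨D, h1, h2⟩ := hcov V hV p hp
        exact ⟨⟨D, h1⟩, h2⟩)
      (fun D D' p hp => by
        obtain ⟨D'', h1, h2⟩ := hcov (D.1.1 ⊓ D'.1.1) (inf_le_left.trans (D.2.trans hV)) p hp
        exact ⟨⟨D'', h1.trans (inf_le_left.trans D.2)⟩, h1.trans inf_le_left,
          h1.trans inf_le_right, h2⟩)
      (fun D => hd D.1 (rmap (baseChange A (algSheaf π)) D.2 x))
      (fun D D' h => by rw [← hdnat, rmap_rmap])
    exact ⟨y, fun D hDV => hy ⟨D, hDV⟩⟩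
  choose y hy using hex
  have huniq : ∀ (V : X.Opens) (hV : V ≤ U) (a b : G.obj (op V)),
      (∀ (D : {D : X.Opens // ∃ f : Γ(X, U), X.basicOpen f = D}) (hDV : D.1 ≤ V),
        rmap G hDV a = rmap G hDV b) → a = b := by
    intro V hV a b hab
    refine hG.sep _ _ fun p hp => ?_
    obtain ⟨D, h1, h2⟩ := hcov V hV p hp
    exact ⟨D.1, h1, h2, hab D h1⟩
  have y_one : ∀ V hV, y V hV 1 = 1 := fun V hV => huniq V hV _ _ fun D h => by
    rw [hy, map_one, map_one, map_one]
  have y_zero : ∀ V hV, y V hV 0 = 0 := fun V hV => huniq V hV _ _ fun D h => by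
    rw [hy, map_zero, map_zero, map_zero]
  have y_mul : ∀ V hV a b, y V hV (a * b) = y V hV a * y V hV b :=
    fun V hV a b => huniq V hV _ _ fun D h => by
      rw [hy, map_mul, map_mul, map_mul, hy, hy]
  have y_add : ∀ V hV a b, y V hV (a + b) = y V hV a + y V hV b :=
    fun V hV a b => huniq V hV _ _ fun D h => by
      rw [hy, map_add, map_add, map_add, hy, hy]
  have y_alg : ∀ V hV r, y V hV (algebraMap A (A ⊗[k] (algSheaf π).obj (op V)) r) =
      algebraMap A (G.obj (op V)) r := fun V hV r => huniq V hV _ _ fun D h => by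
    rw [hy, AlgHom.commutes, AlgHom.commutes, AlgHom.commutes]
  let Y : ∀ V : X.Opens, V ≤ U → (A ⊗[k] (algSheaf π).obj (op V) →ₐ[A] G.obj (op V)) :=
    fun V hV => AlgHom.mk ⟨⟨⟨y V hV, y_one V hV⟩, y_mul V hV⟩, y_zero V hV, y_add V hV⟩ (y_alg V hV)
  have hY : ∀ V hV x, Y V hV x = y V hV x := fun _ _ _ => rfl
  clear_value Y
  refine ⟨⟨Y, fun V W hV hW x => ?_⟩, ?_⟩
  · refine huniq W (hW.trans hV) _ _ fun D h => ?_
    rw [hY, hY, hy, rmap_rmap, rmap_rmap, hy]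
  · refine AlgHom.ext fun x => huniq U le_rfl _ _ fun D h => ?_
    change rmap G h (Y U le_rfl x) = _
    rw [hY, hy, ← hd1]

end AlgFamily

/-! ### Local Artinian algebras with residue field `k`. -/

section LocalArtinian

variable {k A : Type u} [Field k] [CommRing A] [Algebra k A] [IsLocalRing A] [IsArtinianRing A]
  (ε : A →ₐ[k] k)

omit [IsArtinianRing A] in
theorem ker_eq_maximalIdeal : RingHom.ker ε = IsLocalRing.maximalIdeal A := by
  have hs : Function.Surjective ε := fun r => ⟨algebraMap k A r, by simp⟩
  have := RingHom.ker_isMaximal_of_surjective ε hs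
  exact IsLocalRing.eq_maximalIdeal this

theorem isNilpotent_ker : IsNilpotent (RingHom.ker ε) := by
  rw [ker_eq_maximalIdeal]
  have := IsArtinianRing.isNilpotent_jacobson_bot (R := A)
  rwa [IsLocalRing.jacobson_eq_maximalIdeal ⊥ bot_ne_top] at this

-- The algebra acts on each quotient of successive powers of the maximal ideal through `k`, these
-- powers are finitely generated ideals, and one of them is zero. Descending along the powers gives
-- a finite spanning set over `k`.
include ε in
theorem finiteDimensional_of_residue : FiniteDimensional k A := by
  obtain ⟨N, hN⟩ := isNilpotent_ker ε
  set m := RingHom.ker ε with hm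
  have step : ∀ i j, i + j = N → ((m ^ i).restrictScalars k).FG := by
    intro i j
    induction j generalizing i with
    | zero =>
      rintro rfl
      rw [add_zero] at hN
      rw [hN]
      convert Submodule.fg_bot
      ext; simp
    | succ j ih =>
      intro hij
      obtain ⟨S, hS⟩ := (inferInstance : IsNoetherianRing A).noetherian (m ^ i)
      have h2 : (m ^ i).restrictScalars k =
          Submodule.span k (S : Set A) ⊔ (m ^ (i + 1)).restrictScalars k := by
        refine le_antisymm (fun x hx => ?_) (sup_le ?_ ?_)
        · change x ∈ m ^ i at hx
          rw [← hS] at hx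
          induction hx using Submodule.span_induction with
          | mem x hx => exact Submodule.mem_sup_left (Submodule.subset_span hx)
          | zero => exact zero_mem _
          | add x y _ _ hx hy => exact add_mem hx hy
          | smul a x hxS hx =>
            have : a • x = ε a • x + (a - algebraMap k A (ε a)) * x := by
              rw [sub_mul, smul_eq_mul, Algebra.smul_def]; ring
            rw [this]
            refine add_mem (Submodule.smul_mem _ _ hx) (Submodule.mem_sup_right ?_)
            change _ ∈ m ^ (i + 1)
            rw [pow_succ']
            refine Ideal.mul_mem_mul ?_ (hS ▸ hxS)
            rw [hm, RingHom.mem_ker]; simp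
        · rw [Submodule.span_le]
          intro x hx
          change x ∈ m ^ i
          rw [← hS]
          exact Submodule.subset_span hx
        · exact fun x hx => Ideal.pow_le_pow_right (Nat.le_succ i) hx
      rw [h2]
      exact (Submodule.fg_span S.finite_toSet).sup (ih (i + 1) (by omega))
  have := step 0 N (zero_add N)
  rw [pow_zero, Ideal.one_eq_top] at this
  exact ⟨this⟩

end LocalArtinian

/-! ### Nakayama's lemma and maps that are the identity on the closed fibre. -/

section Nakayama

variable {k A : Type u} [Field k] [CommRing A] [Algebra k A] (ε : A →ₐ[k] k)

@[simp]
theorem redk_tmul (B : CommAlgCat.{u} k) (a : A) (b : B) : redk ε B (a ⊗ₜ b) = ε a • b := by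
  simp [redk, red]

theorem redk_one_tmul (B : CommAlgCat.{u} k) (b : B) : redk ε B (1 ⊗ₜ b) = b := by
  simp

theorem sub_redk_mem (B : CommAlgCat.{u} k) (x : A ⊗[k] B) :
    x - 1 ⊗ₜ redk ε B x ∈ (RingHom.ker ε) • (⊤ : Submodule A (A ⊗[k] B)) := by
  induction x with
  | zero => simp
  | add x y hx hy =>
    rw [map_add, TensorProduct.tmul_add, add_sub_add_comm]
    exact add_mem hx hy
  | tmul a b =>
    rw [redk_tmul, ← TensorProduct.smul_tmul, ← TensorProduct.sub_tmul,
      show (a - ε a • (1 : A)) ⊗ₜ[k] b = (a - ε a • (1 : A)) • ((1 : A) ⊗ₜ[k] b) by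
        rw [TensorProduct.smul_tmul', smul_eq_mul, mul_one]]
    exact Submodule.smul_mem_smul (by simp [RingHom.mem_ker]) trivial

/-- Nilpotency of the ideal replaces finite generation in Nakayama's lemma: the inclusion is
iterated until the power of `I` is zero. -/
theorem eq_bot_of_le_smul_of_isNilpotent {R M : Type*} [CommRing R] [AddCommGroup M] [Module R M]
    {I : Ideal R} (hI : IsNilpotent I) {K : Submodule R M} (h : K ≤ I • K) : K = ⊥ := by
  obtain ⟨n, hn⟩ := hI
  have : ∀ i, K ≤ I ^ i • K := by
    intro i
    induction i with
    | zero => simp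
    | succ i ih =>
      rw [pow_succ, mul_smul]
      exact ih.trans (Submodule.smul_mono le_rfl h)
  have := this n
  rwa [hn, Submodule.zero_eq_bot, Submodule.bot_smul, le_bot_iff] at this

theorem eq_top_of_sup_smul_of_isNilpotent {R M : Type*} [CommRing R] [AddCommGroup M] [Module R M]
    {I : Ideal R} (hI : IsNilpotent I) {K : Submodule R M}
    (h : (⊤ : Submodule R M) ≤ K ⊔ I • (⊤ : Submodule R M)) : K = ⊤ := by
  obtain ⟨n, hn⟩ := hI
  have : ∀ i, (⊤ : Submodule R M) ≤ K ⊔ I ^ i • (⊤ : Submodule R M) := by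
    intro i
    induction i with
    | zero => simp
    | succ i ih =>
      refine ih.trans (sup_le le_sup_left ?_)
      refine (Submodule.smul_mono le_rfl h).trans ?_
      rw [Submodule.smul_sup, pow_succ, mul_smul]
      exact sup_le (Submodule.smul_le_right.trans le_sup_left) le_sup_right
  have := this n
  rwa [hn, Submodule.zero_eq_bot, Submodule.bot_smul, sup_bot_eq, top_le_iff] at this

/-- A homomorphism from a trivial deformation to a flat one which is the identity on the closed
fibre is bijective. -/
theorem bijective_of_redk_eq {B : CommAlgCat.{u} k} {C : Type u} [CommRing C] [Algebra A C]
    [Module.Flat A C] (hε : IsNilpotent (RingHom.ker ε)) (q : C →+* B)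
    (hq : RingHom.ker q ≤ (RingHom.ker ε).map (algebraMap A C)) (s : A ⊗[k] B →ₐ[A] C)
    (hs : ∀ x, q (s x) = redk ε B x) : Function.Bijective s := by
  have hker : ∀ c, q c = 0 → c ∈ RingHom.ker ε • (⊤ : Submodule A C) := fun c hc => by
    rw [Ideal.smul_top_eq_map]
    exact hq hc
  have hsurj : Function.Surjective s := by
    have : LinearMap.range s.toLinearMap = ⊤ := by
      refine eq_top_of_sup_smul_of_isNilpotent hε fun c _ => ?_
      have h1 : s (1 ⊗ₜ q c) ∈ LinearMap.range s.toLinearMap := ⟨_, rfl⟩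
      have h2 := hker (c - s (1 ⊗ₜ q c)) (by rw [map_sub, hs, redk_one_tmul, sub_self])
      have := add_mem (Submodule.mem_sup_left (T := RingHom.ker ε • ⊤) h1)
        (Submodule.mem_sup_right h2)
      rwa [add_sub_cancel] at this
    exact LinearMap.range_eq_top.1 this
  refine ⟨?_, hsurj⟩
  have hK : LinearMap.ker s.toLinearMap = ⊥ := by
    set K := LinearMap.ker s.toLinearMap with hKdef
    refine eq_bot_of_le_smul_of_isNilpotent hε fun x hx => ?_
    -- By flatness of `C`, the kernel `K` modulo the maximal ideal still injects into `A ⊗ B` modulo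
    -- it. An element of `K` has zero reduction, so it becomes zero there; hence `K` is contained in
    -- its multiple by the ideal.
    have hinj := LinearMap.lTensor_injective_of_exact_of_flat s.toLinearMap hsurj K.subtype
      K.subtype_injective (LinearMap.exact_subtype_ker_map _) (A ⧸ RingHom.ker ε)
    have hx0 : redk ε B x = 0 := by
      rw [← hs, show s x = 0 from hx, map_zero]
    have hxm := sub_redk_mem ε B x
    rw [hx0, TensorProduct.tmul_zero, sub_zero] at hxm
    have h1 : (1 : A ⧸ RingHom.ker ε) ⊗ₜ[A] x = 0 := by
      apply (TensorProduct.quotTensorEquivQuotSMul (A ⊗[k] B) (RingHom.ker ε)).injective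
      rw [TensorProduct.quotTensorEquivQuotSMul_mk_one_tmul, map_zero]
      exact (Submodule.Quotient.mk_eq_zero _).2 hxm
    have h2 : (1 : A ⧸ RingHom.ker ε) ⊗ₜ[A] (⟨x, hx⟩ : K) = 0 := by
      apply hinj
      rw [LinearMap.lTensor_tmul, map_zero]
      exact h1
    have h3 := congrArg (TensorProduct.quotTensorEquivQuotSMul K (RingHom.ker ε)) h2
    rw [TensorProduct.quotTensorEquivQuotSMul_mk_one_tmul, map_zero] at h3
    have h4 := (Submodule.Quotient.mk_eq_zero _).1 h3
    have h5 := Submodule.mem_map_of_mem (f := K.subtype) h4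
    rw [Submodule.map_smul'', Submodule.map_top, Submodule.range_subtype] at h5
    exact h5
  exact LinearMap.ker_eq_bot.1 hK

theorem ker_redk_le (B : CommAlgCat.{u} k) : RingHom.ker (redk ε B : A ⊗[k] B →+* B) ≤
    (RingHom.ker ε).map (algebraMap A (A ⊗[k] B)) := by
  intro x hx
  have := sub_redk_mem ε B x
  rw [show redk ε B x = 0 from hx, TensorProduct.tmul_zero, sub_zero, Ideal.smul_top_eq_map] at this
  exact this

theorem bijective_of_redk_comp {B : CommAlgCat.{u} k} (hε : IsNilpotent (RingHom.ker ε))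
    (s : A ⊗[k] B →ₐ[A] A ⊗[k] B) (hs : ∀ x, redk ε B (s x) = redk ε B x) : Function.Bijective s :=
  bijective_of_redk_eq ε hε (redk ε B : A ⊗[k] B →+* B) (ker_redk_le ε B) s hs

end Nakayama

/-! ### The kernel of reduction along a small extension. -/

section SmallExtension

variable {k A A₁ : Type u} [Field k] [CommRing A] [Algebra k A] [CommRing A₁] [Algebra k A₁]
  {ε : A →ₐ[k] k} {φ : A₁ →ₐ[k] A} {t : A₁}

/-- By right exactness the kernel comes from `ker φ ⊗ B`. A coefficient of `t` matters only through
its residue, which can be moved to the factor `B`. -/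
theorem exists_eq_tmul_of_red_eq_zero (hφ : Function.Surjective φ)
    (hker : RingHom.ker φ = Ideal.span {t}) (hann : ∀ a, (ε.comp φ) a = 0 → a * t = 0)
    (B : CommAlgCat.{u} k) (x : A₁ ⊗[k] B) (hx : red φ B x = 0) : ∃ b : B, x = t ⊗ₜ b := by
  have hex := rTensor_exact (R := k) B (f := (LinearMap.ker φ.toLinearMap).subtype)
    (g := φ.toLinearMap) (LinearMap.exact_subtype_ker_map _) hφ
  obtain ⟨y, rfl⟩ := (hex x).1 hx
  induction y with
  | zero => exact ⟨0, by simp⟩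
  | add y z hy hz =>
    rw [map_add] at hx ⊢
    obtain ⟨b, hb⟩ := hy ((hex _).2 ⟨_, rfl⟩)
    obtain ⟨c, hc⟩ := hz ((hex _).2 ⟨_, rfl⟩)
    exact ⟨b + c, by rw [hb, hc, TensorProduct.tmul_add]⟩
  | tmul a b =>
    obtain ⟨a, ha⟩ := a
    have ha' : a ∈ Ideal.span {t} := hker ▸ ha
    obtain ⟨c, rfl⟩ := Ideal.mem_span_singleton'.1 ha'
    refine ⟨(ε.comp φ) c • b, ?_⟩
    have h1 := hann (c - algebraMap k A₁ ((ε.comp φ) c)) (by simp)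
    rw [sub_mul, sub_eq_zero, ← Algebra.smul_def] at h1
    change (c * t) ⊗ₜ[k] b = _
    rw [h1, TensorProduct.smul_tmul]

/-- A `k`-linear functional with value `1` at `t` gives a retraction. -/
theorem tmul_left_injective (ht : t ≠ 0) (B : CommAlgCat.{u} k) {b : B}
    (h : t ⊗ₜ[k] b = (0 : A₁ ⊗[k] B)) : b = 0 := by
  obtain ⟨f, hf⟩ := Module.Projective.exists_dual_eq_one k ht
  have := congrArg ((TensorProduct.lid k B).toLinearMap ∘ₗ f.rTensor B) h
  simpa [hf] using this

theorem smallExt_tensor (ht : t ≠ 0)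
    (hker : RingHom.ker φ = Ideal.span {t}) (hann : ∀ a, (ε.comp φ) a = 0 → a * t = 0)
    (B : CommAlgCat.{u} k) :
    SmallExt (redk (ε.comp φ) B : A₁ ⊗[k] B →+* B) (TensorProduct.mk k A₁ B t).toAddMonoidHom where
  surj b := ⟨1 ⊗ₜ b, redk_one_tmul _ B b⟩
  inj := (injective_iff_map_eq_zero _).2 fun _ h => tmul_left_injective ht B h
  mul_j x b := by
    change x * t ⊗ₜ b = t ⊗ₜ (redk (ε.comp φ) B x * b)
    induction x with
    | zero => simp
    | add x y hx hy => rw [add_mul, hx, hy, map_add, add_mul, TensorProduct.tmul_add]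
    | tmul a c =>
      have h1 := hann (a - algebraMap k A₁ ((ε.comp φ) a)) (by simp)
      rw [sub_mul, sub_eq_zero, ← Algebra.smul_def] at h1
      rw [Algebra.TensorProduct.tmul_mul_tmul, h1, redk_tmul, TensorProduct.smul_tmul,
        smul_mul_assoc]
  ρ_j b := by
    change redk (ε.comp φ) B (t ⊗ₜ b) = 0
    have h1 : φ t = 0 := by
      rw [← RingHom.mem_ker, hker]; exact Ideal.mem_span_singleton_self t
    rw [redk_tmul, AlgHom.comp_apply, h1, map_zero, zero_smul]

end SmallExtension

/-! ### Opens of the closed fibre and opens of the total space. -/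

section UpOpen

variable {X Y : Scheme.{u}}

/-- The largest open set of `Y` whose preimage is contained in `V`. -/
def upOpen (i : X ⟶ Y) (V : X.Opens) : Y.Opens := sSup {W | i ⁻¹ᵁ W ≤ V}

theorem upOpen_mono (i : X ⟶ Y) {V V' : X.Opens} (h : V ≤ V') : upOpen i V ≤ upOpen i V' :=
  sSup_le_sSup fun _ hW => le_trans hW h

theorem le_upOpen (i : X ⟶ Y) {V : X.Opens} {W : Y.Opens} (h : i ⁻¹ᵁ W ≤ V) : W ≤ upOpen i V :=
  le_sSup h

theorem preimage_upOpen (i : X ⟶ Y) [IsClosedImmersion i] (V : X.Opens) :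
    i ⁻¹ᵁ upOpen i V = V := by
  refine le_antisymm ?_ ?_
  · rw [upOpen, sSup_eq_iSup', Scheme.Hom.preimage_iSup]
    exact iSup_le fun W => W.2
  · obtain ⟨W, hW, e⟩ := i.isClosedEmbedding.isInducing.isOpen_iff.1 V.2
    have e' : i ⁻¹ᵁ (⟨W, hW⟩ : Y.Opens) = V := Opens.ext e
    calc V = i ⁻¹ᵁ (⟨W, hW⟩ : Y.Opens) := e'.symm
      _ ≤ _ := i.preimage_mono (le_upOpen i e'.le)

theorem upOpen_preimage (i : X ⟶ Y) [IsClosedImmersion i] [Surjective i] (W : Y.Opens) :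
    upOpen i (i ⁻¹ᵁ W) = W :=
  preimage_injective i (preimage_upOpen i _)

theorem isAffineOpen_upOpen (i : X ⟶ Y) [IsClosedImmersion i] [Surjective i] {V : X.Opens}
    (hV : IsAffineOpen V) : IsAffineOpen (upOpen i V) :=
  isAffineOpen_of_preimage i (by rwa [preimage_upOpen])

end UpOpen

/-! ### Bijectivity of sheaf morphisms checked locally. -/

section Basis

variable {T : Type u} [TopologicalSpace T] {A : Type u} [CommRing A]

theorem AlgFamily.bijective_of_basis {F G : (Opens T)ᵒᵖ ⥤ CommAlgCat.{u} A} (hF : IsSheafLike F)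
    (hG : IsSheafLike G) {U : Opens T} (s : AlgFamily F G U)
    (hs : ∀ V ≤ U, ∀ p ∈ V, ∃ (D : Opens T) (hD : D ≤ U), D ≤ V ∧ p ∈ D ∧
      Function.Bijective (s.app D hD))
    (V : Opens T) (hV : V ≤ U) : Function.Bijective (s.app V hV) := by
  have hinj : ∀ (V : Opens T) (hV : V ≤ U), Function.Injective (s.app V hV) := by
    intro V hV x y hxy
    refine hF.sep _ _ fun p hp => ?_
    obtain ⟨D, hD, hDV, hpD, h⟩ := hs V hV p hp
    refine ⟨D, hDV, hpD, h.1 ?_⟩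
    rw [s.naturality V D hV hDV, s.naturality V D hV hDV, hxy]
  refine ⟨hinj V hV, fun y => ?_⟩
  have hex : ∀ D : {D : Opens T // ∃ (hD : D ≤ V), Function.Surjective (s.app D (hD.trans hV))},
      ∃ x, s.app D.1 (D.2.1.trans hV) x = rmap G D.2.1 y := fun D => D.2.2 _
  choose x hx using hex
  obtain ⟨z, hz⟩ := hF.glue
    (ι := {D : Opens T // ∃ (hD : D ≤ V), Function.Surjective (s.app D (hD.trans hV))})
    (fun D => D.1) (fun D => D.2.1) (fun p hp => by
    obtain ⟨D, hD, hDV, hpD, h⟩ := hs V hV p hp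
    exact ⟨⟨D, hDV, h.2⟩, hpD⟩) x (fun D D' Z hi hj => by
    apply hinj Z (hi.trans (D.2.1.trans hV))
    rw [s.naturality D.1 Z (D.2.1.trans hV) hi, s.naturality D'.1 Z (D'.2.1.trans hV) hj, hx, hx,
      rmap_rmap, rmap_rmap])
  refine ⟨z, hG.sep _ _ fun p hp => ?_⟩
  obtain ⟨D, hD, hDV, hpD, h⟩ := hs V hV p hp
  refine ⟨D, hDV, hpD, ?_⟩
  rw [← s.naturality V D hV hDV, hz ⟨D, hDV, h.2⟩, hx ⟨D, hDV, h.2⟩]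

end Basis

/-! ### The structure sheaf of a deformation, viewed on the closed fibre. -/

section Deformation

variable {k A : Type u} [Field k] [CommRing A] [Algebra k A] {X : Scheme.{u}}
  {π : X ⟶ Spec (.of k)} {Λ₀ : PolyVec (algSheaf π) 2 ⊤} {ε : A →ₐ[k] k}

namespace PoissonDeformation

variable (ξ : PoissonDeformation π Λ₀ ε)

theorem surjective_residue (ε : A →ₐ[k] k) : Function.Surjective ε :=
  fun r => ⟨algebraMap k A r, by simp⟩

instance isClosedImmersion_incl : IsClosedImmersion ξ.incl := by
  have : IsClosedImmersion (Spec.map (CommRingCat.ofHom ε.toRingHom)) :=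
    IsClosedImmersion.spec_of_surjective _ (surjective_residue ε)
  exact MorphismProperty.of_isPullback ξ.isPullback.flip this

instance surjective_incl [IsLocalRing A] [IsArtinianRing A] : Surjective ξ.incl := by
  have : Surjective (Spec.map (CommRingCat.ofHom ε.toRingHom)) := by
    refine ⟨fun p => ?_⟩
    refine ⟨(⊥ : PrimeSpectrum k), ?_⟩
    exact Subsingleton.elim (α := PrimeSpectrum A) _ _
  exact MorphismProperty.of_isPullback ξ.isPullback.flip this

/-- The structure sheaf of the total space, as a presheaf on the closed fibre. -/
abbrev sheaf : (Opens X)ᵒᵖ ⥤ CommAlgCat.{u} A where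
  obj V := (algSheaf ξ.proj).obj (op (upOpen ξ.incl V.unop))
  map g := (algSheaf ξ.proj).map (homOfLE (upOpen_mono ξ.incl g.unop.le)).op
  map_id V := (algSheaf ξ.proj).map_id _
  map_comp f g := by rw [← Functor.map_comp]; rfl

theorem rmap_sheaf {V W : X.Opens} (h : W ≤ V) (x : ξ.sheaf.obj (op V)) :
    rmap ξ.sheaf h x = rmap (algSheaf ξ.proj) (upOpen_mono ξ.incl h) x := rfl

theorem isSheafLike_sheaf [IsLocalRing A] [IsArtinianRing A] : IsSheafLike ξ.sheaf where
  sep {V} s t h := (isSheafLike_algSheaf ξ.proj).sep _ _ fun y hy => by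
    obtain ⟨x, rfl⟩ := ξ.incl.surjective y
    have hx : x ∈ ξ.incl ⁻¹ᵁ upOpen ξ.incl V := hy
    rw [preimage_upOpen] at hx
    obtain ⟨W, hW, hxW, e⟩ := h x hx
    rw [← preimage_upOpen ξ.incl W] at hxW
    exact ⟨_, upOpen_mono _ hW, hxW, e⟩
  glue {ι} W {V} hW hV s hs := by
    refine (isSheafLike_algSheaf ξ.proj).glue (fun i => upOpen ξ.incl (W i))
      (fun i => upOpen_mono _ (hW i)) (fun y hy => ?_) s (fun i j Z hi hj => ?_)
    · obtain ⟨x, rfl⟩ := ξ.incl.surjective y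
      have hx : x ∈ ξ.incl ⁻¹ᵁ upOpen ξ.incl V := hy
      rw [preimage_upOpen] at hx
      obtain ⟨i, hi⟩ := hV x hx
      rw [← preimage_upOpen ξ.incl (W i)] at hi
      exact ⟨i, hi⟩
    · have hZ := upOpen_preimage ξ.incl Z
      obtain ⟨Z', rfl⟩ : ∃ Z', Z = upOpen ξ.incl Z' := ⟨_, hZ.symm⟩
      rw [← preimage_le_iff ξ.incl, preimage_upOpen, preimage_upOpen] at hi hj
      exact hs i j Z' hi hj

/-- The reduction to the closed fibre. -/
def rho (V : X.Opens) : ξ.sheaf.obj (op V) →+* (algSheaf π).obj (op V) :=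
  (rmap (algSheaf π) (preimage_upOpen ξ.incl V).ge).toRingHom.comp
    (pullSec π ξ.proj ξ.incl (upOpen ξ.incl V))

theorem rho_apply (V : X.Opens) (x : ξ.sheaf.obj (op V)) : ξ.rho V x =
    rmap (algSheaf π) (preimage_upOpen ξ.incl V).ge (pullSec π ξ.proj ξ.incl _ x) := rfl

end PoissonDeformation

theorem pullSec_rmap {A A' : Type u} [CommRing A] [CommRing A'] {Y Z : Scheme.{u}}
    (f : Y ⟶ Spec (.of A)) (f' : Z ⟶ Spec (.of A')) (g : Y ⟶ Z) {V W : Z.Opens} (h : W ≤ V)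
    (x : (algSheaf f').obj (op V)) : pullSec f f' g W (rmap (algSheaf f') h x) =
      rmap (algSheaf f) (g.preimage_mono h) (pullSec f f' g V x) :=
  app_resSec g h x

theorem pullSec_algebraMap {A A' : Type u} [CommRing A] [CommRing A'] {Y Z : Scheme.{u}}
    (f : Y ⟶ Spec (.of A)) (f' : Z ⟶ Spec (.of A')) (g : Y ⟶ Z) (α : A' →+* A)
    (hg : g ≫ f' = f ≫ Spec.map (CommRingCat.ofHom α)) (V : Z.Opens) (a : A') :
    pullSec f f' g V (algebraMap A' ((algSheaf f').obj (op V)) a) =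
      algebraMap A ((algSheaf f).obj (op (g ⁻¹ᵁ V))) (α a) := by
  change ((((Scheme.ΓSpecIso (.of A')).inv ≫ f'.appLE ⊤ V _) ≫ g.app V).hom a) =
    (CommRingCat.ofHom α ≫ (Scheme.ΓSpecIso (.of A)).inv ≫ f.appLE ⊤ (g ⁻¹ᵁ V) (by simp)).hom a
  have e : ∀ (h : V ≤ f' ⁻¹ᵁ ⊤) (h' : g ⁻¹ᵁ V ≤ f ⁻¹ᵁ ⊤), f'.appLE ⊤ V h ≫ g.appLE V _ le_rfl =
      (Spec.map (CommRingCat.ofHom α)).appLE ⊤ ⊤ le_top ≫ f.appLE ⊤ (g ⁻¹ᵁ V) h' := by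
    intro h h'
    refine (Scheme.Hom.appLE_comp_appLE _ _ _ _ _ _ _).trans
      (Eq.trans ?_ (Scheme.Hom.appLE_comp_appLE _ _ _ _ _ _ _).symm)
    simp only [hg]
  have e' : CommRingCat.ofHom α ≫ (Scheme.ΓSpecIso (.of A)).inv =
      (Scheme.ΓSpecIso (.of A')).inv ≫ (Spec.map (CommRingCat.ofHom α)).appLE ⊤ ⊤ le_top := by
    rw [Scheme.ΓSpecIso_inv_naturality, Scheme.Hom.appTop, Scheme.Hom.app_eq_appLE]
    rfl
  rw [← Category.assoc (CommRingCat.ofHom α), e', Category.assoc, Category.assoc,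
    Scheme.Hom.app_eq_appLE]
  exact congr(((Scheme.ΓSpecIso (.of A')).inv ≫ $(e le_top le_top)).hom a)

namespace PoissonDeformation

variable (ξ : PoissonDeformation π Λ₀ ε)

theorem rho_rmap {V W : X.Opens} (h : W ≤ V) (x : ξ.sheaf.obj (op V)) :
    ξ.rho W (rmap ξ.sheaf h x) = rmap (algSheaf π) h (ξ.rho V x) := by
  rw [rho_apply, rho_apply, rmap_sheaf, pullSec_rmap, rmap_rmap, rmap_rmap]

theorem rho_algebraMap (V : X.Opens) (a : A) :
    ξ.rho V (algebraMap A (ξ.sheaf.obj (op V)) a) = algebraMap k _ (ε a) := by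
  rw [rho_apply, pullSec_algebraMap _ _ _ _ ξ.isPullback.w, AlgHom.commutes]
  rfl

theorem rho_preimage [IsLocalRing A] [IsArtinianRing A] (W : ξ.space.Opens)
    (x : (algSheaf ξ.proj).obj (op W)) :
    ξ.rho (ξ.incl ⁻¹ᵁ W) (rmap (algSheaf ξ.proj) (upOpen_preimage ξ.incl W).le x) =
      pullSec π ξ.proj ξ.incl W x := by
  rw [rho_apply, pullSec_rmap, rmap_rmap, rmap_self]

theorem isUnit_of_isUnit_rho [IsLocalRing A] [IsArtinianRing A] {V : X.Opens}
    {x : ξ.sheaf.obj (op V)} (hx : IsUnit (ξ.rho V x)) : IsUnit x := by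
  have h := hx.map (rmap (algSheaf π) (preimage_upOpen ξ.incl V).le)
  rw [rho_apply, rmap_rmap, rmap_self] at h
  exact isUnit_of_isUnit_app ξ.incl h

/-- The open of the total space over `V` is affine because its trace on the closed fibre is, and a
closed immersion is surjective on functions over affine opens. -/
theorem rho_surjective {V : X.Opens} (hV : IsAffineOpen V) [IsLocalRing A] [IsArtinianRing A] :
    Function.Surjective (ξ.rho V) := by
  intro y
  obtain ⟨x, hx⟩ : ∃ x : ξ.sheaf.obj (op V), pullSec π ξ.proj ξ.incl (upOpen ξ.incl V) x =
      rmap (algSheaf π) (preimage_upOpen ξ.incl V).le y :=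
    ξ.incl.app_surjective _ (isAffineOpen_upOpen ξ.incl hV) _
  refine ⟨x, ?_⟩
  rw [rho_apply, hx, rmap_rmap, rmap_self]

theorem flat_sheaf {V : X.Opens} (hV : IsAffineOpen V) [IsLocalRing A] [IsArtinianRing A] :
    Module.Flat A (ξ.sheaf.obj (op V)) := by
  have := ξ.flat
  have h1 := HasRingHomProperty.appLE @Flat ξ.proj this ⟨⊤, isAffineOpen_top _⟩
    ⟨_, isAffineOpen_upOpen ξ.incl hV⟩ le_top
  have h2 : ((Scheme.ΓSpecIso (.of A)).inv ≫ ξ.proj.appLE ⊤ (upOpen ξ.incl V) le_top).hom.Flat := by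
    rw [CommRingCat.hom_comp]
    exact RingHom.Flat.comp (RingHom.Flat.of_bijective
      (ConcreteCategory.bijective_of_isIso (Scheme.ΓSpecIso (.of A)).inv)) h1
  exact h2

/-- On affine opens the cartesian square becomes a pushout of rings. The quotient of `C` by the
ideal generated by the maximal ideal receives compatible maps from `C` and from `k`, so the quotient
map factors through the reduction and kills its kernel. -/
theorem ker_rho_le {V : X.Opens} (hV : IsAffineOpen V) [IsLocalRing A] [IsArtinianRing A] :
    RingHom.ker (ξ.rho V) ≤ (RingHom.ker ε).map (algebraMap A (ξ.sheaf.obj (op V))) := by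
  have hP := (isIso_pushoutSection_iff ξ.isPullback (US := ⊤) (UT := ⊤) (UX := upOpen ξ.incl V)
    (UY := ξ.incl ⁻¹ᵁ upOpen ξ.incl V) le_top le_top (by simp)).1
      (isIso_pushoutSection_of_isAffineOpen _ _ _ _ (isAffineOpen_top _) (isAffineOpen_top _)
        (isAffineOpen_upOpen ξ.incl hV))
  set C := ξ.sheaf.obj (op V) with hC
  set I := (RingHom.ker ε).map (algebraMap A C) with hI
  let mkI : Γ(ξ.space, upOpen ξ.incl V) ⟶ CommRingCat.of (C ⧸ I) :=
    CommRingCat.ofHom (Ideal.Quotient.mk I)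
  let l : Γ(Spec (.of k), ⊤) ⟶ CommRingCat.of (C ⧸ I) := (Scheme.ΓSpecIso (.of k)).hom ≫
    CommRingCat.ofHom (algebraMap k A) ≫ CommRingCat.ofHom ((Ideal.Quotient.mk I).comp
      (algebraMap A C))
  have hw : ξ.proj.appLE ⊤ (upOpen ξ.incl V) le_top ≫ mkI =
      (Spec.map (CommRingCat.ofHom ε.toRingHom)).appLE ⊤ ⊤ le_top ≫ l := by
    rw [← cancel_epi (Scheme.ΓSpecIso (.of A)).inv]
    have e' : CommRingCat.ofHom ε.toRingHom ≫ (Scheme.ΓSpecIso (.of k)).inv =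
        (Scheme.ΓSpecIso (.of A)).inv ≫
          (Spec.map (CommRingCat.ofHom ε.toRingHom)).appLE ⊤ ⊤ le_top := by
      rw [Scheme.ΓSpecIso_inv_naturality, Scheme.Hom.appTop, Scheme.Hom.app_eq_appLE]
      rfl
    have e'' : (Scheme.ΓSpecIso (.of A)).inv ≫
        (Spec.map (CommRingCat.ofHom ε.toRingHom)).appLE ⊤ ⊤ le_top ≫ l =
        CommRingCat.ofHom ε.toRingHom ≫ CommRingCat.ofHom (algebraMap k A) ≫
          CommRingCat.ofHom ((Ideal.Quotient.mk I).comp (algebraMap A C)) := by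
      rw [← Category.assoc, ← e', Category.assoc, Iso.inv_hom_id_assoc]
    refine Eq.trans ?_ e''.symm
    ext a
    change Ideal.Quotient.mk I (algebraMap A C a) =
      Ideal.Quotient.mk I (algebraMap A C (algebraMap k A (ε a)))
    rw [Ideal.Quotient.eq, ← map_sub]
    exact Ideal.mem_map_of_mem _ (by simp [RingHom.mem_ker])
  intro x hx
  have hx' : pullSec π ξ.proj ξ.incl (upOpen ξ.incl V) x = 0 := by
    have := congrArg (rmap (algSheaf π) (preimage_upOpen ξ.incl V).le) (RingHom.mem_ker.1 hx)
    rwa [rho_apply, rmap_rmap, rmap_self, map_zero] at this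
  have hd := hP.inl_desc mkI l hw
  have hx2 : (ξ.incl.appLE (upOpen ξ.incl V) (ξ.incl ⁻¹ᵁ upOpen ξ.incl V) le_rfl).hom x = 0 := by
    rw [← Scheme.Hom.app_eq_appLE]
    exact hx'
  rw [← Ideal.Quotient.eq_zero_iff_mem]
  change mkI.hom x = 0
  refine (congr($(hd).hom x)).symm.trans ?_
  exact (congrArg (hP.desc mkI l hw).hom hx2).trans (map_zero _)

end PoissonDeformation

end Deformation

/-! ### Uniqueness over affine opens, and lifting by formal smoothness. -/

section RingFamily

variable {k A : Type u} [Field k] [CommRing A] [Algebra k A] {X : Scheme.{u}}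
  {π : X ⟶ Spec (.of k)}

theorem ringHom_ext_localization {k A B B' C : Type*} [CommRing k] [CommRing A] [Algebra k A]
    [CommRing B] [Algebra k B] [CommRing B'] [Algebra k B'] [CommRing C]
    (g : B →ₐ[k] B') (f : B) (hg : letI := g.toRingHom.toAlgebra; IsLocalization.Away f B')
    (h₁ h₂ : A ⊗[k] B' →+* C)
    (e : ∀ x, h₁ (Algebra.TensorProduct.map (AlgHom.id A A) g x) =
      h₂ (Algebra.TensorProduct.map (AlgHom.id A A) g x)) : h₁ = h₂ := by
  let _ : Algebra A C := (h₁.comp Algebra.TensorProduct.includeLeftRingHom).toAlgebra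
  have h : ∀ a : A, h₂ (a ⊗ₜ 1) = h₁ (a ⊗ₜ 1) := fun a => by
    have := e (a ⊗ₜ 1)
    rw [Algebra.TensorProduct.map_tmul, map_one] at this
    exact this.symm
  exact congrArg AlgHom.toRingHom (algHom_ext_localization g f hg
    ({ h₁ with commutes' := fun a => rfl } : A ⊗[k] B' →ₐ[A] C) { h₂ with commutes' := h } e)

/-- Basic opens of `U` separate sections, and over them both families are determined by their values
on `U` because localization is an epimorphism. Ring homomorphisms are used instead of algebra
homomorphisms since the reductions compared later change the base ring. -/
theorem ringFamily_ext {A' : Type u} [CommRing A'] {G : (Opens X)ᵒᵖ ⥤ CommAlgCat.{u} A'}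
    (hG : IsSheafLike G) {U : X.Opens} (hU : IsAffineOpen U)
    (s t : ∀ V : X.Opens, V ≤ U → (A ⊗[k] (algSheaf π).obj (op V) →+* G.obj (op V)))
    (hs : ∀ (V W : X.Opens) (h : V ≤ U) (hW : W ≤ V) (x : A ⊗[k] (algSheaf π).obj (op V)),
      s W (hW.trans h) (rmap (baseChange A (algSheaf π)) hW x) = rmap G hW (s V h x))
    (ht : ∀ (V W : X.Opens) (h : V ≤ U) (hW : W ≤ V) (x : A ⊗[k] (algSheaf π).obj (op V)),
      t W (hW.trans h) (rmap (baseChange A (algSheaf π)) hW x) = rmap G hW (t V h x))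
    (h : ∀ x, s U le_rfl x = t U le_rfl x) (V : X.Opens) (hV : V ≤ U)
    (x : A ⊗[k] (algSheaf π).obj (op V)) : s V hV x = t V hV x := by
  have hbasic : ∀ f : Γ(X, U), s (X.basicOpen f) (X.basicOpen_le f) =
      t (X.basicOpen f) (X.basicOpen_le f) := by
    intro f
    refine ringHom_ext_localization (rmap (algSheaf π) (X.basicOpen_le f)) f
      (isLocalization_rmap π hU f) _ _ fun x => ?_
    have e1 := hs U (X.basicOpen f) le_rfl (X.basicOpen_le f) x
    have e2 := ht U (X.basicOpen f) le_rfl (X.basicOpen_le f) x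
    rw [h, ← e2] at e1
    exact e1
  refine hG.sep _ _ fun p hp => ?_
  obtain ⟨f, hf, hpf⟩ := hU.exists_basicOpen_le (⟨p, hp⟩ : V) (hV hp)
  refine ⟨X.basicOpen f, hf, hpf, ?_⟩
  rw [← hs V _ hV hf, ← ht V _ hV hf, hbasic]

variable (π) in
theorem formallySmooth_algSheaf [Smooth π] {V : X.Opens} (hV : IsAffineOpen V) :
    Algebra.FormallySmooth k ((algSheaf π).obj (op V)) := by
  have h1 := HasRingHomProperty.appLE @Smooth π ‹_› ⟨⊤, isAffineOpen_top _⟩ ⟨V, hV⟩ le_top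
  have h2 : ((Scheme.ΓSpecIso (.of k)).inv ≫ π.appLE ⊤ V le_top).hom.FormallySmooth := by
    rw [CommRingCat.hom_comp]
    exact RingHom.FormallySmooth.comp (RingHom.FormallySmooth.of_bijective
        (ConcreteCategory.bijective_of_isIso (Scheme.ΓSpecIso (.of k)).inv)) h1.formallySmooth
  exact h2

/-- Formal smoothness lifts `g` along `q` as a `k`-algebra map, which is then extended `A`-linearly.
-/
theorem exists_tensor_lift {B B' C : Type u} [CommRing B] [Algebra k B] [CommRing B'] [Algebra k B']
    [CommRing C] [Algebra A C] [Algebra.FormallySmooth k B] (q : C →+* B')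
    (hq : Function.Surjective q) (hn : IsNilpotent (RingHom.ker q))
    (hqk : ∀ r, q (algebraMap A C (algebraMap k A r)) = algebraMap k B' r) (g : B →ₐ[k] B') :
    ∃ s : A ⊗[k] B →ₐ[A] C, ∀ b, q (s (1 ⊗ₜ b)) = g b := by
  let _ : Algebra k C := ((algebraMap A C).comp (algebraMap k A)).toAlgebra
  have : IsScalarTower k A C := IsScalarTower.of_algebraMap_eq fun _ => rfl
  let q' : C →ₐ[k] B' := { q with commutes' := hqk }
  let l := Algebra.FormallySmooth.liftOfSurjective g q' hq hn
  refine ⟨Algebra.TensorProduct.lift (Algebra.ofId A C) l fun _ _ => Commute.all _ _, fun b => ?_⟩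
  rw [Algebra.TensorProduct.lift_tmul, map_one, one_mul]
  exact Algebra.FormallySmooth.liftOfSurjective_apply g q' hq hn b

end RingFamily

/-! ### Deformations of smooth affine schemes are trivial. -/

section Section

variable {k A : Type u} [Field k] [CommRing A] [Algebra k A] {X : Scheme.{u}}
  {π : X ⟶ Spec (.of k)} {Λ₀ : PolyVec (algSheaf π) 2 ⊤} {ε : A →ₐ[k] k}

theorem redk_rmap (ε : A →ₐ[k] k) (F : (Opens X)ᵒᵖ ⥤ CommAlgCat.{u} k) {V W : X.Opens} (h : W ≤ V)
    (x : A ⊗[k] F.obj (op V)) :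
    redk ε _ (rmap (baseChange A F) h x) = rmap F h (redk ε _ x) := by
  induction x with
  | zero => simp
  | add x y hx hy => simp only [map_add, hx, hy]
  | tmul a b =>
    rw [rmap_baseChange_tmul, redk_tmul, redk_tmul, map_smul]

namespace PoissonDeformation

variable [IsLocalRing A] [IsArtinianRing A] (ξ : PoissonDeformation π Λ₀ ε)

/-- Algebra homomorphisms from the trivial deformation over `U` which are the identity on the closed
fibre. -/
structure IsSection {U : X.Opens} (s : AlgFamily (baseChange A (algSheaf π)) ξ.sheaf U) :
    Prop where
  rho_app : ∀ (V : X.Opens) (h : V ≤ U) (x : A ⊗[k] (algSheaf π).obj (op V)),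
    ξ.rho V (s.app V h x) = redk ε _ x

variable {ξ}

/-- Over an affine open this is flatness plus Nakayama, for which the kernel of reduction must be
generated by the maximal ideal. The affine opens form a basis and both sides are sheaves. -/
theorem IsSection.bijective {U : X.Opens} {s : AlgFamily (baseChange A (algSheaf π)) ξ.sheaf U}
    (hs : ξ.IsSection s) (V : X.Opens) (hV : V ≤ U) : Function.Bijective (s.app V hV) := by
  have := finiteDimensional_of_residue ε
  refine AlgFamily.bijective_of_basis (isSheafLike_baseChange A (isSheafLike_algSheaf π))
    ξ.isSheafLike_sheaf s (fun V hV p hp => ?_) V hV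
  obtain ⟨_, ⟨D, hD, rfl⟩, hpD, hDV⟩ := X.isBasis_affineOpens.exists_subset_of_mem_open hp V.2
  have := ξ.flat_sheaf hD
  exact ⟨D, le_trans hDV hV, hDV, hpD, bijective_of_redk_eq ε (isNilpotent_ker ε) (ξ.rho D)
    (ξ.ker_rho_le hD) _ fun x => hs.rho_app D _ x⟩

variable (ξ)

omit [IsLocalRing A] [IsArtinianRing A] in
theorem isSection_of_isAffineOpen {U : X.Opens} (hU : IsAffineOpen U)
    (s : AlgFamily (baseChange A (algSheaf π)) ξ.sheaf U)
    (hs : ∀ b, ξ.rho U (s.app U le_rfl (1 ⊗ₜ b)) = b) : ξ.IsSection s where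
  rho_app := by
    refine ringFamily_ext (isSheafLike_algSheaf π) hU
      (fun V h => (ξ.rho V).comp (s.app V h).toRingHom) (fun V h => (redk ε _).toRingHom)
      (fun V W h hW x => ?_) (fun V W h hW x => redk_rmap ε _ hW x) (fun x => ?_)
    · change ξ.rho W (s.app W _ _) = rmap _ _ (ξ.rho V (s.app V h x))
      rw [s.naturality V W h hW, rho_rmap]
    · change ξ.rho U (s.app U le_rfl x) = redk ε _ x
      induction x with
      | zero => simp
      | add x y hx hy => simp only [map_add, hx, hy]
      | tmul a b =>
        rw [redk_tmul, show a ⊗ₜ[k] b = a • ((1 : A) ⊗ₜ[k] b) by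
          rw [TensorProduct.smul_tmul', smul_eq_mul, mul_one], map_smul, Algebra.smul_def, map_mul,
          hs, rho_algebraMap, ← Algebra.smul_def]

/-- The identity of the functions on `U` is lifted along the reduction, which is surjective with
nilpotent kernel. A function invertible on the closed fibre is invertible, so the lift extends to
all smaller opens. -/
theorem exists_isSection [Smooth π] {U : X.Opens} (hU : IsAffineOpen U) :
    ∃ s : AlgFamily (baseChange A (algSheaf π)) ξ.sheaf U, ξ.IsSection s := by
  have := formallySmooth_algSheaf π hU
  have hn : IsNilpotent (RingHom.ker (ξ.rho U)) := by
    obtain ⟨n, hn⟩ := isNilpotent_ker ε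
    refine ⟨n, le_bot_iff.1 ((Ideal.pow_right_mono (ξ.ker_rho_le hU) n).trans ?_)⟩
    rw [← Ideal.map_pow, hn, Ideal.zero_eq_bot, Ideal.map_bot]
  obtain ⟨h, hh⟩ := exists_tensor_lift (ξ.rho U) (ξ.rho_surjective hU) hn
    (fun r => by rw [rho_algebraMap, AlgHom.commutes]; rfl)
    (AlgHom.id k ((algSheaf π).obj (op U)))
  obtain ⟨s, rfl⟩ := AlgFamily.exists_of_isAffineOpen ξ.isSheafLike_sheaf hU h fun f => by
    apply ξ.isUnit_of_isUnit_rho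
    rw [rho_rmap, hh]
    exact X.toRingedSpace.isUnit_res_basicOpen f
  exact ⟨s, ξ.isSection_of_isAffineOpen hU s hh⟩

variable {ξ} {ι : Type u} {U : ι → X.Opens}

/-- The isomorphisms given by a family of sections. -/
def sectionEquiv {s : ∀ a, AlgFamily (baseChange A (algSheaf π)) ξ.sheaf (U a)}
    (hs : ∀ a, ξ.IsSection (s a)) (a : ι) (W : ξ.space.Opens) (h : ξ.incl ⁻¹ᵁ W ≤ U a) :
    A ⊗[k] (algSheaf π).obj (op (ξ.incl ⁻¹ᵁ W)) ≃ₐ[A] (algSheaf ξ.proj).obj (op W) :=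
  AlgEquiv.ofBijective
    ((rmap (algSheaf ξ.proj) (upOpen_preimage ξ.incl W).ge).comp ((s a).app _ h)) <| by
      refine Function.Bijective.comp (g := rmap (algSheaf ξ.proj) (upOpen_preimage ξ.incl W).ge)
        ?_ ((hs a).bijective _ h)
      refine Function.bijective_iff_has_inverse.2
        ⟨rmap (algSheaf ξ.proj) (upOpen_preimage ξ.incl W).le, fun x => ?_, fun x => ?_⟩
      · rw [rmap_rmap, rmap_self]
      · rw [rmap_rmap, rmap_self]

theorem sectionEquiv_apply {s : ∀ a, AlgFamily (baseChange A (algSheaf π)) ξ.sheaf (U a)}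
    (hs : ∀ a, ξ.IsSection (s a)) (a : ι) (W : ξ.space.Opens) (h : ξ.incl ⁻¹ᵁ W ≤ U a)
    (x : A ⊗[k] (algSheaf π).obj (op (ξ.incl ⁻¹ᵁ W))) : sectionEquiv hs a W h x =
      rmap (algSheaf ξ.proj) (upOpen_preimage ξ.incl W).ge ((s a).app _ h x) :=
  rfl

/-- Sections over an open covering trivialize the deformation. -/
def trivializationOfSection {s : ∀ a, AlgFamily (baseChange A (algSheaf π)) ξ.sheaf (U a)}
    (hs : ∀ a, ξ.IsSection (s a)) : Trivialization ξ U where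
  iso a W h := (sectionEquiv hs a W h).symm
  iso_map a W W' h hW h' x := by
    rw [AlgEquiv.symm_apply_eq, sectionEquiv_apply]
    obtain ⟨y, rfl⟩ := (sectionEquiv hs a W h).surjective x
    rw [AlgEquiv.symm_apply_apply, sectionEquiv_apply]
    have := (s a).naturality _ _ h h' y
    erw [this]
    rw [rmap_sheaf, rmap_rmap, rmap_rmap]
  iso_incl a W h x := by
    obtain ⟨y, rfl⟩ := (sectionEquiv hs a W h).surjective x
    rw [AlgEquiv.symm_apply_apply, sectionEquiv_apply, ← rho_preimage, rmap_rmap, rmap_self,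
      (hs a).rho_app]

variable (ξ) in
theorem nonempty_trivialization [Smooth π] (hU : ∀ a, IsAffineOpen (U a)) :
    Nonempty (Trivialization ξ U) := by
  choose s hs using fun a => ξ.exists_isSection (hU a)
  exact ⟨trivializationOfSection hs⟩

end PoissonDeformation

end Section

/-! ### Building bivector fields from their values on pairs. -/

section BivConstruct

variable {R M : Type*} [CommRing R] [CommRing M] [Algebra R M]

/-- The alternating map of two arguments given by an alternating bilinear map. -/
def altTwo (f : M →ₗ[R] M →ₗ[R] M) (h : ∀ x, f x x = 0) : M [⋀^Fin 2]→ₗ[R] M where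
  toFun v := f (v 0) (v 1)
  map_update_add' := by
    intro inst v i x y
    obtain rfl : inst = instDecidableEqFin 2 := Subsingleton.elim _ _
    fin_cases i <;> simp
  map_update_smul' := by
    intro inst v i r x
    obtain rfl : inst = instDecidableEqFin 2 := Subsingleton.elim _ _
    fin_cases i <;> simp
  map_eq_zero_of_eq' := by
    intro v i j e hij
    fin_cases i <;> fin_cases j <;> simp_all

theorem biv_der_right (P : M [⋀^Fin 2]→ₗ[R] M)
    (h : ∀ x x' y, P ![x * x', y] = x * P ![x', y] + x' * P ![x, y]) (x y y' : M) :
    P ![x, y * y'] = y * P ![x, y'] + y' * P ![x, y] := by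
  rw [biv_swap, h, neg_add, ← mul_neg, ← mul_neg, ← biv_swap, ← biv_swap]

variable {T : Type u} [TopologicalSpace T] {S : Type u} [CommRing S]
  {F : (Opens T)ᵒᵖ ⥤ CommAlgCat.{u} S}

theorem polyVec_mul_left {U : Opens T} (P : PolyVec F 2 U) (V : {V : Opens T // V ≤ U})
    (x x' y : F.obj (op V.1)) :
    P.1 V ![x * x', y] = x * P.1 V ![x', y] + x' * P.1 V ![x, y] := by
  have h := P.2.1 V ![0, y] 0 x x'
  have e : ∀ z : F.obj (op V.1), Function.update ![0, y] 0 z = ![z, y] := fun z => by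
    funext i; fin_cases i <;> simp
  rwa [e, e, e] at h

theorem polyVec_mul_one {U : Opens T} (P : PolyVec F 1 U) (V : {V : Opens T // V ≤ U})
    (x x' : F.obj (op V.1)) :
    P.1 V ![x * x'] = x * P.1 V ![x'] + x' * P.1 V ![x] := by
  have h := P.2.1 V ![0] 0 x x'
  have e : ∀ z : F.obj (op V.1), Function.update ![0] 0 z = ![z] := fun z => by
    funext i; fin_cases i; simp
  rwa [e, e, e] at h

/-- A bivector field from its values on pairs of functions. -/
def PolyVec.mkBiv (U : Opens T)
    (P : ∀ V : {V : Opens T // V ≤ U}, (F.obj (op V.1)) [⋀^Fin 2]→ₗ[S] (F.obj (op V.1)))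
    (h1 : ∀ V x x' y, P V ![x * x', y] = x * P V ![x', y] + x' * P V ![x, y])
    (h2 : ∀ (V W : {V : Opens T // V ≤ U}) (h : W.1 ≤ V.1) x y,
      rmap F h (P V ![x, y]) = P W ![rmap F h x, rmap F h y]) : PolyVec F 2 U :=
  ⟨P, fun V v i f g => by
    fin_cases i
    · have e : ∀ z : F.obj (op V.1), P V (Function.update v 0 z) = P V ![z, v 1] := fun z =>
        alternatingMap_eq_of_two _ (by simp) (by simp)
      change P V (Function.update v 0 _) = _ * P V (Function.update v 0 _) +
        _ * P V (Function.update v 0 _)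
      rw [e, e, e, h1]
    · have e : ∀ z : F.obj (op V.1), P V (Function.update v 1 z) = P V ![v 0, z] := fun z =>
        alternatingMap_eq_of_two _ (by simp) (by simp)
      change P V (Function.update v 1 _) = _ * P V (Function.update v 1 _) +
        _ * P V (Function.update v 1 _)
      rw [e, e, e, biv_der_right _ (h1 V)], fun V W h v => by
    rw [alternatingMap_eq_of_two (P V) rfl rfl, h2 V W h]
    exact (alternatingMap_eq_of_two (P W) (f := fun i => rmap F h (v i)) rfl rfl).symm⟩

theorem PolyVec.mkBiv_apply (U : Opens T)
    (P : ∀ V : {V : Opens T // V ≤ U}, (F.obj (op V.1)) [⋀^Fin 2]→ₗ[S] (F.obj (op V.1)))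
    (h1 : ∀ V x x' y, P V ![x * x', y] = x * P V ![x', y] + x' * P V ![x, y])
    (h2 : ∀ (V W : {V : Opens T // V ≤ U}) (h : W.1 ≤ V.1) x y,
      rmap F h (P V ![x, y]) = P W ![rmap F h x, rmap F h y]) (V : {V : Opens T // V ≤ U}) :
    (PolyVec.mkBiv U P h1 h2).1 V = P V := rfl

end BivConstruct

/-! ### Lifting biderivations of `A ⊗ B` to `A₁ ⊗ B`. -/

section LiftBiv

variable {k A A₁ B : Type*} [Field k] [CommRing A] [Algebra k A] [CommRing A₁] [Algebra k A₁]
  [CommRing B] [Algebra k B] (s : A →ₗ[k] A₁) (Λ : (A ⊗[k] B) [⋀^Fin 2]→ₗ[A] (A ⊗[k] B))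

theorem biv_smul_left' (x y : A ⊗[k] B) (r : k) : Λ ![r • x, y] = r • Λ ![x, y] := by
  rw [← algebraMap_smul A r x, biv_smul_left, algebraMap_smul]

theorem biv_smul_right' (x y : A ⊗[k] B) (r : k) : Λ ![x, r • y] = r • Λ ![x, y] := by
  rw [← algebraMap_smul A r y, biv_smul_right, algebraMap_smul]

/-- The restriction to `B` of a bivector on `A ⊗ B`, composed with a linear map `A → A₁`. -/
def liftBivAux : B →ₗ[k] B →ₗ[k] A₁ ⊗[k] B :=
  LinearMap.mk₂ k (fun x y => s.rTensor B (Λ ![1 ⊗ₜ x, 1 ⊗ₜ y]))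
    (fun x x' y => by rw [TensorProduct.tmul_add, biv_add_left, map_add])
    (fun r x y => by rw [TensorProduct.tmul_smul, biv_smul_left', map_smul])
    (fun x y y' => by rw [TensorProduct.tmul_add, biv_add_right, map_add])
    (fun r x y => by rw [TensorProduct.tmul_smul, biv_smul_right', map_smul])

/-- The `A₁`-bilinear extension of `liftBivAux`. -/
def liftBivBilin : A₁ ⊗[k] B →ₗ[A₁] A₁ ⊗[k] B →ₗ[A₁] A₁ ⊗[k] B :=
  LinearMap.liftBaseChange A₁
    (((LinearMap.liftBaseChangeEquiv A₁).toLinearMap.restrictScalars k) ∘ₗ liftBivAux s Λ)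

theorem liftBivBilin_tmul (a b : A₁) (x y : B) : liftBivBilin s Λ (a ⊗ₜ x) (b ⊗ₜ y) =
    (a * b) • s.rTensor B (Λ ![1 ⊗ₜ x, 1 ⊗ₜ y]) := by
  rw [liftBivBilin, LinearMap.liftBaseChange_tmul, LinearMap.smul_apply, mul_smul]
  rfl

theorem liftBivBilin_swap (x y : A₁ ⊗[k] B) : liftBivBilin s Λ y x = - liftBivBilin s Λ x y := by
  induction x with
  | zero => simp
  | add x x' hx hx' => rw [map_add, map_add, hx, hx', LinearMap.add_apply, neg_add]
  | tmul a x =>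
    induction y with
    | zero => simp
    | add y y' hy hy' => rw [map_add, map_add, LinearMap.add_apply, hy, hy', neg_add]
    | tmul b y => rw [liftBivBilin_tmul, liftBivBilin_tmul, biv_swap, map_neg, smul_neg, mul_comm]

theorem liftBivBilin_self (x : A₁ ⊗[k] B) : liftBivBilin s Λ x x = 0 := by
  induction x with
  | zero => simp
  | add x x' hx hx' =>
    rw [map_add, map_add, LinearMap.add_apply, LinearMap.add_apply, hx, hx',
      liftBivBilin_swap s Λ x x']
    simp
  | tmul a x => rw [liftBivBilin_tmul, biv_self, map_zero, smul_zero]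

/-- A lift to `A₁ ⊗ B` of a bivector on `A ⊗ B`. -/
def liftBiv : (A₁ ⊗[k] B) [⋀^Fin 2]→ₗ[A₁] (A₁ ⊗[k] B) :=
  altTwo (liftBivBilin s Λ) (liftBivBilin_self s Λ)

theorem liftBiv_apply (x y : A₁ ⊗[k] B) : liftBiv s Λ ![x, y] = liftBivBilin s Λ x y := rfl

theorem liftBiv_mul_left (h : ∀ x x' y, Λ ![x * x', y] = x * Λ ![x', y] + x' * Λ ![x, y])
    (x x' y : A₁ ⊗[k] B) :
    liftBiv s Λ ![x * x', y] = x * liftBiv s Λ ![x', y] + x' * liftBiv s Λ ![x, y] := by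
  -- The splitting is merely `k`-linear on coefficients, but tensored with the identity it is
  -- `B`-linear, and that suffices for the Leibniz rule.
  have hs : ∀ (b : B) (z : A ⊗[k] B), s.rTensor B ((1 ⊗ₜ b) * z) = (1 ⊗ₜ b) * s.rTensor B z := by
    intro b z
    induction z with
    | zero => simp
    | add x y hx hy => rw [mul_add, map_add, map_add, mul_add, hx, hy]
    | tmul a c => simp
  simp only [liftBiv_apply]
  induction y with
  | zero => simp
  | add y y' hy hy' => simp only [map_add, hy, hy']; ring
  | tmul c y =>
    induction x with
    | zero => simp
    | add x₁ x₂ h₁ h₂ => simp only [add_mul, map_add, LinearMap.add_apply, h₁, h₂]; ring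
    | tmul a x =>
      induction x' with
      | zero => simp
      | add x₁ x₂ h₁ h₂ => simp only [mul_add, add_mul, map_add, LinearMap.add_apply, h₁, h₂]; ring
      | tmul b x' =>
        have e : (1 : A) ⊗ₜ[k] (x * x') = (1 ⊗ₜ x) * (1 ⊗ₜ x') := by simp
        have e2 : ∀ (a : A₁) (x : B), a ⊗ₜ[k] x = a • ((1 : A₁) ⊗ₜ[k] x) := fun a x => by
          rw [TensorProduct.smul_tmul', smul_eq_mul, mul_one]
        rw [Algebra.TensorProduct.tmul_mul_tmul, liftBivBilin_tmul, liftBivBilin_tmul,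
          liftBivBilin_tmul, e, h, map_add, hs, hs, e2 a x, e2 b x', smul_add]
        simp only [Algebra.smul_def, map_mul]
        ring

theorem map_liftBiv (φ : A₁ →ₐ[k] A) (hs : ∀ a, φ (s a) = a) (x y : A₁ ⊗[k] B) :
    Algebra.TensorProduct.map φ (AlgHom.id k B) (liftBiv s Λ ![x, y]) =
      Λ ![Algebra.TensorProduct.map φ (AlgHom.id k B) x,
        Algebra.TensorProduct.map φ (AlgHom.id k B) y] := by
  have hr : ∀ z : A ⊗[k] B, Algebra.TensorProduct.map φ (AlgHom.id k B) (s.rTensor B z) = z := by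
    intro z
    induction z with
    | zero => simp
    | add x y hx hy => simp only [map_add, hx, hy]
    | tmul a c => simp [hs]
  have hsm : ∀ (a : A₁) (z : A₁ ⊗[k] B), Algebra.TensorProduct.map φ (AlgHom.id k B) (a • z) =
      φ a • Algebra.TensorProduct.map φ (AlgHom.id k B) z := by
    intro a z
    rw [Algebra.smul_def, map_mul, Algebra.smul_def]
    simp
  rw [liftBiv_apply]
  induction x with
  | zero => simp [biv_zero_left]
  | add x x' hx hx' => simp only [map_add, LinearMap.add_apply, biv_add_left, hx, hx']
  | tmul a x =>
    induction y with
    | zero => simp [biv_zero_right]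
    | add y y' hy hy' => simp only [map_add, biv_add_right, hy, hy']
    | tmul b y =>
      rw [liftBivBilin_tmul, hsm, hr]
      simp only [Algebra.TensorProduct.map_tmul, AlgHom.id_apply]
      rw [show φ a ⊗ₜ[k] x = φ a • ((1 : A) ⊗ₜ[k] x) by
          rw [TensorProduct.smul_tmul', smul_eq_mul, mul_one],
        show φ b ⊗ₜ[k] y = φ b • ((1 : A) ⊗ₜ[k] y) by
          rw [TensorProduct.smul_tmul', smul_eq_mul, mul_one], biv_smul_left, biv_smul_right,
        smul_smul, map_mul]

end LiftBiv

/-! ### Lifting bivector fields. -/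

section LiftPolyVec

variable {k A A₁ : Type u} [Field k] [CommRing A] [Algebra k A] [CommRing A₁] [Algebra k A₁]
  {T : Type u} [TopologicalSpace T] {F : (Opens T)ᵒᵖ ⥤ CommAlgCat.{u} k} (φ : A₁ →ₐ[k] A)

theorem red_rmap {V W : Opens T} (h : W ≤ V) (x : A₁ ⊗[k] F.obj (op V)) :
    red φ _ (rmap (baseChange A₁ F) h x) = rmap (baseChange A F) h (red φ _ x) := by
  induction x with
  | zero => simp
  | add x y hx hy => simp only [map_add, hx, hy]
  | tmul a b => rfl

/-- A bivector over `A` is known from its values on functions of `X`. A `k`-linear section of `φ`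
lifts these values, and they are then extended `A₁`-bilinearly. As the same section serves every
open set, the lifts commute with restriction; neither smoothness nor affineness is needed. -/
theorem exists_lift_polyVec (hφ : Function.Surjective φ) {U : Opens T}
    (Λ : PolyVec (baseChange A F) 2 U) : ∃ Λ' : PolyVec (baseChange A₁ F) 2 U,
      ∀ (V : {V : Opens T // V ≤ U}) (v : Fin 2 → A₁ ⊗[k] F.obj (op V.1)),
        red φ _ (Λ'.1 V v) = Λ.1 V fun i => red φ _ (v i) := by
  obtain ⟨s, hs⟩ := φ.toLinearMap.exists_rightInverse_of_surjective (LinearMap.range_eq_top.2 hφ)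
  have hs' : ∀ a, φ (s a) = a := fun a => congr($hs a)
  refine ⟨PolyVec.mkBiv U (fun V => liftBiv (B := F.obj (op V.1)) s (Λ.1 V))
    (fun V x x' y => liftBiv_mul_left s _ (polyVec_mul_left Λ V) x x' y) (fun V W h x y => ?_),
    fun V v => ?_⟩
  · have hr : ∀ z : A ⊗[k] F.obj (op V.1), rmap (baseChange A₁ F) h (s.rTensor _ z) =
        s.rTensor _ (rmap (baseChange A F) h z) := by
      intro z
      induction z with
      | zero => simp
      | add x y hx hy => simp only [map_add, hx, hy]
      | tmul a c => rfl
    rw [liftBiv_apply, liftBiv_apply]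
    change A₁ ⊗[k] F.obj (op V.1) at x y
    induction x with
    | zero => simp
    | add x x' hx hx' => simp only [map_add, LinearMap.add_apply, hx, hx']
    | tmul a x =>
      induction y with
      | zero => simp
      | add y y' hy hy' => simp only [map_add, hy, hy']
      | tmul b y =>
        rw [liftBivBilin_tmul, map_smul, hr, polyVec_rmap Λ V.2 h, rmap_baseChange_tmul,
          rmap_baseChange_tmul, liftBivBilin_tmul]
        congr 2
        exact alternatingMap_eq_of_two _ rfl rfl
  · rw [PolyVec.mkBiv_apply, alternatingMap_eq_of_two _ rfl rfl]
    exact (map_liftBiv s _ φ hs' _ _).trans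
      (alternatingMap_eq_of_two (Λ.1 V) (f := fun i => red φ _ (v i)) rfl rfl).symm

end LiftPolyVec

/-! ### Isomorphisms of sheaves of algebras and transport of polyvector fields. -/

section EquivFamily

variable {T : Type u} [TopologicalSpace T] {R : Type u} [CommRing R]

/-- An isomorphism, over an open set `U`, of presheaves of algebras. -/
structure EquivFamily (F G : (Opens T)ᵒᵖ ⥤ CommAlgCat.{u} R) (U : Opens T) where
  /-- the component at an open set contained in `U` -/
  app : ∀ V : Opens T, V ≤ U → (F.obj (op V) ≃ₐ[R] G.obj (op V))
  naturality : ∀ (V W : Opens T) (h : V ≤ U) (hW : W ≤ V) (x : F.obj (op V)),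
    app W (hW.trans h) (rmap F hW x) = rmap G hW (app V h x)

namespace EquivFamily

variable {F G H : (Opens T)ᵒᵖ ⥤ CommAlgCat.{u} R} {U : Opens T}

/-- The inverse isomorphism. -/
def symm (e : EquivFamily F G U) : EquivFamily G F U where
  app V h := (e.app V h).symm
  naturality V W h hW x := by
    rw [AlgEquiv.symm_apply_eq, e.naturality V W h hW, AlgEquiv.apply_symm_apply]

theorem symm_app (e : EquivFamily F G U) (V : Opens T) (h : V ≤ U) :
    e.symm.app V h = (e.app V h).symm := rfl

/-- The composition of isomorphisms. -/
def trans (e : EquivFamily F G U) (f : EquivFamily G H U) : EquivFamily F H U where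
  app V h := (e.app V h).trans (f.app V h)
  naturality V W h hW x := by
    rw [AlgEquiv.trans_apply, e.naturality V W h hW, f.naturality V W h hW]
    rfl

theorem trans_app (e : EquivFamily F G U) (f : EquivFamily G H U) (V : Opens T) (h : V ≤ U)
    (x : F.obj (op V)) : (e.trans f).app V h x = f.app V h (e.app V h x) := rfl

/-- The restriction to a smaller open set. -/
def restrict (e : EquivFamily F G U) {U' : Opens T} (h : U' ≤ U) : EquivFamily F G U' where
  app V hV := e.app V (hV.trans h)
  naturality V W hV hW x := e.naturality V W (hV.trans h) hW x

/-- A bijective morphism is an isomorphism. -/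
def ofBijective (s : AlgFamily F G U) (h : ∀ V hV, Function.Bijective (s.app V hV)) :
    EquivFamily F G U :=
  ⟨fun V hV => AlgEquiv.ofBijective (s.app V hV) (h V hV), s.naturality⟩

end EquivFamily

/-- The transport of a polyvector field along an isomorphism. -/
def conjPolyVec {F G : (Opens T)ᵒᵖ ⥤ CommAlgCat.{u} R} {U : Opens T} {p : ℕ}
    (P : PolyVec F p U) (e : EquivFamily F G U) : PolyVec G p U :=
  ⟨fun V => (e.app V.1 V.2).toLinearMap.compAlternatingMap
    ((P.1 V).compLinearMap (e.app V.1 V.2).symm.toLinearMap), by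
    refine ⟨fun V v i f g => ?_, fun V W h v => ?_⟩
    · change e.app V.1 V.2 (P.1 V fun j => (e.app V.1 V.2).symm (Function.update v i (f * g) j)) =
        f * e.app V.1 V.2 (P.1 V fun j => (e.app V.1 V.2).symm (Function.update v i g j)) +
        g * e.app V.1 V.2 (P.1 V fun j => (e.app V.1 V.2).symm (Function.update v i f j))
      have hu : ∀ z, (fun j => (e.app V.1 V.2).symm (Function.update v i z j)) =
          Function.update (fun j => (e.app V.1 V.2).symm (v j)) i ((e.app V.1 V.2).symm z) :=
        fun z => funext fun j => Function.apply_update (fun _ => (e.app V.1 V.2).symm) v i z j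
      rw [hu, hu, hu, map_mul, P.2.1, map_add, map_mul, map_mul, AlgEquiv.apply_symm_apply,
        AlgEquiv.apply_symm_apply]
    · change rmap G h (e.app V.1 V.2 (P.1 V fun j => (e.app V.1 V.2).symm (v j))) =
        e.app W.1 W.2 (P.1 W fun j => (e.app W.1 W.2).symm (rmap G h (v j)))
      rw [← e.naturality V.1 W.1 V.2 h, polyVec_rmap P V.2 h]
      have := fun j => e.symm.naturality V.1 W.1 V.2 h (v j)
      simp only [EquivFamily.symm_app] at this
      simp only [this]⟩

theorem conjPolyVec_apply {F G : (Opens T)ᵒᵖ ⥤ CommAlgCat.{u} R} {U : Opens T} {p : ℕ}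
    (P : PolyVec F p U) (e : EquivFamily F G U) (V : {V : Opens T // V ≤ U})
    (v : Fin p → G.obj (op V.1)) :
    (conjPolyVec P e).1 V v = e.app V.1 V.2 (P.1 V fun j => (e.app V.1 V.2).symm (v j)) := rfl

/-- The restriction of a polyvector field to a smaller open set. -/
def resPolyVec {F : (Opens T)ᵒᵖ ⥤ CommAlgCat.{u} R} {U U' : Opens T} {p : ℕ}
    (P : PolyVec F p U) (h : U' ≤ U) : PolyVec F p U' :=
  ⟨fun V => P.1 ⟨V.1, V.2.trans h⟩, fun V => P.2.1 ⟨V.1, V.2.trans h⟩,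
    fun V W => P.2.2 ⟨V.1, V.2.trans h⟩ ⟨W.1, W.2.trans h⟩⟩

/-- The isomorphism between the sections over equal open sets. -/
def rmapEquiv (F : (Opens T)ᵒᵖ ⥤ CommAlgCat.{u} R) {V W : Opens T} (e : V = W) :
    F.obj (op V) ≃ₐ[R] F.obj (op W) :=
  AlgEquiv.ofAlgHom (rmap F e.ge) (rmap F e.le)
    (AlgHom.ext fun x => (rmap_rmap F e.le e.ge x).trans (rmap_self F _ x))
    (AlgHom.ext fun x => (rmap_rmap F e.ge e.le x).trans (rmap_self F _ x))

theorem rmapEquiv_apply (F : (Opens T)ᵒᵖ ⥤ CommAlgCat.{u} R) {V W : Opens T} (e : V = W)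
    (x : F.obj (op V)) : rmapEquiv F e x = rmap F e.ge x := rfl

end EquivFamily

/-! ### Lifting automorphisms of trivial deformations. -/

section LiftAut

variable {k A A₁ : Type u} [Field k] [CommRing A] [Algebra k A] [CommRing A₁] [Algebra k A₁]
  {X : Scheme.{u}} {π : X ⟶ Spec (.of k)} {ε : A →ₐ[k] k} {φ : A₁ →ₐ[k] A}

theorem redk_comp (B : CommAlgCat.{u} k) (x : A₁ ⊗[k] B) :
    redk (ε.comp φ) B x = redk ε B (red φ B x) := by
  induction x with
  | zero => simp
  | add x y hx hy => simp only [map_add, hx, hy]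
  | tmul a b => simp [redk]

theorem red_surjective (hφ : Function.Surjective φ) (B : CommAlgCat.{u} k) :
    Function.Surjective (red φ B) :=
  TensorProduct.map_surjective hφ Function.surjective_id

theorem red_algebraMap (B : CommAlgCat.{u} k) (a : A₁) :
    red φ B (algebraMap A₁ _ a) = algebraMap A _ (φ a) := by
  simp [Algebra.TensorProduct.algebraMap_apply]

theorem tmul_eq_smul (B : CommAlgCat.{u} k) (a : A) (b : B) :
    a ⊗ₜ[k] b = a • ((1 : A) ⊗ₜ[k] b) := by
  rw [TensorProduct.smul_tmul', smul_eq_mul, mul_one]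

theorem red_smul (B : CommAlgCat.{u} k) (a : A₁) (x : A₁ ⊗[k] B) :
    red φ B (a • x) = φ a • red φ B x := by
  rw [Algebra.smul_def, map_mul, red_algebraMap, Algebra.smul_def]

theorem isUnit_of_isUnit_map {R S : Type*} [CommRing R] [CommRing S] (q : R →+* S)
    (hq : Function.Surjective q) (hn : IsNilpotent (RingHom.ker q)) {x : R} (hx : IsUnit (q x)) :
    IsUnit x := by
  obtain ⟨y, hy⟩ := hq (hx.unit⁻¹ : Sˣ)
  obtain ⟨n, hn⟩ := hn
  have h : IsNilpotent (x * y - 1) := by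
    refine ⟨n, ?_⟩
    have : x * y - 1 ∈ RingHom.ker q := by
      rw [RingHom.mem_ker, map_sub, map_mul, hy, map_one, IsUnit.mul_val_inv, sub_self]
    have := Ideal.pow_mem_pow this n
    rwa [hn, Ideal.zero_eq_bot, Ideal.mem_bot] at this
  have := h.isUnit_add_one
  rw [sub_add_cancel] at this
  exact isUnit_of_mul_isUnit_left this

theorem isNilpotent_ker_redk [IsLocalRing A₁] [IsArtinianRing A₁] (ε₁ : A₁ →ₐ[k] k)
    (B : CommAlgCat.{u} k) : IsNilpotent (RingHom.ker (redk ε₁ B : A₁ ⊗[k] B →+* B)) := by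
  obtain ⟨n, hn⟩ := isNilpotent_ker ε₁
  refine ⟨n, le_bot_iff.1 ((Ideal.pow_right_mono (ker_redk_le ε₁ B) n).trans ?_)⟩
  rw [← Ideal.map_pow, hn, Ideal.zero_eq_bot, Ideal.map_bot]

theorem redk_surjective (ε₁ : A₁ →ₐ[k] k) (B : CommAlgCat.{u} k) :
    Function.Surjective (redk ε₁ B) := fun b => ⟨1 ⊗ₜ b, redk_one_tmul _ B b⟩

theorem isUnit_of_isUnit_redk [IsLocalRing A₁] [IsArtinianRing A₁] (ε₁ : A₁ →ₐ[k] k)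
    (B : CommAlgCat.{u} k) {x : A₁ ⊗[k] B} (hx : IsUnit (redk ε₁ B x)) : IsUnit x :=
  isUnit_of_isUnit_map (redk ε₁ B : A₁ ⊗[k] B →+* B) (redk_surjective ε₁ B)
    (isNilpotent_ker_redk ε₁ B) hx

/-- Automorphisms of trivial deformations of smooth affine schemes can be lifted. -/
theorem exists_lift_equivFamily [IsLocalRing A] [IsArtinianRing A] [IsLocalRing A₁]
    [IsArtinianRing A₁] [Smooth π] (hφ : Function.Surjective φ) {U : X.Opens} (hU : IsAffineOpen U)
    (g : EquivFamily (baseChange A (algSheaf π)) (baseChange A (algSheaf π)) U)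
    (hg : ∀ V h (x : A ⊗[k] (algSheaf π).obj (op V)),
      redk ε _ (g.app V h x) = redk ε _ x) :
    ∃ g₁ : EquivFamily (baseChange A₁ (algSheaf π)) (baseChange A₁ (algSheaf π)) U,
      ∀ V h (x : A₁ ⊗[k] (algSheaf π).obj (op V)),
        red φ _ (g₁.app V h x) = g.app V h (red φ _ x) := by
  have := formallySmooth_algSheaf π hU
  have := finiteDimensional_of_residue ε
  have := finiteDimensional_of_residue (ε.comp φ)
  have hn : IsNilpotent (RingHom.ker (red φ ((algSheaf π).obj (op U)) :
      A₁ ⊗[k] (algSheaf π).obj (op U) →+* A ⊗[k] (algSheaf π).obj (op U))) := by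
    obtain ⟨n, hn⟩ := isNilpotent_ker_redk (ε.comp φ) ((algSheaf π).obj (op U))
    refine ⟨n, le_bot_iff.1 ((Ideal.pow_right_mono (fun x hx => ?_) n).trans hn.le)⟩
    change redk (ε.comp φ) _ x = 0
    rw [redk_comp, show red φ _ x = 0 from hx, map_zero]
  -- The given automorphism restricted to functions of `X` is lifted along `A₁ ⊗ B → A ⊗ B`, whose
  -- kernel is nilpotent.
  obtain ⟨h, hh⟩ := exists_tensor_lift (A := A₁) (B := (algSheaf π).obj (op U))
    (red φ ((algSheaf π).obj (op U)) :
      A₁ ⊗[k] (algSheaf π).obj (op U) →+* A ⊗[k] (algSheaf π).obj (op U))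
    (red_surjective hφ _) hn (fun r => by
      change red φ _ (algebraMap A₁ _ _) = _
      rw [red_algebraMap, AlgHom.commutes]
      rfl)
    (((g.app U le_rfl).toAlgHom.restrictScalars k).comp Algebra.TensorProduct.includeRight)
  replace hh : ∀ x, red φ _ (h x) = g.app U le_rfl (red φ _ x) := by
    intro x
    induction x with
    | zero => simp
    | add x y hx hy => simp only [map_add, hx, hy]
    | tmul a b =>
      have h1 : red φ _ (h (1 ⊗ₜ b)) = g.app U le_rfl (1 ⊗ₜ b) := hh b
      rw [tmul_eq_smul, map_smul, red_smul, h1, red_smul, map_smul]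
      congr 2
      simp [red]
  obtain ⟨s, rfl⟩ := AlgFamily.exists_of_isAffineOpen
    (isSheafLike_baseChange A₁ (isSheafLike_algSheaf π)) hU h fun f => by
      apply isUnit_of_isUnit_redk (ε.comp φ) ((algSheaf π).obj (op (X.basicOpen f)))
      rw [redk_rmap, redk_comp, hh, hg, ← redk_comp, redk_one_tmul]
      exact X.toRingedSpace.isUnit_res_basicOpen f
  have hred : ∀ V h (x : A₁ ⊗[k] (algSheaf π).obj (op V)),
      red φ _ (s.app V h x) = g.app V h (red φ _ x) := by
    refine ringFamily_ext (isSheafLike_baseChange A (isSheafLike_algSheaf π)) hU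
      (fun V h => (red φ _).toRingHom.comp (s.app V h).toRingHom)
      (fun V h => (g.app V h).toAlgHom.toRingHom.comp (red φ _).toRingHom)
      (fun V W h hW x => ?_) (fun V W h hW x => ?_) hh
    · change red φ _ (s.app W _ _) = rmap (baseChange A (algSheaf π)) hW (red φ _ (s.app V h x))
      rw [s.naturality V W h hW, red_rmap]
    · change g.app W _ (red φ _ _) = rmap (baseChange A (algSheaf π)) hW (g.app V h (red φ _ x))
      rw [red_rmap, g.naturality V W h hW]
  -- The lift is the identity on the closed fibre, because the given automorphism is, so Nakayama
  -- makes it bijective.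
  refine ⟨EquivFamily.ofBijective s fun V hV => bijective_of_redk_comp (ε.comp φ)
    (isNilpotent_ker _) _ fun x => ?_, hred⟩
  rw [redk_comp, hred, hg, ← redk_comp]

end LiftAut

/-! ### Trivializations and choices in terms of opens of the closed fibre. -/

section OnFibre

variable {k A A₁ : Type u} [Field k] [CommRing A] [Algebra k A] [CommRing A₁] [Algebra k A₁]
  {X : Scheme.{u}} {π : X ⟶ Spec (.of k)} {Λ₀ : PolyVec (algSheaf π) 2 ⊤} {ε : A →ₐ[k] k}
  [IsLocalRing A] [IsArtinianRing A]
  {ξ : PoissonDeformation π Λ₀ ε} {ι : Type u} {U : ι → X.Opens} {φ : A₁ →ₐ[k] A}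

omit [IsLocalRing A] [IsArtinianRing A] in
variable (ξ) in
/-- The Poisson structure of the total space, on the closed fibre. -/
def PoissonDeformation.bivOnFibre (V : X.Opens) : PolyVec ξ.sheaf 2 V :=
  ⟨fun W => ξ.biv.1 ⟨upOpen ξ.incl W.1, le_top⟩, fun W => ξ.biv.2.1 ⟨upOpen ξ.incl W.1, le_top⟩,
    fun W W' h => ξ.biv.2.2 ⟨upOpen ξ.incl W.1, le_top⟩ ⟨upOpen ξ.incl W'.1, le_top⟩
      (upOpen_mono ξ.incl h)⟩

omit [IsLocalRing A] [IsArtinianRing A] in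
theorem PoissonDeformation.bivOnFibre_apply (V : X.Opens) (W : {W : X.Opens // W ≤ V})
    (v : Fin 2 → ξ.sheaf.obj (op W.1)) :
    (ξ.bivOnFibre V).1 W v = ξ.biv.1 ⟨upOpen ξ.incl W.1, le_top⟩ v := rfl

omit [IsLocalRing A] [IsArtinianRing A] in
theorem PoissonDeformation.rho_bivOnFibre (V : X.Opens) (W : {W : X.Opens // W ≤ V})
    (v : Fin 2 → ξ.sheaf.obj (op W.1)) :
    ξ.rho W.1 ((ξ.bivOnFibre V).1 W v) = Λ₀.1 ⟨W.1, le_top⟩ fun i => ξ.rho W.1 (v i) := by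
  rw [bivOnFibre_apply, rho_apply, ξ.incl_biv, polyVec_rmap Λ₀ le_top]
  rfl

namespace Trivialization

/-- The trivializations, over open subsets of the closed fibre. -/
def onFibre (τ : Trivialization ξ U) (a : ι) :
    EquivFamily ξ.sheaf (baseChange A (algSheaf π)) (U a) where
  app V h := (τ.iso a (upOpen ξ.incl V) ((preimage_upOpen ξ.incl V).le.trans h)).trans
    (rmapEquiv (baseChange A (algSheaf π)) (preimage_upOpen ξ.incl V))
  naturality V W h hW x := by
    have h2 : ξ.incl ⁻¹ᵁ upOpen ξ.incl W ≤ ξ.incl ⁻¹ᵁ upOpen ξ.incl V :=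
      ξ.incl.preimage_mono (upOpen_mono ξ.incl hW)
    have := τ.iso_map a _ _ ((preimage_upOpen ξ.incl V).le.trans h) (upOpen_mono ξ.incl hW) h2 x
    rw [AlgEquiv.trans_apply, rmapEquiv_apply]
    refine (congrArg (rmap (baseChange A (algSheaf π)) (preimage_upOpen ξ.incl W).ge) this).trans ?_
    rw [rmap_rmap, AlgEquiv.trans_apply, rmapEquiv_apply, rmap_rmap]

theorem onFibre_app (τ : Trivialization ξ U) (a : ι) (V : X.Opens) (h : V ≤ U a)
    (x : ξ.sheaf.obj (op V)) : (τ.onFibre a).app V h x =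
      rmap (baseChange A (algSheaf π)) (preimage_upOpen ξ.incl V).ge
        (τ.iso a (upOpen ξ.incl V) ((preimage_upOpen ξ.incl V).le.trans h) x) := rfl

theorem iso_eq (τ : Trivialization ξ U) (a : ι) (W : ξ.space.Opens) (h : ξ.incl ⁻¹ᵁ W ≤ U a)
    (x : (algSheaf ξ.proj).obj (op W)) : τ.iso a W h x = (τ.onFibre a).app (ξ.incl ⁻¹ᵁ W) h
      (rmap (algSheaf ξ.proj) (upOpen_preimage ξ.incl W).le x) := by
  have h2 : ξ.incl ⁻¹ᵁ upOpen ξ.incl (ξ.incl ⁻¹ᵁ W) ≤ ξ.incl ⁻¹ᵁ W := (preimage_upOpen _ _).le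
  have := τ.iso_map a W _ h (upOpen_preimage ξ.incl W).le h2 x
  rw [onFibre_app, this, rmap_rmap, rmap_self]

theorem iso_symm_eq (τ : Trivialization ξ U) (a : ι) (W : ξ.space.Opens) (h : ξ.incl ⁻¹ᵁ W ≤ U a)
    (x : A ⊗[k] (algSheaf π).obj (op (ξ.incl ⁻¹ᵁ W))) : (τ.iso a W h).symm x =
      rmap (algSheaf ξ.proj) (upOpen_preimage ξ.incl W).ge
        (((τ.onFibre a).app (ξ.incl ⁻¹ᵁ W) h).symm x) := by
  rw [AlgEquiv.symm_apply_eq, iso_eq, rmap_rmap, rmap_self, AlgEquiv.apply_symm_apply]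

theorem redk_onFibre (τ : Trivialization ξ U) (a : ι) (V : X.Opens) (h : V ≤ U a)
    (x : ξ.sheaf.obj (op V)) : redk ε _ ((τ.onFibre a).app V h x) = ξ.rho V x := by
  rw [onFibre_app, redk_rmap, τ.iso_incl]
  rfl

/-- The transition isomorphisms between the trivializations `σ` and `τ`. -/
def transition {κ : Type u} {U' : κ → X.Opens} (σ : Trivialization ξ U')
    (τ : Trivialization ξ U) (a : κ) (b : ι) {V : X.Opens} (ha : V ≤ U' a) (hb : V ≤ U b) :
    EquivFamily (baseChange A (algSheaf π)) (baseChange A (algSheaf π)) V :=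
  ((τ.onFibre b).restrict hb).symm.trans ((σ.onFibre a).restrict ha)

theorem transition_app {κ : Type u} {U' : κ → X.Opens} (σ : Trivialization ξ U')
    (τ : Trivialization ξ U) (a : κ) (b : ι) {V : X.Opens} (ha : V ≤ U' a) (hb : V ≤ U b)
    (W : X.Opens) (h : W ≤ V) (x : A ⊗[k] (algSheaf π).obj (op W)) :
    (transition σ τ a b ha hb).app W h x =
      (σ.onFibre a).app W (h.trans ha) (((τ.onFibre b).app W (h.trans hb)).symm x) := rfl

theorem redk_transition {κ : Type u} {U' : κ → X.Opens} (σ : Trivialization ξ U')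
    (τ : Trivialization ξ U) (a : κ) (b : ι) {V : X.Opens} (ha : V ≤ U' a) (hb : V ≤ U b)
    (W : X.Opens) (h : W ≤ V) (x : A ⊗[k] (algSheaf π).obj (op W)) :
    redk ε _ ((transition σ τ a b ha hb).app W h x) = redk ε _ x := by
  rw [transition_app, redk_onFibre, ← τ.redk_onFibre b W (h.trans hb), AlgEquiv.apply_symm_apply]

/-- The Poisson structure induced by the trivialization. -/
def bivector (τ : Trivialization ξ U) (a : ι) : PolyVec (baseChange A (algSheaf π)) 2 (U a) :=
  conjPolyVec (ξ.bivOnFibre (U a)) (τ.onFibre a)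

theorem bivector_apply (τ : Trivialization ξ U) (a : ι) (V : X.Opens) (h : V ≤ U a)
    (v : Fin 2 → A ⊗[k] (algSheaf π).obj (op V)) : (τ.bivector a).1 ⟨V, h⟩ v =
      (τ.onFibre a).app V h (ξ.biv.1 ⟨upOpen ξ.incl V, le_top⟩
        fun i => ((τ.onFibre a).app V h).symm (v i)) := rfl

theorem redk_bivector (τ : Trivialization ξ U) (a : ι) (V : X.Opens) (h : V ≤ U a)
    (v : Fin 2 → A ⊗[k] (algSheaf π).obj (op V)) :
    redk ε _ ((τ.bivector a).1 ⟨V, h⟩ v) = Λ₀.1 ⟨V, le_top⟩ fun i => redk ε _ (v i) := by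
  rw [bivector_apply, redk_onFibre]
  refine (ξ.rho_bivOnFibre (U a) ⟨V, h⟩ _).trans (congrArg _ (funext fun i => ?_))
  rw [← τ.redk_onFibre a V h, AlgEquiv.apply_symm_apply]

end Trivialization

namespace LiftChoice

/-- Choices given over open subsets of the closed fibre. -/
def ofFibre {τ : Trivialization ξ U}
    (f : ∀ a b, EquivFamily (baseChange A₁ (algSheaf π)) (baseChange A₁ (algSheaf π)) (U a ⊓ U b))
    (hf : ∀ a b V h (x : A₁ ⊗[k] (algSheaf π).obj (op V)), red φ _ ((f a b).app V h x) =
      (τ.transition τ a b inf_le_left inf_le_right).app V h (red φ _ x))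
    (Λ : ∀ a, PolyVec (baseChange A₁ (algSheaf π)) 2 (U a))
    (hΛ : ∀ a (V : {V : X.Opens // V ≤ U a}) (v : Fin 2 → A₁ ⊗[k] (algSheaf π).obj (op V.1)),
      red φ _ ((Λ a).1 V v) = (τ.bivector a).1 V fun i => red φ _ (v i)) : LiftChoice τ φ where
  aut a b V ha hb := (f a b).app V (le_inf ha hb)
  aut_map a b V V' ha hb h x := (f a b).naturality V V' (le_inf ha hb) h x
  aut_red a b W ha hb x := by
    rw [hf, τ.iso_symm_eq, τ.iso_eq, rmap_rmap, rmap_self, Trivialization.transition_app]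
  biv := Λ
  biv_red a W ha v := by
    rw [hΛ, τ.iso_eq, polyVec_rmap ξ.biv le_top, τ.bivector_apply]
    congr 2
    funext i
    rw [τ.iso_symm_eq, rmap_rmap, rmap_self]

variable {τ : Trivialization ξ U}

/-- The automorphisms `f̃_{ab}`. -/
def autFamily (L : LiftChoice τ φ) (a b : ι) :
    EquivFamily (baseChange A₁ (algSheaf π)) (baseChange A₁ (algSheaf π)) (U a ⊓ U b) where
  app V h := L.aut a b V (h.trans inf_le_left) (h.trans inf_le_right)
  naturality V W _ hW x := L.aut_map a b V W _ _ hW x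

omit [IsLocalRing A] [IsArtinianRing A] in
theorem autFamily_app (L : LiftChoice τ φ) (a b : ι) (V : X.Opens) (h : V ≤ U a ⊓ U b) :
    (L.autFamily a b).app V h = L.aut a b V (h.trans inf_le_left) (h.trans inf_le_right) := rfl

theorem red_aut (L : LiftChoice τ φ) (a b : ι) (V : X.Opens) (ha : V ≤ U a) (hb : V ≤ U b)
    (x : A₁ ⊗[k] (algSheaf π).obj (op V)) : red φ _ (L.aut a b V ha hb x) =
      (τ.transition τ a b ha hb).app V le_rfl (red φ _ x) := by
  -- The conditions on choices are stated on traces of opens of the total space; every open of `X`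
  -- is such a trace.
  obtain ⟨W, rfl⟩ : ∃ W, ξ.incl ⁻¹ᵁ W = V := ⟨_, preimage_upOpen ξ.incl V⟩
  rw [L.aut_red, τ.iso_symm_eq, τ.iso_eq, rmap_rmap, rmap_self, Trivialization.transition_app]

theorem red_biv (L : LiftChoice τ φ) (a : ι) (V : X.Opens) (h : V ≤ U a)
    (v : Fin 2 → A₁ ⊗[k] (algSheaf π).obj (op V)) : red φ _ (L.bivAt a V h v) =
      (τ.bivector a).1 ⟨V, h⟩ fun i => red φ _ (v i) := by
  obtain ⟨W, rfl⟩ : ∃ W, ξ.incl ⁻¹ᵁ W = V := ⟨_, preimage_upOpen ξ.incl V⟩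
  rw [L.biv_red, τ.iso_eq, polyVec_rmap ξ.biv le_top, τ.bivector_apply]
  congr 2
  funext i
  rw [τ.iso_symm_eq, rmap_rmap, rmap_self]

theorem redk_aut (L : LiftChoice τ φ) (a b : ι) (V : X.Opens) (ha : V ≤ U a) (hb : V ≤ U b)
    (x : A₁ ⊗[k] (algSheaf π).obj (op V)) :
    redk (ε.comp φ) _ (L.aut a b V ha hb x) = redk (ε.comp φ) _ x := by
  rw [redk_comp, red_aut, Trivialization.redk_transition, redk_comp]

theorem redk_biv (L : LiftChoice τ φ) (a : ι) (V : X.Opens) (h : V ≤ U a)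
    (v : Fin 2 → A₁ ⊗[k] (algSheaf π).obj (op V)) : redk (ε.comp φ) _ (L.bivAt a V h v) =
      Λ₀.1 ⟨V, le_top⟩ fun i => redk (ε.comp φ) _ (v i) := by
  rw [redk_comp, red_biv, Trivialization.redk_bivector]
  simp only [redk_comp]

variable [IsLocalRing A₁] [IsArtinianRing A₁]

theorem nonempty [Smooth π] [IsSeparated π] (τ : Trivialization ξ U)
    (hφ : Function.Surjective φ) (hU : ∀ a, IsAffineOpen (U a)) : Nonempty (LiftChoice τ φ) := by
  -- Separatedness makes the overlaps of affine opens affine, so that the transition automorphisms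
  -- can be lifted over them.
  have hsep : X.IsSeparated := ⟨by
    rw [← Limits.terminal.comp_from π]
    infer_instance⟩
  choose f hf using fun a b => exists_lift_equivFamily hφ ((hU a).inf (hU b))
    (τ.transition τ a b inf_le_left inf_le_right) (Trivialization.redk_transition _ _ _ _ _ _)
  choose Λ hΛ using fun a => exists_lift_polyVec φ hφ (τ.bivector a)
  exact ⟨ofFibre f hf Λ hΛ⟩

end LiftChoice

end OnFibre

/-! ### What vanishes over `A` is `t` times an object on `X`. -/

section Descend

variable {k A A₁ : Type u} [Field k] [CommRing A] [Algebra k A] [CommRing A₁] [Algebra k A₁]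

/-- `φ` is a small extension with kernel generated by `t`. -/
structure SmallExtension (ε : A →ₐ[k] k) (φ : A₁ →ₐ[k] A) (t : A₁) : Prop where
  surjective : Function.Surjective φ
  ne_zero : t ≠ 0
  ker_eq : RingHom.ker φ = Ideal.span {t}
  ann : ∀ a, (ε.comp φ) a = 0 → a * t = 0

/-- Multiplication by `t`, from `B` to `A₁ ⊗ B`. -/
abbrev tMul (t : A₁) (B : CommAlgCat.{u} k) : B →+ A₁ ⊗[k] B :=
  (TensorProduct.mk k A₁ B t).toAddMonoidHom

variable {ε : A →ₐ[k] k} {φ : A₁ →ₐ[k] A} {t : A₁}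

namespace SmallExtension

variable (h : SmallExtension ε φ t)
include h

theorem smallExt (B : CommAlgCat.{u} k) :
    SmallExt (redk (ε.comp φ) B : A₁ ⊗[k] B →+* B) (tMul t B) :=
  smallExt_tensor h.ne_zero h.ker_eq h.ann B

theorem smul_eq (B : CommAlgCat.{u} k) (x : A₁ ⊗[k] B) : t • x = t ⊗ₜ redk (ε.comp φ) B x := by
  have := (h.smallExt B).mul_j x 1
  rw [mul_one] at this
  refine Eq.trans ?_ this
  rw [Algebra.smul_def, mul_comm]
  rfl

theorem tmul_injective {B : CommAlgCat.{u} k} {b c : B} (e : t ⊗ₜ[k] b = t ⊗ₜ[k] c) : b = c :=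
  (h.smallExt B).inj e

theorem exists_eq_tmul {B : CommAlgCat.{u} k} {x : A₁ ⊗[k] B} (hx : red φ B x = 0) :
    ∃ b : B, x = t ⊗ₜ b :=
  exists_eq_tmul_of_red_eq_zero h.surjective h.ker_eq h.ann B x hx

theorem red_tmul (B : CommAlgCat.{u} k) (b : B) : red φ B (t ⊗ₜ b) = 0 := by
  have h1 : φ t = 0 := by
    rw [← RingHom.mem_ker, h.ker_eq]; exact Ideal.mem_span_singleton_self t
  rw [red, Algebra.TensorProduct.map_tmul, h1, TensorProduct.zero_tmul]

theorem smul_tmul (B : CommAlgCat.{u} k) (a : A₁) (b : B) :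
    a • (t ⊗ₜ[k] b) = t ⊗ₜ[k] ((ε.comp φ) a • b) := by
  rw [tmul_eq_smul, smul_comm, h.smul_eq, ← tmul_eq_smul, redk_tmul]

theorem map_tmul {B : CommAlgCat.{u} k} (f : A₁ ⊗[k] B →ₗ[A₁] A₁ ⊗[k] B)
    (hf : ∀ x, redk (ε.comp φ) B (f x) = redk (ε.comp φ) B x) (b : B) :
    f (t ⊗ₜ b) = t ⊗ₜ b := by
  rw [tmul_eq_smul, map_smul, h.smul_eq, hf, ← h.smul_eq]

/-- A bivector reducing to `Λ₀` is a lift in the sense of `LiftsBiv`. -/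
theorem liftsBiv {B : CommAlgCat.{u} k} (Λ : (A₁ ⊗[k] B) [⋀^Fin 2]→ₗ[A₁] (A₁ ⊗[k] B))
    (Λ₀ : B [⋀^Fin 2]→ₗ[k] B) (hΛ : ∀ v, redk (ε.comp φ) B (Λ v) =
      Λ₀ fun i => redk (ε.comp φ) B (v i)) :
    LiftsBiv (redk (ε.comp φ) B : A₁ ⊗[k] B →+* B) (tMul t B) Λ Λ₀ where
  ρ_apply x y := (hΛ _).trans
    (alternatingMap_eq_of_two Λ₀ (f := fun i => redk (ε.comp φ) B (![x, y] i)) rfl rfl)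
  j_left b y := by
    change Λ ![t ⊗ₜ b, y] = t ⊗ₜ _
    rw [tmul_eq_smul, biv_smul_left, h.smul_eq, hΛ]
    congr 1
    refine alternatingMap_eq_of_two Λ₀ (f := fun i => redk (ε.comp φ) B (![1 ⊗ₜ[k] b, y] i)) ?_ rfl
    exact redk_one_tmul _ B b

/-- All values lie in `t ⊗ B`, which is killed by the maximal ideal. By multilinearity, changing one
argument by a multiple of that ideal has no effect, and the arguments are exchanged one at a time.
-/
theorem apply_eq_of_redk_eq {B : CommAlgCat.{u} k} {p : ℕ}
    (P : (A₁ ⊗[k] B) [⋀^Fin p]→ₗ[A₁] (A₁ ⊗[k] B)) (hP : ∀ v, red φ B (P v) = 0)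
    (v w : Fin p → A₁ ⊗[k] B) (hvw : ∀ i, redk (ε.comp φ) B (v i) = redk (ε.comp φ) B (w i)) :
    P v = P w := by
  have hzero : ∀ (v : Fin p → A₁ ⊗[k] B) i,
      ∀ z ∈ RingHom.ker (ε.comp φ) • (⊤ : Submodule A₁ (A₁ ⊗[k] B)),
        P (Function.update v i z) = 0 := by
    intro v i z hz
    induction hz using Submodule.smul_induction_on' with
    | smul a ha x _ =>
      rw [P.map_update_smul]
      obtain ⟨b, hb⟩ := h.exists_eq_tmul (hP (Function.update v i x))
      rw [hb, h.smul_tmul, show (ε.comp φ) a = 0 from ha, zero_smul, TensorProduct.tmul_zero]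
    | add x _ y _ hx hy => rw [P.map_update_add, hx, hy, add_zero]
  have hupd : ∀ (v : Fin p → A₁ ⊗[k] B) i z, redk (ε.comp φ) B (v i) = redk (ε.comp φ) B z →
      P (Function.update v i z) = P v := by
    intro v i z hz
    have h1 := sub_redk_mem (ε.comp φ) B (z - v i)
    rw [map_sub, hz, sub_self, TensorProduct.tmul_zero, sub_zero] at h1
    have h2 := hzero v i _ h1
    rw [P.map_update_sub, sub_eq_zero, Function.update_eq_self] at h2
    exact h2
  have : ∀ s : Finset (Fin p), P (s.piecewise w v) = P v := by
    intro s
    induction s using Finset.induction_on with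
    | empty => simp
    | insert j s hj ih =>
      rw [Finset.piecewise_insert, hupd _ _ _ ?_, ih]
      rw [Finset.piecewise_eq_of_notMem _ _ _ hj, hvw]
  rw [← this Finset.univ, Finset.piecewise_univ]

variable {T : Type u} [TopologicalSpace T] {F : (Opens T)ᵒᵖ ⥤ CommAlgCat.{u} k}

/-- A polyvector field on the trivial deformation over `A₁` which vanishes over `A` is a multiple
of `t`. -/
theorem exists_polyVec_eq_tmul {p : ℕ} {U : Opens T} (P : PolyVec (baseChange A₁ F) p U)
    (hP : ∀ V (v : Fin p → A₁ ⊗[k] F.obj (op V.1)), red φ (F.obj (op V.1)) (P.1 V v) = 0) :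
    ∃ Q : PolyVec F p U, ∀ V (v : Fin p → A₁ ⊗[k] F.obj (op V.1)),
      P.1 V v = t ⊗ₜ[k] Q.1 V fun i => redk (ε.comp φ) _ (v i) := by
  have hex : ∀ (V : {V : Opens T // V ≤ U}) (b : Fin p → F.obj (op V.1)), ∃ c : F.obj (op V.1),
      P.1 V (fun i => (1 : A₁) ⊗ₜ[k] b i) = t ⊗ₜ[k] c := fun V b => h.exists_eq_tmul (hP V _)
  -- The values on functions `1 ⊗ b` determine the field on `X`; each of its properties follows from
  -- that of `P` by injectivity of multiplication by `t`.
  choose q hq using hex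
  have hu : ∀ (V : {V : Opens T // V ≤ U}) (b : Fin p → F.obj (op V.1)) (i : Fin p)
      (z : F.obj (op V.1)), (fun j => (1 : A₁) ⊗ₜ[k] Function.update b i z j) =
        Function.update (fun j => (1 : A₁) ⊗ₜ[k] b j) i ((1 : A₁) ⊗ₜ[k] z) :=
    fun V b i z => funext fun j => Function.apply_update (fun _ z => (1 : A₁) ⊗ₜ[k] z) b i z j
  have q_add : ∀ V b i x y, q V (Function.update b i (x + y)) =
      q V (Function.update b i x) + q V (Function.update b i y) := by
    intro V b i x y
    apply h.tmul_injective
    rw [TensorProduct.tmul_add, ← hq, ← hq, ← hq, hu, hu, hu, TensorProduct.tmul_add]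
    exact (P.1 V).map_update_add _ _ _ _
  have q_smul : ∀ V b i (r : k) x, q V (Function.update b i (r • x)) =
      r • q V (Function.update b i x) := by
    intro V b i r x
    apply h.tmul_injective
    rw [TensorProduct.tmul_smul, ← hq, ← hq, hu, hu, TensorProduct.tmul_smul,
      ← algebraMap_smul A₁ r, ← algebraMap_smul A₁ r]
    exact (P.1 V).map_update_smul _ _ _ _
  have q_alt : ∀ V b i j, b i = b j → i ≠ j → q V b = 0 := by
    intro V b i j hb hij
    apply h.tmul_injective
    rw [TensorProduct.tmul_zero, ← hq]
    exact (P.1 V).map_eq_zero_of_eq _ (congrArg _ hb) hij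
  refine ⟨⟨fun V => AlternatingMap.mk ⟨q V, ?_, ?_⟩ (q_alt V), fun V v i f g => ?_,
      fun V W hVW v => ?_⟩, fun V v => ?_⟩
  · intro inst b i x y
    obtain rfl : inst = instDecidableEqFin p := Subsingleton.elim _ _
    exact q_add V b i x y
  · intro inst b i r x
    obtain rfl : inst = instDecidableEqFin p := Subsingleton.elim _ _
    exact q_smul V b i r x
  · change q V (Function.update v i (f * g)) = f * q V (Function.update v i g) +
      g * q V (Function.update v i f)
    apply h.tmul_injective
    have e : ∀ b c : F.obj (op V.1), t ⊗ₜ[k] (b * c) = ((1 : A₁) ⊗ₜ[k] b) * (t ⊗ₜ[k] c) := by simp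
    rw [TensorProduct.tmul_add, e, e, ← hq, ← hq, ← hq, hu, hu, hu,
      show (1 : A₁) ⊗ₜ[k] (f * g) = ((1 : A₁) ⊗ₜ[k] f) * ((1 : A₁) ⊗ₜ[k] g) by simp]
    exact P.2.1 V _ _ _ _
  · change rmap F hVW (q V v) = q W fun i => rmap F hVW (v i)
    apply h.tmul_injective
    rw [← hq, ← rmap_baseChange_tmul, ← hq]
    exact polyVec_rmap P V.2 hVW _
  · change P.1 V v = t ⊗ₜ[k] q V fun i => redk (ε.comp φ) _ (v i)
    rw [← hq]
    refine h.apply_eq_of_redk_eq (P.1 V) (hP V) _ _ fun i => ?_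
    rw [redk_one_tmul]

/-- An automorphism of the trivial deformation over `A₁` which is trivial over `A` is given by a
vector field. -/
theorem exists_derivation {U : Opens T}
    (e : EquivFamily (baseChange A₁ F) (baseChange A₁ F) U)
    (he : ∀ V hV (x : A₁ ⊗[k] F.obj (op V)), red φ _ (e.app V hV x) = red φ _ x) :
    ∃ d : PolyVec F 1 U, ∀ V (hV : V ≤ U) (x : A₁ ⊗[k] F.obj (op V)),
      e.app V hV x = x + t ⊗ₜ[k] d.1 ⟨V, hV⟩ fun _ => redk (ε.comp φ) _ x := by
  let D : ∀ V : {V : Opens T // V ≤ U}, (A₁ ⊗[k] F.obj (op V.1)) →ₗ[A₁] A₁ ⊗[k] F.obj (op V.1) :=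
    fun V => (e.app V.1 V.2).toLinearMap - LinearMap.id
  have hD : ∀ V x, D V x = e.app V.1 V.2 x - x := fun _ _ => rfl
  have hDred : ∀ V x, red φ _ (D V x) = 0 := fun V x => by rw [hD, map_sub, he, sub_self]
  -- The difference of an algebra automorphism and the identity satisfies the Leibniz rule up to the
  -- product `D V x * D V y`, which is zero as a product of two multiples of `t`.
  have hDmul : ∀ V x y, D V (x * y) = x * D V y + y * D V x := by
    intro V x y
    obtain ⟨b, hb⟩ := h.exists_eq_tmul (hDred V x)
    obtain ⟨c, hc⟩ := h.exists_eq_tmul (hDred V y)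
    have h0 : D V x * D V y = 0 := by
      rw [hb, hc]
      refine ((h.smallExt _).mul_j (t ⊗ₜ b) c).trans ?_
      refine (congrArg (fun z => tMul t _ (z * c)) ((h.smallExt _).ρ_j b)).trans ?_
      rw [zero_mul, map_zero]
    have h1 : D V x * D V y = D V (x * y) - x * D V y - y * D V x := by
      rw [hD, hD, hD, map_mul]; ring
    rw [h0] at h1
    linear_combination -h1
  let P : PolyVec (baseChange A₁ F) 1 U := ⟨fun V => AlternatingMap.ofSubsingleton A₁ _ _ 0 (D V),
    fun V v i f g => by
      obtain rfl : i = 0 := Subsingleton.elim _ _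
      change D V _ = _ * D V _ + _ * D V _
      simp only [Function.update_self]
      exact hDmul V f g, fun V W hVW v => by
      change rmap (baseChange A₁ F) hVW (e.app V.1 V.2 (v 0) - v 0) =
        e.app W.1 W.2 (rmap (baseChange A₁ F) hVW (v 0)) - rmap (baseChange A₁ F) hVW (v 0)
      rw [map_sub, e.naturality V.1 W.1 V.2]⟩
  obtain ⟨Q, hQ⟩ := h.exists_polyVec_eq_tmul P fun V v => hDred V (v 0)
  refine ⟨Q, fun V hV x => ?_⟩
  rw [← sub_eq_iff_eq_add']
  exact hQ ⟨V, hV⟩ fun _ => x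

end SmallExtension

end Descend

/-! ### The Jacobiator as a trivector field. -/

section HalfSquare

theorem map_halfSquare {R R' M M' : Type*} [CommRing R] [CommRing R'] [CommRing M] [CommRing M']
    [Algebra R M] [Algebra R' M'] (f : M →+* M') (P : M [⋀^Fin 2]→ₗ[R] M)
    (P' : M' [⋀^Fin 2]→ₗ[R'] M') (hf : ∀ v, f (P v) = P' fun i => f (v i)) (F : Fin 3 → M) :
    f (halfSquare P F) = halfSquare P' fun i => f (F i) := by
  have hf' : ∀ x y, f (P ![x, y]) = P' ![f x, f y] := fun x y => (hf _).trans
    (alternatingMap_eq_of_two P' (f := fun i => f (![x, y] i)) rfl rfl)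
  simp only [halfSquare_apply, map_add, map_sub, hf']

variable {T : Type u} [TopologicalSpace T] {S : Type u} [CommRing S]
  {F : (Opens T)ᵒᵖ ⥤ CommAlgCat.{u} S}

/-- Half of the Schouten square of a bivector field. -/
def halfSquarePolyVec {U : Opens T} (P : PolyVec F 2 U) : PolyVec F 3 U :=
  ⟨fun V => halfSquare (P.1 V), fun V v i f g => by
    have hl := polyVec_mul_left P V
    have hr := biv_der_right _ hl
    fin_cases i <;>
    · simp only [halfSquare_apply]
      simp [hl, hr, biv_add_left]
      -- Once the arguments are put in a common order, the remaining products of a bracket with `f`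
      -- and a bracket with `g` cancel, which is why the Jacobiator is a derivation.
      try simp only [fun j => biv_swap (P.1 V) f (v j), fun j => biv_swap (P.1 V) g (v j), biv_neg_left]
      ring, fun V W h v => by
    exact map_halfSquare (rmap F h).toRingHom (P.1 V) (P.1 W)
      (fun v => polyVec_rmap P V.2 h v) v⟩

end HalfSquare

/-! ### The obstruction cochain exists and is a cocycle. -/

section Obstruction

variable {k A A₁ : Type u} [Field k] [CommRing A] [Algebra k A] [CommRing A₁] [Algebra k A₁]
  {X : Scheme.{u}} {π : X ⟶ Spec (.of k)} {Λ₀ : PolyVec (algSheaf π) 2 ⊤} {ε : A →ₐ[k] k}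
  [IsLocalRing A] [IsArtinianRing A]
  {ξ : PoissonDeformation π Λ₀ ε} {ι : Type u} {U : ι → X.Opens} {φ : A₁ →ₐ[k] A} {t : A₁}
  {τ : Trivialization ξ U}

theorem isUnit_two (k A B : Type*) [Field k] [CharZero k] [CommRing A] [Algebra k A] [CommRing B]
    [Algebra A B] : IsUnit (2 : B) := by
  have h : IsUnit (2 : k) := isUnit_iff_ne_zero.2 two_ne_zero
  have := (h.map (algebraMap k A)).map (algebraMap A B)
  rwa [map_ofNat, map_ofNat] at this

/-- The Poisson condition concerns twice the Jacobiator; here `2` is invertible, so the Jacobiator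
itself vanishes, and it is transported by the trivialization. -/
theorem Trivialization.halfSquare_bivector [CharZero k] (τ : Trivialization ξ U) (a : ι)
    (V : X.Opens) (h : V ≤ U a) (F : Fin 3 → A ⊗[k] (algSheaf π).obj (op V)) :
    halfSquare ((τ.bivector a).1 ⟨V, h⟩) F = 0 := by
  have h1 := map_halfSquare ((τ.onFibre a).app V h).toAlgHom.toRingHom
    (ξ.biv.1 ⟨upOpen ξ.incl V, le_top⟩) ((τ.bivector a).1 ⟨V, h⟩) (fun v => by
      rw [τ.bivector_apply]
      change (τ.onFibre a).app V h _ = (τ.onFibre a).app V h (ξ.biv.1 ⟨upOpen ξ.incl V, le_top⟩ fun i =>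
        ((τ.onFibre a).app V h).symm ((τ.onFibre a).app V h (v i)))
      simp only [AlgEquiv.symm_apply_apply]) (fun i => ((τ.onFibre a).app V h).symm (F i))
  have h2 := ξ.isPoisson ⟨upOpen ξ.incl V, le_top⟩ (fun i => ((τ.onFibre a).app V h).symm (F i))
  rw [show (_ : (algSheaf ξ.proj).obj _) = _ from schouten_self _ _] at h2
  have h3 : halfSquare (ξ.biv.1 ⟨upOpen ξ.incl V, le_top⟩)
      (fun i => ((τ.onFibre a).app V h).symm (F i)) = 0 := by
    exact (isUnit_two k A _).mul_right_eq_zero.1 h2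
  rw [h3] at h1
  refine Eq.trans ?_ (h1.symm.trans (map_zero _))
  refine congrArg _ (funext fun i => ?_)
  exact (AlgEquiv.apply_symm_apply _ _).symm

namespace LiftChoice

variable (h : SmallExtension ε φ t) (L : LiftChoice τ φ)
include h

/-- The Jacobiator of the lifted bivector vanishes over `A` since it reduces to that of a Poisson
structure. -/
theorem exists_trivector [CharZero k] (a : ι) {V : X.Opens} (hV : V ≤ U a) :
    ∃ Q : PolyVec (algSheaf π) 3 V, ∀ (W : {W : X.Opens // W ≤ V})
      (G : Fin 3 → A₁ ⊗[k] (algSheaf π).obj (op W.1)),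
      schouten (p := 1) (q := 1) (L.bivAt a W.1 (W.2.trans hV)) (L.bivAt a W.1 (W.2.trans hV)) G =
        t ⊗ₜ[k] Q.1 W fun i => redk (ε.comp φ) _ (G i) := by
  obtain ⟨Q, hQ⟩ := h.exists_polyVec_eq_tmul
    ((2 : A₁) • resPolyVec (halfSquarePolyVec (L.biv a)) hV) fun W v => by
      change red φ _ ((2 : A₁) • halfSquare (L.bivAt a W.1 (W.2.trans hV)) v) = 0
      have h1 := map_halfSquare (red φ ((algSheaf π).obj (op W.1))).toRingHom
        (L.bivAt a W.1 (W.2.trans hV)) ((τ.bivector a).1 ⟨W.1, W.2.trans hV⟩)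
        (L.red_biv a W.1 (W.2.trans hV)) v
      have h2 := h1.trans (τ.halfSquare_bivector a W.1 (W.2.trans hV) _)
      change red φ _ (halfSquare _ v) = 0 at h2
      rw [red_smul, h2, smul_zero]
  refine ⟨Q, fun W G => ?_⟩
  rw [← hQ W G, schouten_self]
  change _ = (2 : A₁) • halfSquare (L.bivAt a W.1 (W.2.trans hV)) G
  rw [Algebra.smul_def, map_ofNat]

/-- Over `A` the two bivectors are the same Poisson structure of the total space read in two
trivializations, so their difference reduces to zero. -/
theorem exists_bivector (a b : ι) {V : X.Opens} (ha : V ≤ U a) (hb : V ≤ U b) :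
    ∃ Q : PolyVec (algSheaf π) 2 V, ∀ (W : {W : X.Opens // W ≤ V})
      (G : Fin 2 → A₁ ⊗[k] (algSheaf π).obj (op W.1)),
      L.aut a b W.1 (W.2.trans ha) (W.2.trans hb) (L.bivAt b W.1 (W.2.trans hb) fun i =>
        (L.aut a b W.1 (W.2.trans ha) (W.2.trans hb)).symm (G i)) -
          L.bivAt a W.1 (W.2.trans ha) G =
        t ⊗ₜ[k] Q.1 W fun i => redk (ε.comp φ) _ (G i) := by
  refine h.exists_polyVec_eq_tmul
    (conjPolyVec (resPolyVec (L.biv b) hb) ((L.autFamily a b).restrict (le_inf ha hb)) -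
      resPolyVec (L.biv a) ha) fun W v => ?_
  change red φ _ (L.aut a b W.1 (W.2.trans ha) (W.2.trans hb) (L.bivAt b W.1 (W.2.trans hb) fun i =>
        (L.aut a b W.1 (W.2.trans ha) (W.2.trans hb)).symm (v i)) -
          L.bivAt a W.1 (W.2.trans ha) v) = 0
  rw [map_sub, red_aut, red_biv, red_biv, sub_eq_zero, Trivialization.transition_app,
    τ.bivector_apply, τ.bivector_apply, AlgEquiv.symm_apply_apply]
  congr 2
  funext i
  rw [AlgEquiv.symm_apply_eq]
  have h1 := L.red_aut a b W.1 (W.2.trans ha) (W.2.trans hb)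
    ((L.aut a b W.1 (W.2.trans ha) (W.2.trans hb)).symm (v i))
  rw [AlgEquiv.apply_symm_apply, Trivialization.transition_app] at h1
  rw [h1, AlgEquiv.symm_apply_apply, AlgEquiv.apply_symm_apply]

/-- The automorphisms over `A` are transition maps of trivializations and so satisfy the cocycle
rule exactly. The vector field is read off from `f̃_ab f̃_bc f̃_ac⁻¹`, an automorphism that is
trivial over `A`. -/
theorem exists_derivation (a b c : ι) {V : X.Opens} (ha : V ≤ U a) (hb : V ≤ U b) (hc : V ≤ U c) :
    ∃ d : PolyVec (algSheaf π) 1 V, ∀ (W : {W : X.Opens // W ≤ V})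
      (x : A₁ ⊗[k] (algSheaf π).obj (op W.1)),
      L.aut a b W.1 (W.2.trans ha) (W.2.trans hb)
          (L.aut b c W.1 (W.2.trans hb) (W.2.trans hc) x) =
        L.aut a c W.1 (W.2.trans ha) (W.2.trans hc) x +
        t ⊗ₜ[k] d.1 W fun _ => redk (ε.comp φ) _
          (L.aut a c W.1 (W.2.trans ha) (W.2.trans hc) x) := by
  obtain ⟨d, hd⟩ := h.exists_derivation
    (((L.autFamily a c).restrict (le_inf ha hc)).symm.trans
      (((L.autFamily b c).restrict (le_inf hb hc)).trans
        ((L.autFamily a b).restrict (le_inf ha hb)))) fun W hW x => by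
      change red φ _ (L.aut a b W (hW.trans ha) (hW.trans hb)
        (L.aut b c W (hW.trans hb) (hW.trans hc)
          ((L.aut a c W (hW.trans ha) (hW.trans hc)).symm x))) = red φ _ x
      obtain ⟨x, rfl⟩ := (L.aut a c W (hW.trans ha) (hW.trans hc)).surjective x
      rw [AlgEquiv.symm_apply_apply]
      rw [red_aut, red_aut, red_aut, Trivialization.transition_app, Trivialization.transition_app,
        Trivialization.transition_app, AlgEquiv.symm_apply_apply]
  refine ⟨d, fun W x => ?_⟩
  have := hd W.1 W.2 (L.aut a c W.1 (W.2.trans ha) (W.2.trans hc) x)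
  refine Eq.trans ?_ this
  change _ = L.aut a b W.1 (W.2.trans ha) (W.2.trans hb)
    (L.aut b c W.1 (W.2.trans hb) (W.2.trans hc)
      ((L.aut a c W.1 (W.2.trans ha) (W.2.trans hc)).symm _))
  rw [AlgEquiv.symm_apply_apply]

theorem exists_isObstructionCochain [CharZero k] :
    ∃ α : CechCochain (algSheaf π) U, L.IsObstructionCochain t α ∧
      α ∈ homogeneous (algSheaf π) U 2 0 := by
  choose Q hQ using fun I : Fin 1 → ι =>
    L.exists_trivector h (I 0) (V := ⨅ j, U (I j)) (iInf_le _ 0)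
  choose N hN using fun I : Fin 2 → ι =>
    L.exists_bivector h (I 0) (I 1) (V := ⨅ j, U (I j)) (iInf_le _ 0) (iInf_le _ 1)
  choose d hd using fun I : Fin 3 → ι =>
    L.exists_derivation h (I 0) (I 1) (I 2) (V := ⨅ j, U (I j)) (iInf_le _ 0) (iInf_le _ 1)
      (iInf_le _ 2)
  let α : CechCochain (algSheaf π) U := fun p q => match p, q with
    | 0, 2 => Q
    | 1, 1 => fun I => (2 : k) • N I
    | 2, 0 => fun I => (-2 : k) • d I
    | _, _ => 0
  refine ⟨α, ⟨fun I V G => hQ I V G, fun I => ⟨N I, rfl, fun V G => hN I V G⟩,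
    fun I => ⟨d I, rfl, fun V x => hd I V x⟩⟩, ?_⟩
  rintro (_ | _ | _ | p) (_ | _ | _ | q) hpq <;> first | rfl | omega

variable {L} {α : CechCochain (algSheaf π) U}

omit h in
theorem aut_bivAt_eq (a b : ι) {V : X.Opens} (ha : V ≤ U a) (hb : V ≤ U b)
    {N : (algSheaf π).obj (op V) [⋀^Fin 2]→ₗ[k] (algSheaf π).obj (op V)}
    (hN : ∀ G : Fin 2 → A₁ ⊗[k] (algSheaf π).obj (op V),
      L.aut a b V ha hb (L.bivAt b V hb fun i => (L.aut a b V ha hb).symm (G i)) - L.bivAt a V ha G =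
        t ⊗ₜ[k] N fun i => redk (ε.comp φ) _ (G i)) (x y : A₁ ⊗[k] (algSheaf π).obj (op V)) :
    L.aut a b V ha hb (L.bivAt b V hb ![x, y]) =
      L.bivAt a V ha ![L.aut a b V ha hb x, L.aut a b V ha hb y] +
        t ⊗ₜ[k] N ![redk (ε.comp φ) _ x, redk (ε.comp φ) _ y] := by
  have h1 := hN ![L.aut a b V ha hb x, L.aut a b V ha hb y]
  rw [sub_eq_iff_eq_add', alternatingMap_eq_of_two (L.bivAt b V hb) (a := x) (b := y)
    (by simp) (by simp), alternatingMap_eq_of_two N (a := redk (ε.comp φ) _ x)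
    (b := redk (ε.comp φ) _ y) (by simp [redk_aut])
    (by simp [redk_aut])] at h1
  exact h1

omit h in
/-- The automorphism `f̃_{ab}` as a ring homomorphism. -/
abbrev autHom (L : LiftChoice τ φ) (a b : ι) (V : X.Opens) (ha : V ≤ U a) (hb : V ≤ U b) :
    A₁ ⊗[k] (algSheaf π).obj (op V) →+* A₁ ⊗[k] (algSheaf π).obj (op V) :=
  (L.aut a b V ha hb).toAlgHom.toRingHom

theorem aut_tmul (L : LiftChoice τ φ) (a b : ι) (V : X.Opens) (ha : V ≤ U a) (hb : V ≤ U b)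
    (x : (algSheaf π).obj (op V)) : L.aut a b V ha hb (t ⊗ₜ x) = t ⊗ₜ x :=
  h.map_tmul (L.aut a b V ha hb).toLinearMap (L.redk_aut a b V ha hb) x

theorem liftsBiv (L : LiftChoice τ φ) (a : ι) (V : X.Opens) (hV : V ≤ U a) :
    LiftsBiv (redk (ε.comp φ) ((algSheaf π).obj (op V)) :
      A₁ ⊗[k] (algSheaf π).obj (op V) →+* (algSheaf π).obj (op V)) (tMul t _)
      (L.bivAt a V hV) (Λ₀.1 ⟨V, le_top⟩) :=
  h.liftsBiv _ _ (L.redk_biv a V hV)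

omit h in
theorem polyVec_eq_two_mul {p : ℕ} {V : X.Opens} {P N : PolyVec (algSheaf π) p V}
    (e : P = (2 : k) • N) (W : {W : X.Opens // W ≤ V}) (G : Fin p → (algSheaf π).obj (op W.1)) :
    P.1 W G = 2 * N.1 W G := by
  rw [e]
  change (2 : k) • N.1 W G = _
  rw [Algebra.smul_def, map_ofNat]

omit h in
theorem polyVec_eq_neg_two_mul {p : ℕ} {V : X.Opens} {P N : PolyVec (algSheaf π) p V}
    (e : P = (-2 : k) • N) (W : {W : X.Opens // W ≤ V}) (G : Fin p → (algSheaf π).obj (op W.1)) :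
    P.1 W G = -2 * N.1 W G := by
  rw [e]
  change (-2 : k) • N.1 W G = _
  rw [Algebra.smul_def, map_neg, map_ofNat]

/-- The value of a cochain on the simplex `I ∘ s`. -/
def _root_.PoissonDeform.CechCochain.val {T : Type u} [TopologicalSpace T] {R : Type u} [CommRing R]
    {F : (Opens T)ᵒᵖ ⥤ CommAlgCat.{u} R} {ι : Type u} {U : ι → Opens T} (c : CechCochain F U)
    {n p q : ℕ} (I : Fin n → ι) (V : {V : Opens T // V ≤ ⨅ j, U (I j)})
    (G : Fin (q + 1) → F.obj (op V.1)) (s : Fin (p + 1) → Fin n) : F.obj (op V.1) :=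
  (c p q fun i => I (s i)).1 ⟨V.1, le_iInf fun i => le_trans V.2 (iInf_le _ (s i))⟩ G

omit h in
theorem _root_.PoissonDeform.cechPart_succ {T : Type u} [TopologicalSpace T] {R : Type u} [CommRing R]
    {F : (Opens T)ᵒᵖ ⥤ CommAlgCat.{u} R} {ι : Type u} {U : ι → Opens T} (c : CechCochain F U)
    (p q : ℕ) (I : Fin (p + 2) → ι) (V : {V : Opens T // V ≤ ⨅ j, U (I j)})
    (G : Fin (q + 1) → F.obj (op V.1)) :
    cechPart c (p + 1) q I V G = ∑ j : Fin (p + 2), (-1) ^ j.1 * c.val I V G j.succAbove := rfl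

/-- Multiplication by `t` is injective, so the entry of `α` on a face must agree on `V` with any
vector field `D` on `V` measuring the same failure of the cocycle rule. -/
theorem val_eq (hα : L.IsObstructionCochain t α) (I : Fin 4 → ι)
    (V : {V : X.Opens // V ≤ ⨅ j, U (I j)}) (G : Fin 1 → (algSheaf π).obj (op V.1))
    (D : PolyVec (algSheaf π) 1 V.1) (s : Fin 3 → Fin 4)
    (hD : ∀ x : A₁ ⊗[k] (algSheaf π).obj (op V.1),
      L.aut (I (s 0)) (I (s 1)) V.1 (le_iInf_iff.1 V.2 _) (le_iInf_iff.1 V.2 _)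
          (L.aut (I (s 1)) (I (s 2)) V.1 (le_iInf_iff.1 V.2 _) (le_iInf_iff.1 V.2 _) x) =
        L.aut (I (s 0)) (I (s 2)) V.1 (le_iInf_iff.1 V.2 _) (le_iInf_iff.1 V.2 _) x +
        t ⊗ₜ[k] D.1 ⟨V.1, le_rfl⟩ fun _ => redk (ε.comp φ) _
          (L.aut (I (s 0)) (I (s 2)) V.1 (le_iInf_iff.1 V.2 _) (le_iInf_iff.1 V.2 _) x)) :
    α.val (p := 2) (q := 0) I V G s = -2 * D.1 ⟨V.1, le_rfl⟩ G := by
  have hG : (fun _ => G 0) = G := funext fun i => congrArg G (Subsingleton.elim _ _)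
  obtain ⟨d, hd, hd'⟩ := hα.derivation fun i => I (s i)
  -- The argument is chosen so that the automorphism sends it to `1 ⊗ G 0`, whose reduction is `G
  -- 0`.
  obtain ⟨x, hx⟩ := (L.aut (I (s 0)) (I (s 2)) V.1 (le_iInf_iff.1 V.2 _)
    (le_iInf_iff.1 V.2 _)).surjective (1 ⊗ₜ G 0)
  have h2 := (hd' ⟨V.1, le_iInf fun i => le_iInf_iff.1 V.2 _⟩ x).symm.trans (hD x)
  rw [add_right_inj, hx] at h2
  have h3 := h.tmul_injective h2
  rw [redk_one_tmul, hG] at h3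
  refine (polyVec_eq_neg_two_mul hd _ _).trans ?_
  rw [h3]

theorem cechPart_three_eq_zero (hα : L.IsObstructionCochain t α) (I : Fin 4 → ι)
    (V : {V : X.Opens // V ≤ ⨅ j, U (I j)}) (G : Fin 1 → (algSheaf π).obj (op V.1)) :
    cechPart α 3 0 I V G = 0 := by
  have hI : ∀ j, V.1 ≤ U (I j) := le_iInf_iff.1 V.2
  have hj := h.smallExt ((algSheaf π).obj (op V.1))
  have hG : (fun _ => G 0) = G := funext fun i => congrArg G (Subsingleton.elim _ _)
  choose D hD using fun a b c : Fin 4 =>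
    L.exists_derivation h (I a) (I b) (I c) (V := V.1) (hI a) (hI b) (hI c)
  have huniq : ∀ s : Fin 3 → Fin 4, α.val (p := 2) (q := 0) I V G s =
      -2 * (D (s 0) (s 1) (s 2)).1 ⟨V.1, le_rfl⟩ G := fun s =>
    val_eq h hα I V G (D (s 0) (s 1) (s 2)) s (hD (s 0) (s 1) (s 2) ⟨V.1, le_rfl⟩)
  have key := derivation_cocycle hj (fun r s => L.autHom (I r) (I s) V.1 (hI r) (hI s))
    (fun r s => aut_tmul h L _ _ _ _ _) (fun r s => L.redk_aut _ _ _ _ _)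
    (fun a b c x => (D a b c).1 ⟨V.1, le_rfl⟩ fun _ => x) (fun r s u _ _ x =>
      (hD r s u ⟨V.1, le_rfl⟩ x).trans (by rw [redk_aut]; rfl)) (G 0)
  simp only [hG] at key
  refine (cechPart_succ α 2 0 I V G).trans ?_
  rw [Fin.sum_univ_four, huniq, huniq, huniq, huniq]
  have e : ∀ (j a b c : Fin 4), j.succAbove 0 = a → j.succAbove 1 = b → j.succAbove 2 = c →
      (D (j.succAbove 0) (j.succAbove 1) (j.succAbove 2)).1 ⟨V.1, le_rfl⟩ G =
        (D a b c).1 ⟨V.1, le_rfl⟩ G := by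
    rintro j a b c rfl rfl rfl
    rfl
  rw [e 0 1 2 3 (by decide) (by decide) (by decide), e 1 0 2 3 (by decide) (by decide) (by decide),
    e 2 0 1 3 (by decide) (by decide) (by decide), e 3 0 1 2 (by decide) (by decide) (by decide)]
  rw [show ((0 : Fin 4) : ℕ) = 0 from rfl, show ((1 : Fin 4) : ℕ) = 1 from rfl,
    show ((2 : Fin 4) : ℕ) = 2 from rfl, show ((3 : Fin 4) : ℕ) = 3 from rfl]
  linear_combination (-2 : (algSheaf π).obj (op V.1)) * key

/-- In total degree `3` there are four bidegrees. `(0, 3)` is the Jacobi identity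
`schouten_trivector_eq_zero`. `(1, 2)` says `Π_b - Π_a = 2 [Λ₀, Λ'_ab]` by `trivector_sub`, and `(2,
1)` says `[Λ₀, d] = -(δ Λ')` by `bivector_cocycle`. `(3, 0)` is `δ d = 0`. The sign `(-1) ^ 3` of
`δ` and the factors `2` and `-2` in `α` turn these into the cocycle equation. -/
theorem mem_cocycles (hα : L.IsObstructionCochain t α) (hα' : α ∈ homogeneous (algSheaf π) U 2 0) :
    α ∈ cocycles Λ₀ U 2 := by
  refine ⟨hα', LinearMap.mem_ker.2 ?_⟩
  have hzero : ∀ p q, p + q ≠ 2 → ∀ I V G, (α p q I).1 V G = 0 := by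
    intro p q hpq I V G
    rw [hα' p q (by omega)]
    rfl
  have hlich : ∀ p q, p + q ≠ 2 → ∀ I V G, lichnerowiczPart Λ₀ α p (q + 1) I V G = 0 := by
    intro p q hpq I V G
    have e : (α p q I).1 V = (0 : k) • (α p q I).1 V := by
      rw [hα' p q (by omega), zero_smul]
      rfl
    change schouten _ ((α p q I).1 V) G = 0
    rw [e, schouten_smul_right, zero_smul]
  have hcech : ∀ p q, p + q ≠ 2 → ∀ I V G, cechPart α (p + 1) q I V G = 0 := by
    intro p q hpq I V G
    refine Finset.sum_eq_zero fun j _ => ?_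
    rw [hzero p q hpq, mul_zero]
  funext p q I V G
  change lichnerowiczPart Λ₀ α p q I V G + (-1) ^ 3 * cechPart α p q I V G = 0
  have hI : ∀ j, V.1 ≤ U (I j) := le_iInf_iff.1 V.2
  by_cases hpq : p + q = 3
  swap
  · have h1 : lichnerowiczPart Λ₀ α p q I V G = 0 := by
      cases q with
      | zero => rfl
      | succ q => exact hlich p q (by omega) I V G
    have h2 : cechPart α p q I V G = 0 := by
      cases p with
      | zero => rfl
      | succ p => exact hcech p q (by omega) I V G
    rw [h1, h2, mul_zero, add_zero]
  have hj := h.smallExt ((algSheaf π).obj (op V.1))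
  obtain ⟨rfl, rfl⟩ | ⟨rfl, rfl⟩ | ⟨rfl, rfl⟩ | ⟨rfl, rfl⟩ :
      (p = 0 ∧ q = 3) ∨ (p = 1 ∧ q = 2) ∨ (p = 2 ∧ q = 1) ∨ (p = 3 ∧ q = 0) := by omega
  · change schouten (p := 1) (q := 2) (Λ₀.1 ⟨V.1, le_top⟩) ((α 0 2 I).1 V) G + (-1) ^ 3 * 0 = 0
    rw [mul_zero, add_zero]
    exact schouten_trivector_eq_zero hj (liftsBiv h L (I 0) V.1 (hI 0)) _ (hα.trivector I V) G
  · obtain ⟨N, hN, hN'⟩ := hα.bivector I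
    have key := trivector_sub hj (liftsBiv h L (I 0) V.1 (hI 0)) (L.autHom (I 0) (I 1) V.1 (hI 0) (hI 1))
      (aut_tmul h L _ _ _ _ _) (L.redk_aut _ _ _ _ _)
      (hα.trivector (fun i => I (Fin.succAbove 1 i)) ⟨V.1, le_iInf fun i => hI _⟩)
      (hα.trivector (fun i => I (Fin.succAbove 0 i)) ⟨V.1, le_iInf fun i => hI _⟩)
      (aut_bivAt_eq (I 0) (I 1) (hI 0) (hI 1) (hN' V)) G
    change schouten (p := 1) (q := 1) (Λ₀.1 ⟨V.1, le_top⟩) ((α 1 1 I).1 V) G +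
      (-1) ^ 3 * cechPart α 1 2 I V G = 0
    rw [hN]
    change schouten (p := 1) (q := 1) (Λ₀.1 ⟨V.1, le_top⟩) ((2 : k) • N.1 V) G +
      (-1) ^ 3 * ∑ j : Fin 2, (-1) ^ j.1 * (α 0 2 fun i => I (j.succAbove i)).1
        ⟨V.1, le_iInf fun i => hI (j.succAbove i)⟩ G = 0
    rw [schouten_smul_right, Fin.sum_univ_two, Algebra.smul_def, map_ofNat, ← key]
    simp
    ring
  · obtain ⟨d, hd, hd'⟩ := hα.derivation I
    obtain ⟨N₀, hN₀, hN₀'⟩ := hα.bivector fun i => I (Fin.succAbove 0 i)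
    obtain ⟨N₁, hN₁, hN₁'⟩ := hα.bivector fun i => I (Fin.succAbove 1 i)
    obtain ⟨N₂, hN₂, hN₂'⟩ := hα.bivector fun i => I (Fin.succAbove 2 i)
    have key := bivector_cocycle hj (liftsBiv h L (I 0) V.1 (hI 0))
      (liftsBiv h L (I 2) V.1 (hI 2)) (L.autHom (I 0) (I 1) V.1 (hI 0) (hI 1))
      (L.autHom (I 1) (I 2) V.1 (hI 1) (hI 2)) (L.autHom (I 0) (I 2) V.1 (hI 0) (hI 2))
      (aut_tmul h L _ _ _ _ _) (L.redk_aut _ _ _ _ _) (L.redk_aut _ _ _ _ _)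
      (aut_bivAt_eq (I 0) (I 1) (hI 0) (hI 1) (hN₂' ⟨V.1, le_iInf fun i => hI _⟩))
      (aut_bivAt_eq (I 1) (I 2) (hI 1) (hI 2) (hN₀' ⟨V.1, le_iInf fun i => hI _⟩))
      (aut_bivAt_eq (I 0) (I 2) (hI 0) (hI 2) (hN₁' ⟨V.1, le_iInf fun i => hI _⟩))
      (d := d.1 V) (fun x => (hd' V x).trans (by
        rw [alternatingMap_eq_of_one (d.1 V) rfl, redk_aut]; rfl)) G
    change schouten (p := 1) (q := 0) (Λ₀.1 ⟨V.1, le_top⟩) ((α 2 0 I).1 V) G +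
      (-1) ^ 3 * ∑ j : Fin 3, (-1) ^ j.1 * (α 1 1 fun i => I (j.succAbove i)).1
        ⟨V.1, le_iInf fun i => hI (j.succAbove i)⟩ G = 0
    rw [hd]
    change schouten (p := 1) (q := 0) (Λ₀.1 ⟨V.1, le_top⟩) ((-2 : k) • d.1 V) G +
      (-1) ^ 3 * ∑ j : Fin 3, (-1) ^ j.1 * (α 1 1 fun i => I (j.succAbove i)).1
        ⟨V.1, le_iInf fun i => hI (j.succAbove i)⟩ G = 0
    rw [schouten_smul_right, Fin.sum_univ_three, Algebra.smul_def, map_neg, map_ofNat, key,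
      polyVec_eq_two_mul hN₀, polyVec_eq_two_mul hN₁, polyVec_eq_two_mul hN₂]
    simp only [Fin.val_zero, Fin.val_one, Fin.val_two]
    ring
  · change 0 + (-1) ^ 3 * cechPart α 3 0 I V G = 0
    rw [cechPart_three_eq_zero h hα I V G, mul_zero, add_zero]

end LiftChoice

end Obstruction


/-! ### The total differential respects degrees. -/

section TotalDiff

variable {T : Type u} [TopologicalSpace T] {R : Type u} [CommRing R]
  {F : (Opens T)ᵒᵖ ⥤ CommAlgCat.{u} R} {ι : Type u} {U : ι → Opens T}

theorem totalDiff_apply_eq_zero (Λ : PolyVec F 2 ⊤) {c : CechCochain F U} {n s m p q : ℕ}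
    (hc : c ∈ homogeneous F U n s) (h : p + q + s ≠ n + 1) (I : Fin (p + 1) → ι)
    (V : {V : Opens T // V ≤ ⨅ j, U (I j)}) (G : Fin (q + 1) → F.obj (op V.1)) :
    totalDiff Λ m c p q I V G = 0 := by
  have h1 : lichnerowiczPart Λ c p q I V G = 0 := by
    cases q with
    | zero => rfl
    | succ q =>
      have e : (c p q I).1 V = (0 : R) • (c p q I).1 V := by
        rw [hc p q (by omega), zero_smul]
        rfl
      change schouten _ ((c p q I).1 V) G = 0
      rw [e, schouten_smul_right, zero_smul]
  have h2 : cechPart c p q I V G = 0 := by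
    cases p with
    | zero => rfl
    | succ p =>
      refine Finset.sum_eq_zero fun j _ => ?_
      rw [hc p q (by omega)]
      exact mul_zero _
  change lichnerowiczPart Λ c p q I V G + (-1) ^ m * cechPart c p q I V G = 0
  rw [h1, h2, mul_zero, add_zero]

end TotalDiff

/-! ### The effect of a change of choices on the cochain. -/

section Change

variable {k A A₁ : Type u} [Field k] [CommRing A] [Algebra k A] [CommRing A₁] [Algebra k A₁]
  {X : Scheme.{u}} {π : X ⟶ Spec (.of k)} {Λ₀ : PolyVec (algSheaf π) 2 ⊤} {ε : A →ₐ[k] k}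
  [IsLocalRing A] [IsArtinianRing A]
  {ξ : PoissonDeformation π Λ₀ ε} {ι : Type u} {U : ι → X.Opens} {φ : A₁ →ₐ[k] A} {t : A₁}
  {τ τ' : Trivialization ξ U}

namespace LiftChoice

/-- The equations of an obstruction cochain multiplied by the denominators `1`, `2` and `-2`, for
families of functions which need not be polyvector fields. -/
structure Represents (L : LiftChoice τ φ) (t : A₁) (r : RawCochain (algSheaf π) U) : Prop where
  trivector : ∀ (I : Fin 1 → ι) (V : {V : X.Opens // V ≤ ⨅ j, U (I j)})
    (G : Fin 3 → A₁ ⊗[k] (algSheaf π).obj (op V.1)),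
    schouten (p := 1) (q := 1) (L.bivAt (I 0) V.1 (le_iInf_iff.1 V.2 0))
        (L.bivAt (I 0) V.1 (le_iInf_iff.1 V.2 0)) G =
      t ⊗ₜ[k] r 0 2 I V fun i => redk (ε.comp φ) _ (G i)
  bivector : ∀ (I : Fin 2 → ι) (V : {V : X.Opens // V ≤ ⨅ j, U (I j)})
    (x y : A₁ ⊗[k] (algSheaf π).obj (op V.1)),
      2 * (L.aut (I 0) (I 1) V.1 (le_iInf_iff.1 V.2 0) (le_iInf_iff.1 V.2 1)
          (L.bivAt (I 1) V.1 (le_iInf_iff.1 V.2 1) ![x, y]) -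
        L.bivAt (I 0) V.1 (le_iInf_iff.1 V.2 0)
          ![L.aut (I 0) (I 1) V.1 (le_iInf_iff.1 V.2 0) (le_iInf_iff.1 V.2 1) x,
            L.aut (I 0) (I 1) V.1 (le_iInf_iff.1 V.2 0) (le_iInf_iff.1 V.2 1) y]) =
      t ⊗ₜ[k] r 1 1 I V ![redk (ε.comp φ) _ x, redk (ε.comp φ) _ y]
  derivation : ∀ (I : Fin 3 → ι) (V : {V : X.Opens // V ≤ ⨅ j, U (I j)})
    (x : A₁ ⊗[k] (algSheaf π).obj (op V.1)),
      -2 * (L.aut (I 0) (I 1) V.1 (le_iInf_iff.1 V.2 0) (le_iInf_iff.1 V.2 1)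
          (L.aut (I 1) (I 2) V.1 (le_iInf_iff.1 V.2 1) (le_iInf_iff.1 V.2 2) x) -
        L.aut (I 0) (I 2) V.1 (le_iInf_iff.1 V.2 0) (le_iInf_iff.1 V.2 2) x) =
        t ⊗ₜ[k] r 2 0 I V ![redk (ε.comp φ) _ x]

/-- The choices `L'` arise from `L` by the automorphisms `g`, the bivectors `t l` and the vector
fields `t p`. -/
structure IsChange (L : LiftChoice τ φ) (L' : LiftChoice τ' φ) (t : A₁)
    (g : ∀ a, EquivFamily (baseChange A₁ (algSheaf π)) (baseChange A₁ (algSheaf π)) (U a))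
    (l : ∀ a, PolyVec (algSheaf π) 2 (U a)) (p : ∀ a b, PolyVec (algSheaf π) 1 (U a ⊓ U b)) :
    Prop where
  redk : ∀ a V (hV : V ≤ U a) (x : A₁ ⊗[k] (algSheaf π).obj (op V)),
    redk (ε.comp φ) _ ((g a).app V hV x) = redk (ε.comp φ) _ x
  biv : ∀ a V (hV : V ≤ U a) (x y : A₁ ⊗[k] (algSheaf π).obj (op V)),
    L'.bivAt a V hV ![(g a).app V hV x, (g a).app V hV y] =
      (g a).app V hV (L.bivAt a V hV ![x, y]) +
        t ⊗ₜ[k] (l a).1 ⟨V, hV⟩ ![PoissonDeform.redk (ε.comp φ) _ x,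
          PoissonDeform.redk (ε.comp φ) _ y]
  aut : ∀ a b V (ha : V ≤ U a) (hb : V ≤ U b) (x : A₁ ⊗[k] (algSheaf π).obj (op V)),
    L'.aut a b V ha hb ((g b).app V hb x) = (g a).app V ha (L.aut a b V ha hb x) +
      t ⊗ₜ[k] (p a b).1 ⟨V, le_inf ha hb⟩ ![PoissonDeform.redk (ε.comp φ) _ x]

variable {L : LiftChoice τ φ} {L' : LiftChoice τ' φ}

/-- The form on the left makes sense for raw cochains such as `α` plus a differential, before one
knows that the entries are polyvector fields. Going back divides by `2` and `-2`. -/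
theorem represents_iff [CharZero k] (α : CechCochain (algSheaf π) U) :
    L.Represents t α.toRaw ↔ L.IsObstructionCochain t α := by
  have two : (2 : k) * 2⁻¹ = 1 := mul_inv_cancel₀ two_ne_zero
  have hs : ∀ (B : CommAlgCat.{u} k) (x : A₁ ⊗[k] B), 2 * x = (2 : k) • x := fun B x => by
    rw [Algebra.smul_def, map_ofNat]
  have hs' : ∀ (B : CommAlgCat.{u} k) (x : A₁ ⊗[k] B), -2 * x = (-2 : k) • x := fun B x => by
    rw [Algebra.smul_def, map_neg, map_ofNat]
  constructor
  · refine fun hr => ⟨hr.trivector, fun I => ⟨(2⁻¹ : k) • α 1 1 I, ?_, fun V G => ?_⟩,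
      fun I => ⟨(-2⁻¹ : k) • α 2 0 I, ?_, fun V x => ?_⟩⟩
    · rw [smul_smul, two, one_smul]
    · have h1 := hr.bivector I V
        ((L.aut (I 0) (I 1) V.1 (le_iInf_iff.1 V.2 0) (le_iInf_iff.1 V.2 1)).symm (G 0))
        ((L.aut (I 0) (I 1) V.1 (le_iInf_iff.1 V.2 0) (le_iInf_iff.1 V.2 1)).symm (G 1))
      rw [hs, AlgEquiv.apply_symm_apply, AlgEquiv.apply_symm_apply] at h1
      change _ = t ⊗ₜ[k] ((2⁻¹ : k) • (α 1 1 I).1 V fun i => redk (ε.comp φ) _ (G i))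
      have hsy : ∀ x : A₁ ⊗[k] (algSheaf π).obj (op V.1), PoissonDeform.redk (ε.comp φ) _
          ((L.aut (I 0) (I 1) V.1 (le_iInf_iff.1 V.2 0) (le_iInf_iff.1 V.2 1)).symm x) =
            PoissonDeform.redk (ε.comp φ) _ x := fun x => by
        rw [← L.redk_aut (I 0) (I 1) V.1 (le_iInf_iff.1 V.2 0) (le_iInf_iff.1 V.2 1),
          AlgEquiv.apply_symm_apply]
      rw [TensorProduct.tmul_smul, eq_inv_smul_iff₀ two_ne_zero,
        alternatingMap_eq_of_two (L.bivAt (I 1) V.1 (le_iInf_iff.1 V.2 1)) rfl rfl,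
        alternatingMap_eq_of_two (L.bivAt (I 0) V.1 (le_iInf_iff.1 V.2 0)) rfl rfl]
      refine h1.trans (congrArg (fun b => t ⊗ₜ[k] b) ?_)
      rw [hsy, hsy]
      exact (alternatingMap_eq_of_two ((α 1 1 I).1 V)
        (f := fun i => PoissonDeform.redk (ε.comp φ) _ (G i)) rfl rfl).symm
    · rw [smul_smul, neg_mul_neg, two, one_smul]
    · have h1 := hr.derivation I V x
      rw [hs'] at h1
      change _ = _ + t ⊗ₜ[k] ((-2⁻¹ : k) • (α 2 0 I).1 V fun i => redk (ε.comp φ) _ _)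
      rw [TensorProduct.tmul_smul, ← sub_eq_iff_eq_add', ← inv_neg,
        eq_inv_smul_iff₀ (neg_ne_zero.2 two_ne_zero)]
      refine h1.trans (congrArg (fun b => t ⊗ₜ[k] b) ?_)
      rw [L.redk_aut]
      exact (alternatingMap_eq_of_one ((α 2 0 I).1 V)
        (f := fun i => PoissonDeform.redk (ε.comp φ) _ x) rfl).symm
  · refine fun hα => ⟨hα.trivector, fun I V x y => ?_, fun I V x => ?_⟩
    · obtain ⟨N, hN, hN'⟩ := hα.bivector I
      rw [aut_bivAt_eq (I 0) (I 1) (le_iInf_iff.1 V.2 0) (le_iInf_iff.1 V.2 1) (hN' V),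
        add_sub_cancel_left, hs, ← TensorProduct.tmul_smul]
      change _ = t ⊗ₜ[k] (α 1 1 I).1 V _
      rw [hN]
      rfl
    · obtain ⟨d, hd, hd'⟩ := hα.derivation I
      rw [hd' V x, add_sub_cancel_left, hs', ← TensorProduct.tmul_smul, L.redk_aut,
        alternatingMap_eq_of_one (d.1 V) rfl]
      change _ = t ⊗ₜ[k] (α 2 0 I).1 V _
      rw [hd]
      rfl

/-- The equations determine the cochain in degree `2`: reduction to the closed fibre is surjective
and multiplication by `t` is injective. -/
theorem Represents.congr (h : SmallExtension ε φ t) {r r' : RawCochain (algSheaf π) U}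
    (hr : L.Represents t r) (hr' : L.Represents t r') (p q : ℕ) (hpq : p + q = 2) :
    r p q = r' p q := by
  have hsurj := fun V : X.Opens => redk_surjective (ε.comp φ) ((algSheaf π).obj (op V))
  obtain ⟨rfl, rfl⟩ | ⟨rfl, rfl⟩ | ⟨rfl, rfl⟩ :
    (p = 0 ∧ q = 2) ∨ (p = 1 ∧ q = 1) ∨ (p = 2 ∧ q = 0) := by omega
  all_goals
    funext I V G
    choose x hx using fun i => hsurj V.1 (G i)
    obtain rfl : (fun i => PoissonDeform.redk (ε.comp φ) _ (x i)) = G := funext hx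
    refine h.tmul_injective ?_
  · exact (hr.trivector I V x).symm.trans (hr'.trivector I V x)
  · have e : (fun i => PoissonDeform.redk (ε.comp φ) _ (x i)) =
        ![PoissonDeform.redk (ε.comp φ) _ (x 0), PoissonDeform.redk (ε.comp φ) _ (x 1)] :=
      funext fun i => by fin_cases i <;> rfl
    rw [e]
    exact (hr.bivector I V (x 0) (x 1)).symm.trans (hr'.bivector I V (x 0) (x 1))
  · have e : (fun i => PoissonDeform.redk (ε.comp φ) _ (x i)) =
        ![PoissonDeform.redk (ε.comp φ) _ (x 0)] :=
      funext fun i => by fin_cases i; rfl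
    rw [e]
    exact (hr.derivation I V (x 0)).symm.trans (hr'.derivation I V (x 0))

section Change

variable (h : SmallExtension ε φ t)
  {g : ∀ a, EquivFamily (baseChange A₁ (algSheaf π)) (baseChange A₁ (algSheaf π)) (U a)}
  {l : ∀ a, PolyVec (algSheaf π) 2 (U a)} {p : ∀ a b, PolyVec (algSheaf π) 1 (U a ⊓ U b)}
  (hL : L.IsChange L' t g l p)
include hL

theorem IsChange.redk_symm (a : ι) (V : X.Opens) (hV : V ≤ U a)
    (x : A₁ ⊗[k] (algSheaf π).obj (op V)) :
    PoissonDeform.redk (ε.comp φ) _ (((g a).app V hV).symm x) =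
      PoissonDeform.redk (ε.comp φ) _ x := by
  rw [← hL.redk a V hV, AlgEquiv.apply_symm_apply]

theorem IsChange.conj_apply (a : ι) (V : X.Opens) (hV : V ≤ U a)
    (x y : A₁ ⊗[k] (algSheaf π).obj (op V)) :
    (conjPolyVec (L.biv a) (g a)).1 ⟨V, hV⟩ ![x, y] =
      (g a).app V hV (L.bivAt a V hV ![((g a).app V hV).symm x, ((g a).app V hV).symm y]) := by
  rw [conjPolyVec_apply, alternatingMap_eq_of_two ((L.biv a).1 ⟨V, hV⟩) rfl rfl]
  rfl

/-- The change is split into transport by `g`, which is harmless because `g` is the identity on the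
closed fibre, and addition of a multiple of `t`. -/
theorem IsChange.biv_eq (a : ι) (V : X.Opens) (hV : V ≤ U a)
    (x y : A₁ ⊗[k] (algSheaf π).obj (op V)) :
    L'.bivAt a V hV ![x, y] = (conjPolyVec (L.biv a) (g a)).1 ⟨V, hV⟩ ![x, y] +
      t ⊗ₜ[k] (l a).1 ⟨V, hV⟩ ![PoissonDeform.redk (ε.comp φ) _ x,
          PoissonDeform.redk (ε.comp φ) _ y] := by
  have h1 := hL.biv a V hV (((g a).app V hV).symm x) (((g a).app V hV).symm y)
  rw [AlgEquiv.apply_symm_apply, AlgEquiv.apply_symm_apply, hL.redk_symm, hL.redk_symm] at h1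
  rw [h1, hL.conj_apply]

include h in
theorem IsChange.liftsBiv (a : ι) (V : X.Opens) (hV : V ≤ U a) :
    LiftsBiv (PoissonDeform.redk (ε.comp φ) ((algSheaf π).obj (op V)) :
      A₁ ⊗[k] (algSheaf π).obj (op V) →+* (algSheaf π).obj (op V)) (tMul t _)
      ((conjPolyVec (L.biv a) (g a)).1 ⟨V, hV⟩) (Λ₀.1 ⟨V, le_top⟩) := by
  refine h.liftsBiv _ _ fun v => ?_
  rw [conjPolyVec_apply, hL.redk, L.redk_biv]
  simp only [hL.redk_symm]

include h in
theorem IsChange.tmul (a : ι) (V : X.Opens) (hV : V ≤ U a) (b : (algSheaf π).obj (op V)) :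
    (g a).app V hV (t ⊗ₜ b) = t ⊗ₜ b :=
  h.map_tmul ((g a).app V hV).toLinearMap (hL.redk a V hV) b

theorem IsChange.schouten_conj (a : ι) (V : X.Opens) (hV : V ≤ U a)
    (G : Fin 3 → A₁ ⊗[k] (algSheaf π).obj (op V)) :
    schouten (p := 1) (q := 1) ((conjPolyVec (L.biv a) (g a)).1 ⟨V, hV⟩)
        ((conjPolyVec (L.biv a) (g a)).1 ⟨V, hV⟩) G =
      (g a).app V hV (schouten (p := 1) (q := 1) (L.bivAt a V hV) (L.bivAt a V hV)
        fun i => ((g a).app V hV).symm (G i)) := by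
  have h1 := map_halfSquare ((g a).app V hV).toAlgHom.toRingHom (L.bivAt a V hV)
    ((conjPolyVec (L.biv a) (g a)).1 ⟨V, hV⟩) (fun v => by
      rw [conjPolyVec_apply]
      change (g a).app V hV _ = (g a).app V hV (L.bivAt a V hV fun i =>
        ((g a).app V hV).symm ((g a).app V hV (v i)))
      simp only [AlgEquiv.symm_apply_apply]) fun i => ((g a).app V hV).symm (G i)
  rw [schouten_self, schouten_self, map_mul, map_ofNat]
  refine congrArg (2 * ·) (Eq.trans ?_ h1.symm)
  refine congrArg _ (funext fun i => ?_)
  exact (AlgEquiv.apply_symm_apply _ _).symm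

variable {α β : CechCochain (algSheaf π) U} (hα : L.IsObstructionCochain t α)
include h hα

theorem IsChange.trivector
    (hl : ∀ (I : Fin 1 → ι) V, (β 0 1 I).1 V = (2 : k) • (l (I 0)).1 ⟨V.1, le_iInf_iff.1 V.2 0⟩)
    (I : Fin 1 → ι) (V : {V : X.Opens // V ≤ ⨅ j, U (I j)})
    (G : Fin 3 → A₁ ⊗[k] (algSheaf π).obj (op V.1)) :
    schouten (p := 1) (q := 1) (L'.bivAt (I 0) V.1 (le_iInf_iff.1 V.2 0))
        (L'.bivAt (I 0) V.1 (le_iInf_iff.1 V.2 0)) G =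
      t ⊗ₜ[k] (α.toRaw + totalDiff Λ₀ 2 β) 0 2 I V fun i =>
        PoissonDeform.redk (ε.comp φ) _ (G i) := by
  have h1 := trivector_change (h.smallExt ((algSheaf π).obj (op V.1)))
    (hL.liftsBiv h (I 0) V.1 (le_iInf_iff.1 V.2 0)) (hL.biv_eq (I 0) V.1 (le_iInf_iff.1 V.2 0)) G
  refine h1.trans ?_
  rw [hL.schouten_conj, hα.trivector I V, hL.tmul h]
  simp only [hL.redk_symm]
  refine ((tMul t _).map_add _ _).symm.trans (congrArg (tMul t _) ?_)
  change _ = (α 0 2 I).1 V (fun i => PoissonDeform.redk (ε.comp φ) _ (G i)) +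
    (schouten (p := 1) (q := 1) (Λ₀.1 ⟨V.1, le_top⟩) ((β 0 1 I).1 V)
      (fun i => PoissonDeform.redk (ε.comp φ) _ (G i)) + (-1) ^ 2 * 0)
  rw [hl, schouten_smul_right, mul_zero, add_zero, Algebra.smul_def, map_ofNat]
  rfl

omit hα in
theorem IsChange.aut_bivAt
    (I : Fin 2 → ι) (V : {V : X.Opens // V ≤ ⨅ j, U (I j)}) (ha : V.1 ≤ U (I 0))
    (hb : V.1 ≤ U (I 1)) {N : PolyVec (algSheaf π) 2 (⨅ j, U (I j))}
    (hN' : ∀ (V : {V : X.Opens // V ≤ ⨅ j, U (I j)}) (G : Fin 2 → A₁ ⊗[k] (algSheaf π).obj (op V.1)),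
      L.aut (I 0) (I 1) V.1 (le_iInf_iff.1 V.2 0) (le_iInf_iff.1 V.2 1)
          (L.bivAt (I 1) V.1 (le_iInf_iff.1 V.2 1) fun i =>
            (L.aut (I 0) (I 1) V.1 (le_iInf_iff.1 V.2 0) (le_iInf_iff.1 V.2 1)).symm (G i))
        - L.bivAt (I 0) V.1 (le_iInf_iff.1 V.2 0) G =
      t ⊗ₜ[k] N.1 V fun i => PoissonDeform.redk (ε.comp φ) _ (G i))
    (x y : A₁ ⊗[k] (algSheaf π).obj (op V.1)) :
      L'.autHom (I 0) (I 1) V.1 ha hb (L'.bivAt (I 1) V.1 hb ![x, y]) =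
        L'.bivAt (I 0) V.1 ha
          ![L'.autHom (I 0) (I 1) V.1 ha hb x, L'.autHom (I 0) (I 1) V.1 ha hb y] +
      tMul t _ (N.1 V ![PoissonDeform.redk (ε.comp φ) _ x, PoissonDeform.redk (ε.comp φ) _ y] +
        (l (I 1)).1 ⟨V.1, hb⟩ ![PoissonDeform.redk (ε.comp φ) _ x, PoissonDeform.redk (ε.comp φ) _ y] -
        (l (I 0)).1 ⟨V.1, ha⟩ ![PoissonDeform.redk (ε.comp φ) _ x, PoissonDeform.redk (ε.comp φ) _ y] -
        schouten (p := 1) (q := 0) (Λ₀.1 ⟨V.1, le_top⟩) ((p (I 0) (I 1)).1 ⟨V.1, le_inf ha hb⟩)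
          ![PoissonDeform.redk (ε.comp φ) _ x, PoissonDeform.redk (ε.comp φ) _ y]) := by
  -- The old automorphism transported by `g`. It relates the transported bivectors with the same
  -- defect `N`, and the new automorphism differs from it by `t p`, so `bivector_change` applies.
  let f : A₁ ⊗[k] (algSheaf π).obj (op V.1) →+* A₁ ⊗[k] (algSheaf π).obj (op V.1) :=
    (((g (I 1)).app V.1 hb).symm.trans ((L.aut (I 0) (I 1) V.1 ha hb).trans
      ((g (I 0)).app V.1 ha))).toAlgHom.toRingHom
  have hf : ∀ z, f z = (g (I 0)).app V.1 ha (L.aut (I 0) (I 1) V.1 ha hb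
    (((g (I 1)).app V.1 hb).symm z)) := fun _ => rfl
  have hfρ : ∀ z, PoissonDeform.redk (ε.comp φ) _ (f z) = PoissonDeform.redk (ε.comp φ) _ z :=
    fun z => by rw [hf, hL.redk, L.redk_aut, hL.redk_symm]
  exact bivector_change (h.smallExt ((algSheaf π).obj (op V.1)))
    (hL.liftsBiv h (I 0) V.1 ha) (hL.liftsBiv h (I 1) V.1 hb)
    (hL.biv_eq (I 0) V.1 ha) (hL.biv_eq (I 1) V.1 hb) f (L'.autHom (I 0) (I 1) V.1 ha hb)
    (fun b => h.map_tmul (((g (I 1)).app V.1 hb).symm.trans ((L.aut (I 0) (I 1) V.1 ha hb).trans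
      ((g (I 0)).app V.1 ha))).toLinearMap hfρ b) hfρ (p := (p (I 0) (I 1)).1 ⟨V.1, le_inf ha hb⟩)
    (fun z => by
      have := hL.aut (I 0) (I 1) V.1 ha hb (((g (I 1)).app V.1 hb).symm z)
      rw [AlgEquiv.apply_symm_apply, hL.redk_symm] at this
      exact this) (N := N.1 V)
    (fun z w => by
      rw [hL.conj_apply, hL.conj_apply, hf, hf, hf, AlgEquiv.symm_apply_apply,
        AlgEquiv.symm_apply_apply, AlgEquiv.symm_apply_apply,
        aut_bivAt_eq (I 0) (I 1) ha hb (hN' V), map_add, hL.tmul h, hL.redk_symm, hL.redk_symm]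
      rfl) x y
end Change

section Formulas

variable {α β : CechCochain (algSheaf π) U}
  {l : ∀ a, PolyVec (algSheaf π) 2 (U a)} {p : ∀ a b, PolyVec (algSheaf π) 1 (U a ⊓ U b)}

omit [IsLocalRing A] [IsArtinianRing A] in
theorem cechPart_two_one
    (hl : ∀ (I : Fin 1 → ι) V, (β 0 1 I).1 V = (2 : k) • (l (I 0)).1 ⟨V.1, le_iInf_iff.1 V.2 0⟩)
    (I : Fin 2 → ι) (V : {V : X.Opens // V ≤ ⨅ j, U (I j)}) (ha : V.1 ≤ U (I 0))
    (hb : V.1 ≤ U (I 1)) (G : Fin 2 → (algSheaf π).obj (op V.1)) :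
    cechPart β 1 1 I V G = 2 * (l (I 1)).1 ⟨V.1, hb⟩ G - 2 * (l (I 0)).1 ⟨V.1, ha⟩ G := by
  have e : ∀ s : Fin 1 → Fin 2, β.val (p := 0) (q := 1) I V G s =
      2 * (l (I (s 0))).1 ⟨V.1, le_iInf_iff.1 V.2 _⟩ G := fun s => by
    rw [CechCochain.val, hl, AlternatingMap.smul_apply, Algebra.smul_def, map_ofNat]
  refine (cechPart_succ β 0 1 I V G).trans ?_
  rw [Fin.sum_univ_two, e, e, Fin.val_zero, Fin.val_one, pow_zero, pow_one, one_mul, neg_one_mul,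
    ← sub_eq_add_neg]
  rfl

omit [IsLocalRing A] [IsArtinianRing A] in
theorem totalDiff_one_one
    (hl : ∀ (I : Fin 1 → ι) V, (β 0 1 I).1 V = (2 : k) • (l (I 0)).1 ⟨V.1, le_iInf_iff.1 V.2 0⟩)
    (hp : ∀ (I : Fin 2 → ι) V, (β 1 0 I).1 V = (-2 : k) • (p (I 0) (I 1)).1
      ⟨V.1, le_inf (le_iInf_iff.1 V.2 0) (le_iInf_iff.1 V.2 1)⟩)
    {I : Fin 2 → ι} {N : PolyVec (algSheaf π) 2 (⨅ j, U (I j))} (hN : α 1 1 I = (2 : k) • N)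
    {V : {V : X.Opens // V ≤ ⨅ j, U (I j)}} (G : Fin 2 → (algSheaf π).obj (op V.1)) :
    (α.toRaw + totalDiff Λ₀ 2 β) 1 1 I V G = 2 * (N.1 V G +
        (l (I 1)).1 ⟨V.1, le_iInf_iff.1 V.2 1⟩ G - (l (I 0)).1 ⟨V.1, le_iInf_iff.1 V.2 0⟩ G -
        schouten (p := 1) (q := 0) (Λ₀.1 ⟨V.1, le_top⟩) ((p (I 0) (I 1)).1
          ⟨V.1, le_inf (le_iInf_iff.1 V.2 0) (le_iInf_iff.1 V.2 1)⟩) G) := by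
  change (α 1 1 I).1 V G + (schouten (p := 1) (q := 0) (Λ₀.1 ⟨V.1, le_top⟩) ((β 1 0 I).1 V) G +
      (-1) ^ 2 * cechPart β 1 1 I V G) = _
  rw [cechPart_two_one hl I V (le_iInf_iff.1 V.2 0) (le_iInf_iff.1 V.2 1), hp, schouten_smul_right,
    Algebra.smul_def, map_neg, map_ofNat, polyVec_eq_two_mul hN]
  ring

omit [IsLocalRing A] [IsArtinianRing A] in
theorem totalDiff_two_zero
    (hp : ∀ (I : Fin 2 → ι) V, (β 1 0 I).1 V = (-2 : k) • (p (I 0) (I 1)).1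
      ⟨V.1, le_inf (le_iInf_iff.1 V.2 0) (le_iInf_iff.1 V.2 1)⟩)
    {I : Fin 3 → ι} {d : PolyVec (algSheaf π) 1 (⨅ j, U (I j))} (hd : α 2 0 I = (-2 : k) • d)
    {V : {V : X.Opens // V ≤ ⨅ j, U (I j)}} (ha : V.1 ≤ U (I 0)) (hb : V.1 ≤ U (I 1))
    (hc : V.1 ≤ U (I 2)) (G : Fin 1 → (algSheaf π).obj (op V.1)) :
    (α.toRaw + totalDiff Λ₀ 2 β) 2 0 I V G = -2 * (d.1 V G +
        (p (I 0) (I 1)).1 ⟨V.1, le_inf ha hb⟩ G + (p (I 1) (I 2)).1 ⟨V.1, le_inf hb hc⟩ G -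
        (p (I 0) (I 2)).1 ⟨V.1, le_inf ha hc⟩ G) := by
  change (α 2 0 I).1 V G + (0 + (-1) ^ 2 * cechPart β 2 0 I V G) = _
  have e : ∀ s : Fin 2 → Fin 3, β.val (p := 1) (q := 0) I V G s =
      -2 * (p (I (s 0)) (I (s 1))).1 ⟨V.1, le_inf (le_iInf_iff.1 V.2 _) (le_iInf_iff.1 V.2 _)⟩ G :=
    fun s => by
      rw [CechCochain.val, hp, AlternatingMap.smul_apply, Algebra.smul_def, map_neg, map_ofNat]
  rw [cechPart_succ, polyVec_eq_neg_two_mul hd, Fin.sum_univ_three, e, e, e,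
    show ((0 : Fin 3) : ℕ) = 0 from rfl, show ((1 : Fin 3) : ℕ) = 1 from rfl,
    show ((2 : Fin 3) : ℕ) = 2 from rfl]
  have e' : ∀ (j a b : Fin 3), j.succAbove 0 = a → j.succAbove 1 = b →
      (p (I (j.succAbove 0)) (I (j.succAbove 1))).1
        ⟨V.1, le_inf (le_iInf_iff.1 V.2 _) (le_iInf_iff.1 V.2 _)⟩ G =
      (p (I a) (I b)).1 ⟨V.1, le_inf (le_iInf_iff.1 V.2 _) (le_iInf_iff.1 V.2 _)⟩ G := by
    rintro j a b rfl rfl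
    rfl
  rw [e' 0 1 2 (by decide) (by decide), e' 1 0 2 (by decide) (by decide),
    e' 2 0 1 (by decide) (by decide)]
  ring

end Formulas

section Change

variable (h : SmallExtension ε φ t)
  {g : ∀ a, EquivFamily (baseChange A₁ (algSheaf π)) (baseChange A₁ (algSheaf π)) (U a)}
  {l : ∀ a, PolyVec (algSheaf π) 2 (U a)} {p : ∀ a b, PolyVec (algSheaf π) 1 (U a ⊓ U b)}
  (hL : L.IsChange L' t g l p) {α β : CechCochain (algSheaf π) U}
  (hα : L.IsObstructionCochain t α)
include hL h hα

theorem IsChange.bivector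
    (hl : ∀ (I : Fin 1 → ι) V, (β 0 1 I).1 V = (2 : k) • (l (I 0)).1 ⟨V.1, le_iInf_iff.1 V.2 0⟩)
    (hp : ∀ (I : Fin 2 → ι) V, (β 1 0 I).1 V = (-2 : k) • (p (I 0) (I 1)).1
      ⟨V.1, le_inf (le_iInf_iff.1 V.2 0) (le_iInf_iff.1 V.2 1)⟩)
    (I : Fin 2 → ι) (V : {V : X.Opens // V ≤ ⨅ j, U (I j)})
    (x y : A₁ ⊗[k] (algSheaf π).obj (op V.1)) :
      2 * (L'.aut (I 0) (I 1) V.1 (le_iInf_iff.1 V.2 0) (le_iInf_iff.1 V.2 1)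
          (L'.bivAt (I 1) V.1 (le_iInf_iff.1 V.2 1) ![x, y]) -
        L'.bivAt (I 0) V.1 (le_iInf_iff.1 V.2 0)
          ![L'.aut (I 0) (I 1) V.1 (le_iInf_iff.1 V.2 0) (le_iInf_iff.1 V.2 1) x,
            L'.aut (I 0) (I 1) V.1 (le_iInf_iff.1 V.2 0) (le_iInf_iff.1 V.2 1) y]) =
      t ⊗ₜ[k] (α.toRaw + totalDiff Λ₀ 2 β) 1 1 I V
        ![PoissonDeform.redk (ε.comp φ) _ x, PoissonDeform.redk (ε.comp φ) _ y] := by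
  obtain ⟨N, hN, hN'⟩ := hα.bivector I
  have h1 := hL.aut_bivAt h I V (le_iInf_iff.1 V.2 0) (le_iInf_iff.1 V.2 1) hN' x y
  refine (congrArg (2 * ·) (sub_eq_iff_eq_add'.2 h1)).trans ?_
  refine Eq.trans (b := tMul t _ ((α.toRaw + totalDiff Λ₀ 2 β) 1 1 I V
    ![PoissonDeform.redk (ε.comp φ) _ x, PoissonDeform.redk (ε.comp φ) _ y])) ?_ rfl
  rw [totalDiff_one_one hl hp hN]
  exact (two_mul _).trans ((map_add (tMul t _) _ _).symm.trans (congrArg (tMul t _) (two_mul _).symm))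

theorem IsChange.derivation
    (hp : ∀ (I : Fin 2 → ι) V, (β 1 0 I).1 V = (-2 : k) • (p (I 0) (I 1)).1
      ⟨V.1, le_inf (le_iInf_iff.1 V.2 0) (le_iInf_iff.1 V.2 1)⟩)
    (I : Fin 3 → ι) (V : {V : X.Opens // V ≤ ⨅ j, U (I j)})
    (x : A₁ ⊗[k] (algSheaf π).obj (op V.1)) :
      -2 * (L'.aut (I 0) (I 1) V.1 (le_iInf_iff.1 V.2 0) (le_iInf_iff.1 V.2 1)
          (L'.aut (I 1) (I 2) V.1 (le_iInf_iff.1 V.2 1) (le_iInf_iff.1 V.2 2) x) -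
        L'.aut (I 0) (I 2) V.1 (le_iInf_iff.1 V.2 0) (le_iInf_iff.1 V.2 2) x) =
        t ⊗ₜ[k] (α.toRaw + totalDiff Λ₀ 2 β) 2 0 I V ![PoissonDeform.redk (ε.comp φ) _ x] := by
  have ha := le_iInf_iff.1 V.2 0
  have hb := le_iInf_iff.1 V.2 1
  have hc := le_iInf_iff.1 V.2 2
  obtain ⟨d, hd, hd'⟩ := hα.derivation I
  obtain ⟨y, rfl⟩ := ((g (I 2)).app V.1 hc).surjective x
  rw [hL.redk]
  have e1 : L'.aut (I 0) (I 1) V.1 ha hb (L'.aut (I 1) (I 2) V.1 hb hc ((g (I 2)).app V.1 hc y)) =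
      L'.aut (I 0) (I 2) V.1 ha hc ((g (I 2)).app V.1 hc y) +
      tMul t _ (d.1 V ![PoissonDeform.redk (ε.comp φ) _ y] +
        (p (I 0) (I 1)).1 ⟨V.1, le_inf ha hb⟩ ![PoissonDeform.redk (ε.comp φ) _ y] +
        (p (I 1) (I 2)).1 ⟨V.1, le_inf hb hc⟩ ![PoissonDeform.redk (ε.comp φ) _ y] -
        (p (I 0) (I 2)).1 ⟨V.1, le_inf ha hc⟩ ![PoissonDeform.redk (ε.comp φ) _ y]) := by
    rw [hL.aut, hL.aut, map_add, aut_tmul h, hL.aut, hd' V y, map_add, hL.tmul h, L.redk_aut,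
      L.redk_aut, alternatingMap_eq_of_one (d.1 V) rfl, map_sub, map_add, map_add]
    change _ + t ⊗ₜ _ + t ⊗ₜ _ + t ⊗ₜ _ = _ + t ⊗ₜ _ + (t ⊗ₜ _ + t ⊗ₜ _ + t ⊗ₜ _ - t ⊗ₜ _)
    abel
  rw [e1, add_sub_cancel_left, neg_mul, two_mul, ← map_add, ← map_neg]
  refine Eq.trans ?_ (congrArg (tMul t _) (totalDiff_two_zero hp hd ha hb hc _).symm)
  congr 1
  ring

end Change

/-- Up to the factors in `α`, the defects change by `[Λ₀, l]`, by `l_b - l_a - [Λ₀, p_ab]` and by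
`p_ab + p_bc - p_ac`. With `β = (2 l, -2 p)` these assemble to the differential of `β`, in which `δ`
carries the sign `(-1) ^ 2`. -/
theorem IsChange.represents [CharZero k] (h : SmallExtension ε φ t)
    {g : ∀ a, EquivFamily (baseChange A₁ (algSheaf π)) (baseChange A₁ (algSheaf π)) (U a)}
    {l : ∀ a, PolyVec (algSheaf π) 2 (U a)} {p : ∀ a b, PolyVec (algSheaf π) 1 (U a ⊓ U b)}
    (hL : L.IsChange L' t g l p) {α β : CechCochain (algSheaf π) U}
    (hα : L.IsObstructionCochain t α)
    (hl : ∀ (I : Fin 1 → ι) V, (β 0 1 I).1 V = (2 : k) • (l (I 0)).1 ⟨V.1, le_iInf_iff.1 V.2 0⟩)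
    (hp : ∀ (I : Fin 2 → ι) V, (β 1 0 I).1 V = (-2 : k) • (p (I 0) (I 1)).1
      ⟨V.1, le_inf (le_iInf_iff.1 V.2 0) (le_iInf_iff.1 V.2 1)⟩) :
    L'.Represents t (α.toRaw + totalDiff Λ₀ 2 β) :=
  ⟨hL.trivector h hα hl, hL.bivector h hα hl hp, hL.derivation h hα hp⟩

end LiftChoice

end Change


/-! ### Independence of the choices up to coboundaries. -/

section Independence

variable {k A A₁ : Type u} [Field k] [CommRing A] [Algebra k A] [CommRing A₁] [Algebra k A₁]
  {X : Scheme.{u}} {π : X ⟶ Spec (.of k)} {Λ₀ : PolyVec (algSheaf π) 2 ⊤} {ε : A →ₐ[k] k}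
  [IsLocalRing A] [IsArtinianRing A]
  {ξ : PoissonDeformation π Λ₀ ε} {ι : Type u} {U : ι → X.Opens} {φ : A₁ →ₐ[k] A} {t : A₁}
  {τ τ' : Trivialization ξ U} {L : LiftChoice τ φ} {L' : LiftChoice τ' φ}

namespace LiftChoice

/-- Over `A` the passage from `τ` to `τ'` carries the automorphisms and bivectors of one
trivialization to those of the other. After lifting this passage to `A₁` over each affine member,
the two systems of choices agree modulo `t`, and their differences define `l` and `p`. -/
theorem exists_isChange [IsLocalRing A₁] [IsArtinianRing A₁] [Smooth π]
    (h : SmallExtension ε φ t) (hU : ∀ a, IsAffineOpen (U a)) (L : LiftChoice τ φ)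
    (L' : LiftChoice τ' φ) : ∃ g l p, L.IsChange L' t g l p := by
  choose g hg using fun a => exists_lift_equivFamily h.surjective (hU a)
    (τ'.transition τ a a le_rfl le_rfl) (Trivialization.redk_transition _ _ _ _ _ _)
  have hgk : ∀ a V (hV : V ≤ U a) (x : A₁ ⊗[k] (algSheaf π).obj (op V)),
      redk (ε.comp φ) _ ((g a).app V hV x) = redk (ε.comp φ) _ x := by
    intro a V hV x
    rw [redk_comp, hg, Trivialization.redk_transition, redk_comp]
  have hgs : ∀ a V (hV : V ≤ U a) (x : A₁ ⊗[k] (algSheaf π).obj (op V)),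
      ((τ.onFibre a).app V hV).symm (red φ _ (((g a).app V hV).symm x)) =
        ((τ'.onFibre a).app V hV).symm (red φ _ x) := by
    intro a V hV x
    have h1 := hg a V hV (((g a).app V hV).symm x)
    rw [AlgEquiv.apply_symm_apply, Trivialization.transition_app] at h1
    rw [h1, AlgEquiv.symm_apply_apply]
  choose l hl using fun a => h.exists_polyVec_eq_tmul (L'.biv a - conjPolyVec (L.biv a) (g a))
    fun V v => by
      change red φ _ (L'.bivAt a V.1 V.2 v - (g a).app V.1 V.2 (L.bivAt a V.1 V.2 fun i =>
        ((g a).app V.1 V.2).symm (v i))) = 0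
      rw [map_sub, hg, L'.red_biv, L.red_biv, τ.bivector_apply, τ'.bivector_apply,
        Trivialization.transition_app, AlgEquiv.symm_apply_apply, sub_eq_zero]
      simp only [hgs]
  choose p hp using fun a b => h.exists_derivation (U := U a ⊓ U b)
    (((g a).symm.restrict inf_le_left).trans ((L.autFamily a b).symm.trans
      (((g b).restrict inf_le_right).trans (L'.autFamily a b)))) fun V hV x => by
      obtain ⟨x, rfl⟩ := ((g a).app V (hV.trans inf_le_left)).surjective x
      obtain ⟨x, rfl⟩ := (L.aut a b V (hV.trans inf_le_left) (hV.trans inf_le_right)).surjective x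
      change red φ _ (L'.aut a b V _ _ ((g b).app V _ ((L.aut a b V _ _).symm (((g a).app V _).symm
        ((g a).app V (hV.trans inf_le_left)
          (L.aut a b V (hV.trans inf_le_left) (hV.trans inf_le_right) x)))))) = _
      rw [AlgEquiv.symm_apply_apply, AlgEquiv.symm_apply_apply, L'.red_aut, hg, hg, L.red_aut,
        Trivialization.transition_app, Trivialization.transition_app,
        Trivialization.transition_app, Trivialization.transition_app,
        AlgEquiv.symm_apply_apply, AlgEquiv.symm_apply_apply]
  refine ⟨g, l, p, hgk, fun a V hV x y => ?_, fun a b V ha hb x => ?_⟩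
  · have h1 := hl a ⟨V, hV⟩ ![(g a).app V hV x, (g a).app V hV y]
    change L'.bivAt a V hV _ - (g a).app V hV (L.bivAt a V hV fun i =>
      ((g a).app V hV).symm (![(g a).app V hV x, (g a).app V hV y] i)) = _ at h1
    rw [sub_eq_iff_eq_add', alternatingMap_eq_of_two (L.bivAt a V hV) (a := x) (b := y)
      (AlgEquiv.symm_apply_apply _ _) (AlgEquiv.symm_apply_apply _ _),
      alternatingMap_eq_of_two ((l a).1 ⟨V, hV⟩) (hgk a V hV x) (hgk a V hV y)] at h1
    exact h1
  · have h1 := hp a b V (le_inf ha hb) ((g a).app V ha (L.aut a b V ha hb x))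
    change L'.aut a b V ha hb ((g b).app V hb ((L.aut a b V ha hb).symm (((g a).app V ha).symm _)))
      = _ at h1
    rw [AlgEquiv.symm_apply_apply, AlgEquiv.symm_apply_apply] at h1
    refine h1.trans (congrArg (fun z => _ + t ⊗ₜ[k] z) ?_)
    refine alternatingMap_eq_of_one _ ?_
    change redk (ε.comp φ) _ _ = _
    rw [hgk, L.redk_aut]

/-- The cochain by which a change of the choices changes the obstruction cochain. -/
def changeCochain (l : ∀ a, PolyVec (algSheaf π) 2 (U a))
    (p : ∀ a b, PolyVec (algSheaf π) 1 (U a ⊓ U b)) : CechCochain (algSheaf π) U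
  | 0, 1 => fun I => (2 : k) • resPolyVec (l (I 0)) (iInf_le _ 0)
  | 1, 0 => fun I => (-2 : k) • resPolyVec (p (I 0) (I 1)) (le_inf (iInf_le _ 0) (iInf_le _ 1))
  | _, _ => 0

omit [IsLocalRing A] [IsArtinianRing A] in
theorem changeCochain_mem (l : ∀ a, PolyVec (algSheaf π) 2 (U a))
    (p : ∀ a b, PolyVec (algSheaf π) 1 (U a ⊓ U b)) :
    changeCochain l p ∈ homogeneous (algSheaf π) U 2 1 := by
  rintro (_ | _ | p) (_ | _ | q) hpq <;> first | rfl | omega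

/-- The second cochain and the first plus the differential satisfy the equations of the same
choices, so they agree in total degree `2`; in the other degrees everything is zero. -/
theorem sub_mem_coboundaries [CharZero k] [IsLocalRing A₁] [IsArtinianRing A₁] [Smooth π]
    (h : SmallExtension ε φ t) (hU : ∀ a, IsAffineOpen (U a)) {α α' : CechCochain (algSheaf π) U}
    (hα : L.IsObstructionCochain t α) (hα' : L'.IsObstructionCochain t α')
    (hm : α ∈ homogeneous (algSheaf π) U 2 0) (hm' : α' ∈ homogeneous (algSheaf π) U 2 0) :
    α' - α ∈ coboundaries Λ₀ U 2 := by
  obtain ⟨g, l, p, hL⟩ := exists_isChange h hU L L'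
  refine ⟨changeCochain l p, changeCochain_mem l p, ?_⟩
  have h1 := hL.represents h hα (β := changeCochain l p) (fun I V => rfl) (fun I V => rfl)
  have h2 := (represents_iff α').2 hα'
  rw [map_sub, eq_sub_iff_add_eq']
  funext r s
  by_cases hrs : r + s = 2
  · exact h1.congr h h2 r s hrs
  · funext I V G
    change (α r s I).1 V G + totalDiff Λ₀ 2 (changeCochain l p) r s I V G = (α' r s I).1 V G
    rw [totalDiff_apply_eq_zero Λ₀ (changeCochain_mem l p) (by omega), hm r s (by omega),
      hm' r s (by omega)]
    exact add_zero _

theorem IsObstructionCochain.eq [CharZero k] (h : SmallExtension ε φ t)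
    {α α' : CechCochain (algSheaf π) U}
    (hα : L.IsObstructionCochain t α) (hα' : L.IsObstructionCochain t α')
    (hm : α ∈ homogeneous (algSheaf π) U 2 0) (hm' : α' ∈ homogeneous (algSheaf π) U 2 0) :
    α = α' := by
  have h1 := (represents_iff α).2 hα
  have h2 := (represents_iff α').2 hα'
  funext r s
  by_cases hrs : r + s = 2
  · funext I
    refine Subtype.ext (funext fun V => AlternatingMap.ext fun G => ?_)
    exact congrFun (congrFun (congrFun (h1.congr h h2 r s hrs) I) V) G
  · rw [hm r s (by omega), hm' r s (by omega)]

end LiftChoice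

/-- The pullback of trivializations to a subfamily. -/
def Trivialization.reindex {κ : Type u} (τ : Trivialization ξ U) (g : κ → ι) :
    Trivialization ξ fun a => U (g a) :=
  ⟨fun a => τ.iso (g a), fun a => τ.iso_map (g a), fun a => τ.iso_incl (g a)⟩

/-- The pullback of choices to a subfamily. -/
def LiftChoice.reindex {κ : Type u} (L : LiftChoice τ φ) (g : κ → ι) :
    LiftChoice (τ.reindex g) φ :=
  ⟨fun a b => L.aut (g a) (g b), fun a b => L.aut_map (g a) (g b),
    fun a b => L.aut_red (g a) (g b), fun a => L.biv (g a), fun a => L.biv_red (g a)⟩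

omit [IsLocalRing A] [IsArtinianRing A] in
theorem LiftChoice.IsObstructionCochain.reindex {κ : Type u} {α : CechCochain (algSheaf π) U}
    (hα : L.IsObstructionCochain t α) (g : κ → ι) :
    (L.reindex g).IsObstructionCochain t (CechCochain.reindex U g α) :=
  ⟨fun I => hα.trivector fun j => g (I j), fun I => hα.bivector fun j => g (I j),
    fun I => hα.derivation fun j => g (I j)⟩

end Independence

/-! ### The obstruction class. -/

section Class

theorem CechHyper.restrict_id {T : Type u} [TopologicalSpace T] {R : Type u} [CommRing R]
    {F : (Opens T)ᵒᵖ ⥤ CommAlgCat.{u} R} {ι : Type u} (Λ : PolyVec F 2 ⊤) (U : ι → Opens T) (n : ℕ)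
    (o : CechHyper Λ U n) : CechHyper.restrict Λ U id n o = o := by
  induction o using Submodule.Quotient.induction_on with
  | _ c => rfl

variable {k A A₁ : Type u} [Field k] [CharZero k] [CommRing A] [Algebra k A] [CommRing A₁]
  [Algebra k A₁]
  {X : Scheme.{u}} {π : X ⟶ Spec (.of k)} {Λ₀ : PolyVec (algSheaf π) 2 ⊤} {ε : A →ₐ[k] k}
  [IsLocalRing A] [IsArtinianRing A] [IsLocalRing A₁] [IsArtinianRing A₁]
  {ξ : PoissonDeformation π Λ₀ ε} {φ : A₁ →ₐ[k] A} {t : A₁} [Smooth π] [IsSeparated π]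

/-- Every affine covering is indexed into the family of all affine opens, so the choices `L`
restrict to it, and their restricted cochain differs from that of any other choices by a coboundary.
-/
theorem PoissonDeformation.isObstructionClass_of_cochain (h : SmallExtension ε φ t)
    {τ : Trivialization ξ fun V : X.affineOpens => V.1} (L : LiftChoice τ φ)
    (α : cocycles Λ₀ (fun V : X.affineOpens => (V.1 : Opens X)) 2)
    (hα : L.IsObstructionCochain t α.1) :
    ξ.IsObstructionClass φ t (Submodule.Quotient.mk α) := by
  intro ι U hU
  refine ⟨nonempty_trivialization ξ fun a => (U a).2, fun τ' =>
    ⟨LiftChoice.nonempty τ' h.surjective fun a => (U a).2, fun L' => ?_⟩⟩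
  obtain ⟨α', hα', hm⟩ := L'.exists_isObstructionCochain h
  refine ⟨⟨α', LiftChoice.mem_cocycles h hα' hm⟩, hα', ?_⟩
  refine (Submodule.Quotient.eq _).2 ?_
  exact LiftChoice.sub_mem_coboundaries h (fun a => (U a).2) (hα.reindex U) hα'
    (reindex_homogeneous _ U 2 0 _ α.2.1) hm

theorem PoissonDeformation.existsUnique_isObstructionClass (h : SmallExtension ε φ t) :
    ∃! o : HyperCoh π Λ₀ 2, ξ.IsObstructionClass φ t o := by
  obtain ⟨τ⟩ : Nonempty (Trivialization ξ fun V : X.affineOpens => V.1) :=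
    nonempty_trivialization ξ fun a => a.2
  obtain ⟨L⟩ := LiftChoice.nonempty τ h.surjective fun a => a.2
  obtain ⟨α, hα, hm⟩ := L.exists_isObstructionCochain h
  refine ⟨_, isObstructionClass_of_cochain h L ⟨α, LiftChoice.mem_cocycles h hα hm⟩ hα, ?_⟩
  intro o ho
  -- For uniqueness, the defining property is applied to the covering by all affine opens with the
  -- same `τ` and `L`, whose cochain is unique.
  obtain ⟨α', hα', e⟩ := ((ho X.affineOpens id (iSup_affineOpens_eq_top X)).2 τ).2 L
  rw [← CechHyper.restrict_id Λ₀ _ 2 o]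
  refine e.symm.trans (congrArg _ (Subtype.ext ?_))
  exact hα'.eq h hα α'.2.1 hm

end Class


/-! ### Restriction of functions from a deformation over `A₁` to one over `A`. -/

section FibreMap

theorem rmap_pullSec_comp {R R' R'' : Type u} [CommRing R] [CommRing R'] [CommRing R'']
    {Y Z Z' : Scheme.{u}} (f : Y ⟶ Spec (.of R)) (f' : Z ⟶ Spec (.of R')) (f'' : Z' ⟶ Spec (.of R''))
    {i : Y ⟶ Z} {g : Z ⟶ Z'} {j : Y ⟶ Z'} (e : i ≫ g = j) (W : Z'.Opens)
    (x : (algSheaf f'').obj (op W)) {V : Y.Opens} (h : V ≤ j ⁻¹ᵁ W) (h' : V ≤ i ⁻¹ᵁ g ⁻¹ᵁ W) :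
    rmap (algSheaf f) h (pullSec f f'' j W x) =
      rmap (algSheaf f) h' (pullSec f f' i (g ⁻¹ᵁ W) (pullSec f' f'' g W x)) := by
  subst e
  refine congrArg (rmap (algSheaf f) h) ?_
  exact congr($(Scheme.Hom.comp_app i g W).hom x)

variable {k A A₁ : Type u} [Field k] [CommRing A] [Algebra k A] [CommRing A₁] [Algebra k A₁]
  {X : Scheme.{u}} {π : X ⟶ Spec (.of k)} {Λ₀ Λ₁ : PolyVec (algSheaf π) 2 ⊤} {ε : A →ₐ[k] k}
  {φ : A₁ →ₐ[k] A}

/-- A homomorphism on which `A₁` acts through `φ` factors through the reduction; the factor is built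
from its restriction to `B`. -/
theorem exists_descend {B C : Type u} [CommRing B] [Algebra k B] [CommRing C] [Algebra A C]
    (h : A₁ ⊗[k] B →+* C) (hh : ∀ a, h (a ⊗ₜ 1) = algebraMap A C (φ a)) :
    ∃ s : A ⊗[k] B →ₐ[A] C, ∀ x,
      s (Algebra.TensorProduct.map φ (AlgHom.id k B) x) = h x := by
  let _ : Algebra k C := ((algebraMap A C).comp (algebraMap k A)).toAlgebra
  have : IsScalarTower k A C := IsScalarTower.of_algebraMap_eq fun _ => rfl
  let l : B →ₐ[k] C :=
    { h.comp Algebra.TensorProduct.includeRight.toRingHom with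
      commutes' := fun r => by
        change h (1 ⊗ₜ algebraMap k B r) = algebraMap A C (algebraMap k A r)
        rw [← AlgHom.commutes φ, ← hh, Algebra.algebraMap_eq_smul_one, TensorProduct.tmul_smul,
          TensorProduct.smul_tmul', ← Algebra.algebraMap_eq_smul_one] }
  refine ⟨Algebra.TensorProduct.lift (Algebra.ofId A C) l fun _ _ => Commute.all _ _, fun x => ?_⟩
  induction x with
  | zero => simp
  | add x y hx hy => simp only [map_add, hx, hy]
  | tmul a b =>
    rw [Algebra.TensorProduct.map_tmul, Algebra.TensorProduct.lift_tmul, Algebra.ofId_apply, ← hh]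
    change h _ * h (1 ⊗ₜ b) = _
    rw [← map_mul, Algebra.TensorProduct.tmul_mul_tmul, mul_one, one_mul]

variable [IsLocalRing A] [IsArtinianRing A] [IsLocalRing A₁] [IsArtinianRing A₁]
  {ξ : PoissonDeformation π Λ₀ ε} {η : PoissonDeformation π Λ₁ (ε.comp φ)}
  (g : ξ.space ⟶ η.space)

omit [IsLocalRing A₁] [IsArtinianRing A₁] in
theorem upOpen_eq_preimage (hi : ξ.incl ≫ g = η.incl) (V : X.Opens) :
    upOpen ξ.incl V = g ⁻¹ᵁ upOpen η.incl V := by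
  rw [← upOpen_preimage ξ.incl (g ⁻¹ᵁ upOpen η.incl V), ← Scheme.Hom.comp_preimage, hi,
    preimage_upOpen]

/-- The pullback of functions along a morphism of deformations. -/
def fibreMap (hi : ξ.incl ≫ g = η.incl) (V : X.Opens) : η.sheaf.obj (op V) →+* ξ.sheaf.obj (op V) :=
  (rmap (algSheaf ξ.proj) (upOpen_eq_preimage g hi V).le).toRingHom.comp
    (pullSec ξ.proj η.proj g (upOpen η.incl V))

variable {g} (hi : ξ.incl ≫ g = η.incl)

theorem fibreMap_apply (V : X.Opens) (x : η.sheaf.obj (op V)) : fibreMap g hi V x =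
    rmap (algSheaf ξ.proj) (upOpen_eq_preimage g hi V).le (pullSec ξ.proj η.proj g _ x) := rfl

theorem fibreMap_rmap {V W : X.Opens} (h : W ≤ V) (x : η.sheaf.obj (op V)) :
    fibreMap g hi W (rmap η.sheaf h x) = rmap ξ.sheaf h (fibreMap g hi V x) := by
  rw [fibreMap_apply, fibreMap_apply, PoissonDeformation.rmap_sheaf, pullSec_rmap, rmap_rmap,
    PoissonDeformation.rmap_sheaf, rmap_rmap]

theorem fibreMap_algebraMap (hg : g ≫ η.proj = ξ.proj ≫ Spec.map (CommRingCat.ofHom φ.toRingHom))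
    (V : X.Opens) (a : A₁) :
    fibreMap g hi V (algebraMap A₁ (η.sheaf.obj (op V)) a) = algebraMap A _ (φ a) := by
  rw [fibreMap_apply, pullSec_algebraMap _ _ _ _ hg, AlgHom.commutes]
  rfl

theorem rho_fibreMap (V : X.Opens) (x : η.sheaf.obj (op V)) :
    ξ.rho V (fibreMap g hi V x) = η.rho V x := by
  rw [PoissonDeformation.rho_apply, fibreMap_apply, pullSec_rmap, rmap_rmap]
  exact (rmap_pullSec_comp π ξ.proj η.proj hi _ x _ _).symm

theorem fibreMap_biv (hb : PreservesBivector ξ.proj η.proj g ξ.biv η.biv) (V : X.Opens)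
    (v : Fin 2 → η.sheaf.obj (op V)) :
    fibreMap g hi V (η.biv.1 ⟨upOpen η.incl V, le_top⟩ v) =
      ξ.biv.1 ⟨upOpen ξ.incl V, le_top⟩ fun i => fibreMap g hi V (v i) := by
  rw [fibreMap_apply, hb, polyVec_rmap ξ.biv le_top]
  rfl

/-- Local trivializations of a lifting induce local trivializations of the deformation it lifts, the
identity on the closed fibre being preserved. -/
theorem exists_section_descend
    (hg : g ≫ η.proj = ξ.proj ≫ Spec.map (CommRingCat.ofHom φ.toRingHom))
    (hφ : Function.Surjective φ) {U : X.Opens}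
    {s : AlgFamily (baseChange A₁ (algSheaf π)) η.sheaf U} (hs : η.IsSection s) :
    ∃ s' : AlgFamily (baseChange A (algSheaf π)) ξ.sheaf U, ξ.IsSection s' ∧
      ∀ V hV (x : A₁ ⊗[k] (algSheaf π).obj (op V)),
        s'.app V hV (red φ _ x) = fibreMap g hi V (s.app V hV x) := by
  choose s' hs' using fun (V : X.Opens) (hV : V ≤ U) => exists_descend (φ := φ)
    (B := (algSheaf π).obj (op V)) (C := ξ.sheaf.obj (op V))
    ((fibreMap g hi V).comp (s.app V hV).toRingHom) fun a => by
      refine Eq.trans ?_ (fibreMap_algebraMap hi hg V a)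
      exact congrArg (fibreMap g hi V) ((s.app V hV).commutes a)
  refine ⟨⟨s', fun V W h hW x => ?_⟩, ⟨fun V h x => ?_⟩, hs'⟩
  · obtain ⟨x, rfl⟩ := red_surjective hφ _ x
    rw [← red_rmap]
    refine (hs' W _ _).trans ((Eq.trans ?_ (fibreMap_rmap hi hW _)).trans
      (congrArg (rmap ξ.sheaf hW) (hs' V _ _).symm))
    exact congrArg (fibreMap g hi W) (s.naturality V W h hW x)
  · obtain ⟨x, rfl⟩ := red_surjective hφ _ x
    refine (congrArg (ξ.rho V) (hs' V h x)).trans ((rho_fibreMap hi V _).trans ?_)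
    rw [← redk_comp]
    exact hs.rho_app V h x

theorem onFibre_trivializationOfSection {ι : Type u} {U : ι → X.Opens}
    {s : ∀ a, AlgFamily (baseChange A (algSheaf π)) ξ.sheaf (U a)}
    (hs : ∀ a, ξ.IsSection (s a)) (a : ι) (V : X.Opens) (h : V ≤ U a)
    (x : A ⊗[k] (algSheaf π).obj (op V)) :
    ((PoissonDeformation.trivializationOfSection hs).onFibre a).app V h ((s a).app V h x) = x := by
  rw [Trivialization.onFibre_app]
  have e : (PoissonDeformation.trivializationOfSection hs).iso a (upOpen ξ.incl V)
      ((preimage_upOpen ξ.incl V).le.trans h) ((s a).app V h x) =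
        rmap (baseChange A (algSheaf π)) (preimage_upOpen ξ.incl V).le x := by
    refine (AlgEquiv.symm_apply_eq _).2 ?_
    have hle : ξ.incl ⁻¹ᵁ upOpen ξ.incl V ≤ V := (preimage_upOpen ξ.incl V).le
    refine Eq.trans ?_ (congrArg (rmap (algSheaf ξ.proj) (upOpen_preimage ξ.incl _).ge)
      ((s a).naturality V _ h hle x)).symm
    rw [PoissonDeformation.rmap_sheaf, rmap_rmap]
    · exact (rmap_self ξ.sheaf le_rfl _).symm
    · exact (preimage_upOpen ξ.incl V).ge
  rw [e, rmap_rmap, rmap_self]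

end FibreMap

/-! ### A lifting makes the class vanish. -/

section Lifting

variable {k A A₁ : Type u} [Field k] [CharZero k] [CommRing A] [Algebra k A] [CommRing A₁]
  [Algebra k A₁]
  {X : Scheme.{u}} {π : X ⟶ Spec (.of k)} {Λ₀ : PolyVec (algSheaf π) 2 ⊤} {ε : A →ₐ[k] k}
  [IsLocalRing A] [IsArtinianRing A] [IsLocalRing A₁] [IsArtinianRing A₁]
  {ξ : PoissonDeformation π Λ₀ ε} {φ : A₁ →ₐ[k] A} {t : A₁}

/-- Take local trivializations `e_a` of the lifting, the trivializations of `ξ` they induce, the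
automorphisms `e_a⁻¹ e_b`, and the bivectors obtained by pulling back the Poisson structure of the
lifting. These data come from a global object, so they satisfy the Jacobi identity, the
compatibility and the cocycle rule exactly. -/
theorem PoissonDeformation.HasLifting.exists_isObstructionCochain_zero [Smooth π]
    (hξ : ξ.HasLifting φ) (hφ : Function.Surjective φ) {ι : Type u} {U : ι → X.Opens}
    (hU : ∀ a, IsAffineOpen (U a)) :
    ∃ (τ : Trivialization ξ U) (L : LiftChoice τ φ), L.IsObstructionCochain t 0 := by
  obtain ⟨η, g, hg, hi, hb⟩ := hξ
  choose s hs using fun a => η.exists_isSection (hU a)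
  choose s' hs' hss using fun a => exists_section_descend hi hg.w hφ (hs a)
  let e : ∀ a, EquivFamily (baseChange A₁ (algSheaf π)) η.sheaf (U a) := fun a =>
    EquivFamily.ofBijective (s a) (hs a).bijective
  let τ : Trivialization ξ U := trivializationOfSection hs'
  have hτ : ∀ a V h (x : A₁ ⊗[k] (algSheaf π).obj (op V)),
      (τ.onFibre a).app V h (fibreMap g hi V ((e a).app V h x)) = red φ _ x := by
    intro a V h x
    rw [← onFibre_trivializationOfSection hs' a V h (red φ _ x)]
    exact congrArg ((τ.onFibre a).app V h) (hss a V h x).symm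
  have hτ' : ∀ a V h (x : A₁ ⊗[k] (algSheaf π).obj (op V)),
      ((τ.onFibre a).app V h).symm (red φ _ x) = fibreMap g hi V ((e a).app V h x) := by
    intro a V h x
    rw [← hτ a V h x, AlgEquiv.symm_apply_apply]
  let L : LiftChoice τ φ := LiftChoice.ofFibre
    (fun a b => ((e b).restrict inf_le_right).trans ((e a).restrict inf_le_left).symm)
    (fun a b V h x => by
      rw [Trivialization.transition_app, hτ' b]
      change red φ _ (((e a).app V (h.trans inf_le_left)).symm
        ((e b).app V (h.trans inf_le_right) x)) = _
      rw [← hτ a V (h.trans inf_le_left), AlgEquiv.apply_symm_apply])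
    (fun a => conjPolyVec (η.bivOnFibre (U a)) (e a).symm)
    (fun a V v => by
      rw [τ.bivector_apply]
      change red φ _ (((e a).app V.1 V.2).symm (η.biv.1 ⟨upOpen η.incl V.1, le_top⟩
        fun i => (e a).app V.1 V.2 (v i))) = _
      rw [← hτ a V.1 V.2, AlgEquiv.apply_symm_apply, fibreMap_biv hi hb]
      simp only [hτ'])
  refine ⟨τ, L, ?_⟩
  rw [← LiftChoice.represents_iff]
  have h0 : ∀ {V : X.Opens}, t ⊗ₜ[k] (0 : (algSheaf π).obj (op V)) = 0 :=
    fun {V} => TensorProduct.tmul_zero _ _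
  refine ⟨fun I V G => Eq.trans ?_ h0.symm, fun I V x y => Eq.trans ?_ h0.symm,
    fun I V x => Eq.trans ?_ h0.symm⟩
  · have ha := le_iInf_iff.1 V.2 0
    have h1 := map_halfSquare ((e (I 0)).app V.1 ha).symm.toAlgHom.toRingHom
      (η.biv.1 ⟨upOpen η.incl V.1, le_top⟩) (L.bivAt (I 0) V.1 ha) (fun v => by
        change ((e (I 0)).app V.1 ha).symm _ = ((e (I 0)).app V.1 ha).symm
          (η.biv.1 ⟨upOpen η.incl V.1, le_top⟩ fun i => (e (I 0)).app V.1 ha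
            (((e (I 0)).app V.1 ha).symm (v i)))
        simp only [AlgEquiv.apply_symm_apply]) fun i => (e (I 0)).app V.1 ha (G i)
    have h2 := η.isPoisson ⟨upOpen η.incl V.1, le_top⟩ fun i => (e (I 0)).app V.1 ha (G i)
    have h3 := (schouten_self _ _).symm.trans h2
    have h4 : halfSquare (L.bivAt (I 0) V.1 ha) G = ((e (I 0)).app V.1 ha).symm
        (halfSquare (η.biv.1 ⟨upOpen η.incl V.1, le_top⟩) fun i => (e (I 0)).app V.1 ha (G i)) := by
      refine Eq.trans (congrArg _ (funext fun i => ?_)) h1.symm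
      exact (AlgEquiv.symm_apply_apply ((e (I 0)).app V.1 ha) (G i)).symm
    rw [schouten_self, h4]
    refine Eq.trans ?_ ((congrArg ((e (I 0)).app V.1 ha).symm h3).trans (map_zero _))
    exact ((map_mul ((e (I 0)).app V.1 ha).symm _ _).trans (congrArg (· * _) (map_ofNat _ 2))).symm
  · have ha := le_iInf_iff.1 V.2 0
    have hb := le_iInf_iff.1 V.2 1
    have h1 : ∀ (r : Fin 2) (hr : V.1 ≤ U (I r)) (x y : A₁ ⊗[k] (algSheaf π).obj (op V.1)),
        (e (I r)).app V.1 hr (L.bivAt (I r) V.1 hr ![x, y]) =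
          η.biv.1 ⟨upOpen η.incl V.1, le_top⟩ ![(e (I r)).app V.1 hr x, (e (I r)).app V.1 hr y] := by
      intro r hr x y
      refine (AlgEquiv.apply_symm_apply ((e (I r)).app V.1 hr) _).trans ?_
      exact alternatingMap_eq_of_two (η.biv.1 ⟨upOpen η.incl V.1, le_top⟩) rfl rfl
    have h2 : ∀ z, L.aut (I 0) (I 1) V.1 ha hb z =
        ((e (I 0)).app V.1 ha).symm ((e (I 1)).app V.1 hb z) := fun _ => rfl
    rw [mul_eq_zero_of_right]
    rw [sub_eq_zero, h2, AlgEquiv.symm_apply_eq, h1, h1, h2, h2, AlgEquiv.apply_symm_apply,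
      AlgEquiv.apply_symm_apply]
  · have ha := le_iInf_iff.1 V.2 0
    have hb := le_iInf_iff.1 V.2 1
    have hc := le_iInf_iff.1 V.2 2
    change -2 * (((e (I 0)).app V.1 ha).symm ((e (I 1)).app V.1 hb
      (((e (I 1)).app V.1 hb).symm ((e (I 2)).app V.1 hc x))) -
        ((e (I 0)).app V.1 ha).symm ((e (I 2)).app V.1 hc x)) = 0
    rw [AlgEquiv.apply_symm_apply, sub_self, mul_zero]

theorem PoissonDeformation.IsObstructionClass.eq_zero_of_hasLifting [Smooth π] [IsSeparated π]
    (h : SmallExtension ε φ t) {o : HyperCoh π Λ₀ 2} (ho : ξ.IsObstructionClass φ t o)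
    (hξ : ξ.HasLifting φ) : o = 0 := by
  obtain ⟨τ, L, hL⟩ := hξ.exists_isObstructionCochain_zero (t := t) h.surjective
    (U := fun V : X.affineOpens => V.1) fun a => a.2
  exact (existsUnique_isObstructionClass h).unique ho (isObstructionClass_of_cochain h L 0 hL)

end Lifting


/-! ### Gluing affine thickenings of a scheme. -/

section Thickening

/-- Compatible surjections with nilpotent kernels onto the rings of functions on the affine open
subsets of a scheme. -/
structure ThickeningData (Z : Scheme.{u}) where
  /-- the rings -/
  ring : Z.affineOpens → CommRingCat.{u}
  /-- the restriction maps -/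
  res : ∀ {V W : Z.affineOpens}, V ≤ W → (ring W ⟶ ring V)
  res_self : ∀ V, res (le_refl V) = 𝟙 _
  res_res : ∀ {V W W' : Z.affineOpens} (h : V ≤ W) (h' : W ≤ W'),
    res h' ≫ res h = res (h.trans h')
  /-- the reductions -/
  quot : ∀ V, ring V ⟶ Γ(Z, V.1)
  res_quot : ∀ {V W : Z.affineOpens} (h : V ≤ W),
    res h ≫ quot V = quot W ≫ Z.presheaf.map (homOfLE h : V.1 ⟶ W.1).op
  surjective : ∀ V, Function.Surjective (quot V).hom
  isNilpotent : ∀ V x, (quot V).hom x = 0 → IsNilpotent x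
  isOpenImmersion : ∀ {V W : Z.affineOpens} (h : V ≤ W), IsOpenImmersion (Spec.map (res h))

namespace ThickeningData

variable {Z : Scheme.{u}} (D : ThickeningData Z)

/-- The diagram of affine schemes. -/
def diagram : Z.affineOpens ⥤ Scheme.{u} where
  obj V := Spec (D.ring V)
  map f := Spec.map (D.res f.le)
  map_id V := by rw [D.res_self, Spec.map_id]
  map_comp f g := by rw [← Spec.map_comp, D.res_res]

instance {V W : Z.affineOpens} (f : V ⟶ W) : IsOpenImmersion (D.diagram.map f) :=
  D.isOpenImmersion f.le

/-- The closed immersions of the affine open subsets into their thickenings. -/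
def toThickening (V : Z.affineOpens) : V.1.toScheme ⟶ Spec (D.ring V) :=
  V.1.toSpecΓ ≫ Spec.map (D.quot V)

instance (V : Z.affineOpens) : IsIso V.1.toSpecΓ := by
  have := V.2.isoSpec_hom
  rw [← this]
  infer_instance


instance (V : Z.affineOpens) : IsClosedImmersion (D.toThickening V) := by
  have := IsClosedImmersion.spec_of_surjective (D.quot V) (D.surjective V)
  unfold toThickening
  infer_instance

/-- A nilpotent element lies in every prime, so every prime of the thickened ring contains the
kernel of the reduction. -/
theorem toThickening_surjective (V : Z.affineOpens) : Function.Surjective (D.toThickening V) := by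
  have h1 : Function.Surjective (Spec.map (D.quot V)) := by
    intro p
    have h2 := range_comap_of_surjective _ (D.quot V).hom (D.surjective V)
    have h3 : p ∈ Set.range (PrimeSpectrum.comap (D.quot V).hom) := by
      rw [h2]
      intro x hx
      obtain ⟨n, hn⟩ := D.isNilpotent V x hx
      exact p.2.mem_of_pow_mem n (hn ▸ p.asIdeal.zero_mem)
    exact h3
  intro p
  obtain ⟨x, hx⟩ := h1 p
  obtain ⟨y, rfl⟩ := (inferInstance : Surjective V.1.toSpecΓ).surj x
  exact ⟨y, hx⟩

theorem homOfLE_toThickening {V W : Z.affineOpens} (h : V ≤ W) :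
    Z.homOfLE h ≫ D.toThickening W = D.toThickening V ≫ Spec.map (D.res h) := by
  rw [toThickening, toThickening, Category.assoc, ← Spec.map_comp, D.res_quot, Spec.map_comp,
    Scheme.Opens.toSpecΓ_SpecMap_presheaf_map_assoc _ _ h]

theorem exists_common (V W : Z.affineOpens) (x : V.1) (y : W.1) (e : V.1.ι x = W.1.ι y) :
    ∃ (l : Z.affineOpens) (hV : l ≤ V) (hW : l ≤ W) (z : l.1),
      Z.homOfLE hV z = x ∧ Z.homOfLE hW z = y := by
  obtain ⟨_, ⟨l, hl, rfl⟩, hxl, hlV⟩ := Z.isBasis_affineOpens.exists_subset_of_mem_open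
    (a := V.1.ι x) (u := ↑(V.1 ⊓ W.1)) ⟨x.2, e ▸ y.2⟩ (V.1 ⊓ W.1).2
  have hV : (⟨l, hl⟩ : Z.affineOpens) ≤ V := fun p hp => (hlV hp).1
  have hW : (⟨l, hl⟩ : Z.affineOpens) ≤ W := fun p hp => (hlV hp).2
  refine ⟨⟨l, hl⟩, hV, hW, ⟨V.1.ι x, hxl⟩, ?_, ?_⟩
  · apply V.1.ι.isOpenEmbedding.injective
    exact congr($(Z.homOfLE_ι hV) (⟨V.1.ι x, hxl⟩ : (⟨l, hl⟩ : Z.affineOpens).1))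
  · apply W.1.ι.isOpenEmbedding.injective
    exact congr($(Z.homOfLE_ι hW) (⟨V.1.ι x, hxl⟩ : (⟨l, hl⟩ : Z.affineOpens).1)).trans e

/-- A thickening has the same points as the affine open it thickens. Two points with the same image
therefore come from one point of `Z`, which has an affine neighbourhood in both opens. -/
instance : (D.diagram ⋙ Scheme.forget).IsLocallyDirected where
  cond {V W W'} f g x y e := by
    change (Spec (D.ring V) : Type u) at x
    change (Spec (D.ring W) : Type u) at y
    change Spec.map (D.res f.le) x = Spec.map (D.res g.le) y at e
    obtain ⟨x, rfl⟩ := D.toThickening_surjective V x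
    obtain ⟨y, rfl⟩ := D.toThickening_surjective W y
    rw [← Scheme.Hom.comp_apply, ← Scheme.Hom.comp_apply, ← homOfLE_toThickening,
      ← homOfLE_toThickening, Scheme.Hom.comp_apply, Scheme.Hom.comp_apply] at e
    have e' := (D.toThickening W').isClosedEmbedding.injective e
    have e2 : (V.1.ι x) = W.1.ι y := by
      have := congrArg W'.1.ι e'
      rwa [← Scheme.Hom.comp_apply, ← Scheme.Hom.comp_apply, Scheme.homOfLE_ι,
        Scheme.homOfLE_ι] at this
    obtain ⟨l, hV, hW, z, hzV, hzW⟩ := exists_common V W x y e2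
    refine ⟨l, homOfLE hV, homOfLE hW, D.toThickening l z, ?_, ?_⟩
    · refine congr($(D.homOfLE_toThickening hV) z).symm.trans ?_
      exact congrArg (D.toThickening V) hzV
    · refine congr($(D.homOfLE_toThickening hW) z).symm.trans ?_
      exact congrArg (D.toThickening W) hzW

/-- The glued thickening. -/
def glued : Scheme.{u} := Limits.colimit D.diagram

/-- The inclusion of an affine piece. -/
def ι (V : Z.affineOpens) : Spec (D.ring V) ⟶ D.glued := Limits.colimit.ι D.diagram V

instance (V : Z.affineOpens) : IsOpenImmersion (D.ι V) :=
  inferInstanceAs (IsOpenImmersion (Limits.colimit.ι D.diagram V))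

theorem res_ι {V W : Z.affineOpens} (h : V ≤ W) : Spec.map (D.res h) ≫ D.ι W = D.ι V :=
  Limits.colimit.w D.diagram (homOfLE h)

theorem exists_desc {S : Scheme.{u}} (f : ∀ V, Spec (D.ring V) ⟶ S)
    (hf : ∀ {V W : Z.affineOpens} (h : V ≤ W), Spec.map (D.res h) ≫ f W = f V) :
    ∃ p : D.glued ⟶ S, ∀ V, D.ι V ≫ p = f V :=
  ⟨Limits.colimit.desc D.diagram ⟨S, ⟨f, fun _ _ h => (hf h.le).trans (Category.comp_id _).symm⟩⟩,
    fun _ => Limits.colimit.ι_desc _ _⟩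

theorem homOfLE_toThickening_ι {V W : Z.affineOpens} (h : V ≤ W) :
    Z.homOfLE h ≫ D.toThickening W ≫ D.ι W = D.toThickening V ≫ D.ι V := by
  rw [← Category.assoc, D.homOfLE_toThickening h, Category.assoc, res_ι]

/-- The closed immersion into the thickening. -/
def incl : Z ⟶ D.glued :=
  Z.directedAffineCover.glueMorphismsOfLocallyDirected (fun V => D.toThickening V ≫ D.ι V)
    fun h => D.homOfLE_toThickening_ι h.le

theorem ι_incl (V : Z.affineOpens) : V.1.ι ≫ D.incl = D.toThickening V ≫ D.ι V :=
  Z.directedAffineCover.map_glueMorphismsOfLocallyDirected _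
    (fun h => D.homOfLE_toThickening_ι h.le) V

/-- Gluing identifies points only through common smaller pieces, so a point of `Z` that lands in the
piece of `V` lies in some affine open below `V`. -/
theorem incl_preimage (V : Z.affineOpens) : D.incl ⁻¹ᵁ (D.ι V).opensRange = V.1 := by
  ext z
  constructor
  · rintro ⟨y, hy⟩
    obtain ⟨_, ⟨W, hW, rfl⟩, hzW, -⟩ := Z.isBasis_affineOpens.exists_subset_of_mem_open
      (a := z) (u := Set.univ) trivial isOpen_univ
    have h1 : D.incl z = D.ι ⟨W, hW⟩ (D.toThickening ⟨W, hW⟩ ⟨z, hzW⟩) :=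
      congr($(D.ι_incl ⟨W, hW⟩) (⟨z, hzW⟩ : (⟨W, hW⟩ : Z.affineOpens).1))
    have h2 := (Scheme.IsLocallyDirected.ι_eq_ι_iff D.diagram).1 (h1.symm.trans hy.symm)
    obtain ⟨l, hl1, hl2, x, hx1, hx2⟩ := h2
    obtain ⟨x, rfl⟩ := D.toThickening_surjective l x
    have h3 := (congr($(D.homOfLE_toThickening hl1.le) x)).trans hx1
    have h4 := (D.toThickening ⟨W, hW⟩).isClosedEmbedding.injective h3
    have h5 : x.1 = z := (congr($(Z.homOfLE_ι hl1.le) x)).symm.trans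
      (congrArg (Scheme.Opens.ι W) h4)
    exact hl2.le (h5 ▸ x.2)
  · intro hz
    exact ⟨D.toThickening V ⟨z, hz⟩, congr($(D.ι_incl V) ⟨z, hz⟩).symm⟩

end ThickeningData

end Thickening


/-! ### Base, flatness and closed fibre of a glued thickening. -/

section ThickeningBase

open Limits

/-- Under these hypotheses `C` is the quotient of `B` by the ideal generated by `ker φ`, and a
cocone on the span kills that ideal. -/
theorem isPushout_of_surjective {R S B C : Type u} [CommRing R] [CommRing S] [CommRing B]
    [CommRing C] (φ : R →+* S) (b : R →+* B) (c : S →+* C) (q : B →+* C)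
    (e : q.comp b = c.comp φ) (hφ : Function.Surjective φ) (hq : Function.Surjective q)
    (hk : RingHom.ker q ≤ (RingHom.ker φ).map b) :
    IsPushout (CommRingCat.ofHom b) (CommRingCat.ofHom φ) (CommRingCat.ofHom q)
      (CommRingCat.ofHom c) := by
  have w : CommRingCat.ofHom b ≫ CommRingCat.ofHom q = CommRingCat.ofHom φ ≫ CommRingCat.ofHom c := by
    ext x
    exact congr($e x)
  refine ⟨⟨w⟩, ⟨PushoutCocone.IsColimit.mk _ (fun s => CommRingCat.ofHom
    (q.liftOfSurjective hq ⟨s.inl.hom, fun x hx => ?_⟩)) (fun s => ?_) (fun s => ?_)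
    (fun s m hm _ => ?_)⟩⟩
  · have h2 : (RingHom.ker φ).map b ≤ RingHom.ker s.inl.hom := by
      refine Ideal.map_le_iff_le_comap.2 fun r hr => ?_
      have h3 : s.inl.hom (b r) = s.inr.hom (φ r) := congr($(s.condition).hom r)
      change s.inl.hom (b r) = 0
      rw [h3, show φ r = 0 from hr, map_zero]
    exact h2 (hk hx)
  · ext x
    exact RingHom.liftOfRightInverse_comp_apply _ _ (Function.rightInverse_surjInv hq) _ x
  · ext y
    obtain ⟨r, rfl⟩ := hφ y
    have h3 : s.inl.hom (b r) = s.inr.hom (φ r) := congr($(s.condition).hom r)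
    refine Eq.trans ?_ h3
    have h4 : c (φ r) = q (b r) := congr($(e.symm) r)
    exact (congrArg _ h4).trans (RingHom.liftOfRightInverse_comp_apply _ _ (Function.rightInverse_surjInv hq) _ (b r))
  · ext y
    obtain ⟨x, rfl⟩ := hq y
    refine Eq.trans ?_ (RingHom.liftOfRightInverse_comp_apply _ _ (Function.rightInverse_surjInv hq) _ x).symm
    exact congr($(hm).hom x)

namespace ThickeningData

variable {Z : Scheme.{u}} (D : ThickeningData Z) {A A₁ : Type u} [CommRing A] [CommRing A₁]
  {φ : A₁ →+* A} (f : Z ⟶ Spec (.of A))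

/-- The open covering of the thickening. -/
def openCover : D.glued.OpenCover := Scheme.IsLocallyDirected.openCover D.diagram

theorem flat_of_ι {S : Scheme.{u}} {p : D.glued ⟶ S} (h : ∀ V, Flat (D.ι V ≫ p)) : Flat p :=
  by
  have : IsZariskiLocalAtSource @Flat.{u} :=
    HasRingHomProperty.instIsZariskiLocalAtSource (P := @Flat.{u}) (Q := RingHom.Flat)
  exact IsZariskiLocalAtSource.of_openCover D.openCover h

theorem isPullback_ι (V : Z.affineOpens) :
    IsPullback (D.toThickening V) V.1.ι (D.ι V) D.incl :=
  IsOpenImmersion.isPullback _ _ _ _ (D.ι_incl V) (by rw [D.incl_preimage, Scheme.Opens.opensRange_ι])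

theorem toSpecΓ_Spec_map {V : Z.Opens} (h : V ≤ f ⁻¹ᵁ ⊤) :
    V.toSpecΓ ≫ Spec.map ((Scheme.ΓSpecIso (.of A)).inv ≫ f.appLE ⊤ V h) = V.ι ≫ f := by
  rw [Spec.map_comp, Scheme.Opens.toSpecΓ_SpecMap_appLE_assoc]
  have h1 : (⊤ : (Spec (.of A)).Opens).toSpecΓ = (⊤ : (Spec (.of A)).Opens).ι ≫
    (Spec (.of A)).toSpecΓ := Scheme.Opens.toSpecΓ_top
  rw [h1, Category.assoc, toSpecΓ_SpecMap_ΓSpecIso_inv, Category.comp_id]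
  exact Scheme.Hom.resLE_comp_ι _ _

theorem isPullback_toThickening (hφ : Function.Surjective φ) (V : Z.affineOpens)
    (b : A₁ →+* D.ring V)
    (hb : ∀ a, (D.quot V).hom (b a) =
      ((Scheme.ΓSpecIso (.of A)).inv ≫ f.appLE ⊤ V.1 (by simp)).hom (φ a))
    (hk : RingHom.ker (D.quot V).hom ≤ (RingHom.ker φ).map b) :
    IsPullback (D.toThickening V) (V.1.ι ≫ f) (Spec.map (CommRingCat.ofHom b))
      (Spec.map (CommRingCat.ofHom φ)) := by
  have h1 := isPullback_SpecMap_of_isPushout _ _ _ _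
    (isPushout_of_surjective φ b ((Scheme.ΓSpecIso (.of A)).inv ≫ f.appLE ⊤ V.1 (by simp)).hom
      (D.quot V).hom (RingHom.ext hb) hφ (D.surjective V) hk)
  have h2 := toSpecΓ_Spec_map f (V := V.1) le_top
  refine .of_iso h1 (asIso V.1.toSpecΓ).symm (Iso.refl _) (Iso.refl _) (Iso.refl _) ?_ ?_ ?_ ?_
  · rw [Iso.symm_hom, Iso.refl_hom, asIso_inv, toThickening, IsIso.inv_hom_id_assoc]
    exact Category.comp_id _
  · rw [← h2, Iso.symm_hom, Iso.refl_hom, asIso_inv, IsIso.inv_hom_id_assoc]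
    exact Category.comp_id _
  · exact (Category.comp_id _).trans (Category.id_comp _).symm
  · exact (Category.comp_id _).trans (Category.id_comp _).symm

/-- Being cartesian is checked over each affine piece, where the square comes from a pushout of
rings. -/
theorem isPullback_incl (hφ : Function.Surjective φ) {p : D.glued ⟶ Spec (.of A₁)}
    (b : ∀ V, A₁ →+* D.ring V) (hp : ∀ V, D.ι V ≫ p = Spec.map (CommRingCat.ofHom (b V)))
    (hb : ∀ V a, (D.quot V).hom (b V a) =
      ((Scheme.ΓSpecIso (.of A)).inv ≫ f.appLE ⊤ V.1 (by simp)).hom (φ a))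
    (hk : ∀ V, RingHom.ker (D.quot V).hom ≤ (RingHom.ker φ).map (b V)) :
    IsPullback D.incl f p (Spec.map (CommRingCat.ofHom φ)) := by
  refine Scheme.isPullback_of_openCover _ _ _ _ D.openCover fun V => ?_
  change Z.affineOpens at V
  have h3 := D.isPullback_toThickening f hφ V (b V) (hb V) (hk V)
  let e : V.1.toScheme ≅ pullback D.incl (D.ι V) := (D.isPullback_ι V).flip.isoPullback
  refine .of_iso h3 e (Iso.refl _) (Iso.refl _) (Iso.refl _) ?_ ?_ ?_ ?_
  · exact (Category.comp_id _).trans (IsPullback.isoPullback_hom_snd _).symm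
  · refine (Category.comp_id _).trans (.trans ?_ (Category.assoc _ _ _))
    exact congrArg (· ≫ f) (IsPullback.isoPullback_hom_fst _).symm
  · exact (Category.comp_id _).trans ((hp V).symm.trans (Category.id_comp _).symm)
  · exact (Category.comp_id _).trans (Category.id_comp _).symm

end ThickeningData

/-! ### Functions on a scheme evaluated on affine charts. -/

section EvalSpec

variable {Y S : Scheme.{u}} {R R' : CommRingCat.{u}}

theorem appTop_eq_appLE (g : Y ⟶ S) (h : ⊤ ≤ g ⁻¹ᵁ ⊤) : g.appTop = g.appLE ⊤ ⊤ h :=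
  g.app_eq_appLE (U := ⊤)

/-- The pullback of functions along `i : Spec R ⟶ Y`. -/
def evalSpec (i : Spec R ⟶ Y) (O : Y.Opens) (h : ⊤ ≤ i ⁻¹ᵁ O) : Γ(Y, O) ⟶ R :=
  i.appLE O ⊤ h ≫ (Scheme.ΓSpecIso R).hom

theorem evalSpec_comp (i : Spec R ⟶ Y) (i' : Spec R' ⟶ Y) (r : R ⟶ R') (e : Spec.map r ≫ i = i')
    (O : Y.Opens) (h : ⊤ ≤ i ⁻¹ᵁ O) (h' : ⊤ ≤ i' ⁻¹ᵁ O) :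
    evalSpec i' O h' = evalSpec i O h ≫ r := by
  subst e
  have hr : ⊤ ≤ Spec.map r ⁻¹ᵁ ⊤ := fun _ _ => trivial
  rw [evalSpec, evalSpec, Category.assoc, ← Scheme.ΓSpecIso_naturality,
    appTop_eq_appLE _ hr, Scheme.Hom.appLE_comp_appLE_assoc]

theorem map_evalSpec (i : Spec R ⟶ Y) {O O' : Y.Opens} (hO : O ≤ O') (h : ⊤ ≤ i ⁻¹ᵁ O)
    (h' : ⊤ ≤ i ⁻¹ᵁ O') :
    Y.presheaf.map (homOfLE hO).op ≫ evalSpec i O h = evalSpec i O' h' := by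
  rw [evalSpec, evalSpec, Scheme.Hom.map_appLE_assoc]

theorem base_evalSpec (i : Spec R ⟶ Y) (O : Y.Opens) (h : ⊤ ≤ i ⁻¹ᵁ O) {A : CommRingCat.{u}}
    (p : Y ⟶ Spec A) (b : A ⟶ R) (hp : i ≫ p = Spec.map b) (h' : O ≤ p ⁻¹ᵁ ⊤) :
    ((Scheme.ΓSpecIso A).inv ≫ p.appLE ⊤ O h') ≫ evalSpec i O h = b := by
  have e : ∀ h'', (i ≫ p).appLE ⊤ ⊤ h'' = (Spec.map b).appTop := by
    rw [hp]
    exact fun h'' => (appTop_eq_appLE _ _).symm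
  rw [evalSpec, Category.assoc, Scheme.Hom.appLE_comp_appLE_assoc, e, Scheme.ΓSpecIso_naturality,
    Iso.inv_hom_id_assoc]

theorem evalSpec_bijective (i : Spec R ⟶ Y) [IsOpenImmersion i] (O : Y.Opens)
    (hO : O = i.opensRange) (h : ⊤ ≤ i ⁻¹ᵁ O) : Function.Bijective (evalSpec i O h).hom := by
  subst hO
  have h1 : IsIso (i.app i.opensRange) := i.isIso_app _ le_rfl
  have h2 : IsIso (homOfLE h) := ⟨homOfLE le_top, rfl, rfl⟩
  have h3 : IsIso (evalSpec i _ h) := by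
    unfold evalSpec Scheme.Hom.appLE
    infer_instance
  exact ConcreteCategory.bijective_of_isIso _

theorem evalSpec_toSpecΓ {Z : Scheme.{u}} (V : Z.Opens) (j : Z ⟶ Y) (i : Spec R ⟶ Y)
    (q : R ⟶ Γ(Z, V)) (e : V.ι ≫ j = (V.toSpecΓ ≫ Spec.map q) ≫ i) (O : Y.Opens) (h : ⊤ ≤ i ⁻¹ᵁ O)
    (hV : V ≤ j ⁻¹ᵁ O) : evalSpec i O h ≫ q = j.appLE O V hV := by
  have h2 : ⊤ ≤ (Spec.map q ≫ i) ⁻¹ᵁ O := fun x _ => h (x := Spec.map q x) trivial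
  have h3 : V.ι ⁻¹ᵁ V = ⊤ := V.ι_preimage_self
  have h4 : ∀ h'', V.ι.appLE V ⊤ h'' = V.topIso.inv := fun h'' => by
    rw [Scheme.Opens.ι_appLE]
    rfl
  have h6 : ⊤ ≤ V.toSpecΓ ⁻¹ᵁ ⊤ := fun _ _ => trivial
  have h5 : ∀ h'', (V.toSpecΓ ≫ Spec.map q ≫ i).appLE O ⊤ h'' =
      j.appLE O V hV ≫ V.ι.appLE V ⊤ h3.ge := by
    rw [← Category.assoc, ← e]
    intro h''
    rw [Scheme.Hom.appLE_comp_appLE]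
  rw [← evalSpec_comp i _ q rfl O h h2, evalSpec, ← cancel_mono V.topIso.inv,
    Category.assoc, ← Scheme.Opens.toSpecΓ_appTop, appTop_eq_appLE _ h6,
    Scheme.Hom.appLE_comp_appLE, h5, h4]

end EvalSpec

end ThickeningBase


/-! ### Fields and automorphisms that are trivial modulo `t`. -/

section Shear

variable {k A A₁ : Type u} [Field k] [CommRing A] [Algebra k A] [CommRing A₁] [Algebra k A₁]
  {ε : A →ₐ[k] k} {φ : A₁ →ₐ[k] A} {t : A₁}

namespace SmallExtension

variable (h : SmallExtension ε φ t)
include h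

theorem mul_tmul {B : CommAlgCat.{u} k} (x : A₁ ⊗[k] B) (b : B) :
    x * t ⊗ₜ b = t ⊗ₜ (redk (ε.comp φ) B x * b) :=
  (h.smallExt B).mul_j x b

theorem redk_tmul {B : CommAlgCat.{u} k} (b : B) : redk (ε.comp φ) B (t ⊗ₜ b) = 0 :=
  (h.smallExt B).ρ_j b

variable {X : Scheme.{u}} {F : (Opens X)ᵒᵖ ⥤ CommAlgCat.{u} k}

omit h in
theorem redk_update (ε₁ : A₁ →ₐ[k] k) {B : CommAlgCat.{u} k} {p : ℕ} (v : Fin p → A₁ ⊗[k] B)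
    (i : Fin p) (x : A₁ ⊗[k] B) : (fun j => redk ε₁ B (Function.update v i x j)) =
      Function.update (fun j => redk ε₁ B (v j)) i (redk ε₁ B x) :=
  funext fun j => Function.apply_update (fun _ z => redk ε₁ B z) v i x j

/-- The multiple by `t` of a polyvector field. -/
theorem exists_tmul_polyVec {p : ℕ} {U : X.Opens} (Q : PolyVec F p U) :
    ∃ P : PolyVec (baseChange A₁ F) p U, ∀ V (v : Fin p → A₁ ⊗[k] F.obj (op V.1)),
      P.1 V v = t ⊗ₜ[k] Q.1 V fun i => redk (ε.comp φ) _ (v i) := by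
  refine ⟨⟨fun V => AlternatingMap.mk ⟨fun v => t ⊗ₜ[k] Q.1 V fun i => redk (ε.comp φ) _ (v i),
    ?_, ?_⟩ ?_, fun V v i f g => ?_, fun V W hVW v => ?_⟩, fun V v => rfl⟩
  · intro inst v i x y
    obtain rfl : inst = instDecidableEqFin p := Subsingleton.elim _ _
    rw [redk_update, redk_update, redk_update, map_add, (Q.1 V).map_update_add,
      TensorProduct.tmul_add]
  · intro inst v i a x
    obtain rfl : inst = instDecidableEqFin p := Subsingleton.elim _ _
    rw [redk_update, redk_update, h.smul_tmul, Algebra.smul_def, map_mul, ← (Q.1 V).map_update_smul,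
      Algebra.smul_def]
    congr 4
    exact (PoissonDeform.redk_tmul (ε.comp φ) _ a 1).trans (Algebra.algebraMap_eq_smul_one _).symm
  · intro v i j hv hij
    change t ⊗ₜ[k] Q.1 V (fun i => redk (ε.comp φ) _ (v i)) = 0
    rw [(Q.1 V).map_eq_zero_of_eq _ (congrArg (redk (ε.comp φ) _) hv) hij, TensorProduct.tmul_zero]
  · change A₁ ⊗[k] F.obj (op V.1) at f g
    change Fin p → A₁ ⊗[k] F.obj (op V.1) at v
    change t ⊗ₜ[k] Q.1 V (fun j => redk (ε.comp φ) _ (Function.update v i (f * g) j)) =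
      f * t ⊗ₜ[k] Q.1 V (fun j => redk (ε.comp φ) _ (Function.update v i g j)) +
      g * t ⊗ₜ[k] Q.1 V (fun j => redk (ε.comp φ) _ (Function.update v i f j))
    rw [redk_update, redk_update, redk_update, h.mul_tmul, h.mul_tmul, ← TensorProduct.tmul_add,
      map_mul, Q.2.1]
  · change t ⊗ₜ[k] rmap F hVW (Q.1 V fun i => redk (ε.comp φ) _ (v i)) = t ⊗ₜ[k] Q.1 W fun i =>
      redk (ε.comp φ) _ (rmap (baseChange A₁ F) hVW (v i))
    rw [polyVec_rmap Q V.2 hVW]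
    exact congrArg (fun w => t ⊗ₜ[k] Q.1 W w) (funext fun i => (redk_rmap (ε.comp φ) F hVW (v i)).symm)

/-- The automorphism given by a vector field. -/
theorem exists_shear {π : X ⟶ Spec (.of k)} [IsLocalRing A₁] [IsArtinianRing A₁]
    {U : X.Opens} (d : PolyVec (algSheaf π) 1 U) :
    ∃ e : EquivFamily (baseChange A₁ (algSheaf π)) (baseChange A₁ (algSheaf π)) U,
      ∀ V (hV : V ≤ U) (x : A₁ ⊗[k] (algSheaf π).obj (op V)),
        e.app V hV x = x + t ⊗ₜ[k] d.1 ⟨V, hV⟩ ![redk (ε.comp φ) _ x] := by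
  obtain ⟨P, hP⟩ := h.exists_tmul_polyVec d
  have hP1 : ∀ V (x : A₁ ⊗[k] (algSheaf π).obj (op V.1)),
      P.1 V ![x] = t ⊗ₜ[k] d.1 V ![redk (ε.comp φ) _ x] := fun V x =>
    (hP V ![x]).trans (congrArg _ (alternatingMap_eq_of_one _ rfl))
  have hu : ∀ (V : {V : X.Opens // V ≤ U}) (z : (baseChange A₁ (algSheaf π)).obj (op V.1)),
      Function.update ![0] (0 : Fin 1) z = ![z] :=
    fun V z => funext fun i => by fin_cases i; simp
  have hadd : ∀ V x y, P.1 V ![x + y] = P.1 V ![x] + P.1 V ![y] := fun V x y => by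
    have := (P.1 V).map_update_add ![0] 0 x y
    rwa [hu, hu, hu] at this
  have hsmul : ∀ V (a : A₁) x, P.1 V ![a • x] = a • P.1 V ![x] := fun V a x => by
    have := (P.1 V).map_update_smul ![0] 0 a x
    rwa [hu, hu] at this
  let D : ∀ V : {V : X.Opens // V ≤ U},
      A₁ ⊗[k] (algSheaf π).obj (op V.1) →ₗ[A₁] A₁ ⊗[k] (algSheaf π).obj (op V.1) := fun V =>
    { toFun := fun x => P.1 V ![x]
      map_add' := hadd V
      map_smul' := hsmul V }
  have hDmul : ∀ V x y, D V (x * y) = x * D V y + y * D V x := fun V x y => polyVec_mul_one P V x y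
  have hD : ∀ V x, D V x = t ⊗ₜ[k] d.1 V ![redk (ε.comp φ) _ x] := hP1
  -- The error in multiplicativity of the identity plus `D` is this product, which vanishes because
  -- both factors are multiples of `t`.
  have hD2 : ∀ V x y, D V x * D V y = 0 := fun V x y => by
    rw [hD V y, h.mul_tmul, hD, h.redk_tmul, zero_mul, TensorProduct.tmul_zero]
  have hD1 : ∀ V, D V 1 = 0 := fun V => by
    have := hDmul V 1 1
    rw [one_mul, one_mul] at this
    exact left_eq_add.1 this
  let s : AlgFamily (baseChange A₁ (algSheaf π)) (baseChange A₁ (algSheaf π)) U :=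
    ⟨fun V hV => AlgHom.ofLinearMap (LinearMap.id + D ⟨V, hV⟩)
      (by rw [LinearMap.add_apply, hD1, LinearMap.id_apply, add_zero])
      (fun x y => by
        simp only [LinearMap.add_apply, LinearMap.id_apply, hDmul]
        linear_combination - hD2 ⟨V, hV⟩ x y), fun V W hV hW x => by
      change rmap (baseChange A₁ (algSheaf π)) hW x + P.1 ⟨W, hW.trans hV⟩ ![rmap _ hW x] =
        rmap (baseChange A₁ (algSheaf π)) hW (x + P.1 ⟨V, hV⟩ ![x])
      rw [map_add, polyVec_rmap P hV hW]
      exact congrArg (rmap (baseChange A₁ (algSheaf π)) hW x + ·)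
        (alternatingMap_eq_of_one (P.1 ⟨W, hW.trans hV⟩)
          (f := fun i => rmap (baseChange A₁ (algSheaf π)) hW (![x] i)) rfl).symm⟩
  refine ⟨EquivFamily.ofBijective s fun V hV => bijective_of_redk_comp (ε.comp φ)
    (isNilpotent_ker _) (s.app V hV) fun x => ?_, fun V hV x => ?_⟩
  · change redk _ _ (x + D ⟨V, hV⟩ x) = _
    rw [map_add, hD, h.redk_tmul, add_zero]
  · exact congrArg (x + ·) (hD ⟨V, hV⟩ x)

end SmallExtension
end Shear

/-! ### Removing a coboundary by changing the choices. -/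

section Correct

variable {k A A₁ : Type u} [Field k] [CharZero k] [CommRing A] [Algebra k A] [CommRing A₁] [Algebra k A₁]
  {X : Scheme.{u}} {π : X ⟶ Spec (.of k)} {Λ₀ : PolyVec (algSheaf π) 2 ⊤} {ε : A →ₐ[k] k}
  [IsLocalRing A] [IsArtinianRing A] [IsLocalRing A₁] [IsArtinianRing A₁]
  {ξ : PoissonDeformation π Λ₀ ε} {ι : Type u} {U : ι → X.Opens} {φ : A₁ →ₐ[k] A} {t : A₁}
  {τ : Trivialization ξ U}

/-- If `α` is the differential of `β`, changing the bivectors and automorphisms by the fields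
belonging to `-β` changes `α` by `-α`. -/
theorem LiftChoice.exists_correction (h : SmallExtension ε φ t) (L : LiftChoice τ φ)
    {α : CechCochain (algSheaf π) U} (hα : L.IsObstructionCochain t α)
    (hb : α ∈ coboundaries Λ₀ U 2) : ∃ L' : LiftChoice τ φ, L'.IsObstructionCochain t 0 := by
  obtain ⟨β, hβ, e⟩ := hb
  -- The coefficients solve `2 l = -β` in bidegree `(0, 1)` and, below, `-2 p = -β` in bidegree `(1,
  -- 0)`.
  let l : ∀ a, PolyVec (algSheaf π) 2 (U a) := fun a =>
    (-2⁻¹ : k) • resPolyVec (β 0 1 fun _ => a) (le_iInf fun _ => le_rfl)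
  let p : ∀ a b, PolyVec (algSheaf π) 1 (U a ⊓ U b) := fun a b =>
    (2⁻¹ : k) • resPolyVec (β 1 0 ![a, b])
      (le_iInf fun j => by fin_cases j <;> [exact inf_le_left; exact inf_le_right])
  choose Q hQ using fun a => h.exists_tmul_polyVec (l a)
  choose f hf using fun a b => h.exists_shear (p a b)
  let L' : LiftChoice τ φ := ofFibre (fun a b => (L.autFamily a b).trans (f a b))
    (fun a b V hV x => by
      rw [EquivFamily.trans_app, hf, map_add, h.red_tmul, add_zero, autFamily_app, L.red_aut]
      rfl)
    (fun a => L.biv a + Q a) (fun a V v => by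
      change red φ _ (L.bivAt a V.1 V.2 v + (Q a).1 V v) = _
      rw [hQ, map_add, h.red_tmul, add_zero, L.red_biv])
  refine ⟨L', (represents_iff _).1 ?_⟩
  have hL : L.IsChange L' t (fun a => ⟨fun V _ => AlgEquiv.refl, fun _ _ _ _ _ => rfl⟩) l p := by
    refine ⟨fun _ _ _ _ => rfl, fun a V hV x y => ?_, fun a b V ha hb x => ?_⟩
    · change L.bivAt a V hV ![x, y] + (Q a).1 ⟨V, hV⟩ ![x, y] = L.bivAt a V hV ![x, y] + _
      rw [hQ]
      exact congrArg (fun z => _ + t ⊗ₜ[k] z) (alternatingMap_eq_of_two _ rfl rfl)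
    · change (f a b).app V _ (L.aut a b V ha hb x) = L.aut a b V ha hb x + _
      rw [hf, L.redk_aut]
  have h2 : (2 : k) ≠ 0 := two_ne_zero
  have h1 := hL.represents h hα (β := -β) (fun I V => ?_) (fun I V => ?_)
  · rwa [map_neg, e, add_neg_cancel] at h1
  · obtain ⟨a, rfl⟩ : ∃ a, I = fun _ => a := ⟨I 0, funext fun i => by fin_cases i; rfl⟩
    change -(β 0 1 fun _ => a).1 V = (2 : k) • (-2⁻¹ : k) • (β 0 1 fun _ => a).1 V
    rw [smul_smul, mul_neg, mul_inv_cancel₀ h2, neg_one_smul]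
  · obtain ⟨a, b, rfl⟩ : ∃ a b, I = ![a, b] := ⟨I 0, I 1, funext fun i => by fin_cases i <;> rfl⟩
    change -(β 1 0 ![a, b]).1 V = (-2 : k) • (2⁻¹ : k) • (β 1 0 ![a, b]).1 V
    rw [smul_smul, neg_mul, mul_inv_cancel₀ h2, neg_one_smul]

end Correct


/-! ### The twisted thickening over the affine opens of the total space. -/

section Twist

variable {k A A₁ : Type u} [Field k] [CommRing A] [Algebra k A] [CommRing A₁] [Algebra k A₁]
  {X : Scheme.{u}} {π : X ⟶ Spec (.of k)} {Λ₀ : PolyVec (algSheaf π) 2 ⊤} {ε : A →ₐ[k] k}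
  {ξ : PoissonDeformation π Λ₀ ε} {φ : A₁ →ₐ[k] A} {t : A₁}

namespace LiftChoice

section Zero

variable {ι : Type u} {U : ι → X.Opens} {τ : Trivialization ξ U} {L : LiftChoice τ φ}

theorem IsObstructionCochain.schouten_eq_zero (hL : L.IsObstructionCochain t 0) (a : ι)
    (V : X.Opens) (h : V ≤ U a) (G : Fin 3 → A₁ ⊗[k] (algSheaf π).obj (op V)) :
    schouten (p := 1) (q := 1) (L.bivAt a V h) (L.bivAt a V h) G = 0 :=
  (hL.trivector (fun _ => a) ⟨V, le_iInf fun _ => h⟩ G).trans (TensorProduct.tmul_zero _ _)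

variable [CharZero k]

theorem IsObstructionCochain.aut_comp (hL : L.IsObstructionCochain t 0) (a b c : ι)
    (V : X.Opens) (ha : V ≤ U a) (hb : V ≤ U b) (hc : V ≤ U c)
    (x : A₁ ⊗[k] (algSheaf π).obj (op V)) :
    L.aut a b V ha hb (L.aut b c V hb hc x) = L.aut a c V ha hc x := by
  obtain ⟨d, hd, h⟩ := hL.derivation ![a, b, c]
  have hV : V ≤ ⨅ j, U (![a, b, c] j) := le_iInf fun j => by fin_cases j <;> assumption
  obtain rfl : d = 0 := (smul_eq_zero.1 hd.symm).resolve_left (neg_ne_zero.2 two_ne_zero)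
  refine (h ⟨V, hV⟩ x).trans ?_
  refine (congrArg (_ + ·) (TensorProduct.tmul_zero _ _)).trans (add_zero _)

/-- The cocycle rule makes this automorphism idempotent, and an injective idempotent is the
identity. -/
theorem IsObstructionCochain.aut_self (hL : L.IsObstructionCochain t 0) (a : ι)
    (V : X.Opens) (ha : V ≤ U a) (x : A₁ ⊗[k] (algSheaf π).obj (op V)) :
    L.aut a a V ha ha x = x :=
  (L.aut a a V ha ha).injective (hL.aut_comp a a a V ha ha ha x)

theorem IsObstructionCochain.aut_biv (hL : L.IsObstructionCochain t 0) (a b : ι)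
    (V : X.Opens) (ha : V ≤ U a) (hb : V ≤ U b) (v : Fin 2 → A₁ ⊗[k] (algSheaf π).obj (op V)) :
    L.aut a b V ha hb (L.bivAt b V hb v) = L.bivAt a V ha fun i => L.aut a b V ha hb (v i) := by
  obtain ⟨d, hd, h⟩ := hL.bivector ![a, b]
  have hV : V ≤ ⨅ j, U (![a, b] j) := le_iInf fun j => by fin_cases j <;> assumption
  obtain rfl : d = 0 := (smul_eq_zero.1 hd.symm).resolve_left two_ne_zero
  have h1 := (h ⟨V, hV⟩ fun i => L.aut a b V ha hb (v i)).trans (TensorProduct.tmul_zero _ _)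
  refine Eq.trans (congrArg (fun w => L.aut a b V ha hb (L.bivAt b V hb w)) (funext fun i => ?_))
    (sub_eq_zero.1 h1)
  exact (AlgEquiv.symm_apply_apply _ _).symm

end Zero

variable {τ : Trivialization ξ fun W : ξ.space.affineOpens => ξ.incl ⁻¹ᵁ W.1} {L : LiftChoice τ φ}

theorem isOpenImmersion_restrict {U V : X.Opens} (hU : IsAffineOpen U) (hV : IsAffineOpen V)
    (h : V ≤ U) : IsOpenImmersion (Spec.map (X.presheaf.map (homOfLE h).op)) := by
  have h1 : IsIso U.toSpecΓ := hU.isoSpec_hom ▸ inferInstance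
  have h2 : IsIso V.toSpecΓ := hV.isoSpec_hom ▸ inferInstance
  have h3 := (IsIso.eq_inv_comp V.toSpecΓ).2 (Scheme.Opens.toSpecΓ_SpecMap_presheaf_map V U h)
  rw [h3]
  infer_instance

/-- Pasting tensor product squares exhibits this map as the base change of the restriction map of
`X`, which is an open immersion on spectra. -/
theorem isOpenImmersion_rmap {U V : X.Opens} (hU : IsAffineOpen U) (hV : IsAffineOpen V)
    (h : V ≤ U) : IsOpenImmersion (Spec.map (CommRingCat.ofHom
      (rmap (baseChange A₁ (algSheaf π)) h).toRingHom)) := by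
  have h1 := CommRingCat.isPushout_tensorProduct k A₁ ((algSheaf π).obj (op U))
  have h2 := CommRingCat.isPushout_tensorProduct k A₁ ((algSheaf π).obj (op V))
  have h3 : CommRingCat.ofHom (algebraMap k ((algSheaf π).obj (op U))) ≫
      CommRingCat.ofHom (rmap (algSheaf π) h).toRingHom =
      CommRingCat.ofHom (algebraMap k ((algSheaf π).obj (op V))) :=
    CommRingCat.hom_ext (RingHom.ext fun x => (rmap (algSheaf π) h).commutes x)
  have h4 : CommRingCat.ofHom (S := A₁ ⊗[k] (algSheaf π).obj (op U))
      Algebra.TensorProduct.includeLeftRingHom ≫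
      CommRingCat.ofHom (rmap (baseChange A₁ (algSheaf π)) h).toRingHom =
      CommRingCat.ofHom (S := A₁ ⊗[k] (algSheaf π).obj (op V))
        Algebra.TensorProduct.includeLeftRingHom :=
    CommRingCat.hom_ext (RingHom.ext fun x => (rmap (baseChange A₁ (algSheaf π)) h).commutes x)
  rw [← h3, ← h4] at h2
  have h5 := IsPushout.of_top h2 rfl h1
  have h6 := isPullback_SpecMap_of_isPushout _ _ _ _ h5
  exact MorphismProperty.of_isPullback (P := @IsOpenImmersion) h6.flip
    (isOpenImmersion_restrict hU hV h)

/-- The restriction maps twisted by the automorphisms. -/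
def twistedRes (L : LiftChoice τ φ) {V W : ξ.space.affineOpens} (h : V ≤ W) :
    A₁ ⊗[k] (algSheaf π).obj (op (ξ.incl ⁻¹ᵁ W.1)) →ₐ[A₁]
      A₁ ⊗[k] (algSheaf π).obj (op (ξ.incl ⁻¹ᵁ V.1)) :=
  (L.aut V W _ le_rfl (ξ.incl.preimage_mono h)).toAlgHom.comp
    (rmap (baseChange A₁ (algSheaf π)) (ξ.incl.preimage_mono h))

theorem twistedRes_apply (L : LiftChoice τ φ) {V W : ξ.space.affineOpens} (h : V ≤ W)
    (x : A₁ ⊗[k] (algSheaf π).obj (op (ξ.incl ⁻¹ᵁ W.1))) : L.twistedRes h x =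
      L.aut V W _ le_rfl (ξ.incl.preimage_mono h)
        (rmap (baseChange A₁ (algSheaf π)) (ξ.incl.preimage_mono h) x) := rfl

/-- The reduction to the functions on the given deformation. -/
def twistedQuot (τ : Trivialization ξ fun W : ξ.space.affineOpens => ξ.incl ⁻¹ᵁ W.1)
    (φ : A₁ →ₐ[k] A) (V : ξ.space.affineOpens) :
    A₁ ⊗[k] (algSheaf π).obj (op (ξ.incl ⁻¹ᵁ V.1)) →+* (algSheaf ξ.proj).obj (op V.1) :=
  (τ.iso V V.1 le_rfl).symm.toAlgHom.toRingHom.comp (red φ _).toRingHom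

theorem twistedQuot_apply (V : ξ.space.affineOpens)
    (x : A₁ ⊗[k] (algSheaf π).obj (op (ξ.incl ⁻¹ᵁ V.1))) :
    twistedQuot τ φ V x = (τ.iso V V.1 le_rfl).symm (red φ _ x) := rfl

theorem iso_symm_map {ι : Type u} {U : ι → X.Opens} (τ : Trivialization ξ U) (a : ι)
    (W W' : ξ.space.Opens) (h : ξ.incl ⁻¹ᵁ W ≤ U a) (hW : W' ≤ W)
    (x : A ⊗[k] (algSheaf π).obj (op (ξ.incl ⁻¹ᵁ W))) :
    (τ.iso a W' ((ξ.incl.preimage_mono hW).trans h)).symm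
      (rmap (baseChange A (algSheaf π)) (ξ.incl.preimage_mono hW) x) =
      rmap (algSheaf ξ.proj) hW ((τ.iso a W h).symm x) := by
  rw [AlgEquiv.symm_apply_eq]
  refine Eq.trans ?_ (τ.iso_map a W W' h hW (ξ.incl.preimage_mono hW) _).symm
  rw [AlgEquiv.apply_symm_apply]

theorem twistedRes_twistedQuot {V W : ξ.space.affineOpens} (h : V ≤ W)
    (x : A₁ ⊗[k] (algSheaf π).obj (op (ξ.incl ⁻¹ᵁ W.1))) :
    twistedQuot τ φ V (L.twistedRes h x) = rmap (algSheaf ξ.proj) h (twistedQuot τ φ W x) := by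
  rw [twistedQuot_apply, twistedRes_apply, L.aut_red, AlgEquiv.symm_apply_apply, red_rmap,
    iso_symm_map]
  rfl

variable [CharZero k] 

/-- The thickening of the total space. -/
def thickening (h : SmallExtension ε φ t) (hL : L.IsObstructionCochain t 0)
    [IsAffineHom ξ.incl] : ThickeningData ξ.space where
  ring W := CommRingCat.of (A₁ ⊗[k] (algSheaf π).obj (op (ξ.incl ⁻¹ᵁ W.1)))
  res h := CommRingCat.ofHom (L.twistedRes h).toRingHom
  res_self V := by
    refine CommRingCat.hom_ext (RingHom.ext fun x => ?_)
    exact (hL.aut_self V _ _ _).trans (rmap_self (baseChange A₁ (algSheaf π)) le_rfl x)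
  res_res {V W W'} h h' := by
    refine CommRingCat.hom_ext (RingHom.ext fun x => ?_)
    -- Transitivity of the twisted restrictions is the cocycle rule, once the inner automorphism has
    -- been moved past the restriction.
    have h1 := L.aut_map W W' (ξ.incl ⁻¹ᵁ W.1) (ξ.incl ⁻¹ᵁ V.1) le_rfl (ξ.incl.preimage_mono h')
      (ξ.incl.preimage_mono h) (rmap (baseChange A₁ (algSheaf π)) (ξ.incl.preimage_mono h') x)
    refine (congrArg (L.aut V W _ le_rfl (ξ.incl.preimage_mono h)) h1.symm).trans ?_
    refine (hL.aut_comp _ _ _ _ _ _ (ξ.incl.preimage_mono (h.trans h')) _).trans ?_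
    exact congrArg (L.aut V W' _ le_rfl (ξ.incl.preimage_mono (h.trans h')))
      (rmap_rmap (baseChange A₁ (algSheaf π)) _ _ x)
  quot V := CommRingCat.ofHom (twistedQuot τ φ V)
  res_quot h := by
    refine CommRingCat.hom_ext (RingHom.ext fun x => ?_)
    exact L.twistedRes_twistedQuot h x
  surjective V := (τ.iso V V.1 le_rfl).symm.surjective.comp (red_surjective h.surjective _)
  isNilpotent V x hx := by
    have h1 : red φ _ x = 0 := (τ.iso V V.1 le_rfl).symm.injective (hx.trans (map_zero _).symm)
    obtain ⟨b, rfl⟩ := h.exists_eq_tmul h1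
    refine ⟨2, ?_⟩
    rw [pow_two]
    refine (h.mul_tmul _ b).trans ?_
    rw [h.redk_tmul, zero_mul, TensorProduct.tmul_zero]
  isOpenImmersion {V W} h := by
    have h1 := isOpenImmersion_rmap (π := π) (A₁ := A₁) (W.2.preimage ξ.incl) (V.2.preimage ξ.incl)
      (ξ.incl.preimage_mono h)
    have h2 : IsIso (CommRingCat.ofHom
        (L.aut V W _ le_rfl (ξ.incl.preimage_mono h)).toAlgHom.toRingHom) := by
      refine (ConcreteCategory.isIso_iff_bijective _).2 ?_
      exact (L.aut V W _ le_rfl (ξ.incl.preimage_mono h)).bijective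
    have h3 : CommRingCat.ofHom (L.twistedRes h).toRingHom =
        CommRingCat.ofHom (rmap (baseChange A₁ (algSheaf π)) (ξ.incl.preimage_mono h)).toRingHom ≫
        CommRingCat.ofHom (L.aut V W _ le_rfl (ξ.incl.preimage_mono h)).toAlgHom.toRingHom := rfl
    rw [h3, Spec.map_comp]
    infer_instance

end LiftChoice

end Twist


/-! ### The glued deformation over `A₁`. -/

section Space

variable {k A A₁ : Type u} [Field k] [CharZero k] [CommRing A] [Algebra k A] [CommRing A₁]
  [Algebra k A₁] [IsLocalRing A] [IsArtinianRing A] [IsLocalRing A₁] [IsArtinianRing A₁]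
  {X : Scheme.{u}} {π : X ⟶ Spec (.of k)} {Λ₀ : PolyVec (algSheaf π) 2 ⊤} {ε : A →ₐ[k] k}
  {ξ : PoissonDeformation π Λ₀ ε} {φ : A₁ →ₐ[k] A} {t : A₁}

/-- A flat deformation with the zero Poisson structure. -/
def PoissonDeformation.ofFlat {A : Type u} [CommRing A] [Algebra k A] {ε : A →ₐ[k] k}
    {Y : Scheme.{u}} {p : Y ⟶ Spec (.of A)} (hp : Flat p) {i : X ⟶ Y}
    (hi : IsPullback i π p (Spec.map (CommRingCat.ofHom ε.toRingHom))) :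
    PoissonDeformation π 0 ε where
  space := Y
  proj := p
  flat := hp
  incl := i
  isPullback := hi
  biv := 0
  isPoisson V G := by
    have h1 := schouten_smul_right (p := 1) (q := 1) (0 : A) (0 : _ [⋀^Fin 2]→ₗ[A] _) 0 G
    rwa [smul_zero, zero_smul] at h1
  incl_biv W v := map_zero _

namespace LiftChoice

variable {τ : Trivialization ξ fun W : ξ.space.affineOpens => ξ.incl ⁻¹ᵁ W.1} {L : LiftChoice τ φ}

theorem ker_twistedQuot_le (h : SmallExtension ε φ t) (V : ξ.space.affineOpens) :
    RingHom.ker (twistedQuot τ φ V) ≤ (RingHom.ker φ.toRingHom).map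
      (algebraMap A₁ (A₁ ⊗[k] (algSheaf π).obj (op (ξ.incl ⁻¹ᵁ V.1)))) := by
  intro x hx
  have h1 : red φ _ x = 0 := (τ.iso V V.1 le_rfl).symm.injective (hx.trans (map_zero _).symm)
  obtain ⟨b, rfl⟩ := h.exists_eq_tmul h1
  have h2 : t ⊗ₜ[k] b = (1 ⊗ₜ[k] b) * algebraMap A₁ (A₁ ⊗[k] (algSheaf π).obj (op (ξ.incl ⁻¹ᵁ V.1))) t := by
    rw [Algebra.TensorProduct.algebraMap_apply, Algebra.TensorProduct.tmul_mul_tmul, one_mul, mul_one]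
    rfl
  rw [h2]
  refine Ideal.mul_mem_left _ _ (Ideal.mem_map_of_mem _ ?_)
  change t ∈ RingHom.ker φ
  rw [h.ker_eq]
  exact Ideal.mem_span_singleton_self t

theorem twistedQuot_algebraMap (V : ξ.space.affineOpens) (a : A₁) :
    twistedQuot τ φ V (algebraMap A₁ _ a) = algebraMap A _ (φ a) := by
  rw [twistedQuot_apply, red_algebraMap, AlgEquiv.commutes]

/-- Evaluating functions on the charts identifies the sections of `η` over the trace of `V` with `R
V`. All structure then matches: base ring, restriction maps, and the restriction of functions to
`ξ`. -/
theorem exists_evalSpec {Λ₁ : PolyVec (algSheaf π) 2 ⊤} (η : PoissonDeformation π Λ₁ (ε.comp φ))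
    (g : ξ.space ⟶ η.space) (hi : ξ.incl ≫ g = η.incl)
    (R : ξ.space.affineOpens → CommRingCat.{u})
    (res : ∀ {V W : ξ.space.affineOpens}, V ≤ W → (R W ⟶ R V))
    (ι : ∀ V, Spec (R V) ⟶ η.space) (hι : ∀ V, IsOpenImmersion (ι V))
    (hres : ∀ {V W : ξ.space.affineOpens} (h : V ≤ W), Spec.map (res h) ≫ ι W = ι V)
    (hg : ∀ V, g ⁻¹ᵁ (ι V).opensRange = V.1) (q : ∀ V, R V ⟶ Γ(ξ.space, V.1))
    (hq : ∀ V : ξ.space.affineOpens, V.1.ι ≫ g = (V.1.toSpecΓ ≫ Spec.map (q V)) ≫ ι V)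
    (b : ∀ V, CommRingCat.of A₁ ⟶ R V) (hb : ∀ V, ι V ≫ η.proj = Spec.map (b V)) :
    ∃ c : ∀ V : ξ.space.affineOpens, η.sheaf.obj (op (ξ.incl ⁻¹ᵁ V.1)) →+* R V,
      (∀ V, Function.Bijective (c V)) ∧
      (∀ V a, c V (algebraMap A₁ _ a) = (b V).hom a) ∧
      (∀ (V W : ξ.space.affineOpens) (h : V ≤ W) x,
        c V (rmap η.sheaf (ξ.incl.preimage_mono h) x) = (res h).hom (c W x)) ∧
      ∀ (V : ξ.space.affineOpens) x, fibreMap g hi (ξ.incl ⁻¹ᵁ V.1) x =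
        rmap (algSheaf ξ.proj) (upOpen_preimage ξ.incl V.1).le ((q V).hom (c V x)) := by
  have hO : ∀ V : ξ.space.affineOpens, upOpen η.incl (ξ.incl ⁻¹ᵁ V.1) = (ι V).opensRange := by
    intro V
    have h1 : η.incl ⁻¹ᵁ (ι V).opensRange = ξ.incl ⁻¹ᵁ V.1 := by
      rw [← hi]
      exact congrArg (ξ.incl ⁻¹ᵁ ·) (hg V)
    rw [← h1, upOpen_preimage]
  have hO' : ∀ V W : ξ.space.affineOpens, V ≤ W →
      ⊤ ≤ (ι V) ⁻¹ᵁ upOpen η.incl (ξ.incl ⁻¹ᵁ W.1) := by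
    intro V W hVW x _
    refine (upOpen_mono η.incl (ξ.incl.preimage_mono hVW)) ?_
    rw [hO V]
    exact ⟨x, rfl⟩
  refine ⟨fun V => (evalSpec (ι V) _ (hO' V V le_rfl)).hom,
    fun V => evalSpec_bijective (ι V) _ (hO V) (hO' V V le_rfl),
    fun V a => congr($(base_evalSpec (ι V) _ (hO' V V le_rfl) η.proj
          (b V) (hb V) le_top).hom a), fun V W hVW x => ?_, fun V x => ?_⟩
  · have h1 := map_evalSpec (ι V) (upOpen_mono η.incl (ξ.incl.preimage_mono hVW))
      (hO' V V le_rfl) (hO' V W hVW)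
    have h2 := evalSpec_comp (ι W) (ι V) (res hVW) (hres hVW)
      (upOpen η.incl (ξ.incl ⁻¹ᵁ W.1)) (hO' W W le_rfl) (hO' V W hVW)
    exact congr($(h1.trans h2).hom x)
  · have hV : V.1 ≤ g ⁻¹ᵁ upOpen η.incl (ξ.incl ⁻¹ᵁ V.1) := by
      rw [hO V, hg]
    have h1 := evalSpec_toSpecΓ V.1 g (ι V) (q V) (hq V) _ (hO' V V le_rfl) hV
    rw [fibreMap_apply]
    refine Eq.trans ?_ (congrArg (rmap (algSheaf ξ.proj) (upOpen_preimage ξ.incl V.1).le)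
      (congr($(h1).hom x)).symm)
    exact (rmap_rmap (algSheaf ξ.proj) hV (upOpen_preimage ξ.incl V.1).le _).symm

theorem exists_glued (hφ : Function.Surjective φ)
    (D : ThickeningData ξ.space) (b : ∀ V, A₁ →+* D.ring V)
    (hres : ∀ (V W : ξ.space.affineOpens) (h : V ≤ W) a, (D.res h).hom (b W a) = b V a)
    (hb : ∀ V a, (D.quot V).hom (b V a) =
      ((Scheme.ΓSpecIso (.of A)).inv ≫ ξ.proj.appLE ⊤ V.1 (by simp)).hom (φ a))
    (hk : ∀ V, RingHom.ker (D.quot V).hom ≤ (RingHom.ker φ.toRingHom).map (b V))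
    (hf : ∀ V, (b V).Flat) :
    ∃ p : D.glued ⟶ Spec (.of A₁), Flat p ∧
      (∀ V, D.ι V ≫ p = Spec.map (CommRingCat.ofHom (b V))) ∧
      IsPullback D.incl ξ.proj p (Spec.map (CommRingCat.ofHom φ.toRingHom)) ∧
      IsPullback (ξ.incl ≫ D.incl) π p (Spec.map (CommRingCat.ofHom (ε.comp φ).toRingHom)) := by
  obtain ⟨p, hp⟩ := D.exists_desc (fun V => Spec.map (CommRingCat.ofHom (b V))) fun {V W} hVW => by
    rw [← Spec.map_comp]
    exact congrArg Spec.map (CommRingCat.hom_ext (RingHom.ext fun a => hres V W hVW a))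
  have hpull : IsPullback D.incl ξ.proj p (Spec.map (CommRingCat.ofHom φ.toRingHom)) :=
    D.isPullback_incl (φ := φ.toRingHom) ξ.proj hφ b hp hb hk
  refine ⟨p, D.flat_of_ι fun V => ?_, hp, hpull, ?_⟩
  · rw [hp, Flat.SpecMap_iff]
    exact hf V
  · have h1 : Spec.map (CommRingCat.ofHom (ε.comp φ).toRingHom) =
        Spec.map (CommRingCat.ofHom ε.toRingHom) ≫ Spec.map (CommRingCat.ofHom φ.toRingHom) := by
      rw [← Spec.map_comp]
      rfl
    rw [h1]
    exact (ξ.isPullback.flip.paste_vert hpull.flip).flip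

/-- The zero bivector is a placeholder: it makes the tools for deformations available on the glued
scheme before its Poisson structure is constructed. -/
theorem exists_space_of_thickening (hφ : Function.Surjective φ)
    (D : ThickeningData ξ.space) (b : ∀ V, A₁ →+* D.ring V)
    (hres : ∀ (V W : ξ.space.affineOpens) (h : V ≤ W) a, (D.res h).hom (b W a) = b V a)
    (hb : ∀ V a, (D.quot V).hom (b V a) =
      ((Scheme.ΓSpecIso (.of A)).inv ≫ ξ.proj.appLE ⊤ V.1 (by simp)).hom (φ a))
    (hk : ∀ V, RingHom.ker (D.quot V).hom ≤ (RingHom.ker φ.toRingHom).map (b V))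
    (hf : ∀ V, (b V).Flat) :
    ∃ (η : PoissonDeformation π 0 (ε.comp φ)) (g : ξ.space ⟶ η.space) (hi : ξ.incl ≫ g = η.incl)
      (c : ∀ V : ξ.space.affineOpens, η.sheaf.obj (op (ξ.incl ⁻¹ᵁ V.1)) →+* D.ring V),
      IsPullback g ξ.proj η.proj (Spec.map (CommRingCat.ofHom φ.toRingHom)) ∧
      (∀ V, Function.Bijective (c V)) ∧
      (∀ V a, c V (algebraMap A₁ _ a) = b V a) ∧
      (∀ (V W : ξ.space.affineOpens) (h : V ≤ W) x,
        c V (rmap η.sheaf (ξ.incl.preimage_mono h) x) = (D.res h).hom (c W x)) ∧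
      ∀ (V : ξ.space.affineOpens) x, fibreMap g hi (ξ.incl ⁻¹ᵁ V.1) x =
        rmap (algSheaf ξ.proj) (upOpen_preimage ξ.incl V.1).le ((D.quot V).hom (c V x)) := by
  have h0 := exists_glued (ξ := ξ) hφ D b hres hb hk hf
  obtain ⟨p, hp, hb, h1, h2⟩ := h0
  have h3 : ∀ V, IsOpenImmersion (D.ι V) := fun V => inferInstance
  have h4 := exists_evalSpec (ξ := ξ) (φ := φ) (PoissonDeformation.ofFlat hp h2)
    D.incl rfl D.ring (fun h' => D.res h') D.ι
    h3 (fun h' => D.res_ι h')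
    D.incl_preimage D.quot D.ι_incl
    (fun V => CommRingCat.ofHom (b V)) hb
  obtain ⟨c, hc⟩ := h4
  exact ⟨.ofFlat hp h2, D.incl, rfl, c, h1, hc⟩

/-- The structure map of the thickening over an affine open subset. -/
def thickeningBase [IsAffineHom ξ.incl] (h : SmallExtension ε φ t)
    (hL : L.IsObstructionCochain t 0) (V : ξ.space.affineOpens) :
    A₁ →+* (thickening h hL).ring V :=
  algebraMap A₁ (A₁ ⊗[k] (algSheaf π).obj (op (ξ.incl ⁻¹ᵁ V.1)))

theorem res_thickeningBase [IsAffineHom ξ.incl] (h : SmallExtension ε φ t)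
    (hL : L.IsObstructionCochain t 0) {V W : ξ.space.affineOpens} (h' : V ≤ W) (a : A₁) :
    ((thickening h hL).res h').hom (thickeningBase h hL W a) = thickeningBase h hL V a :=
  (L.twistedRes h').commutes a

theorem quot_thickeningBase [IsAffineHom ξ.incl] (h : SmallExtension ε φ t)
    (hL : L.IsObstructionCochain t 0) (V : ξ.space.affineOpens) (a : A₁) :
    ((thickening h hL).quot V).hom (thickeningBase h hL V a) =
      ((Scheme.ΓSpecIso (.of A)).inv ≫ ξ.proj.appLE ⊤ V.1 (by simp)).hom (φ a) :=
  twistedQuot_algebraMap V a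

theorem ker_quot_thickening [IsAffineHom ξ.incl] (h : SmallExtension ε φ t)
    (hL : L.IsObstructionCochain t 0) (V : ξ.space.affineOpens) :
    RingHom.ker ((thickening h hL).quot V).hom ≤
      (RingHom.ker φ.toRingHom).map (thickeningBase h hL V) :=
  ker_twistedQuot_le h V

theorem flat_thickeningBase [IsAffineHom ξ.incl] (h : SmallExtension ε φ t)
    (hL : L.IsObstructionCochain t 0) (V : ξ.space.affineOpens) :
    (thickeningBase h hL V).Flat := by
  have h1 : (algebraMap A₁ (A₁ ⊗[k] (algSheaf π).obj (op (ξ.incl ⁻¹ᵁ V.1)))).Flat :=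
    RingHom.flat_algebraMap_iff.2 inferInstance
  exact h1

theorem exists_space [IsAffineHom ξ.incl] (h : SmallExtension ε φ t)
    (hL : L.IsObstructionCochain t 0) :
    ∃ (η : PoissonDeformation π 0 (ε.comp φ)) (g : ξ.space ⟶ η.space) (hi : ξ.incl ≫ g = η.incl)
      (c : ∀ V : ξ.space.affineOpens, η.sheaf.obj (op (ξ.incl ⁻¹ᵁ V.1)) ≃ₐ[A₁]
        A₁ ⊗[k] (algSheaf π).obj (op (ξ.incl ⁻¹ᵁ V.1))),
      IsPullback g ξ.proj η.proj (Spec.map (CommRingCat.ofHom φ.toRingHom)) ∧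
      (∀ (V W : ξ.space.affineOpens) (h : V ≤ W) x,
        c V (rmap η.sheaf (ξ.incl.preimage_mono h) x) = L.twistedRes h (c W x)) ∧
      ∀ (V : ξ.space.affineOpens) x, fibreMap g hi _ x =
        rmap (algSheaf ξ.proj) (upOpen_preimage ξ.incl V.1).le (twistedQuot τ φ V (c V x)) := by
  have h0 := exists_space_of_thickening (ξ := ξ) h.surjective
    (thickening h hL) (thickeningBase h hL) (fun _ _ h' a => res_thickeningBase h hL h' a)
    (quot_thickeningBase h hL) (ker_quot_thickening h hL) (flat_thickeningBase h hL)
  obtain ⟨η, g, hi, c, h1, h2, h3, h4, h5⟩ := h0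
  exact ⟨η, g, hi, fun V => AlgEquiv.ofBijective ⟨c V, h3 V⟩ (h2 V), h1, h4, h5⟩

end LiftChoice

end Space


/-! ### Polyvector fields form a sheaf. -/

section GluePolyVec

variable {T : Type u} [TopologicalSpace T] {R : Type u} [CommRing R]
  {F : (Opens T)ᵒᵖ ⥤ CommAlgCat.{u} R} {ι : Type u} {U : ι → Opens T} {p : ℕ}

theorem IsSheafLike.eq_of_iSup_eq_top (hF : IsSheafLike F) (hU : ⨆ a, U a = ⊤) {V : Opens T}
    {s t : F.obj (op V)}
    (h : ∀ a, rmap F (inf_le_left : V ⊓ U a ≤ V) s = rmap F (inf_le_left : V ⊓ U a ≤ V) t) :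
    s = t := by
  refine hF.sep _ _ fun x hx => ?_
  obtain ⟨a, ha⟩ := Opens.mem_iSup.1 (show x ∈ ⨆ a, U a by rw [hU]; trivial)
  exact ⟨V ⊓ U a, inf_le_left, ⟨hx, ha⟩, h a⟩

/-- The value at functions on an arbitrary open `V` is glued from the values on `V ⊓ U a`; all
identities are then checked on these pieces. -/
theorem IsSheafLike.exists_polyVec (hF : IsSheafLike F) (hU : ⨆ a, U a = ⊤)
    (P : ∀ a, PolyVec F p (U a))
    (hP : ∀ a b V (ha : V ≤ U a) (hb : V ≤ U b) v, (P a).1 ⟨V, ha⟩ v = (P b).1 ⟨V, hb⟩ v) :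
    ∃ Q : PolyVec F p ⊤, ∀ a V (h : V ≤ U a) v, Q.1 ⟨V, le_top⟩ v = (P a).1 ⟨V, h⟩ v := by
  have hex : ∀ (V : Opens T) (v : Fin p → F.obj (op V)), ∃ y : F.obj (op V), ∀ a,
      rmap F (inf_le_left : V ⊓ U a ≤ V) y =
        (P a).1 ⟨V ⊓ U a, inf_le_right⟩ fun i => rmap F inf_le_left (v i) := by
    intro V v
    refine hF.glue (fun a => V ⊓ U a) (fun a => inf_le_left) (fun x hx => ?_) _
      fun a b Z ha hb => ?_
    · obtain ⟨a, ha⟩ := Opens.mem_iSup.1 (show x ∈ ⨆ a, U a by rw [hU]; trivial)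
      exact ⟨a, hx, ha⟩
    · rw [polyVec_rmap (P a) inf_le_right ha, polyVec_rmap (P b) inf_le_right hb,
        hP a b Z _ (hb.trans inf_le_right)]
      simp only [rmap_rmap]
  choose q hq using hex
  have hu : ∀ (V : Opens T) (a : ι) (v : Fin p → F.obj (op V)) (i : Fin p) (z : F.obj (op V)),
      (fun j => rmap F (inf_le_left : V ⊓ U a ≤ V) (Function.update v i z j)) =
        Function.update (fun j => rmap F (inf_le_left : V ⊓ U a ≤ V) (v j)) i (rmap F inf_le_left z) :=
    fun V a v i z => funext fun j => Function.apply_update (fun _ => rmap F inf_le_left) v i z j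
  have hq' : ∀ a V (h : V ≤ U a) v, q V v = (P a).1 ⟨V, h⟩ v := by
    intro a V h v
    refine hF.eq_of_iSup_eq_top hU fun b => ?_
    rw [hq, polyVec_rmap (P a) h inf_le_left, hP b a _ _ (inf_le_left.trans h)]
  refine ⟨⟨fun V => ⟨⟨q V.1, fun {_} v i x y => ?_, fun {_} v i c x => ?_⟩, fun v i j hv hij => ?_⟩,
    fun V v i f g => ?_, fun V W h v => ?_⟩, hq'⟩
  · cases Subsingleton.elim ‹DecidableEq (Fin p)› (instDecidableEqFin p)
    refine hF.eq_of_iSup_eq_top hU fun a => ?_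
    rw [map_add, hq, hq, hq, hu, hu, hu, map_add, AlternatingMap.map_update_add]
  · cases Subsingleton.elim ‹DecidableEq (Fin p)› (instDecidableEqFin p)
    refine hF.eq_of_iSup_eq_top hU fun a => ?_
    rw [map_smul, hq, hq, hu, hu, map_smul, AlternatingMap.map_update_smul]
  · refine hF.eq_of_iSup_eq_top hU fun a => ?_
    rw [map_zero]
    refine (hq V.1 v a).trans (AlternatingMap.map_eq_zero_of_eq _ _ ?_ hij)
    rw [hv]
  · refine hF.eq_of_iSup_eq_top hU fun a => ?_
    change rmap F _ (q V.1 _) = rmap F _ (f * q V.1 _ + g * q V.1 _)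
    rw [map_add, map_mul, map_mul, hq, hq, hq, hu, hu, hu, map_mul, (P a).2.1]
  · change rmap F h (q V.1 v) = q W.1 fun i => rmap F h (v i)
    refine hF.eq_of_iSup_eq_top hU fun a => ?_
    have h1 : W.1 ⊓ U a ≤ V.1 ⊓ U a := inf_le_inf_right _ h
    rw [hq, rmap_rmap, ← rmap_rmap F inf_le_left h1, hq, polyVec_rmap (P a) inf_le_right h1]
    simp only [rmap_rmap]

end GluePolyVec

/-! ### Transport of polyvector fields between spaces. -/

section Transport

variable {T T' : Type u} [TopologicalSpace T] [TopologicalSpace T'] {R : Type u} [CommRing R]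

/-- The transport of a polyvector field to another space. -/
def transportPolyVec {F : (Opens T)ᵒᵖ ⥤ CommAlgCat.{u} R} {G : (Opens T')ᵒᵖ ⥤ CommAlgCat.{u} R}
    {p : ℕ} (Q : PolyVec F p ⊤) (r : Opens T' → Opens T) (hr : ∀ {V W}, V ≤ W → r V ≤ r W)
    (e : ∀ W, F.obj (op (r W)) ≃ₐ[R] G.obj (op W))
    (he : ∀ {V W} (h : W ≤ V) x, e W (rmap F (hr h) x) = rmap G h (e V x)) :
    PolyVec G p ⊤ :=
  ⟨fun W => (e W.1).toLinearMap.compAlternatingMap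
    ((Q.1 ⟨r W.1, le_top⟩).compLinearMap (e W.1).symm.toLinearMap), by
    refine ⟨fun W v i f g => ?_, fun W W' h v => ?_⟩
    · change e W.1 (Q.1 ⟨r W.1, le_top⟩ fun j => (e W.1).symm (Function.update v i (f * g) j)) =
        f * e W.1 (Q.1 ⟨r W.1, le_top⟩ fun j => (e W.1).symm (Function.update v i g j)) +
        g * e W.1 (Q.1 ⟨r W.1, le_top⟩ fun j => (e W.1).symm (Function.update v i f j))
      have hu : ∀ z, (fun j => (e W.1).symm (Function.update v i z j)) =
          Function.update (fun j => (e W.1).symm (v j)) i ((e W.1).symm z) :=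
        fun z => funext fun j => Function.apply_update (fun _ => (e W.1).symm) v i z j
      rw [hu, hu, hu, map_mul, Q.2.1, map_add, map_mul, map_mul, AlgEquiv.apply_symm_apply,
        AlgEquiv.apply_symm_apply]
    · change rmap G h (e W.1 (Q.1 ⟨r W.1, le_top⟩ fun j => (e W.1).symm (v j))) =
        e W'.1 (Q.1 ⟨r W'.1, le_top⟩ fun j => (e W'.1).symm (rmap G h (v j)))
      rw [← he h, polyVec_rmap Q le_top (hr h)]
      refine congrArg (e W'.1) (congrArg (Q.1 ⟨r W'.1, le_top⟩) (funext fun j => ?_))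
      rw [AlgEquiv.eq_symm_apply, he h, AlgEquiv.apply_symm_apply]⟩

end Transport

/-! ### From fields on the closed fibre to fields on the total space. -/

section TotalSpace

variable {k A : Type u} [Field k] [CommRing A] [Algebra k A]
  {X : Scheme.{u}} {π : X ⟶ Spec (.of k)} {Λ₀ : PolyVec (algSheaf π) 2 ⊤} {ε : A →ₐ[k] k}
  [IsLocalRing A] [IsArtinianRing A]

/-- A polyvector field on the total space, from its description on the closed fibre. -/
def PoissonDeformation.polyVecOfFibre (η : PoissonDeformation π Λ₀ ε) {p : ℕ}
    (Q : PolyVec η.sheaf p ⊤) : PolyVec (algSheaf η.proj) p ⊤ :=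
  transportPolyVec Q (η.incl ⁻¹ᵁ ·) (fun h => η.incl.preimage_mono h)
    (fun W => rmapEquiv (algSheaf η.proj) (upOpen_preimage η.incl W)) fun h x => by
      refine (rmap_rmap (algSheaf η.proj) _ _ x).trans (rmap_rmap (algSheaf η.proj) _ _ x).symm

theorem PoissonDeformation.polyVecOfFibre_upOpen (η : PoissonDeformation π Λ₀ ε) {p : ℕ}
    (Q : PolyVec η.sheaf p ⊤) (V : X.Opens) :
    (η.polyVecOfFibre Q).1 ⟨upOpen η.incl V, le_top⟩ = Q.1 ⟨V, le_top⟩ := by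
  have h1 : η.incl ⁻¹ᵁ upOpen η.incl V = V := preimage_upOpen η.incl V
  refine AlternatingMap.ext fun v => ?_
  have h2 := polyVec_rmap Q (V := η.incl ⁻¹ᵁ upOpen η.incl V) le_top h1.ge
    fun j => rmap (algSheaf η.proj) (upOpen_preimage η.incl _).le (v j)
  refine h2.trans (congrArg (Q.1 ⟨V, le_top⟩) (funext fun j => ?_))
  exact (rmap_rmap (algSheaf η.proj) _ _ _).trans (rmap_self _ _ _)

end TotalSpace


/-! ### Local trivializations of the glued deformation. -/

section GluedBivector

variable {k A A₁ : Type u} [Field k] [CharZero k] [CommRing A] [Algebra k A] [CommRing A₁]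
  [Algebra k A₁] [IsLocalRing A] [IsArtinianRing A] [IsLocalRing A₁] [IsArtinianRing A₁]
  {X : Scheme.{u}} {π : X ⟶ Spec (.of k)} {Λ₀ : PolyVec (algSheaf π) 2 ⊤} {ε : A →ₐ[k] k}
  {ξ : PoissonDeformation π Λ₀ ε} {φ : A₁ →ₐ[k] A} {t : A₁}

/-- The zero class restricts to zero on every affine covering, so a covering suited to the gluing
may be used. -/
theorem PoissonDeformation.IsObstructionClass.exists_cochain
    (ho : ξ.IsObstructionClass φ t (0 : HyperCoh π Λ₀ 2)) {ι : Type u} {U : ι → X.Opens}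
    (hU : ∀ a, IsAffineOpen (U a)) (hU' : ⨆ a, U a = ⊤) :
    ∃ (τ : Trivialization ξ U) (L : LiftChoice τ φ) (α : CechCochain (algSheaf π) U),
      L.IsObstructionCochain t α ∧ α ∈ coboundaries Λ₀ U 2 := by
  obtain ⟨⟨τ⟩, h1⟩ := ho ι (fun a => ⟨U a, hU a⟩) hU'
  obtain ⟨⟨L⟩, h2⟩ := h1 τ
  obtain ⟨α, hα, e⟩ := h2 L
  refine ⟨τ, L, α.1, hα, ?_⟩
  exact (Submodule.Quotient.mk_eq_zero ((coboundaries Λ₀ U 2).submoduleOf _)).1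
    (e.trans (map_zero _))

/-- Restriction gives an open immersion of spectra, which is a monomorphism of schemes; hence the
ring map is an epimorphism. -/
theorem ringHom_ext_rmap {U V : X.Opens} (hU : IsAffineOpen U) (hV : IsAffineOpen V) (h : V ≤ U)
    {C : Type u} [CommRing C] {f g : A₁ ⊗[k] (algSheaf π).obj (op V) →+* C}
    (e : ∀ x, f (rmap (baseChange A₁ (algSheaf π)) h x) =
      g (rmap (baseChange A₁ (algSheaf π)) h x)) : f = g := by
  have h1 := LiftChoice.isOpenImmersion_rmap (π := π) (A₁ := A₁) hU hV h
  have h2 : CommRingCat.ofHom (rmap (baseChange A₁ (algSheaf π)) h).toRingHom ≫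
      CommRingCat.ofHom f = CommRingCat.ofHom (rmap (baseChange A₁ (algSheaf π)) h).toRingHom ≫
      CommRingCat.ofHom g := CommRingCat.hom_ext (RingHom.ext e)
  have h3 := congrArg Spec.map h2
  rw [Spec.map_comp, Spec.map_comp, cancel_mono] at h3
  exact congrArg CommRingCat.Hom.hom (Spec.map_injective h3)

namespace LiftChoice

variable {τ : Trivialization ξ fun W : ξ.space.affineOpens => ξ.incl ⁻¹ᵁ W.1} {L : LiftChoice τ φ}
  {Λ₁ : PolyVec (algSheaf π) 2 ⊤} {η : PoissonDeformation π Λ₁ (ε.comp φ)}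
  {g : ξ.space ⟶ η.space} {hi : ξ.incl ≫ g = η.incl}
  {c : ∀ V : ξ.space.affineOpens, η.sheaf.obj (op (ξ.incl ⁻¹ᵁ V.1)) ≃ₐ[A₁]
        A₁ ⊗[k] (algSheaf π).obj (op (ξ.incl ⁻¹ᵁ V.1))}

theorem rho_symm
    (hq : ∀ (V : ξ.space.affineOpens) x, fibreMap g hi _ x =
        rmap (algSheaf ξ.proj) (upOpen_preimage ξ.incl V.1).le (twistedQuot τ φ V (c V x)))
    (V : ξ.space.affineOpens) (x : A₁ ⊗[k] (algSheaf π).obj (op (ξ.incl ⁻¹ᵁ V.1))) :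
    η.rho _ ((c V).symm x) = redk (ε.comp φ) _ x := by
  have h1 := hq V ((c V).symm x)
  rw [AlgEquiv.apply_symm_apply, twistedQuot_apply] at h1
  refine (rho_fibreMap hi _ _).symm.trans ((congrArg (ξ.rho _) h1).trans ?_)
  refine (ξ.rho_preimage V.1 _).trans ((τ.iso_incl V V.1 le_rfl _).symm.trans ?_)
  rw [AlgEquiv.apply_symm_apply]
  exact (redk_comp ((algSheaf π).obj (op (ξ.incl ⁻¹ᵁ V.1))) x).symm

theorem exists_sections [IsAffineHom ξ.incl]
    (hq : ∀ (V : ξ.space.affineOpens) x, fibreMap g hi _ x =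
        rmap (algSheaf ξ.proj) (upOpen_preimage ξ.incl V.1).le (twistedQuot τ φ V (c V x))) :
    ∃ e : ∀ V : ξ.space.affineOpens,
      EquivFamily (baseChange A₁ (algSheaf π)) η.sheaf (ξ.incl ⁻¹ᵁ V.1),
      ∀ (V : ξ.space.affineOpens) x, (e V).app _ le_rfl x = (c V).symm x := by
  have h0 : ∀ V : ξ.space.affineOpens, ∃ s : AlgFamily (baseChange A₁ (algSheaf π)) η.sheaf
      (ξ.incl ⁻¹ᵁ V.1), η.IsSection s ∧ s.app _ le_rfl = (c V).symm.toAlgHom := by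
    intro V
    have hV := V.2.preimage ξ.incl
    have hh : ∀ b, η.rho (ξ.incl ⁻¹ᵁ V.1) ((c V).symm (1 ⊗ₜ b)) = b := fun b => by
      rw [rho_symm hq, redk_one_tmul]
    have h1 := AlgFamily.exists_of_isAffineOpen η.isSheafLike_sheaf hV (c V).symm.toAlgHom
      fun f => by
        apply η.isUnit_of_isUnit_rho
        rw [PoissonDeformation.rho_rmap]
        refine (congrArg _ (congrArg _ (hh f))).mpr ?_
        exact X.toRingedSpace.isUnit_res_basicOpen f
    obtain ⟨s, hs⟩ := h1
    refine ⟨s, η.isSection_of_isAffineOpen hV s fun b => ?_, hs⟩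
    rw [hs]
    exact hh b
  choose s hs hs' using h0
  exact ⟨fun V => EquivFamily.ofBijective (s V) (hs V).bijective, fun V x => congr($(hs' V) x)⟩

variable {e : ∀ V : ξ.space.affineOpens,
      EquivFamily (baseChange A₁ (algSheaf π)) η.sheaf (ξ.incl ⁻¹ᵁ V.1)}

/-- Both sides are morphisms over the affine trace of `W'`, so it suffices to compare them there on
functions restricted from `W`. For those the claim is that restriction in `η` corresponds to twisted
restriction. -/
theorem equiv_aut_of_le [IsAffineHom ξ.incl]
    (he : ∀ (V : ξ.space.affineOpens) x, (e V).app _ le_rfl x = (c V).symm x)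
    (hc : ∀ (V W : ξ.space.affineOpens) (h : V ≤ W) x,
        c V (rmap η.sheaf (ξ.incl.preimage_mono h) x) = L.twistedRes h (c W x))
    {W' W : ξ.space.affineOpens} (h : W' ≤ W) (V : X.Opens) (hV : V ≤ ξ.incl ⁻¹ᵁ W'.1)
    (x : A₁ ⊗[k] (algSheaf π).obj (op V)) :
    (e W').app V hV (L.aut W' W V hV (hV.trans (ξ.incl.preimage_mono h)) x) =
      (e W).app V (hV.trans (ξ.incl.preimage_mono h)) x := by
  have hW := W'.2.preimage ξ.incl
  refine ringFamily_ext η.isSheafLike_sheaf hW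
    (fun V hV => ((e W').app V hV).toAlgHom.toRingHom.comp
      (L.aut W' W V hV (hV.trans (ξ.incl.preimage_mono h))).toAlgHom.toRingHom)
    (fun V hV => ((e W).app V (hV.trans (ξ.incl.preimage_mono h))).toAlgHom.toRingHom)
    (fun V V' hV hV' x => ?_) (fun V V' hV hV' x => (e W).naturality V V' _ hV' x)
    (fun x => ?_) V hV x
  · exact (congrArg ((e W').app V' _) (L.aut_map W' W V V' hV _ hV' x)).trans
      ((e W').naturality V V' hV hV' _)
  · have hle : ξ.incl ⁻¹ᵁ W'.1 ≤ ξ.incl ⁻¹ᵁ W.1 := ξ.incl.preimage_mono h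
    refine congr($(ringHom_ext_rmap (W.2.preimage ξ.incl) hW hle fun x => ?_) x)
    refine Eq.trans ?_ ((e W).naturality _ _ le_rfl hle x).symm
    refine (he W' _).trans ?_
    rw [he, AlgEquiv.symm_apply_eq, hc _ _ h, AlgEquiv.apply_symm_apply]
    rfl

/-- Near each point there is an affine `D` inside both `W` and `W'`. Both sides are compared with
the trivialization of `D` by the nested case, and the cocycle rule for `D`, `W'`, `W` finishes. -/
theorem equiv_aut [IsAffineHom ξ.incl] (hL : L.IsObstructionCochain t 0)
    (he : ∀ (V : ξ.space.affineOpens) x, (e V).app _ le_rfl x = (c V).symm x)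
    (hc : ∀ (V W : ξ.space.affineOpens) (h : V ≤ W) x,
        c V (rmap η.sheaf (ξ.incl.preimage_mono h) x) = L.twistedRes h (c W x))
    (W' W : ξ.space.affineOpens) (V : X.Opens) (hV' : V ≤ ξ.incl ⁻¹ᵁ W'.1)
    (hV : V ≤ ξ.incl ⁻¹ᵁ W.1) (x : A₁ ⊗[k] (algSheaf π).obj (op V)) :
    (e W').app V hV' (L.aut W' W V hV' hV x) = (e W).app V hV x := by
  refine η.isSheafLike_sheaf.sep _ _ fun p hp => ?_
  obtain ⟨_, ⟨D, hD, rfl⟩, hpD, hDV⟩ := ξ.space.isBasis_affineOpens.exists_subset_of_mem_open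
    (show ξ.incl p ∈ ((W.1 ⊓ W'.1 ⊓ upOpen ξ.incl V : ξ.space.Opens) : Set ξ.space) from
      ⟨⟨hV hp, hV' hp⟩, by rw [← preimage_upOpen ξ.incl V] at hp; exact hp⟩) (Opens.isOpen _)
  have h1 : (⟨D, hD⟩ : ξ.space.affineOpens) ≤ W := fun _ h => (hDV h).1.1
  have h2 : (⟨D, hD⟩ : ξ.space.affineOpens) ≤ W' := fun _ h => (hDV h).1.2
  have h3 : ξ.incl ⁻¹ᵁ D ≤ V := by
    rw [← preimage_upOpen ξ.incl V]
    exact ξ.incl.preimage_mono fun _ h => (hDV h).2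
  refine ⟨ξ.incl ⁻¹ᵁ D, h3, hpD, ?_⟩
  rw [← (e W').naturality V _ hV' h3, ← (e W).naturality V _ hV h3,
    ← equiv_aut_of_le he hc h1 _ le_rfl, ← equiv_aut_of_le he hc h2 _ le_rfl]
  refine congrArg ((e ⟨D, hD⟩).app _ le_rfl) ?_
  refine Eq.trans ?_ (hL.aut_comp ⟨D, hD⟩ W' W _ le_rfl (h3.trans hV') (h3.trans hV) _)
  exact congrArg (L.aut ⟨D, hD⟩ W' _ le_rfl (h3.trans hV')) (L.aut_map W' W V _ hV' hV h3 x).symm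

theorem fibreMap_equiv [IsAffineHom ξ.incl]
    (he : ∀ (V : ξ.space.affineOpens) x, (e V).app _ le_rfl x = (c V).symm x)
    (hq : ∀ (V : ξ.space.affineOpens) x, fibreMap g hi _ x =
        rmap (algSheaf ξ.proj) (upOpen_preimage ξ.incl V.1).le (twistedQuot τ φ V (c V x)))
    (W : ξ.space.affineOpens) (V : X.Opens) (hV : V ≤ ξ.incl ⁻¹ᵁ W.1)
    (x : A₁ ⊗[k] (algSheaf π).obj (op V)) :
    fibreMap g hi V ((e W).app V hV x) = ((τ.onFibre W).app V hV).symm (red φ _ x) := by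
  refine ringFamily_ext ξ.isSheafLike_sheaf (W.2.preimage ξ.incl)
    (fun V hV => (fibreMap g hi V).comp ((e W).app V hV).toAlgHom.toRingHom)
    (fun V hV => ((τ.onFibre W).app V hV).symm.toAlgHom.toRingHom.comp (red φ _).toRingHom)
    (fun V V' hV hV' x => ?_) (fun V V' hV hV' x => ?_) (fun x => ?_) V hV x
  · exact (congrArg (fibreMap g hi V') ((e W).naturality V V' _ hV' x)).trans (fibreMap_rmap hi hV' _)
  · exact (congrArg ((τ.onFibre W).app V' _).symm (red_rmap (F := algSheaf π) φ hV' x)).trans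
      ((τ.onFibre W).symm.naturality V V' hV hV' _)
  · change fibreMap g hi _ ((e W).app _ le_rfl x) = ((τ.onFibre W).app _ le_rfl).symm (red φ _ x)
    rw [he, hq, AlgEquiv.apply_symm_apply, twistedQuot_apply, Trivialization.iso_symm_eq, rmap_rmap,
      rmap_self]

end LiftChoice

end GluedBivector


/-! ### A vanishing class produces a lifting. -/

section Lift

variable {k A A₁ : Type u} [Field k] [CharZero k] [CommRing A] [Algebra k A] [CommRing A₁]
  [Algebra k A₁] [IsLocalRing A] [IsArtinianRing A] [IsLocalRing A₁] [IsArtinianRing A₁]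
  {X : Scheme.{u}} {π : X ⟶ Spec (.of k)} {Λ₀ : PolyVec (algSheaf π) 2 ⊤} {ε : A →ₐ[k] k}
  {ξ : PoissonDeformation π Λ₀ ε} {φ : A₁ →ₐ[k] A} {t : A₁}

theorem PreservesBivector.comp {R R' R'' : Type u} [CommRing R] [CommRing R'] [CommRing R'']
    {Y Z Z' : Scheme.{u}} {f : Y ⟶ Spec (.of R)} {f' : Z ⟶ Spec (.of R')} {f'' : Z' ⟶ Spec (.of R'')}
    {i : Y ⟶ Z} {g : Z ⟶ Z'} {Λ : PolyVec (algSheaf f) 2 ⊤} {Λ' : PolyVec (algSheaf f') 2 ⊤}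
    {Λ'' : PolyVec (algSheaf f'') 2 ⊤} (hi : PreservesBivector f f' i Λ Λ')
    (hg : PreservesBivector f' f'' g Λ' Λ'') : PreservesBivector f f'' (i ≫ g) Λ Λ'' := by
  intro W v
  have h1 : ∀ x, pullSec f f'' (i ≫ g) W x = pullSec f f' i (g ⁻¹ᵁ W) (pullSec f' f'' g W x) :=
    fun x => congr($(Scheme.Hom.comp_app i g W).hom x)
  rw [h1, hg, hi]
  exact congrArg (Λ.1 ⟨_, le_top⟩) (funext fun j => (h1 (v j)).symm)

namespace PoissonDeformation

variable {Λ₁ : PolyVec (algSheaf π) 2 ⊤} {η : PoissonDeformation π Λ₁ (ε.comp φ)}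
  {g : ξ.space ⟶ η.space}

/-- The placeholder bivector of `η` is replaced by the one coming from `Q`; compatibility with `X`
follows from that with `ξ` by composition. -/
theorem hasLifting_of_polyVec (hi : ξ.incl ≫ g = η.incl)
    (hg : IsPullback g ξ.proj η.proj (Spec.map (CommRingCat.ofHom φ.toRingHom)))
    (Q : PolyVec η.sheaf 2 ⊤)
    (hQ : ∀ V (G : Fin 3 → η.sheaf.obj (op V)), halfSquare (Q.1 ⟨V, le_top⟩) G = 0)
    (hb : ∀ V v, fibreMap g hi V (Q.1 ⟨V, le_top⟩ v) =
      ξ.biv.1 ⟨upOpen ξ.incl V, le_top⟩ fun i => fibreMap g hi V (v i)) :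
    ξ.HasLifting φ := by
  have hW : ∀ W : η.space.Opens, ∃ V, W = upOpen η.incl V :=
    fun W => ⟨_, (upOpen_preimage η.incl W).symm⟩
  have hP : PreservesBivector ξ.proj η.proj g ξ.biv (η.polyVecOfFibre Q) := by
    intro W v
    obtain ⟨V, rfl⟩ := hW W
    rw [polyVecOfFibre_upOpen]
    have h2 := upOpen_eq_preimage g hi V
    have h1 : rmap (algSheaf ξ.proj) h2.le
        (pullSec ξ.proj η.proj g (upOpen η.incl V) (Q.1 ⟨V, le_top⟩ v)) =
      ξ.biv.1 ⟨upOpen ξ.incl V, le_top⟩ fun i => rmap (algSheaf ξ.proj) h2.le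
        (pullSec ξ.proj η.proj g (upOpen η.incl V) (v i)) := hb V v
    have h3 := polyVec_rmap ξ.biv (V := g ⁻¹ᵁ upOpen η.incl V) le_top h2.le
      fun i => pullSec ξ.proj η.proj g (upOpen η.incl V) (v i)
    exact (rmapEquiv (algSheaf ξ.proj) h2.symm).injective (h1.trans h3.symm)
  refine ⟨{ η with
    biv := η.polyVecOfFibre Q
    isPoisson := fun W G => ?_
    incl_biv := hi ▸ ξ.incl_biv.comp hP }, g, hg, hi, hP⟩
  obtain ⟨W, hW'⟩ := W
  obtain ⟨V, rfl⟩ := hW W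
  rw [schouten_self, polyVecOfFibre_upOpen]
  exact (congrArg (2 * ·) (hQ V G)).trans (mul_zero _)

end PoissonDeformation

namespace LiftChoice

section Glued

variable {ι : Type u} {U : ι → X.Opens} {τ : Trivialization ξ U} {L : LiftChoice τ φ}
  {Λ₁ : PolyVec (algSheaf π) 2 ⊤} {η : PoissonDeformation π Λ₁ (ε.comp φ)}
  {e : ∀ a, EquivFamily (baseChange A₁ (algSheaf π)) η.sheaf (U a)}

/-- The bivectors transported to `η` agree on overlaps, because the automorphisms relating the
trivializations also carry one lifted bivector exactly to the other. -/
theorem IsObstructionCochain.exists_polyVec (hL : L.IsObstructionCochain t 0) (hU : ⨆ a, U a = ⊤)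
    (he : ∀ a b V (ha : V ≤ U a) (hb : V ≤ U b) (x : A₁ ⊗[k] (algSheaf π).obj (op V)),
      (e a).app V ha (L.aut a b V ha hb x) = (e b).app V hb x) :
    ∃ Q : PolyVec η.sheaf 2 ⊤, ∀ a V (ha : V ≤ U a) (v : Fin 2 → A₁ ⊗[k] (algSheaf π).obj (op V)),
      Q.1 ⟨V, le_top⟩ (fun i => (e a).app V ha (v i)) = (e a).app V ha (L.bivAt a V ha v) := by
  have h1 := η.isSheafLike_sheaf.exists_polyVec hU (fun a => conjPolyVec (L.biv a) (e a))
    fun a b V ha hb v => by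
      have h2 : ∀ i, L.aut a b V ha hb (((e b).app V hb).symm (v i)) = ((e a).app V ha).symm (v i) :=
        fun i => by rw [AlgEquiv.eq_symm_apply, he, AlgEquiv.apply_symm_apply]
      have h3 := hL.aut_biv a b V ha hb fun i => ((e b).app V hb).symm (v i)
      simp only [h2] at h3
      have h4 := he a b V ha hb (L.bivAt b V hb fun i => ((e b).app V hb).symm (v i))
      rw [h3] at h4
      exact h4
  obtain ⟨Q, hQ⟩ := h1
  refine ⟨Q, fun a V ha v => (hQ a V ha _).trans (congrArg ((e a).app V ha) ?_)⟩
  refine congrArg (L.bivAt a V ha) (funext fun i => ?_)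
  exact AlgEquiv.symm_apply_apply _ _

theorem IsObstructionCochain.halfSquare_eq_zero (hL : L.IsObstructionCochain t 0)
    (hU : ⨆ a, U a = ⊤) {Q : PolyVec η.sheaf 2 ⊤}
    (hQ : ∀ a V (ha : V ≤ U a) (v : Fin 2 → A₁ ⊗[k] (algSheaf π).obj (op V)),
      Q.1 ⟨V, le_top⟩ (fun i => (e a).app V ha (v i)) = (e a).app V ha (L.bivAt a V ha v))
    (V : X.Opens) (G : Fin 3 → η.sheaf.obj (op V)) : halfSquare (Q.1 ⟨V, le_top⟩) G = 0 := by
  have h1 : ∀ a (V : X.Opens) (ha : V ≤ U a) (G : Fin 3 → η.sheaf.obj (op V)),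
      halfSquare (Q.1 ⟨V, le_top⟩) G = 0 := by
    intro a V ha G
    have h2 := map_halfSquare ((e a).app V ha).toAlgHom.toRingHom (L.bivAt a V ha)
      (Q.1 ⟨V, le_top⟩) (fun v => (hQ a V ha v).symm) fun i => ((e a).app V ha).symm (G i)
    have h3 := hL.schouten_eq_zero a V ha fun i => ((e a).app V ha).symm (G i)
    rw [schouten_self] at h3
    have h4 := (IsUnit.mul_right_eq_zero (isUnit_two k A₁ (A₁ ⊗[k] (algSheaf π).obj (op V)))).1 h3
    rw [h4, map_zero] at h2
    refine Eq.trans (congrArg (halfSquare (Q.1 ⟨V, le_top⟩)) (funext fun i => ?_)) h2.symm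
    exact (AlgEquiv.apply_symm_apply ((e a).app V ha) (G i)).symm
  refine η.isSheafLike_sheaf.eq_of_iSup_eq_top hU fun a => ?_
  rw [map_zero]
  refine (polyVec_rmap (halfSquarePolyVec Q) (V := V) le_top inf_le_left G).trans ?_
  exact h1 a _ inf_le_right _

theorem fibreMap_polyVec {g : ξ.space ⟶ η.space} (hi : ξ.incl ≫ g = η.incl)
    (hU : ⨆ a, U a = ⊤) {Q : PolyVec η.sheaf 2 ⊤}
    (hQ : ∀ a V (ha : V ≤ U a) (v : Fin 2 → A₁ ⊗[k] (algSheaf π).obj (op V)),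
      Q.1 ⟨V, le_top⟩ (fun i => (e a).app V ha (v i)) = (e a).app V ha (L.bivAt a V ha v))
    (he : ∀ a V (ha : V ≤ U a) (x : A₁ ⊗[k] (algSheaf π).obj (op V)),
      fibreMap g hi V ((e a).app V ha x) = ((τ.onFibre a).app V ha).symm (red φ _ x))
    (V : X.Opens) (v : Fin 2 → η.sheaf.obj (op V)) : fibreMap g hi V (Q.1 ⟨V, le_top⟩ v) =
      ξ.biv.1 ⟨upOpen ξ.incl V, le_top⟩ fun i => fibreMap g hi V (v i) := by
  have h1 : ∀ a (V : X.Opens) (ha : V ≤ U a) (v : Fin 2 → η.sheaf.obj (op V)),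
      fibreMap g hi V (Q.1 ⟨V, le_top⟩ v) =
        ξ.biv.1 ⟨upOpen ξ.incl V, le_top⟩ fun i => fibreMap g hi V (v i) := by
    intro a V ha v
    obtain ⟨u, rfl⟩ : ∃ u : Fin 2 → A₁ ⊗[k] (algSheaf π).obj (op V),
        (fun i => (e a).app V ha (u i)) = v :=
      ⟨fun i => ((e a).app V ha).symm (v i), funext fun i => AlgEquiv.apply_symm_apply _ _⟩
    rw [hQ, he, L.red_biv, τ.bivector_apply, AlgEquiv.symm_apply_apply]
    simp only [he]
  refine ξ.isSheafLike_sheaf.eq_of_iSup_eq_top hU fun a => ?_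
  rw [← fibreMap_rmap, polyVec_rmap Q, h1 a _ inf_le_right]
  refine Eq.trans ?_ (polyVec_rmap (ξ.bivOnFibre ⊤) (V := V) le_top inf_le_left _).symm
  exact congrArg (ξ.biv.1 ⟨upOpen ξ.incl (V ⊓ U a), le_top⟩) (funext fun i => fibreMap_rmap hi _ (v i))

end Glued

theorem IsObstructionCochain.hasLifting
    {τ : Trivialization ξ fun W : ξ.space.affineOpens => ξ.incl ⁻¹ᵁ W.1} {L : LiftChoice τ φ}
    (h : SmallExtension ε φ t)
    (hL : L.IsObstructionCochain t 0) [IsAffineHom ξ.incl] : ξ.HasLifting φ := by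
  have h0 := exists_space h hL
  obtain ⟨η, g, hi, c, hg, hc, hq⟩ := h0
  have h1 := exists_sections (hi := hi) (c := c) hq
  obtain ⟨e, he⟩ := h1
  have hU : ⨆ W : ξ.space.affineOpens, ξ.incl ⁻¹ᵁ W.1 = ⊤ := by
    rw [← Scheme.Hom.preimage_iSup, iSup_affineOpens_eq_top]
    rfl
  have h2 := hL.exists_polyVec (e := e) hU
    fun W' W V hV' hV x => equiv_aut hL he hc W' W V hV' hV x
  obtain ⟨Q, hQ⟩ := h2
  exact PoissonDeformation.hasLifting_of_polyVec hi hg Q (hL.halfSquare_eq_zero hU hQ)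
    (fibreMap_polyVec hi hU hQ fun W V hV x => fibreMap_equiv he hq W V hV x)

end LiftChoice

theorem PoissonDeformation.IsObstructionClass.hasLifting (h : SmallExtension ε φ t)
    (ho : ξ.IsObstructionClass φ t (0 : HyperCoh π Λ₀ 2)) : ξ.HasLifting φ := by
  have hU : ⨆ W : ξ.space.affineOpens, ξ.incl ⁻¹ᵁ W.1 = ⊤ := by
    rw [← Scheme.Hom.preimage_iSup, iSup_affineOpens_eq_top]
    rfl
  -- The covering consists of the traces of the affine opens of the total space, since it is the
  -- total space that gets thickened.
  obtain ⟨τ, L, α, hα, hb⟩ := ho.exists_cochain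
    (fun W : ξ.space.affineOpens => W.2.preimage ξ.incl) hU
  obtain ⟨L', hL'⟩ := L.exists_correction h hα hb
  exact hL'.hasLifting h

end Lift

end PoissonDeform

end

theorem mainTheorem2 {k : Type u} [Field k] [IsAlgClosed k] [CharZero k]
    {X : Scheme.{u}} (π : X ⟶ Spec (.of k)) [Smooth π] [IsSeparated π] [QuasiCompact π]
    (Λ₀ : PoissonDeform.PolyVec (PoissonDeform.algSheaf π) 2 ⊤)
    (_hΛ₀ : PoissonDeform.IsPoisson Λ₀)
    {A : Type u} [CommRing A] [Algebra k A] [IsLocalRing A] [IsArtinianRing A] (ε : A →ₐ[k] k)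
    (ξ : PoissonDeform.PoissonDeformation π Λ₀ ε)
    {A₁ : Type u} [CommRing A₁] [Algebra k A₁] [IsLocalRing A₁] [IsArtinianRing A₁]
    (φ : A₁ →ₐ[k] A) (_hφ : Function.Surjective φ)
    (t : A₁) (_ht : t ≠ 0) (_htm : t ∈ IsLocalRing.maximalIdeal A₁)
    (_hann : ∀ x ∈ IsLocalRing.maximalIdeal A₁, x * t = 0)
    (_hker : RingHom.ker φ = Ideal.span {t}) :
    (∃! o : PoissonDeform.HyperCoh π Λ₀ 2, ξ.IsObstructionClass φ t o) ∧
    ∀ o : PoissonDeform.HyperCoh π Λ₀ 2, ξ.IsObstructionClass φ t o →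
      (o = 0 ↔ ξ.HasLifting φ) := by
  -- The kernel of the residue map `ε ∘ φ` is the maximal ideal of `A₁`, so annihilation of `t` can
  -- be stated through residues.
  have h : PoissonDeform.SmallExtension ε φ t := ⟨_hφ, _ht, _hker, fun a ha => _hann a (by
    rw [← PoissonDeform.ker_eq_maximalIdeal (ε.comp φ)]
    exact ha)⟩
  refine ⟨PoissonDeform.PoissonDeformation.existsUnique_isObstructionClass h, fun o ho =>
    ⟨?_, ho.eq_zero_of_hasLifting h⟩⟩
  rintro rfl
  exact ho.hasLifting h
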